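/- All manifolds are finite-dimensional and $C^\infty$ (not necessarily Hausdorff), and immersions need not be injective. For an immersion $j:Y\to X$ let $N(X,Y,j)=j^*TX/TY$ be its normal bundle (a vector bundle over $Y$) and let $$D(X,Y,j)=N(X,Y,j)\sqcup (X\times\mathbb R^*)$$ be its deformation to the normal cone: the manifold whose charts are the charts $(x,t)\mapsto(\phi(x),t)$ of $X\times\mathbb R^*$ together with, for every pair of charts $\psi$ of $Y$ and $\phi$ of $X$ in which $j$ reads $u\mapsto (u,0)$, the chart $([v]_y,0)\mapsto(\psi(y),d_N\phi_y(v),0)$, $(x,t)\mapsto(u,t^{-1}\xi,t)$ where $\phi(x)=(u,\xi)$ and $t\ne0$; here $d_N\phi$ is the normal component of $d\phi$. If $j':Y'\to X'$ is another immersion and $f:X\to X'$, $f_0:Y\to Y'$ are smooth with $f\circ j=j'\circ f_0$, then $N(f,f_0)$ sends $[v]_y$ to $[df(v)]_{f_0(y)}$, and $D(f,f_0)$ is $N(f,f_0)$ over $t=0$ and $(x,t)\mapsto(f(x),t)$ for $t\neq 0$. For a Lie groupoid immersion $j:G_1\to G_2$ (a morphism of Lie groupoids that is an immersion) over $j^{(0)}:G_1^{(0)}\to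 G_2^{(0)}$, applying $N$, resp. $D$, to all structure maps gives the groupoids $N(j)\rightrightarrows N(j^{(0)})$ and $D(j)\rightrightarrows D(j^{(0)})$. **Corollary.** Let $$\begin{array}{ccc} G_1&\xrightarrow{\ i_1\ }&G_2\\ {\scriptstyle j_1}\downarrow&&\downarrow{\scriptstyle j_2}\\ H_1&\xrightarrow{\ i_2\ }&H_2\end{array}$$ be a commutative square of Lie groupoid immersions such that the maps $N(j_2,j_1):N(G_2,G_1,i_1)\to N(H_2,H_1,i_2)$ and $N(i_2,i_1):N(H_1,G_1,j_1)\to N(H_2,G_2,j_2)$ are immersions. Then $D(j_2,j_1):D(G_2,G_1,i_1)\to D(H_2,H_1,i_2)$ and $N(i_2,i_1)$ are Lie groupoid immersions, the normal groupoid $N(D(j_2,j_1))\rightrightarrows N(D(j_2^{(0)},j_1^{(0)}))$ and the deformation groupoid $D(N(i_2,i_1))\rightrightarrows D(N(i_2^{(0)},i_1^{(0)}))$ are Lie groupoids, and there is a canonical isomorphism of Lie groupoids $$N(D(j_2,j_1))\ \cong\ D(N(i_2,i_1))\qquad\text{covering an isomorphism}\qquad N(D(j_2^{(0)},j_1^{(0)}))\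 \cong\ D(N(i_2^{(0)},i_1^{(0)})).$$ Canonical means the following. The diffeomorphism of arrow manifolds covers the identity of $D(G_2,G_1,i_1)$, where $N(D(j_2,j_1))$ is mapped to $D(G_2,G_1,i_1)$ by its bundle projection and $D(N(i_2,i_1))$ by $D(\pi_2,\pi_1)$, with $\pi_2:N(H_2,G_2,j_2)\to G_2$ and $\pi_1:N(H_1,G_1,j_1)\to G_1$ the bundle projections; and over $G_2\times\mathbb R^*\subset D(G_2,G_1,i_1)$ it is the obvious identification with $N(H_2,G_2,j_2)\times\mathbb R^*$ induced by the projections to $H_2$ and $G_2$ and by the parameter $t$. The same holds for the diffeomorphism of unit manifolds. The pair of diffeomorphisms forming the isomorphism is uniquely determined by these properties. -/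

import Mathlib

open scoped Manifold ContDiff Topology
open Set Filter

universe u

section Analysis

theorem contDiff_integral_param {H : Type u} [NormedAddCommGroup H] [NormedSpace ℝ H]
    [FiniteDimensional ℝ H] (n : ℕ) : ∀ {W : Type u} [NormedAddCommGroup W] [NormedSpace ℝ W]
    {f : H × ℝ → W}, ContDiff ℝ n f → ContDiff ℝ n (fun x ↦ ∫ s in (0 : ℝ)..1, f (x, s)) := by
  induction n with
  | zero =>
    intro W _ _ f hf
    simp only [Nat.cast_zero, contDiff_zero] at hf ⊢
    exact intervalIntegral.continuous_parametric_intervalIntegral_of_continuous'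
      (f := fun x s ↦ f (x, s)) (by simpa [Function.uncurry_def] using hf) 0 1
  | succ n ih =>
    intro W _ _ f hf
    have hf1 : ContDiff ℝ ((n : WithTop ℕ∞) + 1) f := by exact_mod_cast hf
    have hd : Differentiable ℝ f := hf1.differentiable (by simp)
    have hc' : ContDiff ℝ n (fun z : H × ℝ ↦ (fderiv ℝ f z).comp (ContinuousLinearMap.inl ℝ H ℝ)) :=
      (hf1.fderiv_right le_rfl).clm_comp contDiff_const
    have key := ih hc'
    have goal : ContDiff ℝ ((n : WithTop ℕ∞) + 1) (fun x ↦ ∫ s in (0 : ℝ)..1, f (x, s)) := by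
      rw [contDiff_succ_iff_hasFDerivAt]
      refine ⟨_, key, fun x₀ ↦ ?_⟩
      have hK : IsCompact (Metric.closedBall x₀ 1 ×ˢ Icc (0 : ℝ) 1) :=
        (isCompact_closedBall x₀ 1).prod isCompact_Icc
      obtain ⟨C, hC⟩ := hK.exists_bound_of_continuousOn hc'.continuous.continuousOn
      refine intervalIntegral.hasFDerivAt_integral_of_dominated_of_fderiv_le (𝕜 := ℝ)
        (F := fun x s ↦ f (x, s))
        (F' := fun x s ↦ (fderiv ℝ f (x, s)).comp (ContinuousLinearMap.inl ℝ H ℝ))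
        (bound := fun _ ↦ C) (Metric.ball_mem_nhds x₀ one_pos) ?_ ?_ ?_ ?_ ?_ ?_
      · exact Eventually.of_forall fun x ↦
          (hd.continuous.comp (by fun_prop : Continuous fun s : ℝ ↦ (x, s))).aestronglyMeasurable
      · exact (hd.continuous.comp
          (by fun_prop : Continuous fun s : ℝ ↦ (x₀, s))).intervalIntegrable _ _
      · exact (hc'.continuous.comp
          (by fun_prop : Continuous fun s : ℝ ↦ (x₀, s))).aestronglyMeasurable
      · refine Eventually.of_forall fun s hs x hx ↦ hC (x, s) ⟨Metric.ball_subset_closedBall hx, ?_⟩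
        rw [uIoc_of_le zero_le_one] at hs
        exact ⟨hs.1.le, hs.2⟩
      · exact intervalIntegrable_const
      · refine Eventually.of_forall fun s _ x _ ↦ ?_
        exact (hd (x, s)).hasFDerivAt.comp x (hasFDerivAt_prodMk_left x s)
    exact_mod_cast goal

theorem contDiffAt_divided_difference {V : Type u} [NormedAddCommGroup V] [NormedSpace ℝ V]
    [FiniteDimensional ℝ V] {W : Type u} [NormedAddCommGroup W] [NormedSpace ℝ W] [CompleteSpace W]
    {g : V → W} {O : Set V} (hO : IsOpen O) (hg : ContDiffOn ℝ ∞ g O) (A B : V →L[ℝ] V) (w₀ : V)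
    (hw₀ : A w₀ ∈ O) (h0 : ∀ᶠ w in 𝓝 w₀, g (A w) = 0) :
    ContDiffAt ℝ ∞ (fun z : V × ℝ ↦ if z.2 = 0 then fderiv ℝ g (A z.1) (B z.1)
      else z.2⁻¹ • g (A z.1 + z.2 • B z.1)) (w₀, 0) := by
  obtain ⟨ε, hε, hεO⟩ := Metric.isOpen_iff.1 hO _ hw₀
  let χ : ContDiffBump (A w₀) := ⟨ε / 4, ε / 2, by positivity, by linarith⟩
  let G : V → W := fun v ↦ χ v • g v
  have hG : ContDiff ℝ ∞ G := by
    rw [contDiff_iff_contDiffAt]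
    intro v
    by_cases hv : v ∈ O
    · exact χ.contDiffAt.smul (hg.contDiffAt (hO.mem_nhds hv))
    · have hv' : v ∉ tsupport χ := by
        rw [χ.tsupport_eq]
        intro h
        apply hv
        apply hεO
        have : dist v (A w₀) ≤ ε / 2 := h
        exact lt_of_le_of_lt this (by linarith)
      have : G =ᶠ[𝓝 v] fun _ ↦ 0 := by
        filter_upwards [(isClosed_tsupport χ).isOpen_compl.mem_nhds hv'] with v' hv'
        simp [G, image_eq_zero_of_notMem_tsupport hv']
      exact contDiffAt_const.congr_of_eventuallyEq this
  have hGg : ∀ v ∈ Metric.ball (A w₀) (ε / 4), G v = g v := by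
    intro v hv
    have : χ v = 1 := χ.one_of_mem_closedBall (Metric.ball_subset_closedBall hv)
    simp [G, this]
  let F : (V × ℝ) × ℝ → W := fun z ↦ fderiv ℝ G (A z.1.1 + (z.2 * z.1.2) • B z.1.1) (B z.1.1)
  have hF : ContDiff ℝ ∞ F :=
    ((hG.fderiv_right (m := ∞) (by simp)).comp (by fun_prop)).clm_apply (by fun_prop)
  have hI : ContDiff ℝ ∞ (fun z : V × ℝ ↦ ∫ s in (0 : ℝ)..1, F (z, s)) := by
    rw [contDiff_infty]
    intro n
    exact contDiff_integral_param n (hF.of_le (by exact_mod_cast le_top))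
  have hGd : Differentiable ℝ G := hG.differentiable (by simp)
  have hint : ∀ z : V × ℝ, z.2 • ∫ s in (0 : ℝ)..1, F (z, s)
      = G (A z.1 + z.2 • B z.1) - G (A z.1) := by
    intro z
    rw [← intervalIntegral.integral_smul]
    have := intervalIntegral.integral_eq_sub_of_hasDerivAt
      (f := fun s : ℝ ↦ G (A z.1 + (s * z.2) • B z.1)) (a := 0) (b := 1)
      (f' := fun s ↦ z.2 • F (z, s)) (fun s _ ↦ ?_) ?_
    · simpa using this
    · have h1 : HasDerivAt (fun s : ℝ ↦ A z.1 + (s * z.2) • B z.1) (z.2 • B z.1) s := by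
        simpa using (((hasDerivAt_id s).mul_const z.2).smul_const (B z.1)).const_add (A z.1)
      have := (hGd (A z.1 + (s * z.2) • B z.1)).hasFDerivAt.comp_hasDerivAt s h1
      simpa [F, Function.comp_def] using this
    · exact ((hF.continuous.comp
        (by fun_prop : Continuous fun s : ℝ ↦ (z, s))).const_smul z.2).intervalIntegrable _ _
  refine hI.contDiffAt.congr_of_eventuallyEq ?_
  have c1 : Tendsto (fun z : V × ℝ ↦ A z.1 + z.2 • B z.1) (𝓝 (w₀, 0)) (𝓝 (A w₀)) := by
    have : Continuous (fun z : V × ℝ ↦ A z.1 + z.2 • B z.1) := by fun_prop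
    simpa using this.tendsto (w₀, 0)
  have c2 : Tendsto (fun z : V × ℝ ↦ A z.1) (𝓝 (w₀, 0)) (𝓝 (A w₀)) := by
    have : Continuous (fun z : V × ℝ ↦ A z.1) := by fun_prop
    simpa using this.tendsto (w₀, 0)
  have hball : Metric.ball (A w₀) (ε / 4) ∈ 𝓝 (A w₀) := Metric.ball_mem_nhds _ (by positivity)
  have c3 : Tendsto (Prod.fst : V × ℝ → V) (𝓝 (w₀, 0)) (𝓝 w₀) := continuous_fst.tendsto _
  filter_upwards [c1.eventually hball, c2.eventually hball, c3.eventually h0] with z h1 h2 h3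
  split_ifs with ht
  · have : fderiv ℝ G (A z.1) = fderiv ℝ g (A z.1) := by
      apply Filter.EventuallyEq.fderiv_eq
      filter_upwards [Metric.isOpen_ball.mem_nhds h2] with v hv using hGg v hv
    simp [F, ht, this]
  · rw [← hGg _ h1, inv_smul_eq_iff₀ ht, hint z, hGg _ h2, h3, sub_zero]

end Analysis

noncomputable section

/-! ### Slice charts, normal bundle and deformation to the normal cone of an immersion -/

section Immersion

variable {EY EX : Type*} [NormedAddCommGroup EY] [NormedSpace ℝ EY] [NormedAddCommGroup EX]
  [NormedSpace ℝ EX] {Y X : Type*} [TopologicalSpace Y] [ChartedSpace EY Y] [TopologicalSpace X]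
  [ChartedSpace EX X]

/-- A slice chart of `j : Y → X`: charts `φ` of `X` and `ψ` of `Y` in which `j` is a linear
embedding `L` with a chosen linear retraction `p`. Thus `EX = L(EY) ⊕ ker p` plays the role of
`ℝᵖ × ℝ^q` and `j` is read as `u ↦ (u, 0)`. -/
structure Slice (EY EX : Type*) [NormedAddCommGroup EY] [NormedSpace ℝ EY]
    [NormedAddCommGroup EX] [NormedSpace ℝ EX] {Y X : Type*} [TopologicalSpace Y]
    [ChartedSpace EY Y] [TopologicalSpace X] [ChartedSpace EX X] (j : Y → X) where
  φ : OpenPartialHomeomorph X EX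
  ψ : OpenPartialHomeomorph Y EY
  L : EY →L[ℝ] EX
  p : EX →L[ℝ] EY
  φ_mem : φ ∈ IsManifold.maximalAtlas 𝓘(ℝ, EX) ∞ X
  ψ_mem : ψ ∈ IsManifold.maximalAtlas 𝓘(ℝ, EY) ∞ Y
  p_L : ∀ u, p (L u) = u
  maps : ∀ y ∈ ψ.source, j y ∈ φ.source
  φ_j : ∀ y ∈ ψ.source, φ (j y) = L (ψ y)

theorem exists_slice {j : Y → X} (hj : Manifold.IsImmersion 𝓘(ℝ, EY) 𝓘(ℝ, EX) ∞ j) (y : Y) :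
    ∃ σ : Slice EY EX j, y ∈ σ.ψ.source := by
  have h := hj.isImmersionOfComplement_complement y
  refine ⟨⟨h.codChart, h.domChart,
    (h.equiv : (EY × hj.complement) →L[ℝ] EX).comp (ContinuousLinearMap.inl ℝ EY hj.complement),
    (ContinuousLinearMap.fst ℝ EY hj.complement).comp
      (h.equiv.symm : EX →L[ℝ] (EY × hj.complement)),
    h.codChart_mem_maximalAtlas, h.domChart_mem_maximalAtlas, ?_, ?_, ?_⟩,
    h.mem_domChart_source⟩
  · intro u; simp
  · exact fun y hy ↦ h.source_subset_preimage_source hy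
  · intro y' hy'
    have := h.writtenInCharts (by simpa using h.domChart.map_source hy' :
      h.domChart y' ∈ (h.domChart.extend 𝓘(ℝ, EY)).target)
    simpa [h.domChart.left_inv hy'] using this

/-- The total space of the normal bundle `N(X, Y, j) = j^*TX / TY` of an immersion `j : Y → X`. -/
@[nolint unusedArguments]
def NormalBundle {j : Y → X} (_hj : Manifold.IsImmersion 𝓘(ℝ, EY) 𝓘(ℝ, EX) ∞ j) : Type _ :=
  Σ y : Y, TangentSpace 𝓘(ℝ, EX) (j y) ⧸ (mfderiv 𝓘(ℝ, EY) 𝓘(ℝ, EX) j y).range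

/-- The set `D(X, Y, j) = N(X, Y, j) ⊔ X × ℝ^*`. -/
inductive DNC {j : Y → X} (hj : Manifold.IsImmersion 𝓘(ℝ, EY) 𝓘(ℝ, EX) ∞ j) : Type _
  | zero (ξ : NormalBundle hj) : DNC hj
  | off (x : X) (t : ℝ) (ht : t ≠ 0) : DNC hj

variable {j : Y → X} {hj : Manifold.IsImmersion 𝓘(ℝ, EY) 𝓘(ℝ, EX) ∞ j}

namespace NormalBundle

/-- The class `[v]` in the fibre at `y` of the tangent vector `v ∈ T_{j(y)} X`. -/
def mk (hj : Manifold.IsImmersion 𝓘(ℝ, EY) 𝓘(ℝ, EX) ∞ j) (y : Y)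
    (v : TangentSpace 𝓘(ℝ, EX) (j y)) : NormalBundle hj :=
  ⟨y, Submodule.Quotient.mk v⟩

/-- The bundle projection. -/
def proj (ξ : NormalBundle hj) : Y := ξ.1

/-- Some representative of a normal vector. -/
def rep (ξ : NormalBundle hj) : TangentSpace 𝓘(ℝ, EX) (j ξ.proj) := Quotient.out ξ.2

theorem mk_rep (ξ : NormalBundle hj) : mk hj ξ.proj ξ.rep = ξ := by
  rcases ξ with ⟨y, ξ⟩
  exact congrArg (Sigma.mk y) (Submodule.Quotient.mk_out _)

theorem mk_eq_mk {y : Y} {v w : TangentSpace 𝓘(ℝ, EX) (j y)} :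
    mk hj y v = mk hj y w ↔ ∃ a, mfderiv 𝓘(ℝ, EY) 𝓘(ℝ, EX) j y a = v - w := by
  refine ⟨fun h ↦ ?_, fun h ↦ congrArg (Sigma.mk y) ((Submodule.Quotient.eq _).2 h)⟩
  exact (Submodule.Quotient.eq _).1 (eq_of_heq (Sigma.mk.inj h).2)

end NormalBundle

theorem contDiffOn_coordChange {φ φ' : OpenPartialHomeomorph X EX}
    (hφ : φ ∈ IsManifold.maximalAtlas 𝓘(ℝ, EX) ∞ X)
    (hφ' : φ' ∈ IsManifold.maximalAtlas 𝓘(ℝ, EX) ∞ X) :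
    ContDiffOn ℝ ∞ (φ' ∘ φ.symm) (φ.symm.trans φ').source := by
  rw [← contMDiffOn_iff_contDiffOn]
  refine (contMDiffOn_of_mem_maximalAtlas hφ').comp
    ((contMDiffOn_symm_of_mem_maximalAtlas hφ).mono ?_) ?_
  · intro w hw; simp at hw; exact hw.1
  · intro w hw; simp at hw; exact hw.2

namespace Slice

variable (σ : Slice EY EX j)

/-- The projection of `EX = L(EY) ⊕ ker p` onto `ker p`. -/
def q : EX →L[ℝ] EX := ContinuousLinearMap.id ℝ EX - σ.L.comp σ.p

/-- The linear map `(u, ξ) ↦ (u, t ξ)` of `EX = L(EY) ⊕ ker p`. -/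
def δ (t : ℝ) (w : EX) : EX := σ.L (σ.p w) + t • σ.q w

theorem q_apply (w : EX) : σ.q w = w - σ.L (σ.p w) := rfl
theorem q_L (u : EY) : σ.q (σ.L u) = 0 := by simp [q_apply, σ.p_L]
theorem p_q (w : EX) : σ.p (σ.q w) = 0 := by simp [q_apply, σ.p_L]
theorem q_q (w : EX) : σ.q (σ.q w) = σ.q w := by rw [σ.q_apply (σ.q w), p_q]; simp
theorem L_p_add_q (w : EX) : σ.L (σ.p w) + σ.q w = w := by simp [q_apply]
theorem p_δ (t : ℝ) (w : EX) : σ.p (σ.δ t w) = σ.p w := by simp [δ, σ.p_L, p_q]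
theorem q_δ (t : ℝ) (w : EX) : σ.q (σ.δ t w) = t • σ.q w := by simp [δ, q_L, q_q]
theorem δ_zero (w : EX) : σ.δ 0 w = σ.L (σ.p w) := by simp [δ]
theorem δ_δ (s t : ℝ) (w : EX) : σ.δ s (σ.δ t w) = σ.δ (s * t) w := by
  rw [δ, p_δ, q_δ, δ, smul_smul]
theorem δ_one (w : EX) : σ.δ 1 w = w := by rw [δ, one_smul, L_p_add_q]
theorem δ_inv {t : ℝ} (ht : t ≠ 0) (w : EX) : σ.δ t⁻¹ (σ.δ t w) = w := by
  rw [δ_δ, inv_mul_cancel₀ ht, δ_one]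
theorem δ_inv' {t : ℝ} (ht : t ≠ 0) (w : EX) : σ.δ t (σ.δ t⁻¹ w) = w := by
  rw [δ_δ, mul_inv_cancel₀ ht, δ_one]

/-- The differential of the chart `φ` at `x`. -/
abbrev dφ (x : X) : TangentSpace 𝓘(ℝ, EX) x →L[ℝ] EX := mfderiv 𝓘(ℝ, EX) 𝓘(ℝ, EX) σ.φ x

theorem φ_mdiff : σ.φ.MDifferentiable 𝓘(ℝ, EX) 𝓘(ℝ, EX) :=
  ⟨fun _ hx ↦ ((contMDiffOn_of_mem_maximalAtlas σ.φ_mem).mdifferentiableOn (by simp)) _ hx,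
    fun _ hx ↦ ((contMDiffOn_symm_of_mem_maximalAtlas σ.φ_mem).mdifferentiableOn (by simp)) _ hx⟩

theorem ψ_mdiff : σ.ψ.MDifferentiable 𝓘(ℝ, EY) 𝓘(ℝ, EY) :=
  ⟨fun _ hx ↦ ((contMDiffOn_of_mem_maximalAtlas σ.ψ_mem).mdifferentiableOn (by simp)) _ hx,
    fun _ hx ↦ ((contMDiffOn_symm_of_mem_maximalAtlas σ.ψ_mem).mdifferentiableOn (by simp)) _ hx⟩

theorem dφ_bij {x : X} (hx : x ∈ σ.φ.source) : Function.Bijective (σ.dφ x) :=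
  σ.φ_mdiff.mfderiv_bijective hx

/-- The inverse of the differential of the chart `φ` at `x`. -/
def dφInv (x : X) (w : EX) : TangentSpace 𝓘(ℝ, EX) x := Function.invFun (σ.dφ x) w

theorem dφ_dφInv {x : X} (hx : x ∈ σ.φ.source) (w : EX) : σ.dφ x (σ.dφInv x w) = w :=
  Function.rightInverse_invFun (σ.dφ_bij hx).2 w

theorem dφ_dj (hj : Manifold.IsImmersion 𝓘(ℝ, EY) 𝓘(ℝ, EX) ∞ j) {y : Y} (hy : y ∈ σ.ψ.source)
    (a : TangentSpace 𝓘(ℝ, EY) y) :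
    σ.dφ (j y) (mfderiv 𝓘(ℝ, EY) 𝓘(ℝ, EX) j y a)
      = σ.L (mfderiv 𝓘(ℝ, EY) 𝓘(ℝ, EY) σ.ψ y a) := by
  have hjd : MDifferentiableAt 𝓘(ℝ, EY) 𝓘(ℝ, EX) j y := hj.contMDiff.mdifferentiable (by simp) y
  have h1 := mfderiv_comp y (σ.φ_mdiff.mdifferentiableAt (σ.maps y hy)) hjd
  have h2 := mfderiv_comp y (σ.L.mdifferentiableAt (x := σ.ψ y)) (σ.ψ_mdiff.mdifferentiableAt hy)
  have h3 : (σ.φ ∘ j) =ᶠ[𝓝 y] (σ.L ∘ σ.ψ) := by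
    filter_upwards [σ.ψ.open_source.mem_nhds hy] with y' hy' using σ.φ_j y' hy'
  have h4 := h3.mfderiv_eq (I := 𝓘(ℝ, EY)) (I' := 𝓘(ℝ, EX))
  rw [h1, h2] at h4
  have := DFunLike.congr_fun h4 a
  rw [ContinuousLinearMap.mfderiv_eq] at this
  exact this

theorem mk_eq_mk_iff {y : Y} (hy : y ∈ σ.ψ.source) (v w : TangentSpace 𝓘(ℝ, EX) (j y)) :
    NormalBundle.mk hj y v = NormalBundle.mk hj y w
      ↔ σ.q (σ.dφ (j y) v) = σ.q (σ.dφ (j y) w) := by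
  rw [NormalBundle.mk_eq_mk]
  constructor
  · rintro ⟨a, ha⟩
    have h := σ.dφ_dj hj hy a
    rw [ha, map_sub] at h
    have h' := congrArg σ.q h
    exact sub_eq_zero.1 ((map_sub σ.q _ _).symm.trans (h'.trans (σ.q_L _)))
  · intro h
    obtain ⟨a, ha⟩ := (σ.ψ_mdiff.mfderiv_bijective hy).2 (σ.p (σ.dφ (j y) (v - w)))
    refine ⟨a, (σ.dφ_bij (σ.maps y hy)).1 ?_⟩
    rw [σ.dφ_dj hj hy a, ha]
    have h0 : σ.q (σ.dφ (j y) (v - w)) = 0 := by rw [map_sub, map_sub, h, sub_self]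
    have := σ.L_p_add_q (σ.dφ (j y) (v - w))
    rw [h0, add_zero] at this
    exact this

theorem q_dφ_rep {y : Y} (hy : y ∈ σ.ψ.source) (v : TangentSpace 𝓘(ℝ, EX) (j y)) :
    σ.q (σ.dφ (j y) (NormalBundle.rep (NormalBundle.mk hj y v))) = σ.q (σ.dφ (j y) v) :=
  (σ.mk_eq_mk_iff hy _ _).1 (NormalBundle.mk_rep (NormalBundle.mk hj y v))

/-- The chart `[v]_y ↦ (ψ y, d_Nφ_y(v))` of the normal bundle given by a slice chart, where
`d_Nφ` is the normal component of the differential of `φ`. -/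
def normalChart (hj : Manifold.IsImmersion 𝓘(ℝ, EY) 𝓘(ℝ, EX) ∞ j) (σ : Slice EY EX j) :
    PartialEquiv (NormalBundle hj) EX where
  toFun ξ := σ.L (σ.ψ ξ.proj) + σ.q (σ.dφ (j ξ.proj) ξ.rep)
  invFun w := NormalBundle.mk hj (σ.ψ.symm (σ.p w)) (σ.dφInv _ (σ.q w))
  source := {ξ | ξ.proj ∈ σ.ψ.source}
  target := {w | σ.p w ∈ σ.ψ.target}
  map_source' ξ hξ := by
    simpa [σ.p_L, p_q] using σ.ψ.map_source hξ
  map_target' w hw := σ.ψ.map_target hw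
  left_inv' ξ hξ := by
    have h1 : σ.p (σ.L (σ.ψ ξ.proj) + σ.q (σ.dφ (j ξ.proj) ξ.rep)) = σ.ψ ξ.proj := by
      simp [σ.p_L, p_q]
    have h2 : σ.q (σ.L (σ.ψ ξ.proj) + σ.q (σ.dφ (j ξ.proj) ξ.rep))
        = σ.q (σ.dφ (j ξ.proj) ξ.rep) := by simp [q_L, q_q]
    have h3 : σ.ψ.symm (σ.ψ ξ.proj) = ξ.proj := σ.ψ.left_inv hξ
    change NormalBundle.mk hj (σ.ψ.symm (σ.p (σ.L (σ.ψ ξ.proj) + σ.q (σ.dφ (j ξ.proj) ξ.rep))))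
      (σ.dφInv _ (σ.q (σ.L (σ.ψ ξ.proj) + σ.q (σ.dφ (j ξ.proj) ξ.rep)))) = ξ
    rw [h1, h2, h3]
    conv_rhs => rw [← NormalBundle.mk_rep ξ]
    rw [σ.mk_eq_mk_iff hξ, σ.dφ_dφInv (σ.maps _ hξ), q_q]
  right_inv' w hw := by
    change σ.L (σ.ψ (σ.ψ.symm (σ.p w))) + σ.q (σ.dφ (j (σ.ψ.symm (σ.p w)))
      (NormalBundle.rep (NormalBundle.mk hj (σ.ψ.symm (σ.p w)) (σ.dφInv _ (σ.q w))))) = w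
    have hy := σ.ψ.map_target hw
    rw [σ.q_dφ_rep hy, σ.dφ_dφInv (σ.maps _ hy), q_q, σ.ψ.right_inv hw, L_p_add_q]

open Classical in
/-- The chart of `D(X, Y, j)` given by a slice chart: `([v]_y, 0) ↦ (ψ y, d_Nφ_y(v), 0)` and
`(x, t) ↦ (u, t⁻¹ ξ, t)` for `t ≠ 0`, where `φ x = (u, ξ)`. -/
def dncChart (hj : Manifold.IsImmersion 𝓘(ℝ, EY) 𝓘(ℝ, EX) ∞ j) (σ : Slice EY EX j) :
    PartialEquiv (DNC hj) (EX × ℝ) where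
  toFun d := match d with
    | .zero ξ => (σ.normalChart hj ξ, 0)
    | .off x t _ => (σ.δ t⁻¹ (σ.φ x), t)
  invFun z := if h : z.2 = 0 then .zero ((σ.normalChart hj).symm z.1)
    else .off (σ.φ.symm (σ.δ z.2 z.1)) z.2 h
  source := {d | match d with
    | .zero ξ => ξ ∈ (σ.normalChart hj).source
    | .off x _ _ => x ∈ σ.φ.source}
  target := {z | if z.2 = 0 then z.1 ∈ (σ.normalChart hj).target else σ.δ z.2 z.1 ∈ σ.φ.target}
  map_source' d hd := by
    rcases d with ξ | ⟨x, t, ht⟩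
    · simpa using (σ.normalChart hj).map_source hd
    · simpa [ht, σ.δ_inv' ht] using σ.φ.map_source hd
  map_target' z hz := by
    by_cases h : z.2 = 0
    · simp only [mem_ofPred_eq, h, if_true, dite_true] at hz ⊢
      exact (σ.normalChart hj).map_target hz
    · simp only [mem_ofPred_eq, h, if_false, dite_false] at hz ⊢
      exact σ.φ.map_target hz
  left_inv' d hd := by
    rcases d with ξ | ⟨x, t, ht⟩
    · simpa using (σ.normalChart hj).left_inv hd
    · simpa [ht, σ.δ_inv' ht] using σ.φ.left_inv hd
  right_inv' z hz := by
    rcases z with ⟨w, t⟩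
    by_cases h : t = 0
    · subst h
      simp only [mem_ofPred_eq, if_true, dite_true] at hz ⊢
      rw [(σ.normalChart hj).right_inv hz]
    · simp only [mem_ofPred_eq, h, if_false, dite_false] at hz ⊢
      rw [σ.φ.right_inv hz, σ.δ_inv h]

theorem normalChart_mk {y : Y} (hy : y ∈ σ.ψ.source) (v : TangentSpace 𝓘(ℝ, EX) (j y)) :
    σ.normalChart hj (NormalBundle.mk hj y v) = σ.L (σ.ψ y) + σ.q (σ.dφ (j y) v) :=
  congrArg (σ.L (σ.ψ y) + ·) (σ.q_dφ_rep hy v)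

variable (σ' : Slice EY EX j)

theorem contDiffOn_φ : ContDiffOn ℝ ∞ (σ'.φ ∘ σ.φ.symm) (σ.φ.symm.trans σ'.φ).source :=
  contDiffOn_coordChange σ.φ_mem σ'.φ_mem

/-- The domain of the coordinate change between two charts of `D(X, Y, j)`. -/
theorem source_dnc : ((σ.dncChart hj).symm.trans (σ'.dncChart hj)).source =
    {z | z.2 ≠ 0 ∧ σ.δ z.2 z.1 ∈ (σ.φ.symm.trans σ'.φ).source} ∪
    {z | σ.p z.1 ∈ (σ.ψ.symm.trans σ'.ψ).source ∧
      σ.δ z.2 z.1 ∈ (σ.φ.symm.trans σ'.φ).source} := by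
  have key : ∀ u, u ∈ (σ.ψ.symm.trans σ'.ψ).source → σ.L u ∈ (σ.φ.symm.trans σ'.φ).source := by
    intro u hu
    simp only [OpenPartialHomeomorph.trans_source, OpenPartialHomeomorph.symm_source, mem_inter_iff,
      mem_preimage] at hu ⊢
    have h1 := σ.φ_j _ (σ.ψ.map_target hu.1)
    rw [σ.ψ.right_inv hu.1] at h1
    have h2 := σ.maps _ (σ.ψ.map_target hu.1)
    rw [← h1]
    refine ⟨σ.φ.map_source h2, ?_⟩
    rw [σ.φ.left_inv h2]
    exact σ'.maps _ hu.2
  ext ⟨w, t⟩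
  by_cases ht : t = 0
  · subst ht
    have : (w, (0 : ℝ)) ∈ ((σ.dncChart hj).symm.trans (σ'.dncChart hj)).source ↔
        σ.p w ∈ (σ.ψ.symm.trans σ'.ψ).source := by
      simp only [PartialEquiv.trans_source, PartialEquiv.symm_source, dncChart, mem_inter_iff,
        mem_preimage, OpenPartialHomeomorph.trans_source, OpenPartialHomeomorph.symm_source]
      have h0 : (if h : (0 : ℝ) = 0 then DNC.zero ((σ.normalChart hj).symm w)
          else DNC.off (σ.φ.symm (σ.δ 0 w)) 0 h) = DNC.zero ((σ.normalChart hj).symm w) :=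
        dif_pos rfl
      change ((if (0 : ℝ) = 0 then _ else _) ∧ (match (if h : (0 : ℝ) = 0 then
          DNC.zero ((σ.normalChart hj).symm w) else DNC.off (σ.φ.symm (σ.δ 0 w)) 0 h) with
        | .zero ξ => ξ ∈ (σ'.normalChart hj).source
        | .off x _ _ => x ∈ σ'.φ.source)) ↔ _
      rw [h0, if_pos rfl]
      exact Iff.rfl
    rw [this]
    simp only [mem_union, mem_ofPred_eq, ne_eq, not_true_eq_false, false_and, false_or, δ_zero]
    exact ⟨fun h ↦ ⟨h, key _ h⟩, fun h ↦ h.1⟩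
  · have : (w, t) ∈ ((σ.dncChart hj).symm.trans (σ'.dncChart hj)).source ↔
        σ.δ t w ∈ (σ.φ.symm.trans σ'.φ).source := by
      simp only [PartialEquiv.trans_source, PartialEquiv.symm_source, dncChart, mem_inter_iff,
        mem_preimage, OpenPartialHomeomorph.trans_source, OpenPartialHomeomorph.symm_source]
      simp [ht]
    rw [this]
    simp only [mem_union, mem_ofPred_eq]
    exact ⟨fun h ↦ Or.inl ⟨ht, h⟩, fun h ↦ h.elim (·.2) (·.2)⟩

theorem contDiff_δ : ContDiff ℝ ∞ fun z : EX × ℝ ↦ σ.δ z.2 z.1 := by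
  unfold δ; fun_prop

theorem continuous_δ : Continuous fun z : EX × ℝ ↦ σ.δ z.2 z.1 :=
  σ.contDiff_δ.continuous

theorem isOpen_source_dnc : IsOpen ((σ.dncChart hj).symm.trans (σ'.dncChart hj)).source := by
  rw [source_dnc]
  have h1 := (σ.φ.symm.trans σ'.φ).open_source.preimage σ.continuous_δ
  have h2 := (σ.ψ.symm.trans σ'.ψ).open_source.preimage (σ.p.continuous.comp continuous_fst :
    Continuous fun z : EX × ℝ ↦ σ.p z.1)
  have h3 : IsOpen {z : EX × ℝ | z.2 ≠ 0} := isOpen_ne_fun continuous_snd continuous_const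
  exact (h3.inter h1).union (h2.inter h1)

/-- The coordinate change of the normal bundle. -/
theorem normal_transition {w : EX} (hw : σ.p w ∈ (σ.ψ.symm.trans σ'.ψ).source) :
    σ'.normalChart hj ((σ.normalChart hj).symm w) =
      σ'.L (σ'.p (σ'.φ (σ.φ.symm (σ.L (σ.p w))))) +
        fderiv ℝ (fun v ↦ σ'.q (σ'.φ (σ.φ.symm v))) (σ.L (σ.p w)) (σ.q w) := by
  have hw' := hw
  simp only [OpenPartialHomeomorph.trans_source, OpenPartialHomeomorph.symm_source, mem_inter_iff,
      mem_preimage] at hw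
  have hy := σ.ψ.map_target hw.1
  set y := σ.ψ.symm (σ.p w) with hydef
  have h1 : σ.φ (j y) = σ.L (σ.p w) := by rw [σ.φ_j y hy, hydef, σ.ψ.right_inv hw.1]
  have h2 : σ.φ.symm (σ.L (σ.p w)) = j y := by rw [← h1, σ.φ.left_inv (σ.maps y hy)]
  have e1 : σ'.normalChart hj ((σ.normalChart hj).symm w) =
      σ'.L (σ'.ψ y) + σ'.q (σ'.dφ (j y) (σ.dφInv (j y) (σ.q w))) :=
    σ'.normalChart_mk (hj := hj) hw.2 (σ.dφInv (j y) (σ.q w))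
  rw [e1, h2, σ'.φ_j y hw.2, σ'.p_L]
  congr 1
  have hLO : σ.L (σ.p w) ∈ (σ.φ.symm.trans σ'.φ).source := by
    simp only [OpenPartialHomeomorph.trans_source, OpenPartialHomeomorph.symm_source,
      mem_inter_iff, mem_preimage]
    rw [h2, ← h1]
    exact ⟨σ.φ.map_source (σ.maps y hy), σ'.maps y hw.2⟩
  have hθ : DifferentiableAt ℝ (σ'.φ ∘ σ.φ.symm) (σ.L (σ.p w)) :=
    ((σ.contDiffOn_φ σ').contDiffAt ((σ.φ.symm.trans σ'.φ).open_source.mem_nhds hLO)).differentiableAt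
      (by simp)
  have h3 : fderiv ℝ (fun v ↦ σ'.q (σ'.φ (σ.φ.symm v))) (σ.L (σ.p w)) =
      σ'.q.comp (fderiv ℝ (σ'.φ ∘ σ.φ.symm) (σ.L (σ.p w))) :=
    (σ'.q.hasFDerivAt.comp (σ.L (σ.p w)) hθ.hasFDerivAt).fderiv
  rw [h3]
  change σ'.q _ = σ'.q _
  congr 1
  have h4 : (σ'.φ : X → EX) =ᶠ[𝓝 (j y)] (σ'.φ ∘ σ.φ.symm) ∘ σ.φ := by
    filter_upwards [σ.φ.open_source.mem_nhds (σ.maps y hy)] with x hx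
    simp [σ.φ.left_inv hx]
  have h5 := h4.mfderiv_eq (I := 𝓘(ℝ, EX)) (I' := 𝓘(ℝ, EX))
  have hθ' : MDifferentiableAt 𝓘(ℝ, EX) 𝓘(ℝ, EX) (σ'.φ ∘ σ.φ.symm) (σ.φ (j y)) := by
    rw [h1]; exact hθ.mdifferentiableAt
  rw [mfderiv_comp (j y) hθ' (σ.φ_mdiff.mdifferentiableAt (σ.maps y hy))] at h5
  have h6 := DFunLike.congr_fun h5 (σ.dφInv (j y) (σ.q w))
  refine h6.trans ?_
  change mfderiv 𝓘(ℝ, EX) 𝓘(ℝ, EX) (σ'.φ ∘ σ.φ.symm) (σ.φ (j y))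
    (σ.dφ (j y) (σ.dφInv (j y) (σ.q w))) = _
  rw [σ.dφ_dφInv (σ.maps y hy), mfderiv_eq_fderiv, h1]
  rfl

theorem contDiffOn_dnc [FiniteDimensional ℝ EX] : ContDiffOn ℝ ∞
    ((σ.dncChart hj).symm.trans (σ'.dncChart hj))
    ((σ.dncChart hj).symm.trans (σ'.dncChart hj)).source := by
  have : CompleteSpace EX := FiniteDimensional.complete ℝ EX
  set g : EX → EX := fun v ↦ σ'.q (σ'.φ (σ.φ.symm v)) with hg
  set O := (σ.φ.symm.trans σ'.φ).source
  have hO : IsOpen O := (σ.φ.symm.trans σ'.φ).open_source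
  have hgO : ContDiffOn ℝ ∞ g O := σ'.q.contDiff.comp_contDiffOn (σ.contDiffOn_φ σ')
  -- the coordinate change, written through a divided difference
  have hT : EqOn ((σ.dncChart hj).symm.trans (σ'.dncChart hj))
      (fun z ↦ (σ'.L (σ'.p (σ'.φ (σ.φ.symm (σ.δ z.2 z.1)))) +
        (if z.2 = 0 then fderiv ℝ g (σ.L.comp σ.p z.1) (σ.q z.1)
          else z.2⁻¹ • g (σ.L.comp σ.p z.1 + z.2 • σ.q z.1)), z.2))
      ((σ.dncChart hj).symm.trans (σ'.dncChart hj)).source := by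
    rintro ⟨w, t⟩ hz
    rw [source_dnc] at hz
    by_cases ht : t = 0
    · subst ht
      have hz' : σ.p w ∈ (σ.ψ.symm.trans σ'.ψ).source := by
        rcases hz with hz | hz
        · exact absurd rfl hz.1
        · exact hz.1
      have := σ.normal_transition (hj := hj) σ' hz'
      simp only [PartialEquiv.coe_trans, dncChart, Function.comp_apply]
      simpa [δ_zero] using this
    · simp only [PartialEquiv.coe_trans, dncChart, Function.comp_apply]
      simp [ht, hg, δ]
  refine ContDiffOn.congr ?_ hT
  have hδ := σ.contDiff_δ
  rw [source_dnc]
  intro z hz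
  refine ContDiffAt.contDiffWithinAt ?_
  have hzO : σ.δ z.2 z.1 ∈ O := by
    rcases hz with hz | hz
    · exact hz.2
    · exact hz.2
  have h1 : ContDiffAt ℝ ∞ (fun z : EX × ℝ ↦ σ'.L (σ'.p (σ'.φ (σ.φ.symm (σ.δ z.2 z.1))))) z :=
    (σ'.L.comp σ'.p).contDiff.contDiffAt.comp z (ContDiffAt.comp (g := σ'.φ ∘ σ.φ.symm) z
      ((σ.contDiffOn_φ σ').contDiffAt (hO.mem_nhds hzO)) hδ.contDiffAt)
  refine (h1.add ?_).prodMk contDiffAt_snd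
  rcases z with ⟨w, t⟩
  by_cases ht : t = 0
  · subst ht
    have hz' : σ.p w ∈ (σ.ψ.symm.trans σ'.ψ).source := by
      rcases hz with hz | hz
      · exact absurd rfl hz.1
      · exact hz.1
    refine contDiffAt_divided_difference hO hgO (σ.L.comp σ.p) σ.q w ?_ ?_
    · simpa [δ_zero] using hzO
    · filter_upwards [((σ.ψ.symm.trans σ'.ψ).open_source.preimage σ.p.continuous).mem_nhds hz']
        with v hv
      simp only [OpenPartialHomeomorph.trans_source, OpenPartialHomeomorph.symm_source,
        mem_inter_iff, mem_preimage] at hv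
      have hy := σ.ψ.map_target hv.1
      have e1 : σ.φ.symm (σ.L (σ.p v)) = j (σ.ψ.symm (σ.p v)) := by
        rw [← σ.φ.left_inv (σ.maps _ hy), σ.φ_j _ hy, σ.ψ.right_inv hv.1]
      change σ'.q (σ'.φ (σ.φ.symm (σ.L (σ.p v)))) = 0
      rw [e1, σ'.φ_j _ hv.2, q_L]
  · have hne : ∀ᶠ z : EX × ℝ in 𝓝 (w, t), z.2 ≠ 0 :=
      (isOpen_ne_fun continuous_snd continuous_const).mem_nhds ht
    have h2 : ContDiffAt ℝ ∞ (fun z : EX × ℝ ↦ z.2⁻¹ • g (σ.δ z.2 z.1)) (w, t) :=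
      (contDiffAt_snd.inv ht).smul (ContDiffAt.comp (g := g) (w, t)
        (hgO.contDiffAt (hO.mem_nhds hzO)) hδ.contDiffAt)
    refine h2.congr_of_eventuallyEq ?_
    filter_upwards [hne] with z hz
    rw [if_neg hz]
    rfl

theorem source_normal : ((σ.normalChart hj).symm.trans (σ'.normalChart hj)).source =
    (fun w ↦ (w, (0 : ℝ))) ⁻¹' ((σ.dncChart hj).symm.trans (σ'.dncChart hj)).source := by
  ext w
  simp only [PartialEquiv.trans_source, PartialEquiv.symm_source, dncChart, mem_inter_iff,
    mem_preimage]
  simp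

theorem contDiffOn_normal [FiniteDimensional ℝ EX] : ContDiffOn ℝ ∞
    ((σ.normalChart hj).symm.trans (σ'.normalChart hj))
    ((σ.normalChart hj).symm.trans (σ'.normalChart hj)).source := by
  rw [source_normal]
  have h := contDiff_fst.comp_contDiffOn ((σ.contDiffOn_dnc (hj := hj) σ').comp
    (contDiff_id.prodMk contDiff_const : ContDiff ℝ ∞ fun w : EX ↦ (w, (0 : ℝ))).contDiffOn
    (mapsTo_preimage _ _))
  refine h.congr fun w hw ↦ ?_
  simp [dncChart]

end Slice

theorem isManifold_of_core {E : Type*} [NormedAddCommGroup E] [NormedSpace ℝ E] {M : Type*}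
    (c : ChartedSpaceCore E M) (h : ∀ e e' : PartialEquiv M E, e ∈ c.atlas → e' ∈ c.atlas →
      ContDiffOn ℝ ∞ (e.symm.trans e') (e.symm.trans e').source) :
    @IsManifold ℝ _ E _ _ E _ 𝓘(ℝ, E) ∞ M c.toTopologicalSpace c.toChartedSpace := by
  let : TopologicalSpace M := c.toTopologicalSpace
  let : ChartedSpace E M := c.toChartedSpace
  refine isManifold_of_contDiffOn 𝓘(ℝ, E) ∞ M fun e e' he he' ↦ ?_
  obtain ⟨f, hf, rfl⟩ : ∃ f, ∃ hf : f ∈ c.atlas, e = c.openPartialHomeomorph f hf := by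
    change e ∈ ⋃ (f : PartialEquiv M E) (hf : f ∈ c.atlas), {c.openPartialHomeomorph f hf} at he
    simpa only [mem_iUnion, mem_singleton_iff] using he
  obtain ⟨f', hf', rfl⟩ : ∃ f, ∃ hf : f ∈ c.atlas, e' = c.openPartialHomeomorph f hf := by
    change e' ∈ ⋃ (f : PartialEquiv M E) (hf : f ∈ c.atlas), {c.openPartialHomeomorph f hf} at he'
    simpa only [mem_iUnion, mem_singleton_iff] using he'
  refine (h f f' hf hf').mono fun x hx ↦ ?_
  exact hx.1

open Classical in
/-- The chart `(x, t) ↦ (φ x, t)` of the part `X × ℝ^*` of `D(X, Y, j)` given by a chart of `X`. -/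
def offChart (hj : Manifold.IsImmersion 𝓘(ℝ, EY) 𝓘(ℝ, EX) ∞ j) (φ : OpenPartialHomeomorph X EX) :
    PartialEquiv (DNC hj) (EX × ℝ) where
  toFun d := match d with
    | .zero _ => 0
    | .off x t _ => (φ x, t)
  invFun z := if h : z.2 = 0 then .off (φ.symm z.1) 1 one_ne_zero else .off (φ.symm z.1) z.2 h
  source := {d | match d with
    | .zero _ => False
    | .off x _ _ => x ∈ φ.source}
  target := {z | z.2 ≠ 0 ∧ z.1 ∈ φ.target}
  map_source' d hd := by
    rcases d with ξ | ⟨x, t, ht⟩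
    · exact hd.elim
    · exact ⟨ht, φ.map_source hd⟩
  map_target' z hz := by
    simp only [mem_ofPred_eq, hz.1, dite_false]
    exact φ.map_target hz.2
  left_inv' d hd := by
    rcases d with ξ | ⟨x, t, ht⟩
    · exact hd.elim
    · simpa [ht] using φ.left_inv hd
  right_inv' z hz := by
    simp only [hz.1, dite_false]
    rw [φ.right_inv hz.2]

section OffTransitions

variable {φ φ' : OpenPartialHomeomorph X EX} (σ : Slice EY EX j)

theorem source_off_off : ((offChart hj φ).symm.trans (offChart hj φ')).source =
    {z | z.2 ≠ 0} ∩ (fun z ↦ z.1) ⁻¹' (φ.symm.trans φ').source := by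
  ext ⟨w, t⟩
  by_cases ht : t = 0 <;> simp [offChart, ht]

theorem source_slice_off : ((σ.dncChart hj).symm.trans (offChart hj φ')).source =
    {z | z.2 ≠ 0} ∩ (fun z ↦ σ.δ z.2 z.1) ⁻¹' (σ.φ.symm.trans φ').source := by
  ext ⟨w, t⟩
  by_cases ht : t = 0 <;> simp [offChart, Slice.dncChart, ht]

theorem source_off_slice : ((offChart hj φ).symm.trans (σ.dncChart hj)).source =
    {z | z.2 ≠ 0} ∩ (fun z ↦ z.1) ⁻¹' (φ.symm.trans σ.φ).source := by
  ext ⟨w, t⟩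
  by_cases ht : t = 0 <;> simp [offChart, Slice.dncChart, ht]

theorem isOpen_ne_zero {E : Type*} [TopologicalSpace E] : IsOpen {z : E × ℝ | z.2 ≠ 0} :=
  isOpen_ne_fun continuous_snd continuous_const

theorem contDiffOn_off_off (hφ : φ ∈ IsManifold.maximalAtlas 𝓘(ℝ, EX) ∞ X)
    (hφ' : φ' ∈ IsManifold.maximalAtlas 𝓘(ℝ, EX) ∞ X) :
    ContDiffOn ℝ ∞ ((offChart hj φ).symm.trans (offChart hj φ'))
      ((offChart hj φ).symm.trans (offChart hj φ')).source := by
  rw [source_off_off]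
  refine ContDiffOn.congr (f := fun z ↦ ((φ' ∘ φ.symm) z.1, z.2)) ?_ ?_
  · exact ((contDiffOn_coordChange hφ hφ').comp contDiff_fst.contDiffOn
      (fun z hz ↦ hz.2)).prodMk contDiffOn_snd
  · rintro ⟨w, t⟩ ⟨ht : t ≠ 0, -⟩
    simp [offChart, ht]

theorem contDiffOn_slice_off (hφ' : φ' ∈ IsManifold.maximalAtlas 𝓘(ℝ, EX) ∞ X) :
    ContDiffOn ℝ ∞ ((σ.dncChart hj).symm.trans (offChart hj φ'))
      ((σ.dncChart hj).symm.trans (offChart hj φ')).source := by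
  rw [source_slice_off]
  refine ContDiffOn.congr (f := fun z ↦ ((φ' ∘ σ.φ.symm) (σ.δ z.2 z.1), z.2)) ?_ ?_
  · exact ((contDiffOn_coordChange σ.φ_mem hφ').comp σ.contDiff_δ.contDiffOn
      (fun z hz ↦ hz.2)).prodMk contDiffOn_snd
  · rintro ⟨w, t⟩ ⟨ht : t ≠ 0, -⟩
    simp [offChart, Slice.dncChart, ht]

theorem contDiffOn_off_slice (hφ : φ ∈ IsManifold.maximalAtlas 𝓘(ℝ, EX) ∞ X) :
    ContDiffOn ℝ ∞ ((offChart hj φ).symm.trans (σ.dncChart hj))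
      ((offChart hj φ).symm.trans (σ.dncChart hj)).source := by
  rw [source_off_slice]
  refine ContDiffOn.congr (f := fun z ↦ (σ.δ z.2⁻¹ ((σ.φ ∘ φ.symm) z.1), z.2)) ?_ ?_
  · have h1 : ContDiffOn ℝ ∞ (fun z : EX × ℝ ↦ ((σ.φ ∘ φ.symm) z.1, z.2⁻¹))
        ({z | z.2 ≠ 0} ∩ (fun z ↦ z.1) ⁻¹' (φ.symm.trans σ.φ).source) :=
      ((contDiffOn_coordChange hφ σ.φ_mem).comp contDiff_fst.contDiffOn
        (fun z hz ↦ hz.2)).prodMk (contDiffOn_snd.inv fun z hz ↦ hz.1)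
    exact (σ.contDiff_δ.comp_contDiffOn h1).prodMk contDiffOn_snd
  · rintro ⟨w, t⟩ ⟨ht : t ≠ 0, -⟩
    simp [offChart, Slice.dncChart, ht]

end OffTransitions

/-- All charts of `D(X, Y, j)`: those given by slice charts and those of `X × ℝ^*`. -/
def dncAtlas (hj : Manifold.IsImmersion 𝓘(ℝ, EY) 𝓘(ℝ, EX) ∞ j) :
    Set (PartialEquiv (DNC hj) (EX × ℝ)) :=
  range (fun σ : Slice EY EX j ↦ σ.dncChart hj) ∪
    offChart hj '' IsManifold.maximalAtlas 𝓘(ℝ, EX) ∞ X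

theorem isOpen_dncAtlas {e e' : PartialEquiv (DNC hj) (EX × ℝ)} (he : e ∈ dncAtlas hj)
    (he' : e' ∈ dncAtlas hj) : IsOpen (e.symm.trans e').source := by
  rcases he with ⟨σ, rfl⟩ | ⟨φ, hφ, rfl⟩ <;> rcases he' with ⟨σ', rfl⟩ | ⟨φ', hφ', rfl⟩
  · exact σ.isOpen_source_dnc σ'
  · rw [source_slice_off]
    exact isOpen_ne_zero.inter ((σ.φ.symm.trans φ').open_source.preimage σ.continuous_δ)
  · rw [source_off_slice]
    exact isOpen_ne_zero.inter ((φ.symm.trans σ'.φ).open_source.preimage continuous_fst)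
  · rw [source_off_off]
    exact isOpen_ne_zero.inter ((φ.symm.trans φ').open_source.preimage continuous_fst)

variable [FiniteDimensional ℝ EX]

/-- The atlas of all slice charts of the normal bundle. -/
def NormalBundle.core (hj : Manifold.IsImmersion 𝓘(ℝ, EY) 𝓘(ℝ, EX) ∞ j) :
    ChartedSpaceCore EX (NormalBundle hj) where
  atlas := range fun σ : Slice EY EX j ↦ σ.normalChart hj
  chartAt ξ := (exists_slice hj ξ.proj).choose.normalChart hj
  mem_chart_source ξ := (exists_slice hj ξ.proj).choose_spec
  chart_mem_atlas ξ := mem_range_self _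
  open_source := by
    rintro _ _ ⟨σ, rfl⟩ ⟨σ', rfl⟩
    rw [Slice.source_normal]
    exact (σ.isOpen_source_dnc σ').preimage (by fun_prop)
  continuousOn_toFun := by
    rintro _ _ ⟨σ, rfl⟩ ⟨σ', rfl⟩
    exact (σ.contDiffOn_normal σ').continuousOn

instance (hj : Manifold.IsImmersion 𝓘(ℝ, EY) 𝓘(ℝ, EX) ∞ j) : TopologicalSpace (NormalBundle hj) :=
  (NormalBundle.core hj).toTopologicalSpace

instance (hj : Manifold.IsImmersion 𝓘(ℝ, EY) 𝓘(ℝ, EX) ∞ j) : ChartedSpace EX (NormalBundle hj) :=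
  (NormalBundle.core hj).toChartedSpace

instance (hj : Manifold.IsImmersion 𝓘(ℝ, EY) 𝓘(ℝ, EX) ∞ j) :
    IsManifold 𝓘(ℝ, EX) ∞ (NormalBundle hj) := by
  refine isManifold_of_core (NormalBundle.core hj) ?_
  rintro _ _ ⟨σ, rfl⟩ ⟨σ', rfl⟩
  exact σ.contDiffOn_normal σ'

theorem contDiffOn_dncAtlas {e e' : PartialEquiv (DNC hj) (EX × ℝ)} (he : e ∈ dncAtlas hj)
    (he' : e' ∈ dncAtlas hj) : ContDiffOn ℝ ∞ (e.symm.trans e') (e.symm.trans e').source := by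
  rcases he with ⟨σ, rfl⟩ | ⟨φ, hφ, rfl⟩ <;> rcases he' with ⟨σ', rfl⟩ | ⟨φ', hφ', rfl⟩
  · exact σ.contDiffOn_dnc σ'
  · exact contDiffOn_slice_off σ hφ'
  · exact contDiffOn_off_slice σ' hφ
  · exact contDiffOn_off_off hφ hφ'

variable [IsManifold 𝓘(ℝ, EX) ∞ X]

/-- The atlas of the deformation to the normal cone. -/
def DNC.core (hj : Manifold.IsImmersion 𝓘(ℝ, EY) 𝓘(ℝ, EX) ∞ j) :
    ChartedSpaceCore (EX × ℝ) (DNC hj) where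
  atlas := dncAtlas hj
  chartAt d := match d with
    | .zero ξ => (exists_slice hj ξ.proj).choose.dncChart hj
    | .off x _ _ => offChart hj (chartAt EX x)
  mem_chart_source d := by
    rcases d with ξ | ⟨x, t, ht⟩
    · exact (exists_slice hj ξ.proj).choose_spec
    · exact mem_chart_source EX x
  chart_mem_atlas d := by
    rcases d with ξ | ⟨x, t, ht⟩
    · exact Or.inl (mem_range_self _)
    · exact Or.inr ⟨_, IsManifold.chart_mem_maximalAtlas x, rfl⟩
  open_source _ _ he he' := isOpen_dncAtlas he he'
  continuousOn_toFun _ _ he he' := (contDiffOn_dncAtlas he he').continuousOn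

instance (hj : Manifold.IsImmersion 𝓘(ℝ, EY) 𝓘(ℝ, EX) ∞ j) : TopologicalSpace (DNC hj) :=
  (DNC.core hj).toTopologicalSpace

instance (hj : Manifold.IsImmersion 𝓘(ℝ, EY) 𝓘(ℝ, EX) ∞ j) : ChartedSpace (EX × ℝ) (DNC hj) :=
  (DNC.core hj).toChartedSpace

instance (hj : Manifold.IsImmersion 𝓘(ℝ, EY) 𝓘(ℝ, EX) ∞ j) :
    IsManifold 𝓘(ℝ, EX × ℝ) ∞ (DNC hj) :=
  isManifold_of_core (DNC.core hj) fun _ _ he he' ↦ contDiffOn_dncAtlas he he'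

end Immersion

/-! ### Functoriality of the normal bundle and of the deformation to the normal cone -/

section Functoriality

variable {EY EX EY' EX' : Type*} [NormedAddCommGroup EY] [NormedSpace ℝ EY] [NormedAddCommGroup EX]
  [NormedSpace ℝ EX] [NormedAddCommGroup EY'] [NormedSpace ℝ EY'] [NormedAddCommGroup EX']
  [NormedSpace ℝ EX'] {Y X Y' X' : Type*} [TopologicalSpace Y] [ChartedSpace EY Y]
  [TopologicalSpace X] [ChartedSpace EX X] [TopologicalSpace Y'] [ChartedSpace EY' Y']
  [TopologicalSpace X'] [ChartedSpace EX' X'] {j : Y → X} {j' : Y' → X'}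

/-- The map `N(f, f₀) : [v]_y ↦ [df(v)]_{f₀ y}` defined for a morphism `(f, f₀)` of immersions, that
is `f ∘ j = j' ∘ f₀`. By `map_mk`, it does not depend on the representative. The tangent spaces at
the equal points `f (j y)` and `j' (f₀ y)` are identified without further notice. -/
def NormalBundle.map (hj : Manifold.IsImmersion 𝓘(ℝ, EY) 𝓘(ℝ, EX) ∞ j)
    (hj' : Manifold.IsImmersion 𝓘(ℝ, EY') 𝓘(ℝ, EX') ∞ j') (f : X → X') (f₀ : Y → Y') :
    NormalBundle hj → NormalBundle hj' :=
  fun ξ ↦ mk hj' (f₀ ξ.proj) (mfderiv 𝓘(ℝ, EX) 𝓘(ℝ, EX') f (j ξ.proj) ξ.rep)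

theorem NormalBundle.map_mk (hj : Manifold.IsImmersion 𝓘(ℝ, EY) 𝓘(ℝ, EX) ∞ j)
    (hj' : Manifold.IsImmersion 𝓘(ℝ, EY') 𝓘(ℝ, EX') ∞ j') {f : X → X'} {f₀ : Y → Y'}
    (hf : ContMDiff 𝓘(ℝ, EX) 𝓘(ℝ, EX') ∞ f) (hf₀ : ContMDiff 𝓘(ℝ, EY) 𝓘(ℝ, EY') ∞ f₀)
    (h : f ∘ j = j' ∘ f₀) (y : Y) (v : TangentSpace 𝓘(ℝ, EX) (j y)) :
    map hj hj' f f₀ (mk hj y v) = mk hj' (f₀ y) (mfderiv 𝓘(ℝ, EX) 𝓘(ℝ, EX') f (j y) v) := by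
  obtain ⟨a, ha⟩ := mk_eq_mk.1 (mk_rep (mk hj y v))
  have h1 := mfderiv_comp y ((hf.mdifferentiable (by simp)) (j y))
    ((hj.contMDiff.mdifferentiable (by simp)) y)
  have h2 := mfderiv_comp y ((hj'.contMDiff.mdifferentiable (by simp)) (f₀ y))
    ((hf₀.mdifferentiable (by simp)) y)
  have h3 : mfderiv 𝓘(ℝ, EX) 𝓘(ℝ, EX') f (j y) (mfderiv 𝓘(ℝ, EY) 𝓘(ℝ, EX) j y a) =
      mfderiv 𝓘(ℝ, EY') 𝓘(ℝ, EX') j' (f₀ y) (mfderiv 𝓘(ℝ, EY) 𝓘(ℝ, EY') f₀ y a) := by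
    have h4 : mfderiv 𝓘(ℝ, EY) 𝓘(ℝ, EX') (f ∘ j) y a =
        mfderiv 𝓘(ℝ, EY) 𝓘(ℝ, EX') (j' ∘ f₀) y a := by rw [h]
    rw [h1, h2] at h4
    exact h4
  refine mk_eq_mk.2 ⟨mfderiv 𝓘(ℝ, EY) 𝓘(ℝ, EY') f₀ y a, h3.symm.trans ?_⟩
  exact (congrArg (mfderiv 𝓘(ℝ, EX) 𝓘(ℝ, EX') f (j y)) ha).trans (map_sub _ _ _)

/-- The map `D(f, f₀)`, equal to `N(f, f₀)` over `0` and to `(x, t) ↦ (f x, t)` for `t ≠ 0`. -/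
def DNC.map (hj : Manifold.IsImmersion 𝓘(ℝ, EY) 𝓘(ℝ, EX) ∞ j)
    (hj' : Manifold.IsImmersion 𝓘(ℝ, EY') 𝓘(ℝ, EX') ∞ j') (f : X → X') (f₀ : Y → Y') :
    DNC hj → DNC hj'
  | .zero ξ => .zero (NormalBundle.map hj hj' f f₀ ξ)
  | .off x t ht => .off (f x) t ht

/-- The canonical map `D(X, Y, j) → X`, sending `([v]_y, 0)` to `j y` and `(x, t)` to `x`. -/
def DNC.toBase {hj : Manifold.IsImmersion 𝓘(ℝ, EY) 𝓘(ℝ, EX) ∞ j} : DNC hj → X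
  | .zero ξ => j ξ.proj
  | .off x _ _ => x

end Functoriality

/-! ### Lie groupoids -/

/-- The structure maps of a groupoid with arrows `G` and units `M`. The product `mul (g, h) = g h`
is only meaningful on composable pairs, that is when `src g = tgt h`. -/
structure GroupoidStr (G M : Type*) where
  src : G → M
  tgt : G → M
  one : M → G
  inv : G → G
  mul : G × G → G

/-- The set `G⁽²⁾` of composable pairs. -/
def GroupoidStr.composable {G M : Type*} (S : GroupoidStr G M) : Set (G × G) :=
  {p | S.src p.1 = S.tgt p.2}

section LieGroupoid

variable (E F : Type*) [NormedAddCommGroup E] [NormedSpace ℝ E] [NormedAddCommGroup F]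
  [NormedSpace ℝ F] {G M : Type*} [TopologicalSpace G] [ChartedSpace E G] [TopologicalSpace M]
  [ChartedSpace F M]

/-- The structure maps `S` make the manifolds `G` (modelled on `E`) and `M` (modelled on `F`) a Lie
groupoid `G ⇉ M`. As source and target are submersions, `G⁽²⁾` is an embedded submanifold of
`G × G`, and smoothness of the product on `G⁽²⁾` is smoothness on this subset. -/
structure IsLieGroupoid (S : GroupoidStr G M) : Prop where
  src_submersion : Manifold.IsSubmersion 𝓘(ℝ, E) 𝓘(ℝ, F) ∞ S.src
  tgt_submersion : Manifold.IsSubmersion 𝓘(ℝ, E) 𝓘(ℝ, F) ∞ S.tgt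
  contMDiff_one : ContMDiff 𝓘(ℝ, F) 𝓘(ℝ, E) ∞ S.one
  contMDiff_inv : ContMDiff 𝓘(ℝ, E) 𝓘(ℝ, E) ∞ S.inv
  contMDiffOn_mul : ContMDiffOn (𝓘(ℝ, E).prod 𝓘(ℝ, E)) 𝓘(ℝ, E) ∞ S.mul S.composable
  src_one : ∀ x, S.src (S.one x) = x
  tgt_one : ∀ x, S.tgt (S.one x) = x
  src_mul : ∀ g h, S.src g = S.tgt h → S.src (S.mul (g, h)) = S.src h
  tgt_mul : ∀ g h, S.src g = S.tgt h → S.tgt (S.mul (g, h)) = S.tgt g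
  mul_assoc : ∀ g h k, S.src g = S.tgt h → S.src h = S.tgt k →
    S.mul (S.mul (g, h), k) = S.mul (g, S.mul (h, k))
  one_mul : ∀ g, S.mul (S.one (S.tgt g), g) = g
  mul_one : ∀ g, S.mul (g, S.one (S.src g)) = g
  src_inv : ∀ g, S.src (S.inv g) = S.tgt g
  tgt_inv : ∀ g, S.tgt (S.inv g) = S.src g
  inv_mul : ∀ g, S.mul (S.inv g, g) = S.one (S.src g)
  mul_inv : ∀ g, S.mul (g, S.inv g) = S.one (S.tgt g)

variable {G' M' : Type*} in
/-- `(f, f₀)` is compatible with source, target and products (hence with units and inverses). -/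
structure IsGroupoidHom (S : GroupoidStr G M) (S' : GroupoidStr G' M') (f : G → G') (f₀ : M → M') :
    Prop where
  src_map : ∀ g, S'.src (f g) = f₀ (S.src g)
  tgt_map : ∀ g, S'.tgt (f g) = f₀ (S.tgt g)
  map_mul : ∀ g h, S.src g = S.tgt h → f (S.mul (g, h)) = S'.mul (f g, f h)

variable (E' F' : Type*) [NormedAddCommGroup E'] [NormedSpace ℝ E'] [NormedAddCommGroup F']
  [NormedSpace ℝ F'] {G' M' : Type*} [TopologicalSpace G'] [ChartedSpace E' G']
  [TopologicalSpace M'] [ChartedSpace F' M']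

/-- A Lie groupoid immersion: a morphism of groupoids which is an immersion on arrows and units
(for a morphism of Lie groupoids the latter follows from the former). -/
structure IsLieGroupoidImmersion (S : GroupoidStr G M) (S' : GroupoidStr G' M') (f : G → G')
    (f₀ : M → M') : Prop extends IsGroupoidHom S S' f f₀ where
  immersion : Manifold.IsImmersion 𝓘(ℝ, E) 𝓘(ℝ, E') ∞ f
  immersion₀ : Manifold.IsImmersion 𝓘(ℝ, F) 𝓘(ℝ, F') ∞ f₀

end LieGroupoid

/-! ### The normal groupoid and the deformation groupoid of a Lie groupoid immersion -/

section Groupoids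

variable {E₁ F₁ E₂ F₂ : Type*} [NormedAddCommGroup E₁] [NormedSpace ℝ E₁] [NormedAddCommGroup F₁]
  [NormedSpace ℝ F₁] [NormedAddCommGroup E₂] [NormedSpace ℝ E₂] [NormedAddCommGroup F₂]
  [NormedSpace ℝ F₂] {G₁ M₁ G₂ M₂ : Type*} [TopologicalSpace G₁] [ChartedSpace E₁ G₁]
  [TopologicalSpace M₁] [ChartedSpace F₁ M₁] [TopologicalSpace G₂] [ChartedSpace E₂ G₂]
  [TopologicalSpace M₂] [ChartedSpace F₂ M₂] {j : G₁ → G₂} {j₀ : M₁ → M₂}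

/-- The product `N(m₂, m₁)` of the normal groupoid. For `N(s)ξ = N(t)η` there are representatives
`v, w` of `ξ, η` with `ds(v) = dt(w)`, that is `(v, w)` is tangent to `G₂⁽²⁾`, and the product of
`ξ` and `η` is the class of `dm₂(v, w)`, which does not depend on the choice of `v, w`. The
differential of `m₂` on vectors tangent to `G₂⁽²⁾` is the one within `G₂⁽²⁾ ⊆ G₂ × G₂`. -/
def NormalBundle.mul (S₁ : GroupoidStr G₁ M₁) (S₂ : GroupoidStr G₂ M₂)
    (hj : Manifold.IsImmersion 𝓘(ℝ, E₁) 𝓘(ℝ, E₂) ∞ j) (z : NormalBundle hj × NormalBundle hj) :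
    NormalBundle hj :=
  let y := z.1.proj
  let y' := z.2.proj
  let vw : E₂ × E₂ := Classical.epsilon fun vw : E₂ × E₂ ↦
    mk hj y vw.1 = z.1 ∧ mk hj y' vw.2 = z.2 ∧
      (mfderiv 𝓘(ℝ, E₂) 𝓘(ℝ, F₂) S₂.src (j y) vw.1 : F₂) =
        mfderiv 𝓘(ℝ, E₂) 𝓘(ℝ, F₂) S₂.tgt (j y') vw.2
  mk hj (S₁.mul (y, y')) (mfderivWithin (𝓘(ℝ, E₂).prod 𝓘(ℝ, E₂)) 𝓘(ℝ, E₂) S₂.mul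
    S₂.composable (j y, j y') vw)

/-- The structure maps of the normal groupoid `N(j) ⇉ N(j₀)`. -/
def NormalBundle.groupoid (S₁ : GroupoidStr G₁ M₁) (S₂ : GroupoidStr G₂ M₂)
    (hj : Manifold.IsImmersion 𝓘(ℝ, E₁) 𝓘(ℝ, E₂) ∞ j)
    (hj₀ : Manifold.IsImmersion 𝓘(ℝ, F₁) 𝓘(ℝ, F₂) ∞ j₀) :
    GroupoidStr (NormalBundle hj) (NormalBundle hj₀) where
  src := NormalBundle.map hj hj₀ S₂.src S₁.src
  tgt := NormalBundle.map hj hj₀ S₂.tgt S₁.tgt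
  one := NormalBundle.map hj₀ hj S₂.one S₁.one
  inv := NormalBundle.map hj hj S₂.inv S₁.inv
  mul := NormalBundle.mul (F₂ := F₂) S₁ S₂ hj

/-- The product `D(m₂, m₁)` of the deformation groupoid (the last case, in which the arrows are
never composable, is irrelevant). -/
def DNC.mul (S₁ : GroupoidStr G₁ M₁) (S₂ : GroupoidStr G₂ M₂)
    (hj : Manifold.IsImmersion 𝓘(ℝ, E₁) 𝓘(ℝ, E₂) ∞ j) : DNC hj × DNC hj → DNC hj
  | (.zero ξ, .zero η) => .zero (NormalBundle.mul (F₂ := F₂) S₁ S₂ hj (ξ, η))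
  | (.off g t ht, .off h _ _) => .off (S₂.mul (g, h)) t ht
  | (d, _) => d

/-- The structure maps of the deformation to the normal cone groupoid `D(j) ⇉ D(j₀)`. -/
def DNC.groupoid (S₁ : GroupoidStr G₁ M₁) (S₂ : GroupoidStr G₂ M₂)
    (hj : Manifold.IsImmersion 𝓘(ℝ, E₁) 𝓘(ℝ, E₂) ∞ j)
    (hj₀ : Manifold.IsImmersion 𝓘(ℝ, F₁) 𝓘(ℝ, F₂) ∞ j₀) :
    GroupoidStr (DNC hj) (DNC hj₀) where
  src := DNC.map hj hj₀ S₂.src S₁.src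
  tgt := DNC.map hj hj₀ S₂.tgt S₁.tgt
  one := DNC.map hj₀ hj S₂.one S₁.one
  inv := DNC.map hj hj S₂.inv S₁.inv
  mul := DNC.mul (F₂ := F₂) S₁ S₂ hj

end Groupoids

/-! ### The canonical identification `N(D(j₂, j₁)) ≅ D(N(i₂, i₁))` -/

section Canonical

variable {A₁ A₂ B₁ B₂ : Type*} [NormedAddCommGroup A₁] [NormedSpace ℝ A₁] [NormedAddCommGroup A₂]
  [NormedSpace ℝ A₂] [FiniteDimensional ℝ A₂] [NormedAddCommGroup B₁] [NormedSpace ℝ B₁]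
  [FiniteDimensional ℝ B₁] [NormedAddCommGroup B₂] [NormedSpace ℝ B₂] [FiniteDimensional ℝ B₂]
  {L₁ L₂ M₁ M₂ : Type*} [TopologicalSpace L₁] [ChartedSpace A₁ L₁] [TopologicalSpace L₂]
  [ChartedSpace A₂ L₂] [IsManifold 𝓘(ℝ, A₂) ∞ L₂] [TopologicalSpace M₁] [ChartedSpace B₁ M₁]
  [TopologicalSpace M₂] [ChartedSpace B₂ M₂] [IsManifold 𝓘(ℝ, B₂) ∞ M₂]
  {i₁ : L₁ → L₂} {i₂ : M₁ → M₂} {j₁ : L₁ → M₁} {j₂ : L₂ → M₂}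
  {hi₁ : Manifold.IsImmersion 𝓘(ℝ, A₁) 𝓘(ℝ, A₂) ∞ i₁}
  {hi₂ : Manifold.IsImmersion 𝓘(ℝ, B₁) 𝓘(ℝ, B₂) ∞ i₂}
  {hj₁ : Manifold.IsImmersion 𝓘(ℝ, A₁) 𝓘(ℝ, B₁) ∞ j₁}
  {hj₂ : Manifold.IsImmersion 𝓘(ℝ, A₂) 𝓘(ℝ, B₂) ∞ j₂}

/-- For a commutative square of immersions `j₂ ∘ i₁ = i₂ ∘ j₁`, this says that the map
`Φ : N(D(j₂, j₁)) → D(N(i₂, i₁))` is the canonical one: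
* it covers the identity of `D(L₂, L₁, i₁)`, where the left-hand side is a bundle over
  `D(L₂, L₁, i₁)` by definition and the right-hand side projects to `D(L₂, L₁, i₁)` by `D(π₂, π₁)`,
  the `πₖ` being the projections of the bundles `N(M₂, L₂, j₂) → L₂` and `N(M₁, L₁, j₁) → L₁`;
* over `L₂ × ℝ^*` it is the obvious identification with `N(M₂, L₂, j₂) × ℝ^*`, that is
  `N(pr, pr)`, for the projections `pr` to `M₂` and `L₂`, together with the parameter `t`. -/
def IsCanonical
    (hD : Manifold.IsImmersion 𝓘(ℝ, A₂ × ℝ) 𝓘(ℝ, B₂ × ℝ) ∞ (DNC.map hi₁ hi₂ j₂ j₁))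
    (hN : Manifold.IsImmersion 𝓘(ℝ, B₁) 𝓘(ℝ, B₂) ∞ (NormalBundle.map hj₁ hj₂ i₂ i₁))
    (Φ : NormalBundle hD → DNC hN) : Prop :=
  (∀ ξ, DNC.map hN hi₁ NormalBundle.proj NormalBundle.proj (Φ ξ) = ξ.proj) ∧
  ∀ ξ x t ht, ξ.proj = DNC.off x t ht →
    Φ ξ = DNC.off (NormalBundle.map hD hj₂ DNC.toBase DNC.toBase ξ) t ht

end Canonical

end

/-!
The isomorphism `N(D(j₂, j₁)) ≅ D(N(i₂, i₁))` is constructed from charts in which the whole square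
is linear.

The existence of such charts rests on cleanness of the square (`IsCleanAt`): if `dj₂(l) = di₂(m)`,
then `l` is tangent to `G₁`. This holds because `N(j₂, j₁)`, being an immersion, does not identify
the small normal vectors `[s l]` with `0` unless they vanish (`isCleanAt_of_isImmersion_map`). The
square of units inherits cleanness through the unit maps and the source maps (`isCleanAt_units`), so
that everything below applies to arrows and units alike. Cleanness provides compatible linear
retractions (`LinearSquare.exists_of_clean`), and the inverse function theorem a chart of the
largest manifold in which both maps into it are linear (`LinearSquare.exists_chart`,
`exists_squareChart`). In these charts `D(j₂, j₁)` and `N(i₂, i₁)` are linear embeddings, hence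
immersions (`DNC.isImmersion_map`, `NormalBundle.isImmersion_map`), and the induced charts of
`N(D(j₂, j₁))` and `D(N(i₂, i₁))` have the same image. Over `t ≠ 0` the obvious identification is
the identity in these charts (`SquareChart.chartDN_off`), so that it extends to `t = 0` as the
identity in charts, independently of their choice by continuity (`canonicalMap_chart`). This gives
the diffeomorphism (`exists_diffeomorph_isCanonical`).

That normal and deformation groupoids are Lie groupoids (`DNC.isLieGroupoid`,
`NormalBundle.isLieGroupoid`) is proved first on the deformation, whose restriction to `t = 0` is
the normal groupoid. The maps `D(f, f₀)` are smooth, since in charts they are divided differences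
near `t = 0` (`DNC.contMDiff_map`). For the product, which is only defined on composable pairs, the
same argument is applied to an extension to all pairs, obtained from charts in which the target map
is linear (`MulData.ext`, `DNC.contMDiffOn_mul`). Source and target are submersions, as a morphism
of immersions with submersive components is linear in suitable charts (`exists_slice_isLinear`).

All remaining identities are evident over `t ≠ 0` and extend to `t = 0` by density: the axioms of a
groupoid, the homomorphism property (`IsCanonical.isGroupoidHom`) and the uniqueness
(`IsCanonical.eq`) of the isomorphism. The manifolds need not be Hausdorff, but limits over `t = 0`
are unique once their base points in the smallest manifold of the square agree, since points over
the same base point lie in a common chart (`DNC.eq_of_tendsto`, `eq_of_tendsto_of_proj_proj`).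
Identities involving products are obtained from limits of composable pairs over `t ≠ 0`, which exist
since the source map is a submersion (`Manifold.IsSubmersion.exists_lift`).
-/


noncomputable section

/-! ### Divided differences and local diffeomorphisms -/

section Calculus

/-- The divided difference of a map between different spaces; the case `V = W` is applied to
`(v, w) ↦ (0, g v)` on `V × W`. -/
theorem contDiffAt_divided_difference' {V W : Type*} [NormedAddCommGroup V] [NormedSpace ℝ V]
    [FiniteDimensional ℝ V] [NormedAddCommGroup W] [NormedSpace ℝ W] [FiniteDimensional ℝ W]
    {g : V → W} {O : Set V} (hO : IsOpen O) (hg : ContDiffOn ℝ ∞ g O) (A B : V →L[ℝ] V) (w₀ : V)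
    (hw₀ : A w₀ ∈ O) (h0 : ∀ᶠ w in 𝓝 w₀, g (A w) = 0) :
    ContDiffAt ℝ ∞ (fun z : V × ℝ ↦ if z.2 = 0 then fderiv ℝ g (A z.1) (B z.1)
      else z.2⁻¹ • g (A z.1 + z.2 • B z.1)) (w₀, 0) := by
  let g' : V × W → V × W := fun z ↦ (0, g z.1)
  let A' : V × W →L[ℝ] V × W := (A.comp (.fst ℝ V W)).prod 0
  let B' : V × W →L[ℝ] V × W := (B.comp (.fst ℝ V W)).prod 0
  have h := contDiffAt_divided_difference (g := g') (O := Prod.fst ⁻¹' O)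
    (hO.preimage continuous_fst) (contDiffOn_const.prodMk
      (hg.comp contDiff_fst.contDiffOn fun _ hz ↦ hz)) A' B' (w₀, 0) hw₀ (by
      have : Tendsto (Prod.fst : V × W → V) (𝓝 (w₀, 0)) (𝓝 w₀) := continuous_fst.tendsto _
      filter_upwards [this.eventually h0] with z hz
      simp [g', A', hz])
  have h2 : ContDiffAt ℝ ∞ (fun z : V × ℝ ↦ ((z.1, (0 : W)), z.2)) (w₀, 0) := by fun_prop
  have h3 := contDiffAt_snd.comp (w₀, (0 : ℝ)) (ContDiffAt.comp (w₀, (0 : ℝ)) h h2)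
  refine h3.congr_of_eventuallyEq ?_
  have c2 : Tendsto (fun z : V × ℝ ↦ A z.1) (𝓝 (w₀, 0)) (𝓝 (A w₀)) := by
    have : Continuous (fun z : V × ℝ ↦ A z.1) := by fun_prop
    simpa using this.tendsto (w₀, 0)
  filter_upwards [c2.eventually (hO.mem_nhds hw₀)] with z hz
  by_cases ht : z.2 = 0
  · have hgd : DifferentiableAt ℝ g (A z.1) :=
      (hg.contDiffAt (hO.mem_nhds hz)).differentiableAt (by simp)
    have hd : HasFDerivAt g' ((0 : V × W →L[ℝ] V).prod
        ((fderiv ℝ g (A z.1)).comp (.fst ℝ V W))) (A' (z.1, 0)) :=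
      (hasFDerivAt_const _ _).prodMk
        (HasFDerivAt.comp (g := g) (A' (z.1, (0 : W))) hgd.hasFDerivAt hasFDerivAt_fst)
    simp [ht, hd.fderiv, B']
  · simp [ht, g', A', B']

/-- The inverse function theorem for a smooth map whose derivative at the point is the identity,
as a member of the smooth groupoid. -/
theorem exists_contDiffGroupoid_of_hasFDerivAt_id {E : Type*} [NormedAddCommGroup E]
    [NormedSpace ℝ E] [FiniteDimensional ℝ E] {F : E → E} {O : Set E} (hO : IsOpen O)
    (hF : ContDiffOn ℝ ∞ F O) {a : E} (ha : a ∈ O)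
    (hd : HasFDerivAt F (ContinuousLinearMap.id ℝ E) a) :
    ∃ θ : OpenPartialHomeomorph E E, θ ∈ contDiffGroupoid ∞ 𝓘(ℝ, E) ∧ a ∈ θ.source ∧
      θ.source ⊆ O ∧ ∀ x, θ x = F x := by
  have : CompleteSpace E := FiniteDimensional.complete ℝ E
  have hFa : ContDiffAt ℝ ∞ F a := hF.contDiffAt (hO.mem_nhds ha)
  let θ₀ := hFa.toOpenPartialHomeomorph (f' := ContinuousLinearEquiv.refl ℝ E) F hd (by simp)
  have hcont : ContinuousAt (fderiv ℝ F) a :=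
    (hFa.fderiv_right (m := ∞) (by simp)).continuousAt
  have hunit : ∀ᶠ x in 𝓝 a, x ∈ O ∧
      fderiv ℝ F x ∈ range ((↑) : (E ≃L[ℝ] E) → E →L[ℝ] E) := by
    refine (hO.eventually_mem ha).and (hcont.eventually ?_)
    rw [hd.fderiv]
    exact ContinuousLinearEquiv.nhds (ContinuousLinearEquiv.refl ℝ E)
  obtain ⟨U, hU, hUo, haU⟩ := eventually_nhds_iff.1 hunit
  refine ⟨θ₀.restrOpen U hUo, ?_, ?_, ?_, fun x ↦ rfl⟩
  · rw [contDiffGroupoid, mem_groupoid_of_pregroupoid]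
    constructor
    · rw [contDiffPregroupoid]
      simp only [modelWithCornersSelf_coe, modelWithCornersSelf_coe_symm, Function.id_comp,
        Function.comp_id, preimage_id, range_id, inter_univ]
      exact fun x hx ↦ (hF x (hU x hx.2).1).mono fun y hy ↦ (hU y hy.2).1
    · rw [contDiffPregroupoid]
      simp only [modelWithCornersSelf_coe, modelWithCornersSelf_coe_symm, Function.id_comp,
        Function.comp_id, preimage_id, range_id, inter_univ]
      intro x hx
      have hx' := (θ₀.restrOpen U hUo).map_target hx
      obtain ⟨e, he⟩ := (hU _ hx'.2).2
      have hx0 : x ∈ θ₀.target := hx.1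
      have hFx : ContDiffAt ℝ ∞ F (θ₀.symm x) := hF.contDiffAt (hO.mem_nhds (hU _ hx'.2).1)
      refine (θ₀.contDiffAt_symm hx0 (f₀' := e) ?_ hFx).contDiffWithinAt
      rw [he]
      exact (hFx.differentiableAt (by simp)).hasFDerivAt
  · exact ⟨hFa.mem_toOpenPartialHomeomorph_source (f' := ContinuousLinearEquiv.refl ℝ E) hd
      (by simp), haU⟩
  · exact fun x hx ↦ (hU x hx.2).1

/-- The composition of a chart with a local diffeomorphism of the model space is a chart. -/
theorem trans_mem_maximalAtlas {E X : Type*} [NormedAddCommGroup E] [NormedSpace ℝ E]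
    [TopologicalSpace X] [ChartedSpace E X] {φ : OpenPartialHomeomorph X E}
    (hφ : φ ∈ IsManifold.maximalAtlas 𝓘(ℝ, E) ∞ X) {θ : OpenPartialHomeomorph E E}
    (hθ : θ ∈ contDiffGroupoid ∞ 𝓘(ℝ, E)) :
    φ.trans θ ∈ IsManifold.maximalAtlas 𝓘(ℝ, E) ∞ X := by
  intro e he
  constructor
  · have h1 := (hφ e he).1
    have := (contDiffGroupoid ∞ 𝓘(ℝ, E)).trans ((contDiffGroupoid ∞ 𝓘(ℝ, E)).symm hθ) h1
    rwa [← OpenPartialHomeomorph.trans_assoc, ← OpenPartialHomeomorph.trans_symm_eq_symm_trans_symm]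
      at this
  · have h1 := (hφ e he).2
    have := (contDiffGroupoid ∞ 𝓘(ℝ, E)).trans h1 hθ
    rwa [OpenPartialHomeomorph.trans_assoc] at this

theorem restrOpen_mem_maximalAtlas {E X : Type*} [NormedAddCommGroup E] [NormedSpace ℝ E]
    [TopologicalSpace X] [ChartedSpace E X] {φ : OpenPartialHomeomorph X E}
    (hφ : φ ∈ IsManifold.maximalAtlas 𝓘(ℝ, E) ∞ X) {s : Set X} (hs : IsOpen s) :
    φ.restrOpen s hs ∈ IsManifold.maximalAtlas 𝓘(ℝ, E) ∞ X := by
  have := restr_mem_maximalAtlas (contDiffGroupoid ∞ 𝓘(ℝ, E)) hφ hs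
  have e : φ.restr s = φ.restrOpen s hs := by
    unfold OpenPartialHomeomorph.restr
    congr 1
    exact hs.interior_eq
  rwa [e] at this

end Calculus

/-! ### Charts of the normal bundle and of the deformation to the normal cone -/

section Charts

variable {EY EX : Type*} [NormedAddCommGroup EY] [NormedSpace ℝ EY] [NormedAddCommGroup EX]
  [NormedSpace ℝ EX] {Y X : Type*} [TopologicalSpace Y] [ChartedSpace EY Y] [TopologicalSpace X]
  [ChartedSpace EX X]

/-- A map into a manifold is smooth if it is the composition of the inverse of a chart with a smooth
map into the model space. -/
theorem contMDiffWithinAt_of_chart_symm {EZ HZ Z : Type*} [NormedAddCommGroup EZ] [NormedSpace ℝ EZ]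
    [TopologicalSpace HZ] {I : ModelWithCorners ℝ EZ HZ} [TopologicalSpace Z] [ChartedSpace HZ Z]
    {e : OpenPartialHomeomorph X EX} (he : e ∈ IsManifold.maximalAtlas 𝓘(ℝ, EX) ∞ X)
    {f : Z → X} {h : Z → EX} {s : Set Z} {z : Z} (hh : ContMDiffWithinAt I 𝓘(ℝ, EX) ∞ h s z)
    (hz : h z ∈ e.target) (hfz : f z = e.symm (h z)) (hf : ∀ᶠ z' in 𝓝[s] z, f z' = e.symm (h z')) :
    ContMDiffWithinAt I 𝓘(ℝ, EX) ∞ f s z := by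
  have h1 := contMDiffAt_symm_of_mem_maximalAtlas he hz
  exact (h1.comp_contMDiffWithinAt z hh).congr_of_eventuallyEq hf hfz

theorem contMDiffAt_of_chart_symm {EZ HZ Z : Type*} [NormedAddCommGroup EZ] [NormedSpace ℝ EZ]
    [TopologicalSpace HZ] {I : ModelWithCorners ℝ EZ HZ} [TopologicalSpace Z] [ChartedSpace HZ Z]
    {e : OpenPartialHomeomorph X EX} (he : e ∈ IsManifold.maximalAtlas 𝓘(ℝ, EX) ∞ X)
    {f : Z → X} {h : Z → EX} {z : Z} (hh : ContMDiffAt I 𝓘(ℝ, EX) ∞ h z)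
    (hz : h z ∈ e.target) (hf : ∀ᶠ z' in 𝓝 z, f z' = e.symm (h z')) :
    ContMDiffAt I 𝓘(ℝ, EX) ∞ f z :=
  contMDiffWithinAt_of_chart_symm he hh hz hf.self_of_nhds (by simpa using hf)

theorem ContDiffAt.contMDiffAt_comp_chart {W : Type*} [NormedAddCommGroup W] [NormedSpace ℝ W]
    {e : OpenPartialHomeomorph X EX} (he : e ∈ IsManifold.maximalAtlas 𝓘(ℝ, EX) ∞ X)
    {h : EX → W} {x : X} (hx : x ∈ e.source) (hh : ContDiffAt ℝ ∞ h (e x)) :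
    ContMDiffAt 𝓘(ℝ, EX) 𝓘(ℝ, W) ∞ (fun x ↦ h (e x)) x :=
  hh.contMDiffAt.comp x (contMDiffAt_of_mem_maximalAtlas he hx)

/-- The partial equivalences of a `ChartedSpaceCore` with smooth transition maps are charts of the
manifold they define. The instances are given explicitly, so that the lemma applies to types whose
topology is defined by the core. -/
theorem isManifold_core_mem_maximalAtlas {E : Type*} [NormedAddCommGroup E] [NormedSpace ℝ E]
    {M : Type*} (c : ChartedSpaceCore E M)
    (h : ∀ e e' : PartialEquiv M E, e ∈ c.atlas → e' ∈ c.atlas →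
      ContDiffOn ℝ ∞ (e.symm.trans e') (e.symm.trans e').source) (e : PartialEquiv M E)
    (he : e ∈ c.atlas) :
    @Membership.mem _ _ _ (@IsManifold.maximalAtlas ℝ _ E _ _ E _ 𝓘(ℝ, E) ∞ M c.toTopologicalSpace
      c.toChartedSpace) (c.openPartialHomeomorph e he) := by
  let : TopologicalSpace M := c.toTopologicalSpace
  let : ChartedSpace E M := c.toChartedSpace
  have : IsManifold 𝓘(ℝ, E) ∞ M := isManifold_of_core c h
  refine IsManifold.subset_maximalAtlas ?_
  change _ ∈ ⋃ (f : PartialEquiv M E) (hf : f ∈ c.atlas), {c.openPartialHomeomorph f hf}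
  simp only [mem_iUnion, mem_singleton_iff]
  exact ⟨e, he, rfl⟩

variable {j : Y → X} {hj : Manifold.IsImmersion 𝓘(ℝ, EY) 𝓘(ℝ, EX) ∞ j}

namespace Slice

variable (σ : Slice EY EX j)

/-- In a slice chart the immersion `j` is the linear embedding `L`. -/
theorem φ_symm_L {y : Y} (hy : y ∈ σ.ψ.source) : σ.φ.symm (σ.L (σ.ψ y)) = j y := by
  rw [← σ.φ_j y hy, σ.φ.left_inv (σ.maps y hy)]

theorem φ_symm_L' {u : EY} (hu : u ∈ σ.ψ.target) : σ.φ.symm (σ.L u) = j (σ.ψ.symm u) := by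
  rw [← σ.φ_symm_L (σ.ψ.map_target hu), σ.ψ.right_inv hu]

end Slice

namespace DNC

/-- The deformation parameter `D(X, Y, j) → ℝ`. -/
def param : DNC hj → ℝ
  | .zero _ => 0
  | .off _ t _ => t

@[simp] theorem param_zero (ξ : NormalBundle hj) : param (.zero ξ) = 0 := rfl
@[simp] theorem param_off (x : X) (t : ℝ) (ht : t ≠ 0) : param (hj := hj) (.off x t ht) = t := rfl

@[simp] theorem toBase_zero (ξ : NormalBundle hj) : toBase (.zero ξ) = j ξ.proj := rfl

@[simp] theorem toBase_off (x : X) (t : ℝ) (ht : t ≠ 0) :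
    toBase (hj := hj) (.off x t ht) = x := rfl

theorem eq_off_of_param_ne_zero {d : DNC hj} (h : d.param ≠ 0) : d = .off d.toBase d.param h := by
  rcases d with ξ | ⟨x, t, ht⟩
  · exact absurd rfl h
  · rfl

open Classical in
/-- The inclusion of `X × ℝ^*`, extended by an arbitrary value over `t = 0`. -/
def incl (hj : Manifold.IsImmersion 𝓘(ℝ, EY) 𝓘(ℝ, EX) ∞ j) (z : X × ℝ) : DNC hj :=
  if h : z.2 ≠ 0 then .off z.1 z.2 h else .off z.1 1 one_ne_zero

theorem incl_of_ne (x : X) {t : ℝ} (ht : t ≠ 0) : incl hj (x, t) = .off x t ht := dif_pos ht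

end DNC

variable [FiniteDimensional ℝ EX]

namespace Slice

/-- The slice chart of the normal bundle as a homeomorphism between open sets. -/
def normalHomeo (hj : Manifold.IsImmersion 𝓘(ℝ, EY) 𝓘(ℝ, EX) ∞ j) (σ : Slice EY EX j) :
    OpenPartialHomeomorph (NormalBundle hj) EX :=
  (NormalBundle.core hj).openPartialHomeomorph (σ.normalChart hj) (mem_range_self σ)

variable (σ : Slice EY EX j)

theorem normalHomeo_mem : σ.normalHomeo hj ∈ IsManifold.maximalAtlas 𝓘(ℝ, EX) ∞ (NormalBundle hj) :=
  isManifold_core_mem_maximalAtlas (NormalBundle.core hj) (by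
    rintro _ _ ⟨σ, rfl⟩ ⟨σ', rfl⟩
    exact σ.contDiffOn_normal σ') _ _

theorem mem_normalHomeo_target {w : EX} :
    w ∈ (σ.normalHomeo hj).target ↔ σ.p w ∈ σ.ψ.target := Iff.rfl

theorem normalHomeo_mk {y : Y} (hy : y ∈ σ.ψ.source) (v : TangentSpace 𝓘(ℝ, EX) (j y)) :
    σ.normalHomeo hj (NormalBundle.mk hj y v) = σ.L (σ.ψ y) + σ.q (σ.dφ (j y) v) :=
  σ.normalChart_mk hy v

/-- The tangential component of the slice chart of the normal bundle is the chart of the base. -/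
theorem p_normalHomeo (ξ : NormalBundle hj) : σ.p (σ.normalHomeo hj ξ) = σ.ψ ξ.proj := by
  change σ.p (σ.L (σ.ψ ξ.proj) + σ.q (σ.dφ (j ξ.proj) ξ.rep)) = _
  simp [σ.p_L, p_q]

variable [IsManifold 𝓘(ℝ, EX) ∞ X]

/-- The slice chart of the deformation to the normal cone as a homeomorphism between open sets. -/
def dncHomeo (hj : Manifold.IsImmersion 𝓘(ℝ, EY) 𝓘(ℝ, EX) ∞ j) (σ : Slice EY EX j) :
    OpenPartialHomeomorph (DNC hj) (EX × ℝ) :=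
  (DNC.core hj).openPartialHomeomorph (σ.dncChart hj) (Or.inl (mem_range_self σ))

theorem dncHomeo_mem : σ.dncHomeo hj ∈ IsManifold.maximalAtlas 𝓘(ℝ, EX × ℝ) ∞ (DNC hj) :=
  isManifold_core_mem_maximalAtlas (DNC.core hj) (fun _ _ he he' ↦ contDiffOn_dncAtlas he he') _ _

@[simp] theorem dncHomeo_zero (ξ : NormalBundle hj) :
    σ.dncHomeo hj (.zero ξ) = (σ.normalHomeo hj ξ, 0) := rfl

@[simp] theorem dncHomeo_off (x : X) (t : ℝ) (ht : t ≠ 0) :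
    σ.dncHomeo hj (.off x t ht) = (σ.δ t⁻¹ (σ.φ x), t) := rfl

theorem mem_dncHomeo_target_zero {w : EX} :
    (w, (0 : ℝ)) ∈ (σ.dncHomeo hj).target ↔ σ.p w ∈ σ.ψ.target := by
  change (if (0 : ℝ) = 0 then _ else _) ↔ _
  rw [if_pos rfl]; rfl

theorem mem_dncHomeo_target_off {w : EX} {t : ℝ} (ht : t ≠ 0) :
    (w, t) ∈ (σ.dncHomeo hj).target ↔ σ.δ t w ∈ σ.φ.target := by
  change (if t = 0 then _ else _) ↔ _
  rw [if_neg ht]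

theorem dncHomeo_symm_zero (w : EX) :
    (σ.dncHomeo hj).symm (w, 0) = .zero ((σ.normalHomeo hj).symm w) := by
  change (if h : (0 : ℝ) = 0 then _ else _) = _
  rw [dif_pos rfl]; rfl

end Slice

theorem NormalBundle.contMDiff_proj :
    ContMDiff 𝓘(ℝ, EX) 𝓘(ℝ, EY) ∞ (proj : NormalBundle hj → Y) := by
  intro ξ
  obtain ⟨σ, hσ⟩ := exists_slice hj ξ.proj
  have hσ' : ξ ∈ (σ.normalHomeo hj).source := hσ
  refine contMDiffAt_of_chart_symm σ.ψ_mem (ContDiffAt.contMDiffAt_comp_chart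
    (σ.normalHomeo_mem (hj := hj)) hσ' (h := σ.p) σ.p.contDiff.contDiffAt) ?_ ?_
  · exact (σ.normalHomeo hj).map_source hσ'
  · filter_upwards [(σ.normalHomeo hj).open_source.mem_nhds hσ'] with ξ' hξ'
    rw [σ.p_normalHomeo]
    exact (σ.ψ.left_inv hξ').symm

variable [IsManifold 𝓘(ℝ, EX) ∞ X]

/-- The chart of the part `X × ℝ^*` of the deformation to the normal cone given by a chart of `X`,
as a homeomorphism between open sets. -/
def offHomeo (hj : Manifold.IsImmersion 𝓘(ℝ, EY) 𝓘(ℝ, EX) ∞ j) {φ : OpenPartialHomeomorph X EX}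
    (hφ : φ ∈ IsManifold.maximalAtlas 𝓘(ℝ, EX) ∞ X) : OpenPartialHomeomorph (DNC hj) (EX × ℝ) :=
  (DNC.core hj).openPartialHomeomorph (offChart hj φ) (Or.inr (mem_image_of_mem _ hφ))

section offHomeo

variable {φ : OpenPartialHomeomorph X EX} (hφ : φ ∈ IsManifold.maximalAtlas 𝓘(ℝ, EX) ∞ X)

theorem offHomeo_mem : offHomeo hj hφ ∈ IsManifold.maximalAtlas 𝓘(ℝ, EX × ℝ) ∞ (DNC hj) :=
  isManifold_core_mem_maximalAtlas (DNC.core hj) (fun _ _ he he' ↦ contDiffOn_dncAtlas he he') _ _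

theorem offHomeo_symm (w : EX) {t : ℝ} (ht : t ≠ 0) :
    (offHomeo hj hφ).symm (w, t) = .off (φ.symm w) t ht := by
  change (if h : t = 0 then _ else _) = _
  rw [dif_neg ht]

end offHomeo

namespace DNC

theorem dncHomeo_snd (σ : Slice EY EX j) (d : DNC hj) : (σ.dncHomeo hj d).2 = d.param := by
  rcases d with ξ | ⟨x, t, ht⟩ <;> rfl

theorem exists_slice_zero (ξ : NormalBundle hj) :
    ∃ σ : Slice EY EX j, .zero ξ ∈ (σ.dncHomeo hj).source :=
  exists_slice hj ξ.proj

/-- The map `D(X, Y, j) → X` in slice charts is `(w, t) ↦ δ t w`, also over `t = 0`. -/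
theorem toBase_eq_of_mem (σ : Slice EY EX j) {d : DNC hj} (hd : d ∈ (σ.dncHomeo hj).source) :
    d.toBase = σ.φ.symm (σ.δ (σ.dncHomeo hj d).2 (σ.dncHomeo hj d).1) := by
  rcases d with ξ | ⟨x, t, ht⟩
  · simp [Slice.δ_zero, Slice.p_normalHomeo, σ.φ_symm_L hd]
  · simpa [σ.δ_inv' ht] using (σ.φ.left_inv hd).symm

theorem contMDiff_param : ContMDiff 𝓘(ℝ, EX × ℝ) 𝓘(ℝ, ℝ) ∞ (param : DNC hj → ℝ) := by
  intro d
  rcases d with ξ | ⟨x, t, ht⟩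
  · obtain ⟨σ, hσ⟩ := exists_slice_zero ξ
    refine (ContDiffAt.contMDiffAt_comp_chart σ.dncHomeo_mem hσ (h := Prod.snd)
      contDiffAt_snd).congr_of_eventuallyEq (Eventually.of_forall fun d ↦ ?_)
    exact (dncHomeo_snd σ d).symm
  · have hφ := IsManifold.chart_mem_maximalAtlas (I := 𝓘(ℝ, EX)) (n := ∞) x
    have hx : DNC.off x t ht ∈ (offHomeo hj hφ).source := mem_chart_source EX x
    refine (ContDiffAt.contMDiffAt_comp_chart (offHomeo_mem hφ) hx (h := Prod.snd)
      contDiffAt_snd).congr_of_eventuallyEq ?_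
    filter_upwards [(offHomeo hj hφ).open_source.mem_nhds hx] with d hd
    rcases d with ξ | ⟨x, t, ht⟩
    · exact hd.elim
    · rfl

theorem contMDiff_toBase : ContMDiff 𝓘(ℝ, EX × ℝ) 𝓘(ℝ, EX) ∞ (toBase : DNC hj → X) := by
  intro d
  rcases d with ξ | ⟨x, t, ht⟩
  · obtain ⟨σ, hσ⟩ := exists_slice_zero ξ
    refine contMDiffAt_of_chart_symm σ.φ_mem (ContDiffAt.contMDiffAt_comp_chart σ.dncHomeo_mem hσ
      (h := fun z ↦ σ.δ z.2 z.1) σ.contDiff_δ.contDiffAt) ?_ ?_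
    · simp only [Slice.dncHomeo_zero, Slice.δ_zero, Slice.p_normalHomeo]
      rw [← σ.φ_j _ hσ]
      exact σ.φ.map_source (σ.maps _ hσ)
    · filter_upwards [(σ.dncHomeo hj).open_source.mem_nhds hσ] with d hd using toBase_eq_of_mem σ hd
  · have hφ := IsManifold.chart_mem_maximalAtlas (I := 𝓘(ℝ, EX)) (n := ∞) x
    have hx : DNC.off x t ht ∈ (offHomeo hj hφ).source := mem_chart_source EX x
    refine contMDiffAt_of_chart_symm hφ (ContDiffAt.contMDiffAt_comp_chart (offHomeo_mem hφ) hx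
      (h := Prod.fst) contDiffAt_fst) ((chartAt EX x).map_source hx) ?_
    filter_upwards [(offHomeo hj hφ).open_source.mem_nhds hx] with d hd
    rcases d with ξ | ⟨x', t, ht⟩
    · exact hd.elim
    · exact ((chartAt EX x).left_inv hd).symm

theorem contMDiff_zero : ContMDiff 𝓘(ℝ, EX) 𝓘(ℝ, EX × ℝ) ∞ (zero : NormalBundle hj → DNC hj) := by
  intro ξ
  obtain ⟨σ, hσ⟩ := exists_slice_zero ξ
  refine contMDiffAt_of_chart_symm σ.dncHomeo_mem (ContDiffAt.contMDiffAt_comp_chart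
    (x := ξ) (σ.normalHomeo_mem (hj := hj)) hσ (h := fun w ↦ (w, (0 : ℝ))) (by fun_prop)) ?_ ?_
  · exact (σ.dncHomeo hj).map_source hσ
  · filter_upwards [(σ.normalHomeo hj).open_source.mem_nhds hσ] with ξ' hξ'
    exact ((σ.dncHomeo hj).left_inv (x := .zero ξ') hξ').symm

/-- The inclusion of `X × ℝ^*` is smooth. -/
theorem contMDiffAt_incl (x : X) {t : ℝ} (ht : t ≠ 0) :
    ContMDiffAt (𝓘(ℝ, EX).prod 𝓘(ℝ, ℝ)) 𝓘(ℝ, EX × ℝ) ∞ (incl hj) (x, t) := by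
  have hφ := IsManifold.chart_mem_maximalAtlas (I := 𝓘(ℝ, EX)) (n := ∞) x
  refine contMDiffAt_of_chart_symm (offHomeo_mem hφ) (h := fun z ↦ (chartAt EX x z.1, z.2)) ?_
    ⟨ht, mem_chart_target EX x⟩ ?_
  · refine ContMDiffAt.prodMk_space ?_ contMDiffAt_snd
    exact ContMDiffAt.comp (x, t) (contMDiffAt_of_mem_maximalAtlas hφ (mem_chart_source EX x))
      contMDiffAt_fst
  · have h1 : ∀ᶠ z : X × ℝ in 𝓝 (x, t), z.1 ∈ (chartAt EX x).source :=
      continuous_fst.continuousAt.eventually ((chartAt EX x).open_source.mem_nhds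
        (mem_chart_source EX x))
    have h2 : ∀ᶠ z : X × ℝ in 𝓝 (x, t), z.2 ≠ 0 :=
      continuous_snd.continuousAt.eventually (eventually_ne_nhds ht)
    filter_upwards [h1, h2] with ⟨x', t'⟩ hx' ht'
    rw [incl_of_ne _ ht', offHomeo_symm hφ _ ht', (chartAt EX x).left_inv hx']

/-- The inclusion of the normal bundle as the fibre over `t = 0` detects smoothness, since it has
smooth local left inverses. -/
theorem contMDiffWithinAt_of_zero {EZ HZ Z : Type*} [NormedAddCommGroup EZ] [NormedSpace ℝ EZ]
    [TopologicalSpace HZ] {I : ModelWithCorners ℝ EZ HZ} [TopologicalSpace Z] [ChartedSpace HZ Z]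
    {g : Z → NormalBundle hj} {s : Set Z} {z : Z}
    (h : ContMDiffWithinAt I 𝓘(ℝ, EX × ℝ) ∞ (fun z ↦ DNC.zero (g z)) s z) :
    ContMDiffWithinAt I 𝓘(ℝ, EX) ∞ g s z := by
  obtain ⟨σ, hσ⟩ := exists_slice_zero (g z)
  have h1 : ContMDiffAt 𝓘(ℝ, EX × ℝ) 𝓘(ℝ, EX) ∞ (fun d : DNC hj ↦ (σ.dncHomeo hj d).1)
      (.zero (g z)) :=
    ContDiffAt.contMDiffAt_comp_chart σ.dncHomeo_mem hσ (h := Prod.fst) contDiffAt_fst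
  refine contMDiffWithinAt_of_chart_symm (σ.normalHomeo_mem (hj := hj))
    (h := fun z ↦ σ.normalHomeo hj (g z))
    (ContMDiffAt.comp_contMDiffWithinAt (f := fun z ↦ DNC.zero (g z)) z h1 h)
    ((σ.normalHomeo hj).map_source hσ)
    ((σ.normalHomeo hj).left_inv hσ).symm ?_
  filter_upwards [h.continuousWithinAt.eventually ((σ.dncHomeo hj).open_source.mem_nhds hσ)]
    with z' hz'
  exact ((σ.normalHomeo hj).left_inv hz').symm

theorem contMDiff_of_zero {EZ HZ Z : Type*} [NormedAddCommGroup EZ] [NormedSpace ℝ EZ]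
    [TopologicalSpace HZ] {I : ModelWithCorners ℝ EZ HZ} [TopologicalSpace Z] [ChartedSpace HZ Z]
    {g : Z → NormalBundle hj} (h : ContMDiff I 𝓘(ℝ, EX × ℝ) ∞ (fun z ↦ DNC.zero (g z))) :
    ContMDiff I 𝓘(ℝ, EX) ∞ g :=
  fun z ↦ contMDiffWithinAt_of_zero (h z)

end DNC

end Charts

/-! ### Smoothness of `N(f, f₀)` and `D(f, f₀)` -/

section ChartDomain

variable {E E' X X' : Type*} [TopologicalSpace E] [TopologicalSpace E'] [TopologicalSpace X]
  [TopologicalSpace X'] {φ : OpenPartialHomeomorph X E} {φ' : OpenPartialHomeomorph X' E'}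
  {f : X → X'}

/-- The domain of the expression of `f` in charts. -/
def chartDomain (φ : OpenPartialHomeomorph X E) (φ' : OpenPartialHomeomorph X' E') (f : X → X') :
    Set E := φ.target ∩ φ.symm ⁻¹' (f ⁻¹' φ'.source)

theorem isOpen_chartDomain (hf : Continuous f) : IsOpen (chartDomain φ φ' f) :=
  φ.symm.isOpen_inter_preimage (φ'.open_source.preimage hf)

theorem mem_chartDomain {x : X} (hx : x ∈ φ.source) (hx' : f x ∈ φ'.source) :
    φ x ∈ chartDomain φ φ' f :=
  ⟨φ.map_source hx, by simpa [φ.left_inv hx] using hx'⟩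

end ChartDomain

section ChartDerivative

variable {E E' X X' : Type*} [NormedAddCommGroup E] [NormedSpace ℝ E] [NormedAddCommGroup E']
  [NormedSpace ℝ E'] [TopologicalSpace X] [ChartedSpace E X] [TopologicalSpace X']
  [ChartedSpace E' X'] {φ : OpenPartialHomeomorph X E} {φ' : OpenPartialHomeomorph X' E'}
  {f : X → X'}

theorem mdifferentiable_of_mem_maximalAtlas (hφ : φ ∈ IsManifold.maximalAtlas 𝓘(ℝ, E) ∞ X) :
    φ.MDifferentiable 𝓘(ℝ, E) 𝓘(ℝ, E) :=
  ⟨fun _ hx ↦ ((contMDiffOn_of_mem_maximalAtlas hφ).mdifferentiableOn (by simp)) _ hx,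
    fun _ hx ↦ ((contMDiffOn_symm_of_mem_maximalAtlas hφ).mdifferentiableOn (by simp)) _ hx⟩

theorem contDiffOn_chart (hφ : φ ∈ IsManifold.maximalAtlas 𝓘(ℝ, E) ∞ X)
    (hφ' : φ' ∈ IsManifold.maximalAtlas 𝓘(ℝ, E') ∞ X') (hf : ContMDiff 𝓘(ℝ, E) 𝓘(ℝ, E') ∞ f) :
    ContDiffOn ℝ ∞ (φ' ∘ f ∘ φ.symm) (chartDomain φ φ' f) := by
  rw [← contMDiffOn_iff_contDiffOn]
  refine (contMDiffOn_of_mem_maximalAtlas hφ').comp (hf.comp_contMDiffOn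
    ((contMDiffOn_symm_of_mem_maximalAtlas hφ).mono fun w hw ↦ hw.1)) fun w hw ↦ hw.2

/-- The derivative of the expression of `f` in charts, applied to the coordinates of `v`. -/
theorem fderiv_chart (hφ : φ ∈ IsManifold.maximalAtlas 𝓘(ℝ, E) ∞ X)
    (hφ' : φ' ∈ IsManifold.maximalAtlas 𝓘(ℝ, E') ∞ X') (hf : ContMDiff 𝓘(ℝ, E) 𝓘(ℝ, E') ∞ f)
    {x : X} (hx : x ∈ φ.source) (hx' : f x ∈ φ'.source) (v : TangentSpace 𝓘(ℝ, E) x) :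
    fderiv ℝ (φ' ∘ f ∘ φ.symm) (φ x) (mfderiv 𝓘(ℝ, E) 𝓘(ℝ, E) φ x v : E) =
      (mfderiv 𝓘(ℝ, E') 𝓘(ℝ, E') φ' (f x) (mfderiv 𝓘(ℝ, E) 𝓘(ℝ, E') f x v) : E') := by
  have hd : DifferentiableAt ℝ (φ' ∘ f ∘ φ.symm) (φ x) :=
    ((contDiffOn_chart hφ hφ' hf).contDiffAt ((isOpen_chartDomain hf.continuous).mem_nhds
      (mem_chartDomain hx hx'))).differentiableAt (by simp)
  have h1 := mfderiv_comp x hd.mdifferentiableAt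
    ((mdifferentiable_of_mem_maximalAtlas hφ).mdifferentiableAt hx)
  have h2 := mfderiv_comp x ((mdifferentiable_of_mem_maximalAtlas hφ').mdifferentiableAt hx')
    (hf.mdifferentiable (by simp) x)
  have h3 : (φ' ∘ f ∘ φ.symm) ∘ φ =ᶠ[𝓝 x] φ' ∘ f := by
    filter_upwards [φ.open_source.mem_nhds hx] with y hy
    simp [φ.left_inv hy]
  have h4 := h3.mfderiv_eq (I := 𝓘(ℝ, E)) (I' := 𝓘(ℝ, E'))
  rw [h1, h2] at h4
  have := DFunLike.congr_fun h4 v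
  rw [mfderiv_eq_fderiv] at this
  exact this

/-- The derivatives at equal points agree as maps of the model spaces, to which all tangent spaces
are definitionally equal. This replaces transports between tangent spaces. -/
theorem mfderiv_congr_point' {x x' : X} (h : x = x') (v : E) :
    (mfderiv 𝓘(ℝ, E) 𝓘(ℝ, E') f x v : E') = mfderiv 𝓘(ℝ, E) 𝓘(ℝ, E') f x' v := by
  subst h; rfl

end ChartDerivative

section Functoriality

variable {EY EX EY' EX' : Type*} [NormedAddCommGroup EY] [NormedSpace ℝ EY] [NormedAddCommGroup EX]
  [NormedSpace ℝ EX] [NormedAddCommGroup EY'] [NormedSpace ℝ EY'] [NormedAddCommGroup EX']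
  [NormedSpace ℝ EX'] {Y X Y' X' : Type*} [TopologicalSpace Y] [ChartedSpace EY Y]
  [TopologicalSpace X] [ChartedSpace EX X] [TopologicalSpace Y'] [ChartedSpace EY' Y']
  [TopologicalSpace X'] [ChartedSpace EX' X'] {j : Y → X} {j' : Y' → X'}
  {hj : Manifold.IsImmersion 𝓘(ℝ, EY) 𝓘(ℝ, EX) ∞ j}
  {hj' : Manifold.IsImmersion 𝓘(ℝ, EY') 𝓘(ℝ, EX') ∞ j'} {f : X → X'} {f₀ : Y → Y'}

@[simp] theorem NormalBundle.proj_map (ξ : NormalBundle hj) :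
    (NormalBundle.map hj hj' f f₀ ξ).proj = f₀ ξ.proj := rfl

@[simp] theorem DNC.map_zero (ξ : NormalBundle hj) :
    DNC.map hj hj' f f₀ (.zero ξ) = .zero (NormalBundle.map hj hj' f f₀ ξ) := rfl

@[simp] theorem DNC.map_off (x : X) (t : ℝ) (ht : t ≠ 0) :
    DNC.map hj hj' f f₀ (.off x t ht) = .off (f x) t ht := rfl

@[simp] theorem DNC.param_map (d : DNC hj) : (DNC.map hj hj' f f₀ d).param = d.param := by
  rcases d with ξ | ⟨x, t, ht⟩ <;> rfl

namespace Slice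

section Ext

variable {V : Type*} [NormedAddCommGroup V] [NormedSpace ℝ V]

open Classical in
/-- For a map `F` into the model space of `X` whose normal component vanishes on the image of `A`,
the map `(w, t) ↦ (F(A w + t B w), t)` into `X × ℝ^*`, read in the chart of `D(X, Y, j)` and
extended to `t = 0`. -/
def dncExt (σ : Slice EY EX j) (F : V → EX) (A B : V →L[ℝ] V) (z : V × ℝ) : EX × ℝ :=
  (σ.L (σ.p (F (A z.1 + z.2 • B z.1))) + if z.2 = 0 then σ.q (fderiv ℝ F (A z.1) (B z.1))
    else z.2⁻¹ • σ.q (F (A z.1 + z.2 • B z.1)), z.2)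

variable (σ : Slice EY EX j) {F : V → EX} {A B : V →L[ℝ] V}

theorem dncExt_zero (w : V) :
    σ.dncExt F A B (w, 0) = (σ.L (σ.p (F (A w))) + σ.q (fderiv ℝ F (A w) (B w)), 0) := by
  simp [dncExt]

theorem dncExt_of_ne (w : V) {t : ℝ} (ht : t ≠ 0) :
    σ.dncExt F A B (w, t) = (σ.δ t⁻¹ (F (A w + t • B w)), t) := by
  simp [dncExt, ht, δ]

/-- The extension to `t = 0` is smooth, since its normal component is a divided difference of the
normal component of `F`. -/
theorem contDiffAt_dncExt [FiniteDimensional ℝ V] [FiniteDimensional ℝ EX] {O : Set V}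
    (hO : IsOpen O) (hF : ContDiffOn ℝ ∞ F O) {w₀ : V} (hw₀ : A w₀ ∈ O)
    (h0 : ∀ᶠ w in 𝓝 w₀, σ.q (F (A w)) = 0) : ContDiffAt ℝ ∞ (σ.dncExt F A B) (w₀, 0) := by
  have h1 := contDiffAt_divided_difference' (g := fun w ↦ σ.q (F w)) hO
    (σ.q.contDiff.comp_contDiffOn hF) A B w₀ hw₀ h0
  have hl : ContDiffAt ℝ ∞ (fun z : V × ℝ ↦ A z.1 + z.2 • B z.1) (w₀, 0) := by fun_prop
  have hF' : ContDiffAt ℝ ∞ F (A w₀ + (0 : ℝ) • B w₀) := by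
    simpa using hF.contDiffAt (hO.mem_nhds hw₀)
  have h2 : ContDiffAt ℝ ∞ (fun z : V × ℝ ↦ σ.L (σ.p (F (A z.1 + z.2 • B z.1)))) (w₀, 0) :=
    (σ.L.comp σ.p).contDiff.contDiffAt.comp _ (ContDiffAt.comp (g := F) (w₀, (0 : ℝ)) hF' hl)
  refine ((h2.add h1).prodMk contDiffAt_snd).congr_of_eventuallyEq ?_
  have c2 : Tendsto (fun z : V × ℝ ↦ A z.1) (𝓝 (w₀, 0)) (𝓝 (A w₀)) := by
    have : Continuous (fun z : V × ℝ ↦ A z.1) := by fun_prop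
    simpa using this.tendsto (w₀, 0)
  filter_upwards [c2.eventually (hO.mem_nhds hw₀)] with z hz
  have hd : DifferentiableAt ℝ F (A z.1) :=
    (hF.contDiffAt (hO.mem_nhds hz)).differentiableAt (by simp)
  have h3 : fderiv ℝ (fun v ↦ σ.q (F v)) (A z.1) = σ.q.comp (fderiv ℝ F (A z.1)) :=
    (σ.q.hasFDerivAt.comp (A z.1) hd.hasFDerivAt).fderiv
  simp [dncExt, h3]

end Ext

variable (σ : Slice EY EX j) (σ' : Slice EY' EX' j')

/-- The normal chart of the class of `v`, computed at an equal base point. -/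
theorem normalChart_mk' {y : Y} {x : X} (h : x = j y) (hy : y ∈ σ.ψ.source)
    (v : TangentSpace 𝓘(ℝ, EX) x) :
    σ.normalChart hj (NormalBundle.mk hj y (v : EX)) =
      σ.L (σ.ψ y) + σ.q (mfderiv 𝓘(ℝ, EX) 𝓘(ℝ, EX) σ.φ x v) := by
  subst h
  exact σ.normalChart_mk hy v

/-- In slice charts `f` restricts to the expression of `f₀` in charts. -/
theorem chart_L (h : f ∘ j = j' ∘ f₀) {u : EY} (hu : u ∈ σ.ψ.target)
    (hu' : f₀ (σ.ψ.symm u) ∈ σ'.ψ.source) :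
    (σ'.φ ∘ f ∘ σ.φ.symm) (σ.L u) = σ'.L ((σ'.ψ ∘ f₀ ∘ σ.ψ.symm) u) := by
  simp only [Function.comp_apply]
  rw [σ.φ_symm_L' hu, ← σ'.φ_j _ hu']
  exact congrArg σ'.φ (congrFun h _)

variable (hf : ContMDiff 𝓘(ℝ, EX) 𝓘(ℝ, EX') ∞ f) (hf₀ : ContMDiff 𝓘(ℝ, EY) 𝓘(ℝ, EY') ∞ f₀)
  (h : f ∘ j = j' ∘ f₀)
include hf hf₀ h

/-- The map `N(f, f₀)` in slice charts: its normal component is the normal component of the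
derivative of `f` in charts. -/
theorem normalChart_map_mk {y : Y} (hy : y ∈ σ.ψ.source) (hy' : f₀ y ∈ σ'.ψ.source)
    (v : TangentSpace 𝓘(ℝ, EX) (j y)) :
    σ'.normalChart hj' (NormalBundle.map hj hj' f f₀ (NormalBundle.mk hj y v)) =
      σ'.L (σ'.ψ (f₀ y)) +
        σ'.q (fderiv ℝ (σ'.φ ∘ f ∘ σ.φ.symm) (σ.φ (j y)) (σ.dφ (j y) v : EX)) := by
  have hx : f (j y) = j' (f₀ y) := congrFun h y
  rw [NormalBundle.map_mk hj hj' hf hf₀ h]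
  refine (σ'.normalChart_mk' hx hy' _).trans ?_
  refine congrArg (fun e : EX' ↦ σ'.L (σ'.ψ (f₀ y)) + σ'.q e)
    (fderiv_chart σ.φ_mem σ'.φ_mem hf (σ.maps y hy) ?_ v).symm
  rw [hx]
  exact σ'.maps _ hy'

/-- The map `N(f, f₀)` as a map between model spaces: at `w` it is the value of `f` in charts at the
tangential component of `w`, plus the normal component of its derivative in the direction of the
normal component of `w`. This is `dncExt` at `t = 0`. -/
theorem normalChart_map_symm {w : EX} (hw : σ.p w ∈ σ.ψ.target)
    (hw' : f₀ (σ.ψ.symm (σ.p w)) ∈ σ'.ψ.source) :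
    σ'.normalChart hj' (NormalBundle.map hj hj' f f₀ ((σ.normalChart hj).symm w)) =
      σ'.L (σ'.p ((σ'.φ ∘ f ∘ σ.φ.symm) (σ.L (σ.p w)))) +
        σ'.q (fderiv ℝ (σ'.φ ∘ f ∘ σ.φ.symm) (σ.L (σ.p w)) (σ.q w)) := by
  have hy := σ.ψ.map_target hw
  have h1 := σ.normalChart_map_mk (hj := hj) (hj' := hj') σ' hf hf₀ h hy hw'
    (σ.dφInv (j (σ.ψ.symm (σ.p w))) (σ.q w))
  refine h1.trans ?_
  rw [σ.dφ_dφInv (σ.maps _ hy), σ.φ_j _ hy, σ.ψ.right_inv hw]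
  have h2 : (σ'.φ ∘ f ∘ σ.φ.symm) (σ.L (σ.p w)) = σ'.L (σ'.ψ (f₀ (σ.ψ.symm (σ.p w)))) := by
    simp only [Function.comp_apply]
    rw [σ.φ_symm_L' hw, ← σ'.φ_j _ hw']
    exact congrArg σ'.φ (congrFun h _)
  rw [h2, σ'.p_L]

end Slice

variable [FiniteDimensional ℝ EX] [FiniteDimensional ℝ EX'] [IsManifold 𝓘(ℝ, EX) ∞ X]
  [IsManifold 𝓘(ℝ, EX') ∞ X']

/-- Over `t ≠ 0` the map `D(f, f₀)` is `f × id`. -/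
theorem DNC.contMDiffAt_of_param_ne_zero {d : DNC hj} (hd : d.param ≠ 0)
    (hf : ContMDiff 𝓘(ℝ, EX) 𝓘(ℝ, EX') ∞ f) :
    ContMDiffAt 𝓘(ℝ, EX × ℝ) 𝓘(ℝ, EX' × ℝ) ∞ (DNC.map hj hj' f f₀) d := by
  have h1 : ContMDiffAt 𝓘(ℝ, EX × ℝ) (𝓘(ℝ, EX').prod 𝓘(ℝ, ℝ)) ∞
      (fun d : DNC hj ↦ (f d.toBase, d.param)) d :=
    (hf.contMDiffAt.comp d DNC.contMDiff_toBase.contMDiffAt).prodMk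
      DNC.contMDiff_param.contMDiffAt
  refine (ContMDiffAt.comp d (DNC.contMDiffAt_incl (hj := hj') (f d.toBase) hd)
    h1).congr_of_eventuallyEq ?_
  filter_upwards [DNC.contMDiff_param.continuous.continuousAt.eventually
    (eventually_ne_nhds hd)] with d hd
  rw [Function.comp_apply, DNC.incl_of_ne _ hd]
  conv_lhs => rw [DNC.eq_off_of_param_ne_zero hd]
  rfl

/-- The map `D(f, f₀)` is smooth: near `t = 0` this is smoothness of a divided difference of the
normal component of `f`. -/
theorem DNC.contMDiff_map (hf : ContMDiff 𝓘(ℝ, EX) 𝓘(ℝ, EX') ∞ f)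
    (hf₀ : ContMDiff 𝓘(ℝ, EY) 𝓘(ℝ, EY') ∞ f₀) (h : f ∘ j = j' ∘ f₀) :
    ContMDiff 𝓘(ℝ, EX × ℝ) 𝓘(ℝ, EX' × ℝ) ∞ (DNC.map hj hj' f f₀) := by
  intro d
  rcases d with ξ | ⟨x, t, ht⟩
  swap
  · exact DNC.contMDiffAt_of_param_ne_zero ht hf
  obtain ⟨σ, hσ⟩ := DNC.exists_slice_zero ξ
  obtain ⟨σ', hσ'⟩ := exists_slice hj' (f₀ ξ.proj)
  have hσ₀ : ξ.proj ∈ σ.ψ.source := hσ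
  set F := σ'.φ ∘ f ∘ σ.φ.symm with hF
  set w₀ := σ.normalHomeo hj ξ with hw₀
  have hpw₀ : σ.p w₀ = σ.ψ ξ.proj := σ.p_normalHomeo ξ
  have hx' : f (j ξ.proj) ∈ σ'.φ.source := by
    rw [show f (j ξ.proj) = j' (f₀ ξ.proj) from congrFun h _]
    exact σ'.maps _ hσ'
  have hw₀O : (σ.L.comp σ.p) w₀ ∈ chartDomain σ.φ σ'.φ f := by
    rw [ContinuousLinearMap.comp_apply, hpw₀, ← σ.φ_j _ hσ₀]
    exact mem_chartDomain (σ.maps _ hσ₀) hx'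
  have hev : ∀ᶠ w in 𝓝 w₀, σ.p w ∈ chartDomain σ.ψ σ'.ψ f₀ := by
    refine σ.p.continuous.continuousAt.eventually ((isOpen_chartDomain hf₀.continuous).mem_nhds ?_)
    rw [hpw₀]
    exact mem_chartDomain hσ₀ hσ'
  have hH := σ'.contDiffAt_dncExt (isOpen_chartDomain hf.continuous)
    (contDiffOn_chart σ.φ_mem σ'.φ_mem hf) (A := σ.L.comp σ.p) (B := σ.q) hw₀O (by
      filter_upwards [hev] with w hw
      rw [ContinuousLinearMap.comp_apply, σ.chart_L σ' h hw.1 hw.2, σ'.q_L])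
  -- the map in charts
  have key : ∀ᶠ d in 𝓝 (DNC.zero ξ), DNC.map hj hj' f f₀ d ∈ (σ'.dncHomeo hj').source ∧
      σ'.dncHomeo hj' (DNC.map hj hj' f f₀ d) =
        σ'.dncExt F (σ.L.comp σ.p) σ.q (σ.dncHomeo hj d) := by
    have hz : Tendsto (fun d ↦ (σ.dncHomeo hj d).1) (𝓝 (DNC.zero ξ)) (𝓝 w₀) :=
      continuousAt_fst.tendsto.comp ((σ.dncHomeo hj).continuousAt hσ)
    have hb : ∀ᶠ d : DNC hj in 𝓝 (DNC.zero ξ), f d.toBase ∈ σ'.φ.source :=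
      (hf.continuous.comp DNC.contMDiff_toBase.continuous).continuousAt.eventually
        (σ'.φ.open_source.mem_nhds hx')
    filter_upwards [hz.eventually hev, hb, (σ.dncHomeo hj).open_source.mem_nhds hσ] with d hd hd' hs
    rcases d with η | ⟨x, t, ht⟩
    · have hη : η.proj ∈ σ.ψ.source := hs
      have hd : σ.p (σ.normalHomeo hj η) ∈ chartDomain σ.ψ σ'.ψ f₀ := hd
      have h1 := σ.normalChart_map_symm (hj := hj) (hj' := hj') σ' hf hf₀ h hd.1 hd.2
      have h2 : (σ.normalChart hj).symm (σ.normalHomeo hj η) = η :=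
        (σ.normalHomeo hj).left_inv hη
      rw [h2] at h1
      refine ⟨?_, ?_⟩
      · have := hd.2
        rw [σ.p_normalHomeo, mem_preimage, mem_preimage, σ.ψ.left_inv hη] at this
        exact this
      · rw [σ.dncHomeo_zero, σ'.dncExt_zero, DNC.map_zero, σ'.dncHomeo_zero]
        exact Prod.ext h1 rfl
    · refine ⟨hd', ?_⟩
      rw [σ.dncHomeo_off, σ'.dncExt_of_ne _ ht, DNC.map_off, σ'.dncHomeo_off]
      have : (σ.L.comp σ.p) (σ.δ t⁻¹ (σ.φ x)) + t • σ.q (σ.δ t⁻¹ (σ.φ x)) = σ.φ x :=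
        σ.δ_inv' ht _
      rw [this, hF, Function.comp_apply, Function.comp_apply, σ.φ.left_inv hs]
  have key0 := key.self_of_nhds
  refine contMDiffAt_of_chart_symm σ'.dncHomeo_mem (ContDiffAt.contMDiffAt_comp_chart
    σ.dncHomeo_mem hσ hH) ?_ ?_
  · rw [← key0.2]
    exact (σ'.dncHomeo hj').map_source key0.1
  · filter_upwards [key] with d hd
    rw [← hd.2, (σ'.dncHomeo hj').left_inv hd.1]

/-- The map `N(f, f₀)` is smooth, being the restriction of `D(f, f₀)` to `t = 0`. -/
theorem NormalBundle.contMDiff_map (hf : ContMDiff 𝓘(ℝ, EX) 𝓘(ℝ, EX') ∞ f)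
    (hf₀ : ContMDiff 𝓘(ℝ, EY) 𝓘(ℝ, EY') ∞ f₀) (h : f ∘ j = j' ∘ f₀) :
    ContMDiff 𝓘(ℝ, EX) 𝓘(ℝ, EX') ∞ (NormalBundle.map hj hj' f f₀) :=
  DNC.contMDiff_of_zero ((DNC.contMDiff_map (hj := hj) (hj' := hj') hf hf₀ h).comp
    DNC.contMDiff_zero)

end Functoriality

/-! ### Immersions and submersions in linear charts -/

section LinearCharts

variable {E E' X X' : Type*} [NormedAddCommGroup E] [NormedSpace ℝ E] [NormedAddCommGroup E']
  [NormedSpace ℝ E'] [TopologicalSpace X] [ChartedSpace E X] [TopologicalSpace X']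
  [ChartedSpace E' X'] {f : X → X'}

/-- In suitable charts around `x` and `f x` the map `f` is the linear map `T`. -/
def HasLinearCharts (f : X → X') (x : X) (T : E →L[ℝ] E') : Prop :=
  ∃ φ ∈ IsManifold.maximalAtlas 𝓘(ℝ, E) ∞ X, ∃ φ' ∈ IsManifold.maximalAtlas 𝓘(ℝ, E') ∞ X',
    x ∈ φ.source ∧ (∀ z ∈ φ.source, f z ∈ φ'.source) ∧ ∀ z ∈ φ.source, φ' (f z) = T (φ z)

/-- A map which is an injective linear map in suitable charts is an immersion. The complements of
the images all have the same dimension, so that one model of the complement serves all points. -/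
theorem isImmersion_of_hasLinearCharts [FiniteDimensional ℝ E] [FiniteDimensional ℝ E']
    (h : ∀ x, ∃ T : E →L[ℝ] E', Function.Injective T ∧ HasLinearCharts f x T) :
    Manifold.IsImmersion 𝓘(ℝ, E) 𝓘(ℝ, E') ∞ f := by
  let C := EuclideanSpace ℝ (Fin (Module.finrank ℝ E' - Module.finrank ℝ E))
  suffices Manifold.IsImmersionOfComplement C 𝓘(ℝ, E) 𝓘(ℝ, E') ∞ f from this.isImmersion
  intro x
  obtain ⟨T, hT, φ, hφ, φ', hφ', hx, hmaps, hlin⟩ := h x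
  obtain ⟨K, hK⟩ := Submodule.exists_isCompl T.range
  have hrk : Module.finrank ℝ K = Module.finrank ℝ C := by
    have h1 := Submodule.finrank_add_eq_of_isCompl hK
    have h2 : Module.finrank ℝ T.range = Module.finrank ℝ E :=
      LinearMap.finrank_range_of_inj (f := T.toLinearMap) hT
    simp only [C, finrank_euclideanSpace, Fintype.card_fin]
    omega
  let e₁ : E ≃ₗ[ℝ] T.range := LinearEquiv.ofInjective T.toLinearMap hT
  let e₂ : C ≃ₗ[ℝ] K := LinearEquiv.ofFinrankEq _ _ hrk.symm
  let e : (E × C) ≃ₗ[ℝ] E' := (e₁.prodCongr e₂).trans (Submodule.prodEquivOfIsCompl _ _ hK)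
  refine Manifold.IsImmersionAtOfComplement.mk_of_charts e.toContinuousLinearEquiv φ φ' hx
    (hmaps x hx) hφ hφ' hmaps ?_
  intro u hu
  have hu' : u ∈ φ.target := by simpa using hu
  have := hlin _ (φ.map_target hu')
  rw [φ.right_inv hu'] at this
  simpa [e, e₁] using this

/-- A map which is a surjective linear map in suitable charts is a submersion. As for immersions,
one model of the kernel serves all points. -/
theorem isSubmersion_of_hasLinearCharts [FiniteDimensional ℝ E] [FiniteDimensional ℝ E']
    (h : ∀ x, ∃ T : E →L[ℝ] E', Function.Surjective T ∧ HasLinearCharts f x T) :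
    Manifold.IsSubmersion 𝓘(ℝ, E) 𝓘(ℝ, E') ∞ f := by
  let C := EuclideanSpace ℝ (Fin (Module.finrank ℝ E - Module.finrank ℝ E'))
  suffices Manifold.IsSubmersionOfComplement C 𝓘(ℝ, E) 𝓘(ℝ, E') ∞ f from this.isSubmersion
  intro x
  obtain ⟨T, hT, φ, hφ, φ', hφ', hx, hmaps, hlin⟩ := h x
  obtain ⟨p, hp⟩ := T.ker.exists_isCompl
  have hrk : Module.finrank ℝ T.ker = Module.finrank ℝ C := by
    have h1 := LinearMap.finrank_range_add_finrank_ker T.toLinearMap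
    rw [LinearMap.range_eq_top.2 hT, finrank_top] at h1
    simp only [C, finrank_euclideanSpace, Fintype.card_fin]
    change _ + Module.finrank ℝ T.ker = _ at h1
    omega
  let e₂ : T.ker ≃ₗ[ℝ] C := LinearEquiv.ofFinrankEq _ _ hrk
  obtain ⟨S, hS⟩ := LinearMap.exists_rightInverse_of_surjective T.toLinearMap
    (LinearMap.range_eq_top.2 hT)
  have hS' : ∀ e, T (S e) = e := fun e ↦ LinearMap.congr_fun hS e
  let e : E ≃ₗ[ℝ] E' × C :=
    LinearEquiv.ofBijective (T.toLinearMap.prod (e₂.toLinearMap.comp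
      (LinearMap.codRestrict T.ker (LinearMap.id - S.comp T.toLinearMap)
        fun v ↦ by simp [hS']))) (by
      constructor
      · rw [← LinearMap.ker_eq_bot, LinearMap.ker_eq_bot']
        intro v hv
        simp only [LinearMap.prod_apply, Function.prod, Prod.mk_eq_zero] at hv
        have h1 : T v = 0 := hv.1
        have h2 := hv.2
        simp only [LinearMap.comp_apply, LinearEquiv.coe_coe, EmbeddingLike.map_eq_zero_iff] at h2
        have h3 := congrArg Subtype.val h2
        simpa [h1] using h3
      · rintro ⟨a, c⟩
        refine ⟨S a + (e₂.symm c : E), ?_⟩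
        have hc : T (e₂.symm c : E) = 0 := (e₂.symm c).2
        refine Prod.ext ?_ ?_
        · simp [hS', hc]
        · simp only [LinearMap.prod_apply, Function.prod, LinearMap.comp_apply,
            LinearEquiv.coe_coe]
          rw [← e₂.eq_symm_apply]
          ext
          simp [hS', hc])
  refine Manifold.IsSubmersionAtOfComplement.mk_of_charts e.toContinuousLinearEquiv φ φ' hx
    (hmaps x hx) hφ hφ' hmaps ?_
  intro u hu
  have hu' : u ∈ φ.target := by simpa using hu
  have := hlin _ (φ.map_target hu')
  rw [φ.right_inv hu'] at this
  have he : (e u).1 = T u := rfl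
  simpa [he] using this

theorem exists_hasLinearCharts_of_isSubmersion (h : Manifold.IsSubmersion 𝓘(ℝ, E) 𝓘(ℝ, E') ∞ f)
    (x : X) : ∃ T : E →L[ℝ] E', Function.Surjective T ∧ HasLinearCharts f x T := by
  have hx := h.isSubmersionAt x
  have hc := hx.isSubmersionAtOfComplement_complement
  refine ⟨(ContinuousLinearMap.fst ℝ E' _).comp (hc.equiv : E →L[ℝ] E' × hx.complement),
    fun e ↦ ⟨hc.equiv.symm (e, 0), by simp⟩, hc.domChart, hc.domChart_mem_maximalAtlas,
    hc.codChart, hc.codChart_mem_maximalAtlas, hc.mem_domChart_source,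
    hc.source_subset_preimage_source, fun z hz ↦ ?_⟩
  have := hc.writtenInCharts (by simpa using hc.domChart.map_source hz :
      hc.domChart z ∈ (hc.domChart.extend 𝓘(ℝ, E)).target)
  simpa [hc.domChart.left_inv hz] using this

theorem exists_hasLinearCharts_of_isImmersion (h : Manifold.IsImmersion 𝓘(ℝ, E) 𝓘(ℝ, E') ∞ f)
    (x : X) : ∃ T : E →L[ℝ] E', Function.Injective T ∧ HasLinearCharts f x T := by
  obtain ⟨σ, hσ⟩ := exists_slice h x
  exact ⟨σ.L, Function.LeftInverse.injective σ.p_L, σ.ψ, σ.ψ_mem, σ.φ, σ.φ_mem, hσ, σ.maps, σ.φ_j⟩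

/-- In linear charts the differential of `f` is the linear map `T`. -/
theorem HasLinearCharts.exists_mfderiv {x : X} {T : E →L[ℝ] E'} (h : HasLinearCharts f x T)
    (hf : ContMDiff 𝓘(ℝ, E) 𝓘(ℝ, E') ∞ f) : ∃ φ ∈ IsManifold.maximalAtlas 𝓘(ℝ, E) ∞ X,
      ∃ φ' ∈ IsManifold.maximalAtlas 𝓘(ℝ, E') ∞ X', x ∈ φ.source ∧ f x ∈ φ'.source ∧ ∀ v,
        (mfderiv 𝓘(ℝ, E') 𝓘(ℝ, E') φ' (f x) (mfderiv 𝓘(ℝ, E) 𝓘(ℝ, E') f x v) : E') =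
          T (mfderiv 𝓘(ℝ, E) 𝓘(ℝ, E) φ x v : E) := by
  obtain ⟨φ, hφ, φ', hφ', hx, hmaps, hlin⟩ := h
  refine ⟨φ, hφ, φ', hφ', hx, hmaps x hx, fun v ↦ ?_⟩
  rw [← fderiv_chart hφ hφ' hf hx (hmaps x hx) v]
  have : φ' ∘ f ∘ φ.symm =ᶠ[𝓝 (φ x)] T := by
    filter_upwards [φ.open_target.mem_nhds (φ.map_source hx)] with w hw
    simp [hlin _ (φ.map_target hw), φ.right_inv hw]
  rw [this.fderiv_eq, T.fderiv]

theorem mfderiv_injective_of_isImmersion (h : Manifold.IsImmersion 𝓘(ℝ, E) 𝓘(ℝ, E') ∞ f) (x : X) :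
    Function.Injective (mfderiv 𝓘(ℝ, E) 𝓘(ℝ, E') f x) := by
  obtain ⟨T, hT, hc⟩ := exists_hasLinearCharts_of_isImmersion h x
  obtain ⟨φ, hφ, φ', hφ', hx, hx', h1⟩ := hc.exists_mfderiv h.contMDiff
  intro v w hvw
  refine ((mdifferentiable_of_mem_maximalAtlas hφ).mfderiv_bijective hx).1 (hT ?_)
  rw [← h1, ← h1, hvw]

theorem mfderiv_surjective_of_isSubmersion (h : Manifold.IsSubmersion 𝓘(ℝ, E) 𝓘(ℝ, E') ∞ f)
    (x : X) : Function.Surjective (mfderiv 𝓘(ℝ, E) 𝓘(ℝ, E') f x) := by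
  obtain ⟨T, hT, hc⟩ := exists_hasLinearCharts_of_isSubmersion h x
  obtain ⟨φ, hφ, φ', hφ', hx, hx', h1⟩ := hc.exists_mfderiv h.contMDiff
  intro w
  obtain ⟨a, ha⟩ := hT (mfderiv 𝓘(ℝ, E') 𝓘(ℝ, E') φ' (f x) w)
  obtain ⟨v, rfl⟩ := ((mdifferentiable_of_mem_maximalAtlas hφ).mfderiv_bijective hx).2 a
  refine ⟨v, ((mdifferentiable_of_mem_maximalAtlas hφ').mfderiv_bijective hx').1 ?_⟩
  rw [← ha]
  exact h1 v

/-- Maps into the target of a submersion lift locally. -/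
theorem Manifold.IsSubmersion.exists_lift {ι : Type*} {l : Filter ι}
    (h : Manifold.IsSubmersion 𝓘(ℝ, E) 𝓘(ℝ, E') ∞ f) {x : X} {u : ι → X'}
    (hu : Tendsto u l (𝓝 (f x))) : ∃ v : ι → X, Tendsto v l (𝓝 x) ∧ ∀ᶠ i in l, f (v i) = u i := by
  have hc := h.isSubmersionAt x
  have hE := hc.isSubmersionAtOfComplement_complement
  let e := hE.equiv
  -- the lift keeps the coordinates of `x` in the direction of the fibre
  let c := e (hE.domChart x)
  have hx := hE.mem_domChart_source
  have hx' : f x ∈ hE.codChart.source := hE.source_subset_preimage_source hx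
  have hlin : ∀ z ∈ hE.domChart.source, hE.codChart (f z) = (e (hE.domChart z)).1 := by
    intro z hz
    have := hE.writtenInCharts (by simpa using hE.domChart.map_source hz :
      hE.domChart z ∈ (hE.domChart.extend 𝓘(ℝ, E)).target)
    simpa [hE.domChart.left_inv hz] using this
  let k : ι → E := fun i ↦ e.symm (hE.codChart (u i), c.2)
  have hk : Tendsto k l (𝓝 (hE.domChart x)) := by
    have h1 : Tendsto (fun i ↦ (hE.codChart (u i), c.2)) l (𝓝 c) := by
      have : c = (hE.codChart (f x), c.2) := Prod.ext (hlin x hx).symm rfl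
      rw [this]
      exact ((hE.codChart.continuousAt hx').tendsto.comp hu).prodMk_nhds tendsto_const_nhds
    have := (e.symm.continuous.tendsto c).comp h1
    rwa [e.symm_apply_apply] at this
  refine ⟨fun i ↦ hE.domChart.symm (k i), ?_, ?_⟩
  · have := (hE.domChart.continuousAt_symm (hE.domChart.map_source hx)).tendsto
    rw [hE.domChart.left_inv hx] at this
    exact this.comp hk
  · filter_upwards [hk.eventually (hE.domChart.open_target.mem_nhds (hE.domChart.map_source hx)),
      hu.eventually (hE.codChart.open_source.mem_nhds hx')] with i hi hi'
    have hs := hE.domChart.map_target hi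
    refine hE.codChart.injOn (hE.source_subset_preimage_source hs) hi' ?_
    rw [hlin _ hs, hE.domChart.right_inv hi]
    simp [k]

end LinearCharts

/-! ### Morphisms of immersions which are linear in slice charts -/

section LinearSlices

variable {EY EX EY' EX' : Type*} [NormedAddCommGroup EY] [NormedSpace ℝ EY] [NormedAddCommGroup EX]
  [NormedSpace ℝ EX] [NormedAddCommGroup EY'] [NormedSpace ℝ EY'] [NormedAddCommGroup EX']
  [NormedSpace ℝ EX'] {Y X Y' X' : Type*} [TopologicalSpace Y] [ChartedSpace EY Y]
  [TopologicalSpace X] [ChartedSpace EX X] [TopologicalSpace Y'] [ChartedSpace EY' Y']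
  [TopologicalSpace X'] [ChartedSpace EX' X'] {j : Y → X} {j' : Y' → X'}
  {hj : Manifold.IsImmersion 𝓘(ℝ, EY) 𝓘(ℝ, EX) ∞ j}
  {hj' : Manifold.IsImmersion 𝓘(ℝ, EY') 𝓘(ℝ, EX') ∞ j'} {f : X → X'} {f₀ : Y → Y'}

/-- In the slice charts `σ` and `σ'` the morphism of immersions `(f, f₀)` is given by a linear map
`T` compatible with the decompositions into tangential and normal part. -/
structure Slice.IsLinear (σ : Slice EY EX j) (σ' : Slice EY' EX' j') (f : X → X') (f₀ : Y → Y')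
    (T : EX →L[ℝ] EX') : Prop where
  maps : ∀ x ∈ σ.φ.source, f x ∈ σ'.φ.source
  maps₀ : ∀ y ∈ σ.ψ.source, f₀ y ∈ σ'.ψ.source
  φ_f : ∀ x ∈ σ.φ.source, σ'.φ (f x) = T (σ.φ x)
  T_L_p : ∀ w, T (σ.L (σ.p w)) = σ'.L (σ'.p (T w))

namespace Slice.IsLinear

variable {σ : Slice EY EX j} {σ' : Slice EY' EX' j'} {T : EX →L[ℝ] EX'}
  (hT : σ.IsLinear σ' f f₀ T)
include hT

theorem T_q (w : EX) : T (σ.q w) = σ'.q (T w) := by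
  rw [σ.q_apply, σ'.q_apply, map_sub, hT.T_L_p]

theorem T_δ (t : ℝ) (w : EX) : T (σ.δ t w) = σ'.δ t (T w) := by
  rw [Slice.δ, Slice.δ, map_add, map_smul, hT.T_L_p, hT.T_q]

variable (hf : ContMDiff 𝓘(ℝ, EX) 𝓘(ℝ, EX') ∞ f) (hf₀ : ContMDiff 𝓘(ℝ, EY) 𝓘(ℝ, EY') ∞ f₀)
  (h : f ∘ j = j' ∘ f₀)
include hf hf₀ h

/-- If `(f, f₀)` is the linear map `T` in slice charts, then so is `N(f, f₀)`. -/
theorem normalChart_map {ξ : NormalBundle hj} (hξ : ξ.proj ∈ σ.ψ.source) :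
    σ'.normalChart hj' (NormalBundle.map hj hj' f f₀ ξ) = T (σ.normalChart hj ξ) := by
  obtain ⟨y, v, rfl⟩ : ∃ y v, ξ = NormalBundle.mk hj y v := ⟨_, _, (NormalBundle.mk_rep ξ).symm⟩
  have hy : y ∈ σ.ψ.source := hξ
  rw [σ.normalChart_map_mk σ' hf hf₀ h hy (hT.maps₀ y hy) v, σ.normalChart_mk hy]
  have h1 : σ'.φ ∘ f ∘ σ.φ.symm =ᶠ[𝓝 (σ.φ (j y))] T := by
    filter_upwards [σ.φ.open_target.mem_nhds (σ.φ.map_source (σ.maps y hy))] with w hw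
    simp [hT.φ_f _ (σ.φ.map_target hw), σ.φ.right_inv hw]
  rw [h1.fderiv_eq, T.fderiv, map_add, hT.T_q, ← σ.φ_j y hy, ← hT.φ_f _ (σ.maps y hy),
    ← σ'.φ_j _ (hT.maps₀ y hy), show f (j y) = j' (f₀ y) from congrFun h y]

variable [FiniteDimensional ℝ EX] [FiniteDimensional ℝ EX']

theorem hasLinearCharts_normal {ξ : NormalBundle hj} (hξ : ξ.proj ∈ σ.ψ.source) :
    HasLinearCharts (NormalBundle.map hj hj' f f₀) ξ T :=
  ⟨_, σ.normalHomeo_mem, _, σ'.normalHomeo_mem, hξ, fun _ hη ↦ hT.maps₀ _ hη,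
    fun _ hη ↦ hT.normalChart_map hf hf₀ h hη⟩

variable [IsManifold 𝓘(ℝ, EX) ∞ X] [IsManifold 𝓘(ℝ, EX') ∞ X']

omit hf hf₀ h in
theorem maps_dnc {d : DNC hj} (hd : d ∈ (σ.dncHomeo hj).source) :
    DNC.map hj hj' f f₀ d ∈ (σ'.dncHomeo hj').source := by
  rcases d with η | ⟨x, t, ht⟩
  · exact hT.maps₀ _ hd
  · exact hT.maps _ hd

/-- If `(f, f₀)` is the linear map `T` in slice charts, then `D(f, f₀)` is `T × id`, since `T`
commutes with the dilations `δ t` of the normal component. -/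
theorem dncHomeo_map {d : DNC hj} (hd : d ∈ (σ.dncHomeo hj).source) :
    σ'.dncHomeo hj' (DNC.map hj hj' f f₀ d) =
      T.prodMap (ContinuousLinearMap.id ℝ ℝ) (σ.dncHomeo hj d) := by
  rcases d with η | ⟨x, t, ht⟩
  · exact Prod.ext (hT.normalChart_map hf hf₀ h hd) rfl
  · simp [hT.φ_f x hd, hT.T_δ]

theorem hasLinearCharts_dnc {ξ : NormalBundle hj} (hξ : ξ.proj ∈ σ.ψ.source) :
    HasLinearCharts (DNC.map hj hj' f f₀) (.zero ξ) (T.prodMap (ContinuousLinearMap.id ℝ ℝ)) :=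
  ⟨_, σ.dncHomeo_mem, _, σ'.dncHomeo_mem, hξ, fun _ hd ↦ hT.maps_dnc hd,
    fun _ hd ↦ hT.dncHomeo_map hf hf₀ h hd⟩

end Slice.IsLinear

theorem HasLinearCharts.off [FiniteDimensional ℝ EX] [FiniteDimensional ℝ EX']
    [IsManifold 𝓘(ℝ, EX) ∞ X] [IsManifold 𝓘(ℝ, EX') ∞ X'] {x : X} {T : EX →L[ℝ] EX'}
    (h : HasLinearCharts f x T) {t : ℝ} (ht : t ≠ 0) :
    HasLinearCharts (DNC.map hj hj' f f₀) (.off x t ht)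
      (T.prodMap (ContinuousLinearMap.id ℝ ℝ)) := by
  obtain ⟨φ, hφ, φ', hφ', hx, hmaps, hlin⟩ := h
  refine ⟨_, offHomeo_mem hφ, _, offHomeo_mem hφ', hx, fun d hd ↦ ?_, fun d hd ↦ ?_⟩
  · rcases d with η | ⟨x, t, ht⟩
    · exact hd.elim
    · exact hmaps x hd
  · rcases d with η | ⟨x, t, ht⟩
    · exact hd.elim
    · exact Prod.ext (hlin x hd) rfl

theorem exists_continuous_rightInverse {E E' : Type*} [NormedAddCommGroup E] [NormedSpace ℝ E]
    [NormedAddCommGroup E'] [NormedSpace ℝ E'] [FiniteDimensional ℝ E'] {T : E →L[ℝ] E'}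
    (hT : Function.Surjective T) : ∃ S : E' →L[ℝ] E, ∀ e, T (S e) = e := by
  obtain ⟨S, hS⟩ := LinearMap.exists_rightInverse_of_surjective T.toLinearMap
    (LinearMap.range_eq_top.2 hT)
  exact ⟨S.toContinuousLinearMap, fun e ↦ LinearMap.congr_fun hS e⟩

theorem fderiv_chart_surjective (hf : Manifold.IsSubmersion 𝓘(ℝ, EX) 𝓘(ℝ, EX') ∞ f)
    {φ : OpenPartialHomeomorph X EX} (hφ : φ ∈ IsManifold.maximalAtlas 𝓘(ℝ, EX) ∞ X)
    {φ' : OpenPartialHomeomorph X' EX'} (hφ' : φ' ∈ IsManifold.maximalAtlas 𝓘(ℝ, EX') ∞ X')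
    {x : X} (hx : x ∈ φ.source) (hx' : f x ∈ φ'.source) :
    Function.Surjective (fderiv ℝ (φ' ∘ f ∘ φ.symm) (φ x)) := by
  intro e
  obtain ⟨w, hw⟩ := ((mdifferentiable_of_mem_maximalAtlas hφ').mfderiv_bijective hx').2 e
  obtain ⟨v, hv⟩ := mfderiv_surjective_of_isSubmersion hf x w
  refine ⟨mfderiv 𝓘(ℝ, EX) 𝓘(ℝ, EX) φ x v, ?_⟩
  rw [fderiv_chart hφ hφ' hf.contMDiff hx hx' v, hv]
  exact hw

/-- A morphism of immersions whose components are submersions is linear in suitable slice charts,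
and the linear map has a right inverse compatible with the linear embeddings. If `f̂` is the map in
given charts and `T` its derivative at the point, with right inverse `R`, the new chart is obtained
by composing with the local diffeomorphism `w ↦ R (f̂ w) + w - R (T w)`. -/
theorem exists_slice_isLinear [FiniteDimensional ℝ EY] [FiniteDimensional ℝ EX]
    [FiniteDimensional ℝ EY'] [FiniteDimensional ℝ EX']
    (hj : Manifold.IsImmersion 𝓘(ℝ, EY) 𝓘(ℝ, EX) ∞ j)
    (hj' : Manifold.IsImmersion 𝓘(ℝ, EY') 𝓘(ℝ, EX') ∞ j')
    (hf : Manifold.IsSubmersion 𝓘(ℝ, EX) 𝓘(ℝ, EX') ∞ f)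
    (hf₀ : Manifold.IsSubmersion 𝓘(ℝ, EY) 𝓘(ℝ, EY') ∞ f₀) (h : f ∘ j = j' ∘ f₀) (y : Y) :
    ∃ (σ : Slice EY EX j) (σ' : Slice EY' EX' j') (T : EX →L[ℝ] EX') (T₀ : EY →L[ℝ] EY')
      (R : EX' →L[ℝ] EX) (R₀ : EY' →L[ℝ] EY), y ∈ σ.ψ.source ∧ σ.IsLinear σ' f f₀ T ∧
      (∀ u, T (σ.L u) = σ'.L (T₀ u)) ∧ (∀ e, T (R e) = e) ∧ (∀ e, T₀ (R₀ e) = e) ∧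
      ∀ e, R (σ'.L e) = σ.L (R₀ e) := by
  obtain ⟨σ, hσ⟩ := exists_slice hj y
  obtain ⟨σ', hσ'⟩ := exists_slice hj' (f₀ y)
  have hx := σ.maps y hσ
  have hx' : f (j y) ∈ σ'.φ.source := by
    rw [show f (j y) = j' (f₀ y) from congrFun h y]; exact σ'.maps _ hσ'
  have ha : σ.φ (j y) ∈ chartDomain σ.φ σ'.φ f := mem_chartDomain hx hx'
  have ha₀ : σ.ψ y ∈ chartDomain σ.ψ σ'.ψ f₀ := mem_chartDomain hσ hσ'
  have hO : IsOpen (chartDomain σ.φ σ'.φ f) := isOpen_chartDomain hf.contMDiff.continuous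
  have hO₀ : IsOpen (chartDomain σ.ψ σ'.ψ f₀) := isOpen_chartDomain hf₀.contMDiff.continuous
  have hg := contDiffOn_chart σ.φ_mem σ'.φ_mem hf.contMDiff
  have hg₀ := contDiffOn_chart σ.ψ_mem σ'.ψ_mem hf₀.contMDiff
  have hTs := fderiv_chart_surjective hf σ.φ_mem σ'.φ_mem hx hx'
  have hTs₀ := fderiv_chart_surjective hf₀ σ.ψ_mem σ'.ψ_mem hσ hσ'
  have hL : ∀ u ∈ chartDomain σ.ψ σ'.ψ f₀,
      (σ'.φ ∘ f ∘ σ.φ.symm) (σ.L u) = σ'.L ((σ'.ψ ∘ f₀ ∘ σ.ψ.symm) u) :=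
    fun u hu ↦ σ.chart_L σ' h hu.1 hu.2
  set g := σ'.φ ∘ f ∘ σ.φ.symm with hgdef
  set g₀ := σ'.ψ ∘ f₀ ∘ σ.ψ.symm with hgdef₀
  have hd : HasFDerivAt g (fderiv ℝ g (σ.φ (j y))) (σ.φ (j y)) :=
    ((hg.contDiffAt (hO.mem_nhds ha)).differentiableAt (by simp)).hasFDerivAt
  have hd₀ : HasFDerivAt g₀ (fderiv ℝ g₀ (σ.ψ y)) (σ.ψ y) :=
    ((hg₀.contDiffAt (hO₀.mem_nhds ha₀)).differentiableAt (by simp)).hasFDerivAt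
  set T := fderiv ℝ g (σ.φ (j y))
  set T₀ := fderiv ℝ g₀ (σ.ψ y)
  have hTL : ∀ u, T (σ.L u) = σ'.L (T₀ u) := by
    have h1 : HasFDerivAt (g ∘ σ.L) (T.comp σ.L) (σ.ψ y) := by
      refine HasFDerivAt.comp _ ?_ σ.L.hasFDerivAt
      rwa [← σ.φ_j y hσ]
    have h2 : HasFDerivAt (σ'.L ∘ g₀) (σ'.L.comp T₀) (σ.ψ y) :=
      σ'.L.hasFDerivAt.comp _ hd₀
    have h3 : g ∘ σ.L =ᶠ[𝓝 (σ.ψ y)] σ'.L ∘ g₀ := by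
      filter_upwards [hO₀.mem_nhds ha₀] with u hu using hL u hu
    exact fun u ↦ DFunLike.congr_fun (h1.unique (h2.congr_of_eventuallyEq h3)) u
  obtain ⟨S, hS⟩ := exists_continuous_rightInverse hTs
  obtain ⟨R₀, hR₀⟩ := exists_continuous_rightInverse hTs₀
  -- right inverses in the base and in the total space need not be compatible, so that `S` is only
  -- used in the normal direction
  let R : EX' →L[ℝ] EX := (σ.L.comp R₀).comp σ'.p + S.comp σ'.q
  have hR : ∀ e, T (R e) = e := by
    intro e
    simp only [R, add_apply, ContinuousLinearMap.comp_apply, map_add, hTL]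
    rw [hR₀, hS, σ'.L_p_add_q]
  have hRL : ∀ e, R (σ'.L e) = σ.L (R₀ e) := by
    intro e
    simp [R, σ'.p_L, σ'.q_L]
  obtain ⟨θ, hθ, haθ, hθO, hθF⟩ := exists_contDiffGroupoid_of_hasFDerivAt_id
    (F := fun w ↦ R (g w) + (w - R (T w))) hO
    ((R.contDiff.comp_contDiffOn hg).add (by fun_prop)) ha (by
      have := ((R.hasFDerivAt).comp _ hd).add
        ((hasFDerivAt_id (σ.φ (j y))).sub ((R.comp T).hasFDerivAt))
      refine this.congr_fderiv ?_
      ext e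
      simp)
  obtain ⟨θ₀, hθ₀, haθ₀, hθO₀, hθF₀⟩ := exists_contDiffGroupoid_of_hasFDerivAt_id
    (F := fun w ↦ R₀ (g₀ w) + (w - R₀ (T₀ w))) hO₀
    ((R₀.contDiff.comp_contDiffOn hg₀).add (by fun_prop)) ha₀ (by
      have := ((R₀.hasFDerivAt).comp _ hd₀).add
        ((hasFDerivAt_id (σ.ψ y)).sub ((R₀.comp T₀).hasFDerivAt))
      refine this.congr_fderiv ?_
      ext e
      simp)
  have hjc : Continuous j := hj.contMDiff.continuous
  have hφs : ∀ x, x ∈ (σ.φ.trans θ).source ↔ x ∈ σ.φ.source ∧ σ.φ x ∈ θ.source := by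
    intro x; simp
  let φn := σ.φ.trans θ
  let ψn := (σ.ψ.trans θ₀).restrOpen (j ⁻¹' φn.source) (φn.open_source.preimage hjc)
  have hψs : ∀ z, z ∈ ψn.source ↔ (z ∈ σ.ψ.source ∧ σ.ψ z ∈ θ₀.source) ∧ j z ∈ φn.source := by
    intro z; simp [ψn]
  -- the retraction is corrected such that `T₀ ∘ pn = σ'.p ∘ T`
  let pn : EX →L[ℝ] EY := σ.p + R₀.comp (σ'.p.comp T - T₀.comp σ.p)
  have hTp : ∀ w, T₀ (pn w) = σ'.p (T w) := by
    intro w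
    simp [pn, hR₀]
  let σn : Slice EY EX j :=
    { φ := φn
      ψ := ψn
      L := σ.L
      p := pn
      φ_mem := trans_mem_maximalAtlas σ.φ_mem hθ
      ψ_mem := restrOpen_mem_maximalAtlas (trans_mem_maximalAtlas σ.ψ_mem hθ₀) _
      p_L := fun u ↦ by simp [pn, σ.p_L, hTL, σ'.p_L]
      maps := fun z hz ↦ ((hψs z).1 hz).2
      φ_j := fun z hz ↦ by
        have hz' := (hψs z).1 hz
        change θ (σ.φ (j z)) = σ.L (θ₀ (σ.ψ z))
        rw [hθF, hθF₀, σ.φ_j z hz'.1.1, hL _ (hθO₀ hz'.1.2), hRL, hTL, hRL]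
        simp }
  refine ⟨σn, σ', T, T₀, R, R₀, ?_, ⟨?_, ?_, ?_, ?_⟩, hTL, hR, hR₀, hRL⟩
  · exact (hψs y).2 ⟨⟨hσ, haθ₀⟩, (hφs _).2 ⟨hx, haθ⟩⟩
  · intro x hx
    have := (hφs x).1 hx
    have h2 := (hθO this.2).2
    rw [mem_preimage, mem_preimage, σ.φ.left_inv this.1] at h2
    exact h2
  · intro z hz
    have := (hψs z).1 hz
    have h2 := (hθO₀ this.1.2).2
    rw [mem_preimage, mem_preimage, σ.ψ.left_inv this.1.1] at h2
    exact h2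
  · intro x hx
    have := (hφs x).1 hx
    change σ'.φ (f x) = T (θ (σ.φ x))
    rw [hθF, map_add, map_sub, hR, hR, sub_self, add_zero]
    simp [hgdef, σ.φ.left_inv this.1]
  · intro w
    change T (σ.L (pn w)) = _
    rw [hTL, hTp]

section Submersion

variable [FiniteDimensional ℝ EY] [FiniteDimensional ℝ EX]
  [FiniteDimensional ℝ EY'] [FiniteDimensional ℝ EX']
  (hf : Manifold.IsSubmersion 𝓘(ℝ, EX) 𝓘(ℝ, EX') ∞ f)
  (hf₀ : Manifold.IsSubmersion 𝓘(ℝ, EY) 𝓘(ℝ, EY') ∞ f₀) (h : f ∘ j = j' ∘ f₀)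
include hf hf₀ h

theorem NormalBundle.isSubmersion_map :
    Manifold.IsSubmersion 𝓘(ℝ, EX) 𝓘(ℝ, EX') ∞ (NormalBundle.map hj hj' f f₀) := by
  refine isSubmersion_of_hasLinearCharts fun ξ ↦ ?_
  obtain ⟨σ, σ', T, T₀, R, R₀, hy, hlin, -, hR, -, -⟩ :=
    exists_slice_isLinear hj hj' hf hf₀ h ξ.proj
  exact ⟨T, fun e ↦ ⟨R e, hR e⟩,
    hlin.hasLinearCharts_normal hf.contMDiff hf₀.contMDiff h hy⟩

variable [IsManifold 𝓘(ℝ, EX) ∞ X] [IsManifold 𝓘(ℝ, EX') ∞ X']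

theorem DNC.isSubmersion_map :
    Manifold.IsSubmersion 𝓘(ℝ, EX × ℝ) 𝓘(ℝ, EX' × ℝ) ∞ (DNC.map hj hj' f f₀) := by
  refine isSubmersion_of_hasLinearCharts fun d ↦ ?_
  rcases d with ξ | ⟨x, t, ht⟩
  · obtain ⟨σ, σ', T, T₀, R, R₀, hy, hlin, -, hR, -, -⟩ :=
      exists_slice_isLinear hj hj' hf hf₀ h ξ.proj
    exact ⟨_, fun e ↦ ⟨(R e.1, e.2), Prod.ext (hR e.1) rfl⟩,
      hlin.hasLinearCharts_dnc hf.contMDiff hf₀.contMDiff h hy⟩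
  · obtain ⟨T, hT, hc⟩ := exists_hasLinearCharts_of_isSubmersion hf x
    refine ⟨_, fun e ↦ ?_, hc.off ht⟩
    obtain ⟨a, ha⟩ := hT e.1
    exact ⟨(a, e.2), Prod.ext ha rfl⟩

end Submersion

end LinearSlices

/-! ### The product of a Lie groupoid in charts -/

section MulData

variable {E F G M : Type*} [NormedAddCommGroup E] [NormedSpace ℝ E] [NormedAddCommGroup F]
  [NormedSpace ℝ F] [TopologicalSpace G] [ChartedSpace E G] [TopologicalSpace M]
  [ChartedSpace F M] {S : GroupoidStr G M}

/-- Charts `φ`, `φ'`, `φ''` of the arrows and `φt` of the units, such that the target map is the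
linear map `T` in the charts `φ'` and `φt`, and a linear right inverse `R` of `T`. -/
structure MulData (E F : Type*) [NormedAddCommGroup E] [NormedSpace ℝ E] [NormedAddCommGroup F]
    [NormedSpace ℝ F] {G M : Type*} [TopologicalSpace G] [ChartedSpace E G] [TopologicalSpace M]
    [ChartedSpace F M] (S : GroupoidStr G M) where
  φ : OpenPartialHomeomorph G E
  φ' : OpenPartialHomeomorph G E
  φ'' : OpenPartialHomeomorph G E
  φt : OpenPartialHomeomorph M F
  T : E →L[ℝ] F
  R : F →L[ℝ] E
  φ_mem : φ ∈ IsManifold.maximalAtlas 𝓘(ℝ, E) ∞ G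
  φ'_mem : φ' ∈ IsManifold.maximalAtlas 𝓘(ℝ, E) ∞ G
  φ''_mem : φ'' ∈ IsManifold.maximalAtlas 𝓘(ℝ, E) ∞ G
  φt_mem : φt ∈ IsManifold.maximalAtlas 𝓘(ℝ, F) ∞ M
  T_R : ∀ e, T (R e) = e
  maps : ∀ g ∈ φ'.source, S.tgt g ∈ φt.source
  φt_tgt : ∀ g ∈ φ'.source, φt (S.tgt g) = T (φ' g)

namespace MulData

variable (D : MulData E F S)

/-- The second component of a retraction of `G × G` onto the composable pairs, in charts: the
second arrow is moved in the direction of `R` until its target is the source of the first one. -/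
def shift (z : E × E) : E := z.2 + D.R ((D.φt ∘ S.src ∘ D.φ.symm) z.1 - D.T z.2)

/-- The retraction of `G × G` onto the composable pairs, defined in charts. -/
def retract (z : E × E) : G × G := (D.φ.symm z.1, D.φ'.symm (D.shift z))

/-- A domain on which the retraction takes values in the composable pairs. -/
def dom₀ : Set (E × E) :=
  Prod.fst ⁻¹' chartDomain D.φ D.φt S.src ∩ D.shift ⁻¹' D.φ'.target

/-- The domain of the extension of the product to non-composable pairs, in charts. -/
def dom : Set (E × E) := D.dom₀ ∩ (S.mul ∘ D.retract) ⁻¹' D.φ''.source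

/-- An extension of the product, read in charts, from composable to arbitrary pairs: the product
composed with the retraction onto the composable pairs. -/
def ext (z : E × E) : E := D.φ'' (S.mul (D.retract z))

variable {D}

theorem retract_mem {z : E × E} (hz : z ∈ D.dom₀) : D.retract z ∈ S.composable := by
  have h2 : D.shift z ∈ D.φ'.target := hz.2
  have hs := D.φ'.map_target h2
  change S.src (D.φ.symm z.1) = S.tgt (D.φ'.symm (D.shift z))
  refine D.φt.injOn hz.1.2 (D.maps _ hs) ?_
  rw [D.φt_tgt _ hs, D.φ'.right_inv h2, shift, map_add, D.T_R]
  simp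

section composable

variable {g h : G} (hg : g ∈ D.φ.source) (hh : h ∈ D.φ'.source) (hgh : S.src g = S.tgt h)
include hg hh hgh

theorem shift_of_composable : D.shift (D.φ g, D.φ' h) = D.φ' h := by
  simp [shift, D.φ.left_inv hg, hgh, D.φt_tgt h hh]

theorem retract_of_composable : D.retract (D.φ g, D.φ' h) = (g, h) := by
  rw [retract, shift_of_composable hg hh hgh, D.φ.left_inv hg, D.φ'.left_inv hh]

theorem mem_dom₀ : (D.φ g, D.φ' h) ∈ D.dom₀ := by
  refine ⟨mem_chartDomain hg (hgh ▸ D.maps h hh), ?_⟩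
  rw [mem_preimage, shift_of_composable hg hh hgh]
  exact D.φ'.map_source hh

theorem mem_dom_iff : (D.φ g, D.φ' h) ∈ D.dom ↔ S.mul (g, h) ∈ D.φ''.source := by
  rw [dom, mem_inter_iff, mem_preimage, Function.comp_apply, retract_of_composable hg hh hgh]
  exact and_iff_right (mem_dom₀ hg hh hgh)

theorem ext_of_composable : D.ext (D.φ g, D.φ' h) = D.φ'' (S.mul (g, h)) := by
  rw [ext, retract_of_composable hg hh hgh]

end composable

variable (D) (hS : IsLieGroupoid E F S)
include hS

theorem contDiffOn_shift :
    ContDiffOn ℝ ∞ D.shift (Prod.fst ⁻¹' chartDomain D.φ D.φt S.src) := by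
  refine contDiffOn_snd.add (D.R.contDiff.comp_contDiffOn (ContDiffOn.sub ?_ (by fun_prop)))
  exact (contDiffOn_chart D.φ_mem D.φt_mem hS.src_submersion.contMDiff).comp
    contDiff_fst.contDiffOn fun z hz ↦ hz

theorem isOpen_dom₀ : IsOpen D.dom₀ :=
  (D.contDiffOn_shift hS).continuousOn.isOpen_inter_preimage
    ((isOpen_chartDomain hS.src_submersion.contMDiff.continuous).preimage continuous_fst)
    D.φ'.open_target

theorem contMDiffOn_retract :
    ContMDiffOn 𝓘(ℝ, E × E) (𝓘(ℝ, E).prod 𝓘(ℝ, E)) ∞ D.retract D.dom₀ := by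
  refine ContMDiffOn.prodMk ?_ ?_
  · exact (contMDiffOn_symm_of_mem_maximalAtlas D.φ_mem).comp contDiff_fst.contMDiff.contMDiffOn
      fun z hz ↦ hz.1.1
  · exact (contMDiffOn_symm_of_mem_maximalAtlas D.φ'_mem).comp
      ((D.contDiffOn_shift hS).mono inter_subset_left).contMDiffOn fun z hz ↦ hz.2

theorem contMDiffOn_mul_retract :
    ContMDiffOn 𝓘(ℝ, E × E) 𝓘(ℝ, E) ∞ (S.mul ∘ D.retract) D.dom₀ :=
  hS.contMDiffOn_mul.comp (D.contMDiffOn_retract hS) fun _ hz ↦ retract_mem hz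

theorem isOpen_dom : IsOpen D.dom :=
  (D.contMDiffOn_mul_retract hS).continuousOn.isOpen_inter_preimage (D.isOpen_dom₀ hS)
    D.φ''.open_source

theorem contDiffOn_ext : ContDiffOn ℝ ∞ D.ext D.dom := by
  rw [← contMDiffOn_iff_contDiffOn]
  exact (contMDiffOn_of_mem_maximalAtlas D.φ''_mem).comp
    ((D.contMDiffOn_mul_retract hS).mono inter_subset_left) fun z hz ↦ hz.2

/-- On vectors tangent to the composable pairs, the derivative of the extended product is the
differential of the product within the composable pairs. -/
theorem fderiv_ext {g h : G} (hg : g ∈ D.φ.source) (hh : h ∈ D.φ'.source)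
    (hgh : S.src g = S.tgt h) (hm : S.mul (g, h) ∈ D.φ''.source) (v w : E)
    (hvw : (mfderiv 𝓘(ℝ, E) 𝓘(ℝ, F) S.src g v : F) = mfderiv 𝓘(ℝ, E) 𝓘(ℝ, F) S.tgt h w) :
    fderiv ℝ D.ext (D.φ g, D.φ' h) ((mfderiv 𝓘(ℝ, E) 𝓘(ℝ, E) D.φ g v : E),
        (mfderiv 𝓘(ℝ, E) 𝓘(ℝ, E) D.φ' h w : E)) =
      (mfderiv 𝓘(ℝ, E) 𝓘(ℝ, E) D.φ'' (S.mul (g, h)) (mfderivWithin (𝓘(ℝ, E).prod 𝓘(ℝ, E)) 𝓘(ℝ, E)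
        S.mul S.composable (g, h) (v, w)) : E) := by
  have hφ := mdifferentiable_of_mem_maximalAtlas D.φ_mem
  have hφ' := mdifferentiable_of_mem_maximalAtlas D.φ'_mem
  have hz₀ := mem_dom₀ hg hh hgh
  set z : E × E := (D.φ g, D.φ' h) with hz
  -- the derivative of the shift
  have hsrc : HasFDerivAt (D.φt ∘ S.src ∘ D.φ.symm)
      (fderiv ℝ (D.φt ∘ S.src ∘ D.φ.symm) (D.φ g)) z.1 :=
    (((contDiffOn_chart D.φ_mem D.φt_mem hS.src_submersion.contMDiff).contDiffAt
      ((isOpen_chartDomain hS.src_submersion.contMDiff.continuous).mem_nhds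
        hz₀.1)).differentiableAt (by simp)).hasFDerivAt
  have hshift : HasFDerivAt D.shift (.snd ℝ E E + D.R.comp
      ((fderiv ℝ (D.φt ∘ S.src ∘ D.φ.symm) (D.φ g)).comp (.fst ℝ E E) -
        D.T.comp (.snd ℝ E E))) z :=
    hasFDerivAt_snd.add (D.R.hasFDerivAt.comp z ((hsrc.comp z hasFDerivAt_fst).sub
      (D.T.hasFDerivAt.comp z hasFDerivAt_snd)))
  -- the shift does not move vectors tangent to the composable pairs
  have hT : D.T (mfderiv 𝓘(ℝ, E) 𝓘(ℝ, E) D.φ' h w : E) =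
      (mfderiv 𝓘(ℝ, F) 𝓘(ℝ, F) D.φt (S.tgt h) (mfderiv 𝓘(ℝ, E) 𝓘(ℝ, F) S.tgt h w) : F) := by
    rw [← fderiv_chart D.φ'_mem D.φt_mem hS.tgt_submersion.contMDiff hh (D.maps h hh) w]
    have : D.φt ∘ S.tgt ∘ D.φ'.symm =ᶠ[𝓝 (D.φ' h)] D.T := by
      filter_upwards [D.φ'.open_target.mem_nhds (D.φ'.map_source hh)] with e he
      simp [D.φt_tgt _ (D.φ'.map_target he), D.φ'.right_inv he]
    rw [this.fderiv_eq, D.T.fderiv]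
  have hs := fderiv_chart D.φ_mem D.φt_mem hS.src_submersion.contMDiff hg
    (hgh ▸ D.maps h hh : S.src g ∈ D.φt.source) v
  have hst : (mfderiv 𝓘(ℝ, F) 𝓘(ℝ, F) D.φt (S.src g) (mfderiv 𝓘(ℝ, E) 𝓘(ℝ, F) S.src g v) : F) =
      (mfderiv 𝓘(ℝ, F) 𝓘(ℝ, F) D.φt (S.tgt h) (mfderiv 𝓘(ℝ, E) 𝓘(ℝ, F) S.tgt h w) : F) := by
    refine (mfderiv_congr_point' (E := F) (E' := F) (f := D.φt) hgh _).trans ?_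
    exact congrArg (fun e : F ↦ (mfderiv 𝓘(ℝ, F) 𝓘(ℝ, F) D.φt (S.tgt h) e : F)) hvw
  have hRzero : D.R (fderiv ℝ (D.φt ∘ S.src ∘ D.φ.symm) (D.φ g)
      (mfderiv 𝓘(ℝ, E) 𝓘(ℝ, E) D.φ g v : E) - D.T (mfderiv 𝓘(ℝ, E) 𝓘(ℝ, E) D.φ' h w : E)) = 0 := by
    rw [sub_eq_zero.2 (hs.trans (hst.trans hT.symm)), map_zero]
  -- the derivative of the retraction
  have hz2 : D.shift z = D.φ' h := shift_of_composable hg hh hgh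
  have hr₁ : HasMFDerivAt 𝓘(ℝ, E × E) 𝓘(ℝ, E) (fun z : E × E ↦ D.φ.symm z.1) z
      ((mfderiv 𝓘(ℝ, E) 𝓘(ℝ, E) D.φ.symm (D.φ g)).comp (.fst ℝ E E)) :=
    HasMFDerivAt.comp z (hφ.mdifferentiableAt_symm (D.φ.map_source hg)).hasMFDerivAt
      hasFDerivAt_fst.hasMFDerivAt
  have hr₂ : HasMFDerivAt 𝓘(ℝ, E × E) 𝓘(ℝ, E) (fun z : E × E ↦ D.φ'.symm (D.shift z)) z
      ((mfderiv 𝓘(ℝ, E) 𝓘(ℝ, E) D.φ'.symm (D.φ' h)).comp (.snd ℝ E E + D.R.comp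
      ((fderiv ℝ (D.φt ∘ S.src ∘ D.φ.symm) (D.φ g)).comp (.fst ℝ E E) -
        D.T.comp (.snd ℝ E E)))) := by
    refine HasMFDerivAt.comp z ?_ hshift.hasMFDerivAt
    rw [hz2]
    exact (hφ'.mdifferentiableAt_symm (D.φ'.map_source hh)).hasMFDerivAt
  have hr := hr₁.prodMk hr₂
  have hzr : D.retract z = (g, h) := retract_of_composable hg hh hgh
  have hmul : HasMFDerivWithinAt (𝓘(ℝ, E).prod 𝓘(ℝ, E)) 𝓘(ℝ, E) S.mul S.composable (D.retract z)
      (mfderivWithin (𝓘(ℝ, E).prod 𝓘(ℝ, E)) 𝓘(ℝ, E) S.mul S.composable (g, h)) := by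
    rw [hzr]
    exact ((hS.contMDiffOn_mul (g, h) hgh).mdifferentiableWithinAt (by simp)).hasMFDerivWithinAt
  have hcomp := (hmul.comp z (f := D.retract) (hr.hasMFDerivWithinAt (s := D.dom₀))
    fun _ hz ↦ retract_mem hz).hasMFDerivAt ((D.isOpen_dom₀ hS).mem_nhds hz₀)
  have hφ'' : HasMFDerivAt 𝓘(ℝ, E) 𝓘(ℝ, E) D.φ'' ((S.mul ∘ D.retract) z)
      (mfderiv 𝓘(ℝ, E) 𝓘(ℝ, E) D.φ'' (S.mul (g, h))) := by
    rw [Function.comp_apply, hzr]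
    exact ((mdifferentiable_of_mem_maximalAtlas D.φ''_mem).mdifferentiableAt hm).hasMFDerivAt
  have hext := (HasMFDerivAt.comp z hφ'' hcomp).mfderiv
  rw [mfderiv_eq_fderiv] at hext
  have e₁ : mfderiv 𝓘(ℝ, E) 𝓘(ℝ, E) D.φ.symm (D.φ g) (mfderiv 𝓘(ℝ, E) 𝓘(ℝ, E) D.φ g v) = v :=
    DFunLike.congr_fun (hφ.symm_comp_deriv hg) v
  have e₂ : mfderiv 𝓘(ℝ, E) 𝓘(ℝ, E) D.φ'.symm (D.φ' h) (mfderiv 𝓘(ℝ, E) 𝓘(ℝ, E) D.φ' h w) = w :=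
    DFunLike.congr_fun (hφ'.symm_comp_deriv hh) w
  refine (DFunLike.congr_fun hext _).trans ?_
  refine congrArg (fun e : E × E ↦ (mfderiv 𝓘(ℝ, E) 𝓘(ℝ, E) D.φ'' (S.mul (g, h))
    (mfderivWithin (𝓘(ℝ, E).prod 𝓘(ℝ, E)) 𝓘(ℝ, E) S.mul S.composable (g, h) e) : E))
    (Prod.ext e₁ ?_)
  refine Eq.trans ?_ e₂
  refine congrArg (fun e : E ↦ (mfderiv 𝓘(ℝ, E) 𝓘(ℝ, E) D.φ'.symm (D.φ' h) e : E)) ?_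
  have hadd : ∀ a b : E, b = 0 → a + b = a := fun a b hb ↦ by rw [hb, add_zero]
  exact hadd _ _ hRzero

end MulData

end MulData

section GroupoidHom

variable {G M G' M' : Type*} {S : GroupoidStr G M} {S' : GroupoidStr G' M'} {f : G → G'}
  {f₀ : M → M'}

theorem IsGroupoidHom.maps_composable (hf : IsGroupoidHom S S' f f₀) {g h : G}
    (hgh : S.src g = S.tgt h) : S'.src (f g) = S'.tgt (f h) := by
  rw [hf.src_map, hf.tgt_map, hgh]

theorem IsGroupoidHom.src_comp (hf : IsGroupoidHom S S' f f₀) : S'.src ∘ f = f₀ ∘ S.src :=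
  funext hf.src_map

theorem IsGroupoidHom.tgt_comp (hf : IsGroupoidHom S S' f f₀) : S'.tgt ∘ f = f₀ ∘ S.tgt :=
  funext hf.tgt_map

end GroupoidHom

/-! ### Smoothness of the product of the deformation groupoid -/

section Product

variable {E₁ F₁ E₂ F₂ : Type*} [NormedAddCommGroup E₁] [NormedSpace ℝ E₁] [NormedAddCommGroup F₁]
  [NormedSpace ℝ F₁] [NormedAddCommGroup E₂] [NormedSpace ℝ E₂] [NormedAddCommGroup F₂]
  [NormedSpace ℝ F₂] {G₁ M₁ G₂ M₂ : Type*} [TopologicalSpace G₁] [ChartedSpace E₁ G₁]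
  [TopologicalSpace M₁] [ChartedSpace F₁ M₁] [TopologicalSpace G₂] [ChartedSpace E₂ G₂]
  [TopologicalSpace M₂] [ChartedSpace F₂ M₂] {S₁ : GroupoidStr G₁ M₁} {S₂ : GroupoidStr G₂ M₂}
  {j : G₁ → G₂} {j₀ : M₁ → M₂}
  {hj : Manifold.IsImmersion 𝓘(ℝ, E₁) 𝓘(ℝ, E₂) ∞ j}
  {hj₀ : Manifold.IsImmersion 𝓘(ℝ, F₁) 𝓘(ℝ, F₂) ∞ j₀}

theorem NormalBundle.mk_eq_mk_of_eq {y y' : G₁} {v w : E₂}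
    (h : NormalBundle.mk hj y (v : TangentSpace 𝓘(ℝ, E₂) (j y)) =
      NormalBundle.mk hj y' (w : TangentSpace 𝓘(ℝ, E₂) (j y'))) :
    y = y' ∧ ∃ a : E₁, (mfderiv 𝓘(ℝ, E₁) 𝓘(ℝ, E₂) j y a : E₂) = v - w := by
  obtain rfl : y = y' := congrArg NormalBundle.proj h
  exact ⟨rfl, NormalBundle.mk_eq_mk.1 h⟩

variable (hS₁ : IsLieGroupoid E₁ F₁ S₁) (hS₂ : IsLieGroupoid E₂ F₂ S₂)
  (hom : IsGroupoidHom S₁ S₂ j j₀)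
include hS₁ hS₂ hom

/-- Composable normal vectors have representatives tangent to the composable pairs. -/
theorem NormalBundle.exists_rep_composable {ξ η : NormalBundle hj}
    (h : NormalBundle.map hj hj₀ S₂.src S₁.src ξ = NormalBundle.map hj hj₀ S₂.tgt S₁.tgt η) :
    ∃ v w : E₂, NormalBundle.mk hj ξ.proj v = ξ ∧ NormalBundle.mk hj η.proj w = η ∧
      (mfderiv 𝓘(ℝ, E₂) 𝓘(ℝ, F₂) S₂.src (j ξ.proj) v : F₂) =
        mfderiv 𝓘(ℝ, E₂) 𝓘(ℝ, F₂) S₂.tgt (j η.proj) w := by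
  obtain ⟨hy, a, ha⟩ := NormalBundle.mk_eq_mk_of_eq (hj := hj₀) h.symm
  obtain ⟨α, hα⟩ := mfderiv_surjective_of_isSubmersion hS₁.src_submersion ξ.proj
    (a : TangentSpace 𝓘(ℝ, F₁) (S₁.src ξ.proj))
  have hsj : S₂.src ∘ j = j₀ ∘ S₁.src := funext hom.src_map
  have h1 := mfderiv_comp ξ.proj (hS₂.src_submersion.contMDiff.mdifferentiable (by simp) _)
    (hj.contMDiff.mdifferentiable (by simp) _)
  have h2 := mfderiv_comp ξ.proj (hj₀.contMDiff.mdifferentiable (by simp) _)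
    (hS₁.src_submersion.contMDiff.mdifferentiable (by simp) _)
  rw [hsj] at h1
  have h3 := DFunLike.congr_fun (h1.symm.trans h2) α
  have h4 : (mfderiv 𝓘(ℝ, E₂) 𝓘(ℝ, F₂) S₂.src (j ξ.proj)
      (mfderiv 𝓘(ℝ, E₁) 𝓘(ℝ, E₂) j ξ.proj α) : F₂) =
      mfderiv 𝓘(ℝ, F₁) 𝓘(ℝ, F₂) j₀ (S₁.src ξ.proj) a := by
    refine h3.trans ?_
    exact congrArg (fun e : F₁ ↦ (mfderiv 𝓘(ℝ, F₁) 𝓘(ℝ, F₂) j₀ (S₁.src ξ.proj) e : F₂)) hα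
  have h5 : (mfderiv 𝓘(ℝ, F₁) 𝓘(ℝ, F₂) j₀ (S₁.src ξ.proj) a : F₂) =
      mfderiv 𝓘(ℝ, F₁) 𝓘(ℝ, F₂) j₀ (S₁.tgt η.proj) a :=
    mfderiv_congr_point' (E := F₁) (E' := F₂) (f := j₀) hy.symm a
  refine ⟨(ξ.rep : E₂) + (mfderiv 𝓘(ℝ, E₁) 𝓘(ℝ, E₂) j ξ.proj α : E₂), η.rep, ?_,
    NormalBundle.mk_rep η, ?_⟩
  · conv_rhs => rw [← NormalBundle.mk_rep ξ]
    exact NormalBundle.mk_eq_mk.2 ⟨α, (add_sub_cancel_left (G := E₂) _ _).symm⟩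
  · refine (map_add (mfderiv 𝓘(ℝ, E₂) 𝓘(ℝ, F₂) S₂.src (j ξ.proj)) _ _).trans ?_
    have h6 := h4.trans (h5.trans ha)
    have hadd : ∀ a b c : F₂, b = c - a → a + b = c := by rintro a _ c rfl; abel
    exact hadd _ _ _ h6

/-- The product of composable normal vectors is computed with some representatives tangent to the
composable pairs, namely those chosen in its definition. Independence of the choice is not needed.
-/
theorem NormalBundle.mul_spec {ξ η : NormalBundle hj}
    (h : NormalBundle.map hj hj₀ S₂.src S₁.src ξ = NormalBundle.map hj hj₀ S₂.tgt S₁.tgt η) :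
    ∃ v w : E₂, NormalBundle.mk hj ξ.proj v = ξ ∧ NormalBundle.mk hj η.proj w = η ∧
      (mfderiv 𝓘(ℝ, E₂) 𝓘(ℝ, F₂) S₂.src (j ξ.proj) v : F₂) =
        mfderiv 𝓘(ℝ, E₂) 𝓘(ℝ, F₂) S₂.tgt (j η.proj) w ∧
      NormalBundle.mul (F₂ := F₂) S₁ S₂ hj (ξ, η) =
        NormalBundle.mk hj (S₁.mul (ξ.proj, η.proj)) (mfderivWithin (𝓘(ℝ, E₂).prod 𝓘(ℝ, E₂))
          𝓘(ℝ, E₂) S₂.mul S₂.composable (j ξ.proj, j η.proj) (v, w) : E₂) := by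
  obtain ⟨v₀, w₀, h₁, h₂, h₃⟩ := NormalBundle.exists_rep_composable hS₁ hS₂ hom h
  have hex : ∃ vw : E₂ × E₂, NormalBundle.mk hj ξ.proj vw.1 = ξ ∧
      NormalBundle.mk hj η.proj vw.2 = η ∧
      (mfderiv 𝓘(ℝ, E₂) 𝓘(ℝ, F₂) S₂.src (j ξ.proj) vw.1 : F₂) =
        mfderiv 𝓘(ℝ, E₂) 𝓘(ℝ, F₂) S₂.tgt (j η.proj) vw.2 := ⟨(v₀, w₀), h₁, h₂, h₃⟩
  have hspec := Classical.epsilon_spec hex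
  exact ⟨_, _, hspec.1, hspec.2.1, hspec.2.2, rfl⟩

end Product

section Slices

variable {E₁ F₁ E₂ F₂ : Type*} [NormedAddCommGroup E₁] [NormedSpace ℝ E₁] [NormedAddCommGroup F₁]
  [NormedSpace ℝ F₁] [NormedAddCommGroup E₂] [NormedSpace ℝ E₂] [NormedAddCommGroup F₂]
  [NormedSpace ℝ F₂] {G₁ M₁ G₂ M₂ : Type*} [TopologicalSpace G₁] [ChartedSpace E₁ G₁]
  [TopologicalSpace M₁] [ChartedSpace F₁ M₁] [TopologicalSpace G₂] [ChartedSpace E₂ G₂]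
  [TopologicalSpace M₂] [ChartedSpace F₂ M₂] {S₁ : GroupoidStr G₁ M₁} {S₂ : GroupoidStr G₂ M₂}
  {j : G₁ → G₂} {j₀ : M₁ → M₂} (σ σ' σ'' : Slice E₁ E₂ j) (σt : Slice F₁ F₂ j₀)
  {T : E₂ →L[ℝ] F₂} {R : F₂ →L[ℝ] E₂} {T₀ : E₁ →L[ℝ] F₁} {R₀ : F₁ →L[ℝ] E₁}

/-- The data for the extension of the product of `G₂` given by slice charts. -/
@[simps]
def MulData.ofSlices (hT : σ'.IsLinear σt S₂.tgt S₁.tgt T) (hR : ∀ e, T (R e) = e) :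
    MulData E₂ F₂ S₂ where
  φ := σ.φ
  φ' := σ'.φ
  φ'' := σ''.φ
  φt := σt.φ
  T := T
  R := R
  φ_mem := σ.φ_mem
  φ'_mem := σ'.φ_mem
  φ''_mem := σ''.φ_mem
  φt_mem := σt.φ_mem
  T_R := hR
  maps := hT.maps
  φt_tgt := hT.φ_f

/-- The data for the extension of the product of `G₁` given by slice charts. -/
@[simps]
def MulData.ofSlices₀ (hom : IsGroupoidHom S₁ S₂ j j₀) (hT : σ'.IsLinear σt S₂.tgt S₁.tgt T)
    (hTL : ∀ u, T (σ'.L u) = σt.L (T₀ u)) (hR₀ : ∀ e, T₀ (R₀ e) = e) :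
    MulData E₁ F₁ S₁ where
  φ := σ.ψ
  φ' := σ'.ψ
  φ'' := σ''.ψ
  φt := σt.ψ
  T := T₀
  R := R₀
  φ_mem := σ.ψ_mem
  φ'_mem := σ'.ψ_mem
  φ''_mem := σ''.ψ_mem
  φt_mem := σt.ψ_mem
  T_R := hR₀
  maps := hT.maps₀
  φt_tgt g hg := by
    have h1 := hT.φ_f _ (σ'.maps g hg)
    rw [hom.tgt_map, σt.φ_j _ (hT.maps₀ g hg), σ'.φ_j g hg, hTL] at h1
    simpa [σt.p_L] using congrArg σt.p h1

variable {σ σ' σ'' σt} {hT : σ'.IsLinear σt S₂.tgt S₁.tgt T} {hR : ∀ e, T (R e) = e}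

/-- In slice charts the extension of the product of `G₂` restricts to that of `G₁`. -/
theorem MulData.ext_L (hom : IsGroupoidHom S₁ S₂ j j₀)
    (hTL : ∀ u, T (σ'.L u) = σt.L (T₀ u)) (hR₀ : ∀ e, T₀ (R₀ e) = e)
    (hRL : ∀ e, R (σt.L e) = σ'.L (R₀ e)) {z : E₁ × E₁}
    (hz : z ∈ (MulData.ofSlices₀ σ σ' σ'' σt hom hT hTL hR₀).dom) :
    (MulData.ofSlices σ σ' σ'' σt hT hR).ext (σ.L z.1, σ'.L z.2) =
      σ''.L ((MulData.ofSlices₀ σ σ' σ'' σt hom hT hTL hR₀).ext z) := by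
  set D₀ := MulData.ofSlices₀ σ σ' σ'' σt hom hT hTL hR₀
  set D := MulData.ofSlices σ σ' σ'' σt hT hR
  have h1 : z.1 ∈ σ.ψ.target := hz.1.1.1
  have h2 : S₁.src (σ.ψ.symm z.1) ∈ σt.ψ.source := hz.1.1.2
  have h3 : D₀.shift z ∈ σ'.ψ.target := hz.1.2
  have h4 : S₁.mul (D₀.retract z) ∈ σ''.ψ.source := hz.2
  have hc : S₁.src (σ.ψ.symm z.1) = S₁.tgt (σ'.ψ.symm (D₀.shift z)) :=
    MulData.retract_mem (D := D₀) hz.1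
  have hshift : D.shift (σ.L z.1, σ'.L z.2) = σ'.L (D₀.shift z) := by
    have h5 : (σt.φ ∘ S₂.src ∘ σ.φ.symm) (σ.L z.1) = σt.L (σt.ψ (S₁.src (σ.ψ.symm z.1))) := by
      simp only [Function.comp_apply]
      rw [σ.φ_symm_L' h1, hom.src_map, σt.φ_j _ h2]
    change σ'.L z.2 + R ((σt.φ ∘ S₂.src ∘ σ.φ.symm) (σ.L z.1) - T (σ'.L z.2)) =
      σ'.L (z.2 + R₀ ((σt.ψ ∘ S₁.src ∘ σ.ψ.symm) z.1 - T₀ z.2))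
    rw [h5, hTL, ← map_sub, hRL, map_add]
    rfl
  have hretr : D.retract (σ.L z.1, σ'.L z.2) =
      (j (σ.ψ.symm z.1), j (σ'.ψ.symm (D₀.shift z))) := by
    refine Prod.ext (σ.φ_symm_L' h1) ?_
    change σ'.φ.symm (D.shift (σ.L z.1, σ'.L z.2)) = _
    rw [hshift, σ'.φ_symm_L' h3]
  change σ''.φ (S₂.mul (D.retract (σ.L z.1, σ'.L z.2))) = σ''.L (σ''.ψ (S₁.mul (D₀.retract z)))
  rw [hretr, ← hom.map_mul _ _ hc, ← σ''.φ_j _ h4]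
  rfl

end Slices

section DeformationProduct

variable {E₁ F₁ E₂ F₂ : Type*} [NormedAddCommGroup E₁] [NormedSpace ℝ E₁]
  [NormedAddCommGroup F₁] [NormedSpace ℝ F₁] [NormedAddCommGroup E₂]
  [NormedSpace ℝ E₂] [FiniteDimensional ℝ E₂] [NormedAddCommGroup F₂] [NormedSpace ℝ F₂]
  {G₁ M₁ G₂ M₂ : Type*} [TopologicalSpace G₁] [ChartedSpace E₁ G₁]
  [TopologicalSpace M₁] [ChartedSpace F₁ M₁] [TopologicalSpace G₂] [ChartedSpace E₂ G₂]
  [TopologicalSpace M₂] [ChartedSpace F₂ M₂]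
  {S₁ : GroupoidStr G₁ M₁} {S₂ : GroupoidStr G₂ M₂} {j : G₁ → G₂} {j₀ : M₁ → M₂}
  {hj : Manifold.IsImmersion 𝓘(ℝ, E₁) 𝓘(ℝ, E₂) ∞ j}
  {hj₀ : Manifold.IsImmersion 𝓘(ℝ, F₁) 𝓘(ℝ, F₂) ∞ j₀}

omit [FiniteDimensional ℝ E₂] in
theorem DNC.toBase_map {hj : Manifold.IsImmersion 𝓘(ℝ, E₁) 𝓘(ℝ, E₂) ∞ j}
    {hj₀ : Manifold.IsImmersion 𝓘(ℝ, F₁) 𝓘(ℝ, F₂) ∞ j₀} {f : G₂ → M₂} {f₀ : G₁ → M₁}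
    (h : f ∘ j = j₀ ∘ f₀) (d : DNC hj) : (DNC.map hj hj₀ f f₀ d).toBase = f d.toBase := by
  rcases d with ξ | ⟨x, t, ht⟩
  · exact (congrFun h _).symm
  · rfl

omit [FiniteDimensional ℝ E₂] in
theorem DNC.composable_toBase (hom : IsGroupoidHom S₁ S₂ j j₀) {p : DNC hj × DNC hj}
    (hp : p ∈ (DNC.groupoid S₁ S₂ hj hj₀).composable) :
    (p.1.toBase, p.2.toBase) ∈ S₂.composable := by
  have h : DNC.map hj hj₀ S₂.src S₁.src p.1 = DNC.map hj hj₀ S₂.tgt S₁.tgt p.2 := hp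
  have := congrArg DNC.toBase h
  rwa [DNC.toBase_map hom.src_comp, DNC.toBase_map hom.tgt_comp] at this

omit [FiniteDimensional ℝ E₂] in
theorem DNC.param_eq_of_composable {p : DNC hj × DNC hj}
    (hp : p ∈ (DNC.groupoid S₁ S₂ hj hj₀).composable) : p.1.param = p.2.param := by
  have h : DNC.map hj hj₀ S₂.src S₁.src p.1 = DNC.map hj hj₀ S₂.tgt S₁.tgt p.2 := hp
  simpa using congrArg DNC.param h

section

variable (hS₁ : IsLieGroupoid E₁ F₁ S₁) (hS₂ : IsLieGroupoid E₂ F₂ S₂)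
  (hom : IsGroupoidHom S₁ S₂ j j₀)
include hS₁ hS₂ hom

/-- The product of the normal groupoid in slice charts is the derivative of the extended product
in the normal direction. -/
theorem NormalBundle.normalChart_mul {σ σ' σ'' : Slice E₁ E₂ j} {σt : Slice F₁ F₂ j₀}
    {T : E₂ →L[ℝ] F₂} {R : F₂ →L[ℝ] E₂} {T₀ : E₁ →L[ℝ] F₁} {R₀ : F₁ →L[ℝ] E₁}
    (hT : σ'.IsLinear σt S₂.tgt S₁.tgt T) (hR : ∀ e, T (R e) = e)
    (hTL : ∀ u, T (σ'.L u) = σt.L (T₀ u)) (hR₀ : ∀ e, T₀ (R₀ e) = e)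
    (hRL : ∀ e, R (σt.L e) = σ'.L (R₀ e)) {ξ η : NormalBundle hj}
    (h : NormalBundle.map hj hj₀ S₂.src S₁.src ξ = NormalBundle.map hj hj₀ S₂.tgt S₁.tgt η)
    (hξ : ξ.proj ∈ σ.ψ.source) (hη : η.proj ∈ σ'.ψ.source)
    (hm : S₁.mul (ξ.proj, η.proj) ∈ σ''.ψ.source) :
    σ''.normalChart hj (NormalBundle.mul (F₂ := F₂) S₁ S₂ hj (ξ, η)) =
      σ''.L (σ''.p ((MulData.ofSlices σ σ' σ'' σt hT hR).ext
        (σ.L (σ.p (σ.normalChart hj ξ)), σ'.L (σ'.p (σ'.normalChart hj η))))) +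
      σ''.q (fderiv ℝ (MulData.ofSlices σ σ' σ'' σt hT hR).ext
        (σ.L (σ.p (σ.normalChart hj ξ)), σ'.L (σ'.p (σ'.normalChart hj η)))
        (σ.q (σ.normalChart hj ξ), σ'.q (σ'.normalChart hj η))) := by
  obtain ⟨v, w, hv, hw, hvw, hmul⟩ := NormalBundle.mul_spec hS₁ hS₂ hom h
  have hc₁ : S₁.src ξ.proj = S₁.tgt η.proj := congrArg NormalBundle.proj h
  have hc : S₂.src (j ξ.proj) = S₂.tgt (j η.proj) := hom.maps_composable hc₁
  have hm2 : S₂.mul (j ξ.proj, j η.proj) = j (S₁.mul (ξ.proj, η.proj)) :=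
    (hom.map_mul _ _ hc₁).symm
  have hm2s : S₂.mul (j ξ.proj, j η.proj) ∈ σ''.φ.source := by
    rw [hm2]; exact σ''.maps _ hm
  set D₀ := MulData.ofSlices₀ σ σ' σ'' σt hom hT hTL hR₀ with hD₀
  set D := MulData.ofSlices σ σ' σ'' σt hT hR with hD
  have hp₁ : σ.p (σ.normalChart hj ξ) = σ.ψ ξ.proj := σ.p_normalHomeo ξ
  have hp₂ : σ'.p (σ'.normalChart hj η) = σ'.ψ η.proj := σ'.p_normalHomeo η
  set y := ξ.proj
  set y' := η.proj
  have hz : (σ.ψ y, σ'.ψ y') ∈ D₀.dom :=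
    (MulData.mem_dom_iff (D := D₀) hξ hη hc₁).2 hm
  -- the chart of the product of the representatives
  have h1 : σ''.normalChart hj (NormalBundle.mul (F₂ := F₂) S₁ S₂ hj (ξ, η)) =
      σ''.L (σ''.ψ (S₁.mul (y, y'))) + σ''.q (fderiv ℝ D.ext (σ.φ (j y), σ'.φ (j y'))
        ((σ.dφ (j y) v : E₂), (σ'.dφ (j y') w : E₂))) := by
    rw [hmul]
    refine (σ''.normalChart_mk' hm2 hm _).trans ?_
    exact congrArg (fun e : E₂ ↦ σ''.L (σ''.ψ (S₁.mul (y, y'))) + σ''.q e)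
      (D.fderiv_ext hS₂ (σ.maps y hξ) (σ'.maps y' hη) hc hm2s v w hvw).symm
  -- the normal components of the representatives
  have hq₁ : σ.q (σ.normalChart hj ξ) = σ.q (σ.dφ (j y) v : E₂) := by
    have e := (congrArg (σ.normalChart hj) hv.symm).trans (σ.normalChart_mk (hj := hj) hξ v)
    rw [e, map_add, σ.q_L, zero_add, σ.q_q]
  have hq₂ : σ'.q (σ'.normalChart hj η) = σ'.q (σ'.dφ (j y') w : E₂) := by
    have e := (congrArg (σ'.normalChart hj) hw.symm).trans (σ'.normalChart_mk (hj := hj) hη w)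
    rw [e, map_add, σ'.q_L, zero_add, σ'.q_q]
  -- the derivative of the extended product in tangential directions is tangential
  have hzD : (σ.L (σ.ψ y), σ'.L (σ'.ψ y')) ∈ D.dom := by
    rw [← σ.φ_j y hξ, ← σ'.φ_j y' hη]
    exact (MulData.mem_dom_iff (D := D) (σ.maps y hξ) (σ'.maps y' hη) hc).2 hm2s
  have hdD : HasFDerivAt D.ext (fderiv ℝ D.ext (σ.L (σ.ψ y), σ'.L (σ'.ψ y')))
      (σ.L (σ.ψ y), σ'.L (σ'.ψ y')) :=
    (((D.contDiffOn_ext hS₂).contDiffAt ((D.isOpen_dom hS₂).mem_nhds hzD)).differentiableAt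
      (by simp)).hasFDerivAt
  have htang : ∀ a b, σ''.q (fderiv ℝ D.ext (σ.L (σ.ψ y), σ'.L (σ'.ψ y'))
      (σ.L a, σ'.L b)) = 0 := by
    have h2 : HasFDerivAt (σ''.q ∘ D.ext ∘ σ.L.prodMap σ'.L) (σ''.q.comp
        ((fderiv ℝ D.ext (σ.L (σ.ψ y), σ'.L (σ'.ψ y'))).comp (σ.L.prodMap σ'.L)))
        (σ.ψ y, σ'.ψ y') :=
      σ''.q.hasFDerivAt.comp _ (HasFDerivAt.comp (g := D.ext) (f := σ.L.prodMap σ'.L)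
        (σ.ψ y, σ'.ψ y') hdD (σ.L.prodMap σ'.L).hasFDerivAt)
    have h3 : σ''.q ∘ D.ext ∘ σ.L.prodMap σ'.L =ᶠ[𝓝 (σ.ψ y, σ'.ψ y')] fun _ ↦ 0 := by
      filter_upwards [(D₀.isOpen_dom hS₁).mem_nhds hz] with z hz
      have := MulData.ext_L (hT := hT) (hR := hR) hom hTL hR₀ hRL hz
      change σ''.q (D.ext (σ.L z.1, σ'.L z.2)) = 0
      rw [this, σ''.q_L]
    have h4 := h2.unique ((hasFDerivAt_const (0 : E₂) _).congr_of_eventuallyEq h3)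
    exact fun a b ↦ DFunLike.congr_fun h4 (a, b)
  rw [h1, hp₁, hp₂, MulData.ext_L (hT := hT) (hR := hR) hom hTL hR₀ hRL hz, σ''.p_L, hq₁, hq₂,
    σ.φ_j y hξ, σ'.φ_j y' hη]
  have h5 : D₀.ext (σ.ψ y, σ'.ψ y') = σ''.ψ (S₁.mul (y, y')) :=
    MulData.ext_of_composable (D := D₀) hξ hη hc₁
  rw [h5]
  congr 1
  have h6 : (((σ.dφ (j y) v : E₂), (σ'.dφ (j y') w : E₂)) : E₂ × E₂) =
      (σ.L (σ.p (σ.dφ (j y) v : E₂)), σ'.L (σ'.p (σ'.dφ (j y') w : E₂))) +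
        (σ.q (σ.dφ (j y) v : E₂), σ'.q (σ'.dφ (j y') w : E₂)) :=
    Prod.ext (σ.L_p_add_q _).symm (σ'.L_p_add_q _).symm
  refine (congrArg (fun e ↦ σ''.q (fderiv ℝ D.ext (σ.L (σ.ψ y), σ'.L (σ'.ψ y')) e)) h6).trans ?_
  rw [map_add, map_add, htang, zero_add]

end

section

variable [FiniteDimensional ℝ E₁] [FiniteDimensional ℝ F₁] [FiniteDimensional ℝ F₂]
  [IsManifold 𝓘(ℝ, E₂) ∞ G₂] (hS₁ : IsLieGroupoid E₁ F₁ S₁) (hS₂ : IsLieGroupoid E₂ F₂ S₂)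
  (hom : IsGroupoidHom S₁ S₂ j j₀)

omit [FiniteDimensional ℝ E₁] [FiniteDimensional ℝ F₁] [FiniteDimensional ℝ F₂] in
include hS₂ hom in
/-- Over `t ≠ 0` the product is that of `G₂`, at a fixed parameter. -/
theorem DNC.contMDiffWithinAt_mul_of_param_ne_zero {p : DNC hj × DNC hj}
    (hp : p ∈ (DNC.groupoid S₁ S₂ hj hj₀).composable) (ht : p.1.param ≠ 0) :
    ContMDiffWithinAt (𝓘(ℝ, E₂ × ℝ).prod 𝓘(ℝ, E₂ × ℝ)) 𝓘(ℝ, E₂ × ℝ) ∞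
      (DNC.mul (F₂ := F₂) S₁ S₂ hj) (DNC.groupoid S₁ S₂ hj hj₀).composable p := by
  have hb : ContMDiffWithinAt (𝓘(ℝ, E₂ × ℝ).prod 𝓘(ℝ, E₂ × ℝ)) 𝓘(ℝ, E₂) ∞
      (S₂.mul ∘ fun p : DNC hj × DNC hj ↦ (p.1.toBase, p.2.toBase))
      (DNC.groupoid S₁ S₂ hj hj₀).composable p :=
    (hS₂.contMDiffOn_mul _ (DNC.composable_toBase hom hp)).comp p
      (((DNC.contMDiff_toBase.comp contMDiff_fst).prodMk
        (DNC.contMDiff_toBase.comp contMDiff_snd)) p).contMDiffWithinAt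
      fun _ hp ↦ DNC.composable_toBase hom hp
  have hpar : ContMDiff (𝓘(ℝ, E₂ × ℝ).prod 𝓘(ℝ, E₂ × ℝ)) 𝓘(ℝ, ℝ) ∞
      (fun p : DNC hj × DNC hj ↦ p.1.param) := DNC.contMDiff_param.comp contMDiff_fst
  have hval : ∀ p ∈ (DNC.groupoid S₁ S₂ hj hj₀).composable, p.1.param ≠ 0 →
      DNC.mul (F₂ := F₂) S₁ S₂ hj p =
        DNC.incl hj (S₂.mul (p.1.toBase, p.2.toBase), p.1.param) := by
    rintro ⟨d, e⟩ hp ht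
    have ht' : e.param ≠ 0 := fun h ↦ ht ((DNC.param_eq_of_composable hp).trans h)
    rcases d with ξ | ⟨x, t, h⟩
    · exact absurd rfl ht
    rcases e with η | ⟨x', t', h'⟩
    · exact absurd rfl ht'
    exact (DNC.incl_of_ne _ ht).symm
  refine (ContMDiffAt.comp_contMDiffWithinAt p
    (f := fun p : DNC hj × DNC hj ↦ (S₂.mul (p.1.toBase, p.2.toBase), p.1.param))
    (DNC.contMDiffAt_incl _ ht) (hb.prodMk (hpar p).contMDiffWithinAt)).congr_of_eventuallyEq ?_
    (hval p hp ht)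
  filter_upwards [self_mem_nhdsWithin, mem_nhdsWithin_of_mem_nhds
    (hpar.continuous.continuousAt.eventually_ne ht)] with p hp ht using hval p hp ht

include hS₁ hS₂ hom in
/-- The product of the deformation groupoid is smooth. Near `t = 0` it is, in slice charts, the
divided difference of the normal component of the extended product. -/
theorem DNC.contMDiffOn_mul : ContMDiffOn (𝓘(ℝ, E₂ × ℝ).prod 𝓘(ℝ, E₂ × ℝ)) 𝓘(ℝ, E₂ × ℝ) ∞
    (DNC.mul (F₂ := F₂) S₁ S₂ hj) (DNC.groupoid S₁ S₂ hj hj₀).composable := by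
  intro p hp
  by_cases ht : p.1.param = 0
  swap
  · exact DNC.contMDiffWithinAt_mul_of_param_ne_zero hS₂ hom hp ht
  obtain ⟨ξ | ⟨x, t, h⟩, η | ⟨x', t', h'⟩⟩ := p
  rotate_left
  · exact absurd (DNC.param_eq_of_composable hp).symm h'
  · exact absurd ht h
  · exact absurd ht h
  have hc : NormalBundle.map hj hj₀ S₂.src S₁.src ξ = NormalBundle.map hj hj₀ S₂.tgt S₁.tgt η :=
    DNC.zero.inj hp
  have hc₁ : S₁.src ξ.proj = S₁.tgt η.proj := congrArg NormalBundle.proj hc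
  obtain ⟨σ, hξ⟩ := exists_slice hj ξ.proj
  obtain ⟨σ', σt, T, T₀, R, R₀, hη, hT, hTL, hR, hR₀, hRL⟩ := exists_slice_isLinear hj hj₀
    hS₂.tgt_submersion hS₁.tgt_submersion hom.tgt_comp η.proj
  obtain ⟨σ'', hm⟩ := exists_slice hj (S₁.mul (ξ.proj, η.proj))
  set D := MulData.ofSlices σ σ' σ'' σt hT hR with hD
  set D₀ := MulData.ofSlices₀ σ σ' σ'' σt hom hT hTL hR₀ with hD₀
  let A : E₂ × E₂ →L[ℝ] E₂ × E₂ := (σ.L.comp σ.p).prodMap (σ'.L.comp σ'.p)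
  let B : E₂ × E₂ →L[ℝ] E₂ × E₂ := σ.q.prodMap σ'.q
  let w : DNC hj × DNC hj → E₂ × E₂ := fun p ↦ ((σ.dncHomeo hj p.1).1, (σ'.dncHomeo hj p.2).1)
  set p₀ : DNC hj × DNC hj := (.zero ξ, .zero η) with hp₀
  have hw : ContMDiffAt (𝓘(ℝ, E₂ × ℝ).prod 𝓘(ℝ, E₂ × ℝ)) 𝓘(ℝ, E₂ × E₂) ∞ w p₀ := by
    have h1 : ContMDiffAt 𝓘(ℝ, E₂ × ℝ) 𝓘(ℝ, E₂) ∞ (fun d ↦ (σ.dncHomeo hj d).1) (.zero ξ) :=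
      contDiffAt_fst.contMDiffAt_comp_chart σ.dncHomeo_mem hξ
    have h2 : ContMDiffAt 𝓘(ℝ, E₂ × ℝ) 𝓘(ℝ, E₂) ∞ (fun d ↦ (σ'.dncHomeo hj d).1) (.zero η) :=
      contDiffAt_fst.contMDiffAt_comp_chart σ'.dncHomeo_mem hη
    exact (h1.comp p₀ contMDiffAt_fst).prodMk_space (h2.comp p₀ contMDiffAt_snd)
  have hpar : ContMDiff (𝓘(ℝ, E₂ × ℝ).prod 𝓘(ℝ, E₂ × ℝ)) 𝓘(ℝ, ℝ) ∞
      (fun p : DNC hj × DNC hj ↦ p.1.param) := DNC.contMDiff_param.comp contMDiff_fst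
  -- points at which the coordinates are those of a product in `G₁`
  have hdom₀ : (σ.p (w p₀).1, σ'.p (w p₀).2) ∈ D₀.dom := by
    have h1 : σ.p (w p₀).1 = σ.ψ ξ.proj := σ.p_normalHomeo ξ
    have h2 : σ'.p (w p₀).2 = σ'.ψ η.proj := σ'.p_normalHomeo η
    rw [h1, h2]
    exact (MulData.mem_dom_iff (D := D₀) hξ hη hc₁).2 hm
  have hev₀ : ∀ᶠ z in 𝓝 (w p₀), (σ.p z.1, σ'.p z.2) ∈ D₀.dom :=
    (by fun_prop : Continuous fun z : E₂ × E₂ ↦ (σ.p z.1, σ'.p z.2)).continuousAt.eventually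
      ((D₀.isOpen_dom hS₁).mem_nhds hdom₀)
  have hdom : (σ.φ (j ξ.proj), σ'.φ (j η.proj)) ∈ D.dom := by
    refine (MulData.mem_dom_iff (D := D) (σ.maps _ hξ) (σ'.maps _ hη)
      (hom.maps_composable hc₁)).2 ?_
    rw [← hom.map_mul _ _ hc₁]
    exact σ''.maps _ hm
  have hAdom : A (w p₀) ∈ D.dom := by
    have h1 : A (w p₀) = (σ.φ (j ξ.proj), σ'.φ (j η.proj)) := by
      rw [σ.φ_j _ hξ, σ'.φ_j _ hη, ← σ.p_normalHomeo ξ, ← σ'.p_normalHomeo η]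
      rfl
    rwa [h1]
  have hH := σ''.contDiffAt_dncExt (D.isOpen_dom hS₂) (D.contDiffOn_ext hS₂) (A := A) (B := B)
    hAdom (by
      filter_upwards [hev₀] with z hz
      have := MulData.ext_L (hT := hT) (hR := hR) hom hTL hR₀ hRL hz
      change σ''.q (D.ext (σ.L (σ.p z.1), σ'.L (σ'.p z.2))) = 0
      rw [this, σ''.q_L])
  -- the product in charts
  have key : ∀ᶠ p in 𝓝[(DNC.groupoid S₁ S₂ hj hj₀).composable] p₀,
      DNC.mul (F₂ := F₂) S₁ S₂ hj p ∈ (σ''.dncHomeo hj).source ∧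
      σ''.dncHomeo hj (DNC.mul (F₂ := F₂) S₁ S₂ hj p) = σ''.dncExt D.ext A B (w p, p.1.param) := by
    have h1 : ∀ᶠ p in 𝓝 p₀, p.1 ∈ (σ.dncHomeo hj).source :=
      continuousAt_fst.eventually ((σ.dncHomeo hj).open_source.mem_nhds hξ)
    have h2 : ∀ᶠ p in 𝓝 p₀, p.2 ∈ (σ'.dncHomeo hj).source :=
      continuousAt_snd.eventually ((σ'.dncHomeo hj).open_source.mem_nhds hη)
    have h3 : ∀ᶠ p in 𝓝 p₀, (σ.φ p.1.toBase, σ'.φ p.2.toBase) ∈ D.dom := by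
      have c1 : ContinuousAt (fun p : DNC hj × DNC hj ↦ σ.φ p.1.toBase) p₀ :=
        ContinuousAt.comp (g := σ.φ) (σ.φ.continuousAt (σ.maps _ hξ))
          (DNC.contMDiff_toBase.continuous.comp continuous_fst).continuousAt
      have c2 : ContinuousAt (fun p : DNC hj × DNC hj ↦ σ'.φ p.2.toBase) p₀ :=
        ContinuousAt.comp (g := σ'.φ) (σ'.φ.continuousAt (σ'.maps _ hη))
          (DNC.contMDiff_toBase.continuous.comp continuous_snd).continuousAt
      exact (c1.prodMk c2).eventually ((D.isOpen_dom hS₂).mem_nhds hdom)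
    filter_upwards [self_mem_nhdsWithin, mem_nhdsWithin_of_mem_nhds h1,
      mem_nhdsWithin_of_mem_nhds h2, mem_nhdsWithin_of_mem_nhds h3,
      mem_nhdsWithin_of_mem_nhds (hw.continuousAt.eventually hev₀)] with p hp hd he h3 h4
    obtain ⟨ξ | ⟨x, t, h⟩, η | ⟨x', t', h'⟩⟩ := p
    · have hc : NormalBundle.map hj hj₀ S₂.src S₁.src ξ =
        NormalBundle.map hj hj₀ S₂.tgt S₁.tgt η := DNC.zero.inj hp
      have hc₁ : S₁.src ξ.proj = S₁.tgt η.proj := congrArg NormalBundle.proj hc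
      have h5 : (σ.ψ ξ.proj, σ'.ψ η.proj) ∈ D₀.dom := by
        rw [← σ.p_normalHomeo ξ, ← σ'.p_normalHomeo η]
        exact h4
      have h6 : S₁.mul (ξ.proj, η.proj) ∈ σ''.ψ.source :=
        (MulData.mem_dom_iff (D := D₀) hd he hc₁).1 h5
      refine ⟨h6, ?_⟩
      refine Eq.trans ?_ (σ''.dncExt_zero _).symm
      exact Prod.ext (NormalBundle.normalChart_mul hS₁ hS₂ hom hT hR hTL hR₀ hRL hc hd he h6) rfl
    · exact absurd (DNC.param_eq_of_composable hp).symm h'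
    · exact absurd (DNC.param_eq_of_composable hp) h
    · obtain rfl : t = t' := DNC.param_eq_of_composable hp
      have hxx : S₂.src x = S₂.tgt x' := DNC.composable_toBase hom hp
      refine ⟨(MulData.mem_dom_iff (D := D) hd he hxx).1 h3, ?_⟩
      refine Eq.trans ?_ (σ''.dncExt_of_ne _ h).symm
      have h5 : A (w (.off x t h, .off x' t h')) + t • B (w (.off x t h, .off x' t h')) =
          (σ.φ x, σ'.φ x') :=
        Prod.ext (σ.δ_inv' h (σ.φ x)) (σ'.δ_inv' h (σ'.φ x'))
      rw [h5]
      have h6 : D.ext (σ.φ x, σ'.φ x') = σ''.φ (S₂.mul (x, x')) :=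
        MulData.ext_of_composable (D := D) hd he hxx
      rw [h6]
      rfl
  have hp₀' := key.self_of_nhdsWithin hp
  refine contMDiffWithinAt_of_chart_symm σ''.dncHomeo_mem
    (h := fun p ↦ σ''.dncExt D.ext A B (w p, p.1.param)) ?_ ?_ ?_ ?_
  · exact (hH.contMDiffAt.comp (I := 𝓘(ℝ, E₂ × ℝ).prod 𝓘(ℝ, E₂ × ℝ)) p₀
      (f := fun p : DNC hj × DNC hj ↦ (w p, p.1.param))
      (hw.prodMk_space hpar.contMDiffAt)).contMDiffWithinAt
  · rw [← hp₀'.2]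
    exact (σ''.dncHomeo hj).map_source hp₀'.1
  · rw [← hp₀'.2, (σ''.dncHomeo hj).left_inv hp₀'.1]
  · filter_upwards [key] with p hp
    rw [← hp.2, (σ''.dncHomeo hj).left_inv hp.1]

include hS₁ hS₂ hom in
theorem NormalBundle.contMDiffOn_mul : ContMDiffOn (𝓘(ℝ, E₂).prod 𝓘(ℝ, E₂)) 𝓘(ℝ, E₂) ∞
    (NormalBundle.mul (F₂ := F₂) S₁ S₂ hj) (NormalBundle.groupoid S₁ S₂ hj hj₀).composable := by
  intro p hp
  refine DNC.contMDiffWithinAt_of_zero ?_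
  refine (DNC.contMDiffOn_mul hS₁ hS₂ hom (hj := hj) (hj₀ := hj₀) (.zero p.1, .zero p.2)
    (congrArg DNC.zero hp)).comp p (f := fun p : NormalBundle hj × NormalBundle hj ↦
      ((.zero p.1 : DNC hj), (.zero p.2 : DNC hj))) ?_ ?_
  · exact (((DNC.contMDiff_zero.comp contMDiff_fst).prodMk
      (DNC.contMDiff_zero.comp contMDiff_snd)) p).contMDiffWithinAt
  · exact fun p hp ↦ congrArg DNC.zero hp

end

end DeformationProduct

/-! ### Density of the part over `t ≠ 0` -/

section Density

/-- Limits lying in a common chart are unique, even if the space is not Hausdorff. -/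
theorem OpenPartialHomeomorph.eq_of_tendsto {X E ι : Type*} [TopologicalSpace X]
    [TopologicalSpace E] [T2Space E] {l : Filter ι} [l.NeBot] (e : OpenPartialHomeomorph X E)
    {a b : X} (ha : a ∈ e.source) (hb : b ∈ e.source) {u : ι → X} (hua : Tendsto u l (𝓝 a))
    (hub : Tendsto u l (𝓝 b)) : a = b :=
  e.injOn ha hb (tendsto_nhds_unique ((e.continuousAt ha).tendsto.comp hua)
    ((e.continuousAt hb).tendsto.comp hub))

variable {EY EX EY' EX' : Type*} [NormedAddCommGroup EY] [NormedSpace ℝ EY]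
  [NormedAddCommGroup EX] [NormedSpace ℝ EX] [NormedAddCommGroup EY'] [NormedSpace ℝ EY']
  [NormedAddCommGroup EX'] [NormedSpace ℝ EX'] {Y X Y' X' : Type*} [TopologicalSpace Y]
  [ChartedSpace EY Y] [TopologicalSpace X] [ChartedSpace EX X] [TopologicalSpace Y']
  [ChartedSpace EY' Y'] [TopologicalSpace X'] [ChartedSpace EX' X'] {j : Y → X} {j' : Y' → X'}
  {hj : Manifold.IsImmersion 𝓘(ℝ, EY) 𝓘(ℝ, EX) ∞ j}
  {hj' : Manifold.IsImmersion 𝓘(ℝ, EY') 𝓘(ℝ, EX') ∞ j'}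
  [FiniteDimensional ℝ EX] [IsManifold 𝓘(ℝ, EX) ∞ X]
  [FiniteDimensional ℝ EX'] [IsManifold 𝓘(ℝ, EX') ∞ X']

/-- Although `D(X, Y, j)` need not be Hausdorff, limits over `t = 0` are unique once their base
point is known, since all points of a fibre lie in a common chart. -/
theorem DNC.eq_of_tendsto {ι : Type*} {l : Filter ι} [l.NeBot] {u : ι → DNC hj}
    {a b : NormalBundle hj} (h : a.proj = b.proj) (ha : Tendsto u l (𝓝 (.zero a)))
    (hb : Tendsto u l (𝓝 (.zero b))) : a = b := by
  obtain ⟨σ, hσ⟩ := exists_slice hj a.proj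
  exact DNC.zero.inj ((σ.dncHomeo hj).eq_of_tendsto hσ (h ▸ hσ : b.proj ∈ σ.ψ.source) ha hb)

/-- The part of `D(X, Y, j)` over `t ≠ 0` is dense. -/
theorem DNC.exists_tendsto_zero (ξ : NormalBundle hj) : ∃ u : ℝ → DNC hj,
    Tendsto u (𝓝[≠] 0) (𝓝 (.zero ξ)) ∧ ∀ᶠ t in 𝓝[≠] 0, (u t).param ≠ 0 := by
  obtain ⟨σ, hσ⟩ := DNC.exists_slice_zero ξ
  have ht : (σ.normalHomeo hj ξ, (0 : ℝ)) ∈ (σ.dncHomeo hj).target :=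
    (σ.dncHomeo hj).map_source hσ
  have hc : ContinuousAt (fun t : ℝ ↦ (σ.normalHomeo hj ξ, t)) 0 := by fun_prop
  refine ⟨fun t ↦ (σ.dncHomeo hj).symm (σ.normalHomeo hj ξ, t), ?_, ?_⟩
  · refine Tendsto.mono_left ?_ nhdsWithin_le_nhds
    have h1 := ((σ.dncHomeo hj).continuousAt_symm ht).tendsto.comp hc.tendsto
    have h2 : (σ.dncHomeo hj).symm (σ.normalHomeo hj ξ, (0 : ℝ)) = .zero ξ :=
      (σ.dncHomeo hj).left_inv hσ
    rwa [h2] at h1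
  · filter_upwards [self_mem_nhdsWithin, nhdsWithin_le_nhds
      (hc.eventually ((σ.dncHomeo hj).open_target.mem_nhds ht))] with t ht0 ht
    rwa [← DNC.dncHomeo_snd σ, (σ.dncHomeo hj).right_inv ht]

/-- Two maps which agree over `t ≠ 0` and are continuous over `t = 0` agree over `t = 0`, provided
that the base points agree. -/
theorem DNC.eq_of_forall_off {f g : DNC hj → DNC hj'} {ξ : NormalBundle hj}
    {a b : NormalBundle hj'} (hf : ContinuousAt f (.zero ξ)) (hg : ContinuousAt g (.zero ξ))
    (h : ∀ x t ht, f (.off x t ht) = g (.off x t ht)) (ha : f (.zero ξ) = .zero a)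
    (hb : g (.zero ξ) = .zero b) (hab : a.proj = b.proj) : a = b := by
  obtain ⟨u, hu, hu'⟩ := DNC.exists_tendsto_zero ξ
  have h1 := hf.tendsto.comp hu
  have h2 := hg.tendsto.comp hu
  rw [ha] at h1
  rw [hb] at h2
  refine DNC.eq_of_tendsto hab h1 (h2.congr' ?_)
  filter_upwards [hu'] with t ht
  rw [Function.comp_apply, Function.comp_apply, DNC.eq_off_of_param_ne_zero ht, h]

end Density

/-! ### Functoriality -/

section Functoriality

variable {EY EX EY' EX' EY'' EX'' : Type*} [NormedAddCommGroup EY] [NormedSpace ℝ EY]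
  [NormedAddCommGroup EX] [NormedSpace ℝ EX] [NormedAddCommGroup EY'] [NormedSpace ℝ EY']
  [NormedAddCommGroup EX'] [NormedSpace ℝ EX'] [NormedAddCommGroup EY''] [NormedSpace ℝ EY'']
  [NormedAddCommGroup EX''] [NormedSpace ℝ EX''] {Y X Y' X' Y'' X'' : Type*} [TopologicalSpace Y]
  [ChartedSpace EY Y] [TopologicalSpace X] [ChartedSpace EX X] [TopologicalSpace Y']
  [ChartedSpace EY' Y'] [TopologicalSpace X'] [ChartedSpace EX' X'] [TopologicalSpace Y'']
  [ChartedSpace EY'' Y''] [TopologicalSpace X''] [ChartedSpace EX'' X''] {j : Y → X} {j' : Y' → X'}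
  {j'' : Y'' → X''}
  {hj : Manifold.IsImmersion 𝓘(ℝ, EY) 𝓘(ℝ, EX) ∞ j}
  {hj' : Manifold.IsImmersion 𝓘(ℝ, EY') 𝓘(ℝ, EX') ∞ j'}
  {hj'' : Manifold.IsImmersion 𝓘(ℝ, EY'') 𝓘(ℝ, EX'') ∞ j''}
  {f : X → X'} {f₀ : Y → Y'} {g : X' → X''} {g₀ : Y' → Y''}

theorem NormalBundle.map_map (hf : ContMDiff 𝓘(ℝ, EX) 𝓘(ℝ, EX') ∞ f)
    (hg : ContMDiff 𝓘(ℝ, EX') 𝓘(ℝ, EX'') ∞ g) (hg₀ : ContMDiff 𝓘(ℝ, EY') 𝓘(ℝ, EY'') ∞ g₀)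
    (h : f ∘ j = j' ∘ f₀) (h' : g ∘ j' = j'' ∘ g₀) (ξ : NormalBundle hj) :
    NormalBundle.map hj' hj'' g g₀ (NormalBundle.map hj hj' f f₀ ξ) =
      NormalBundle.map hj hj'' (g ∘ f) (g₀ ∘ f₀) ξ := by
  refine (NormalBundle.map_mk hj' hj'' hg hg₀ h' (f₀ ξ.proj) _).trans ?_
  refine congrArg (fun e : EX'' ↦ NormalBundle.mk hj'' (g₀ (f₀ ξ.proj)) e) ?_
  have h1 := mfderiv_comp (j ξ.proj) ((hg.mdifferentiable (by simp)) (f (j ξ.proj)))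
    ((hf.mdifferentiable (by simp)) (j ξ.proj))
  refine Eq.trans ?_ (DFunLike.congr_fun h1 ξ.rep).symm
  exact mfderiv_congr_point' (E := EX') (E' := EX'') (f := g) (congrFun h ξ.proj).symm _

theorem DNC.map_map (hf : ContMDiff 𝓘(ℝ, EX) 𝓘(ℝ, EX') ∞ f)
    (hg : ContMDiff 𝓘(ℝ, EX') 𝓘(ℝ, EX'') ∞ g) (hg₀ : ContMDiff 𝓘(ℝ, EY') 𝓘(ℝ, EY'') ∞ g₀)
    (h : f ∘ j = j' ∘ f₀) (h' : g ∘ j' = j'' ∘ g₀) (d : DNC hj) :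
    DNC.map hj' hj'' g g₀ (DNC.map hj hj' f f₀ d) = DNC.map hj hj'' (g ∘ f) (g₀ ∘ f₀) d := by
  rcases d with ξ | ⟨x, t, ht⟩
  · exact congrArg DNC.zero (NormalBundle.map_map hf hg hg₀ h h' ξ)
  · rfl

end Functoriality

/-! ### The deformation groupoid and the normal groupoid are Lie groupoids -/

section GroupoidHom

variable {E F E' F' : Type*} [NormedAddCommGroup E] [NormedSpace ℝ E] [NormedAddCommGroup F]
  [NormedSpace ℝ F] [NormedAddCommGroup E'] [NormedSpace ℝ E'] [NormedAddCommGroup F']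
  [NormedSpace ℝ F'] {G M G' M' : Type*} [TopologicalSpace G] [ChartedSpace E G]
  [TopologicalSpace M] [ChartedSpace F M] [TopologicalSpace G'] [ChartedSpace E' G']
  [TopologicalSpace M'] [ChartedSpace F' M'] {S : GroupoidStr G M} {S' : GroupoidStr G' M'}
  {f : G → G'} {f₀ : M → M'}

theorem IsGroupoidHom.one_comp (hf : IsGroupoidHom S S' f f₀) (hS : IsLieGroupoid E F S)
    (hS' : IsLieGroupoid E' F' S') : S'.one ∘ f₀ = f ∘ S.one := by
  funext x
  change S'.one (f₀ x) = f (S.one x)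
  have hs : S'.src (f (S.one x)) = f₀ x := by rw [hf.src_map, hS.src_one]
  have ht : S'.tgt (f (S.one x)) = f₀ x := by rw [hf.tgt_map, hS.tgt_one]
  -- `f (1 x)` is idempotent, hence a unit
  have hidem : S'.mul (f (S.one x), f (S.one x)) = f (S.one x) := by
    rw [← hf.map_mul _ _ (by rw [hS.src_one, hS.tgt_one])]
    have := hS.one_mul (S.one x)
    rw [hS.tgt_one] at this
    rw [this]
  have h1 := hS'.mul_assoc (S'.inv (f (S.one x))) (f (S.one x)) (f (S.one x)) (hS'.src_inv _)
    (hs.trans ht.symm)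
  rw [hidem, hS'.inv_mul, hs] at h1
  have h2 := hS'.one_mul (f (S.one x))
  rw [ht] at h2
  exact h1.symm.trans h2

theorem IsGroupoidHom.inv_comp (hf : IsGroupoidHom S S' f f₀) (hS : IsLieGroupoid E F S)
    (hS' : IsLieGroupoid E' F' S') : S'.inv ∘ f = f ∘ S.inv := by
  funext g
  change S'.inv (f g) = f (S.inv g)
  have h1 : S'.mul (f (S.inv g), f g) = S'.one (S'.src (f g)) := by
    rw [← hf.map_mul _ _ (hS.src_inv g), hS.inv_mul, hf.src_map]
    exact (congrFun (hf.one_comp hS hS') _).symm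
  have hs : S'.src (f (S.inv g)) = S'.tgt (f g) := by rw [hf.src_map, hS.src_inv, hf.tgt_map]
  have h2 := hS'.mul_assoc (f (S.inv g)) (f g) (S'.inv (f g)) hs (hS'.tgt_inv _).symm
  rw [h1, hS'.mul_inv, ← hS'.tgt_inv, hS'.one_mul, ← hs, hS'.mul_one] at h2
  exact h2

end GroupoidHom

section DeformationGroupoid

variable {E₁ F₁ E₂ F₂ : Type*} [NormedAddCommGroup E₁] [NormedSpace ℝ E₁] [FiniteDimensional ℝ E₁]
  [NormedAddCommGroup F₁] [NormedSpace ℝ F₁] [FiniteDimensional ℝ F₁] [NormedAddCommGroup E₂]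
  [NormedSpace ℝ E₂] [FiniteDimensional ℝ E₂] [NormedAddCommGroup F₂] [NormedSpace ℝ F₂]
  [FiniteDimensional ℝ F₂] {G₁ M₁ G₂ M₂ : Type*} [TopologicalSpace G₁] [ChartedSpace E₁ G₁]
  [TopologicalSpace M₁] [ChartedSpace F₁ M₁] [TopologicalSpace G₂] [ChartedSpace E₂ G₂]
  [IsManifold 𝓘(ℝ, E₂) ∞ G₂] [TopologicalSpace M₂] [ChartedSpace F₂ M₂]
  [IsManifold 𝓘(ℝ, F₂) ∞ M₂] {S₁ : GroupoidStr G₁ M₁} {S₂ : GroupoidStr G₂ M₂} {j : G₁ → G₂}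
  {j₀ : M₁ → M₂} {hj : Manifold.IsImmersion 𝓘(ℝ, E₁) 𝓘(ℝ, E₂) ∞ j}
  {hj₀ : Manifold.IsImmersion 𝓘(ℝ, F₁) 𝓘(ℝ, F₂) ∞ j₀}
  (hS₁ : IsLieGroupoid E₁ F₁ S₁) (hS₂ : IsLieGroupoid E₂ F₂ S₂) (hom : IsGroupoidHom S₁ S₂ j j₀)
include hS₁ hS₂ hom

/-- A curve of arrows lifts to a curve of composable arrows, as the source map is a submersion. -/
theorem DNC.exists_tendsto_composable {ι : Type*} {l : Filter ι} {d e : DNC hj}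
    (hde : (d, e) ∈ (DNC.groupoid S₁ S₂ hj hj₀).composable) {v : ι → DNC hj}
    (hv : Tendsto v l (𝓝 e)) : ∃ u : ι → DNC hj, Tendsto u l (𝓝 d) ∧
      ∀ᶠ i in l, (u i, v i) ∈ (DNC.groupoid S₁ S₂ hj hj₀).composable := by
  have hc := (DNC.contMDiff_map (hj := hj) (hj' := hj₀) hS₂.tgt_submersion.contMDiff
    hS₁.tgt_submersion.contMDiff hom.tgt_comp).continuous.tendsto e
  have hde' : DNC.map hj hj₀ S₂.src S₁.src d = DNC.map hj hj₀ S₂.tgt S₁.tgt e := hde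
  rw [← hde'] at hc
  exact (DNC.isSubmersion_map (hj := hj) (hj' := hj₀) hS₂.src_submersion hS₁.src_submersion
    hom.src_comp).exists_lift (hc.comp hv)

omit [IsManifold 𝓘(ℝ, F₂) ∞ M₂] in
/-- The product of composable arrows is continuous, in terms of limits along a filter. -/
theorem DNC.tendsto_mul {ι : Type*} {l : Filter ι} {d e : DNC hj} {u v : ι → DNC hj}
    (hde : (d, e) ∈ (DNC.groupoid S₁ S₂ hj hj₀).composable) (hu : Tendsto u l (𝓝 d))
    (hv : Tendsto v l (𝓝 e))
    (huv : ∀ᶠ i in l, (u i, v i) ∈ (DNC.groupoid S₁ S₂ hj hj₀).composable) :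
    Tendsto (fun i ↦ DNC.mul (F₂ := F₂) S₁ S₂ hj (u i, v i)) l
      (𝓝 (DNC.mul (F₂ := F₂) S₁ S₂ hj (d, e))) := by
  refine (DNC.contMDiffOn_mul hS₁ hS₂ hom (d, e) hde).continuousWithinAt.tendsto.comp
    (tendsto_nhdsWithin_iff.2 ⟨hu.prodMk_nhds hv, huv⟩)

omit hS₁ hS₂ hom [FiniteDimensional ℝ E₁] [FiniteDimensional ℝ E₂] [FiniteDimensional ℝ F₁]
  [FiniteDimensional ℝ F₂] [IsManifold 𝓘(ℝ, E₂) ∞ G₂] [IsManifold 𝓘(ℝ, F₂) ∞ M₂] in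
theorem DNC.exists_off_of_composable {d e : DNC hj}
    (hde : (d, e) ∈ (DNC.groupoid S₁ S₂ hj hj₀).composable) (he : e.param ≠ 0) :
    ∃ x x' t, ∃ ht : t ≠ 0, S₂.src x = S₂.tgt x' ∧ d = .off x t ht ∧ e = .off x' t ht := by
  have hp : d.param = e.param := DNC.param_eq_of_composable hde
  rcases e with η | ⟨x', t', h'⟩
  · exact absurd rfl he
  rcases d with ξ | ⟨x, t, h⟩
  · exact absurd hp.symm he
  obtain rfl : t = t' := hp
  exact ⟨x, x', t, h, (DNC.off.inj hde).1, rfl, rfl⟩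

omit hS₁ hS₂ hom [FiniteDimensional ℝ E₁] [FiniteDimensional ℝ E₂] [FiniteDimensional ℝ F₁]
  [FiniteDimensional ℝ F₂] [IsManifold 𝓘(ℝ, E₂) ∞ G₂] [IsManifold 𝓘(ℝ, F₂) ∞ M₂] in
theorem DNC.exists_zero_of_composable {d e : DNC hj}
    (hde : (d, e) ∈ (DNC.groupoid S₁ S₂ hj hj₀).composable) (he : e.param = 0) :
    ∃ ξ η, S₁.src ξ.proj = S₁.tgt η.proj ∧ d = .zero ξ ∧ e = .zero η := by
  have hp : d.param = e.param := DNC.param_eq_of_composable hde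
  rcases e with η | ⟨x', t', h'⟩
  · rcases d with ξ | ⟨x, t, h⟩
    · exact ⟨ξ, η, congrArg NormalBundle.proj (DNC.zero.inj hde), rfl, rfl⟩
    · exact absurd hp h
  · exact absurd he h'

/-- The deformation groupoid is a Lie groupoid. The identities hold over `t ≠ 0`, and hence over
`t = 0` by continuity. -/
theorem DNC.isLieGroupoid :
    IsLieGroupoid (E₂ × ℝ) (F₂ × ℝ) (DNC.groupoid S₁ S₂ hj hj₀) := by
  set S := DNC.groupoid S₁ S₂ hj hj₀ with hS
  have hsrc : Manifold.IsSubmersion 𝓘(ℝ, E₂ × ℝ) 𝓘(ℝ, F₂ × ℝ) ∞ S.src :=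
    DNC.isSubmersion_map hS₂.src_submersion hS₁.src_submersion hom.src_comp
  have htgt : Manifold.IsSubmersion 𝓘(ℝ, E₂ × ℝ) 𝓘(ℝ, F₂ × ℝ) ∞ S.tgt :=
    DNC.isSubmersion_map hS₂.tgt_submersion hS₁.tgt_submersion hom.tgt_comp
  have hone : ContMDiff 𝓘(ℝ, F₂ × ℝ) 𝓘(ℝ, E₂ × ℝ) ∞ S.one :=
    DNC.contMDiff_map hS₂.contMDiff_one hS₁.contMDiff_one (hom.one_comp hS₁ hS₂)
  have hinv : ContMDiff 𝓘(ℝ, E₂ × ℝ) 𝓘(ℝ, E₂ × ℝ) ∞ S.inv :=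
    DNC.contMDiff_map hS₂.contMDiff_inv hS₁.contMDiff_inv (hom.inv_comp hS₁ hS₂)
  have cs := hsrc.contMDiff.continuous
  have ct := htgt.contMDiff.continuous
  have co := hone.continuous
  have ci := hinv.continuous
  have src_one : ∀ x, S.src (S.one x) = x := by
    rintro (ξ | ⟨x, t, ht⟩)
    · exact congrArg DNC.zero (DNC.eq_of_forall_off (cs.comp co).continuousAt continuousAt_id
        (fun x t ht ↦ congrArg (DNC.off · t ht) (hS₂.src_one x)) rfl rfl (hS₁.src_one _))
    · exact congrArg (DNC.off · t ht) (hS₂.src_one x)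
  have tgt_one : ∀ x, S.tgt (S.one x) = x := by
    rintro (ξ | ⟨x, t, ht⟩)
    · exact congrArg DNC.zero (DNC.eq_of_forall_off (ct.comp co).continuousAt continuousAt_id
        (fun x t ht ↦ congrArg (DNC.off · t ht) (hS₂.tgt_one x)) rfl rfl (hS₁.tgt_one _))
    · exact congrArg (DNC.off · t ht) (hS₂.tgt_one x)
  have src_inv : ∀ g, S.src (S.inv g) = S.tgt g := by
    rintro (ξ | ⟨x, t, ht⟩)
    · exact congrArg DNC.zero (DNC.eq_of_forall_off (cs.comp ci).continuousAt ct.continuousAt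
        (fun x t ht ↦ congrArg (DNC.off · t ht) (hS₂.src_inv x)) rfl rfl (hS₁.src_inv _))
    · exact congrArg (DNC.off · t ht) (hS₂.src_inv x)
  have tgt_inv : ∀ g, S.tgt (S.inv g) = S.src g := by
    rintro (ξ | ⟨x, t, ht⟩)
    · exact congrArg DNC.zero (DNC.eq_of_forall_off (ct.comp ci).continuousAt cs.continuousAt
        (fun x t ht ↦ congrArg (DNC.off · t ht) (hS₂.tgt_inv x)) rfl rfl (hS₁.tgt_inv _))
    · exact congrArg (DNC.off · t ht) (hS₂.tgt_inv x)
  have cmul : ∀ {f g : DNC hj → DNC hj}, Continuous f → Continuous g →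
      (∀ d, S.src (f d) = S.tgt (g d)) → Continuous fun d ↦ S.mul (f d, g d) := by
    intro f g hf hg h
    exact continuous_iff_continuousAt.2 fun d ↦ DNC.tendsto_mul hS₁ hS₂ hom (h d) (hf.tendsto d)
      (hg.tendsto d) (Eventually.of_forall h)
  have src_mul : ∀ g h, S.src g = S.tgt h → S.src (S.mul (g, h)) = S.src h := by
    intro d e hde
    by_cases hp : e.param = 0
    · obtain ⟨ξ, η, hc, rfl, rfl⟩ := DNC.exists_zero_of_composable hde hp
      obtain ⟨v, hv, hv'⟩ := DNC.exists_tendsto_zero η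
      obtain ⟨u, hu, huv⟩ := DNC.exists_tendsto_composable hS₁ hS₂ hom hde hv
      refine congrArg DNC.zero (DNC.eq_of_tendsto (hS₁.src_mul _ _ hc)
        ((cs.tendsto _).comp (DNC.tendsto_mul hS₁ hS₂ hom hde hu hv huv))
        (((cs.tendsto _).comp hv).congr' ?_))
      filter_upwards [hv', huv] with i hi hi'
      obtain ⟨x, x', t, ht, hxx, hd, he⟩ := DNC.exists_off_of_composable hi' hi
      rw [Function.comp_apply, Function.comp_apply, hd, he]
      exact congrArg (DNC.off · t ht) (hS₂.src_mul x x' hxx).symm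
    · obtain ⟨x, x', t, ht, hxx, rfl, rfl⟩ := DNC.exists_off_of_composable hde hp
      exact congrArg (DNC.off · t ht) (hS₂.src_mul x x' hxx)
  have tgt_mul : ∀ g h, S.src g = S.tgt h → S.tgt (S.mul (g, h)) = S.tgt g := by
    intro d e hde
    by_cases hp : e.param = 0
    · obtain ⟨ξ, η, hc, rfl, rfl⟩ := DNC.exists_zero_of_composable hde hp
      obtain ⟨v, hv, hv'⟩ := DNC.exists_tendsto_zero η
      obtain ⟨u, hu, huv⟩ := DNC.exists_tendsto_composable hS₁ hS₂ hom hde hv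
      refine congrArg DNC.zero (DNC.eq_of_tendsto (hS₁.tgt_mul _ _ hc)
        ((ct.tendsto _).comp (DNC.tendsto_mul hS₁ hS₂ hom hde hu hv huv))
        (((ct.tendsto _).comp hu).congr' ?_))
      filter_upwards [hv', huv] with i hi hi'
      obtain ⟨x, x', t, ht, hxx, hd, he⟩ := DNC.exists_off_of_composable hi' hi
      rw [Function.comp_apply, Function.comp_apply, hd, he]
      exact congrArg (DNC.off · t ht) (hS₂.tgt_mul x x' hxx).symm
    · obtain ⟨x, x', t, ht, hxx, rfl, rfl⟩ := DNC.exists_off_of_composable hde hp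
      exact congrArg (DNC.off · t ht) (hS₂.tgt_mul x x' hxx)
  refine ⟨hsrc, htgt, hone, hinv, DNC.contMDiffOn_mul hS₁ hS₂ hom, src_one, tgt_one, src_mul,
    tgt_mul, ?_, ?_, ?_, src_inv, tgt_inv, ?_, ?_⟩
  -- associativity over `t = 0`: a curve ending in the last arrow is lifted successively to
  -- composable curves ending in the other two
  · intro d e k hde hek
    have hdek : S.src d = S.tgt (S.mul (e, k)) := hde.trans (tgt_mul e k hek).symm
    have hdek' : S.src (S.mul (d, e)) = S.tgt k := (src_mul d e hde).trans hek
    by_cases hp : k.param = 0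
    · obtain ⟨η, ζ, hc, rfl, rfl⟩ := DNC.exists_zero_of_composable hek hp
      obtain ⟨ξ, _, hc', rfl, hη⟩ := DNC.exists_zero_of_composable hde rfl
      obtain rfl := DNC.zero.inj hη
      obtain ⟨w, hw, hw'⟩ := DNC.exists_tendsto_zero ζ
      obtain ⟨v, hv, hvw⟩ := DNC.exists_tendsto_composable hS₁ hS₂ hom hek hw
      obtain ⟨u, hu, huv⟩ := DNC.exists_tendsto_composable hS₁ hS₂ hom hde hv
      have h1 := DNC.tendsto_mul hS₁ hS₂ hom hdek' (DNC.tendsto_mul hS₁ hS₂ hom hde hu hv huv) hw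
        (by filter_upwards [hvw, huv] with i hi hi' using (src_mul _ _ hi').trans hi)
      have h2 := DNC.tendsto_mul hS₁ hS₂ hom hdek hu (DNC.tendsto_mul hS₁ hS₂ hom hek hv hw hvw)
        (by filter_upwards [hvw, huv] with i hi hi' using hi'.trans (tgt_mul _ _ hi).symm)
      refine congrArg DNC.zero (DNC.eq_of_tendsto (hS₁.mul_assoc _ _ _ hc' hc) h1 (h2.congr' ?_))
      filter_upwards [hw', hvw, huv] with i hi hi' hi''
      obtain ⟨x', x'', t, ht, hxx', hd, he⟩ := DNC.exists_off_of_composable hi' hi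
      obtain ⟨x, _, s, hs, hxx, hd', he'⟩ := DNC.exists_off_of_composable hi'' (by rwa [hd])
      obtain ⟨rfl, rfl⟩ := DNC.off.inj (hd.symm.trans he')
      rw [hd', hd, he]
      exact congrArg (DNC.off · t ht) (hS₂.mul_assoc x x' x'' hxx hxx').symm
    · obtain ⟨x', x'', t, ht, hxx', rfl, rfl⟩ := DNC.exists_off_of_composable hek hp
      obtain ⟨x, _, s, hs, hxx, rfl, he'⟩ := DNC.exists_off_of_composable hde ht
      obtain ⟨rfl, rfl⟩ := DNC.off.inj he'
      exact congrArg (DNC.off · t ht) (hS₂.mul_assoc x x' x'' hxx hxx')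
  · rintro (ξ | ⟨x, t, ht⟩)
    · exact congrArg DNC.zero (DNC.eq_of_forall_off (f := fun d ↦ S.mul (S.one (S.tgt d), d))
        (cmul (co.comp ct) continuous_id fun d ↦ src_one _).continuousAt continuousAt_id
        (fun x t ht ↦ congrArg (DNC.off · t ht) (hS₂.one_mul x)) rfl rfl (hS₁.one_mul _))
    · exact congrArg (DNC.off · t ht) (hS₂.one_mul x)
  · rintro (ξ | ⟨x, t, ht⟩)
    · exact congrArg DNC.zero (DNC.eq_of_forall_off (f := fun d ↦ S.mul (d, S.one (S.src d)))
        (cmul continuous_id (co.comp cs) fun d ↦ (tgt_one _).symm).continuousAt continuousAt_id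
        (fun x t ht ↦ congrArg (DNC.off · t ht) (hS₂.mul_one x)) rfl rfl (hS₁.mul_one _))
    · exact congrArg (DNC.off · t ht) (hS₂.mul_one x)
  · rintro (ξ | ⟨x, t, ht⟩)
    · exact congrArg DNC.zero (DNC.eq_of_forall_off (f := fun d ↦ S.mul (S.inv d, d))
        (cmul ci continuous_id src_inv).continuousAt (co.comp cs).continuousAt
        (fun x t ht ↦ congrArg (DNC.off · t ht) (hS₂.inv_mul x)) rfl rfl (hS₁.inv_mul _))
    · exact congrArg (DNC.off · t ht) (hS₂.inv_mul x)
  · rintro (ξ | ⟨x, t, ht⟩)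
    · exact congrArg DNC.zero (DNC.eq_of_forall_off (f := fun d ↦ S.mul (d, S.inv d))
        (cmul continuous_id ci fun d ↦ (tgt_inv d).symm).continuousAt (co.comp ct).continuousAt
        (fun x t ht ↦ congrArg (DNC.off · t ht) (hS₂.mul_inv x)) rfl rfl (hS₁.mul_inv _))
    · exact congrArg (DNC.off · t ht) (hS₂.mul_inv x)

/-- The normal groupoid is a Lie groupoid, being the restriction of the deformation groupoid to
`t = 0`. -/
theorem NormalBundle.isLieGroupoid :
    IsLieGroupoid E₂ F₂ (NormalBundle.groupoid S₁ S₂ hj hj₀) := by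
  have h := DNC.isLieGroupoid (hj := hj) (hj₀ := hj₀) hS₁ hS₂ hom
  refine ⟨NormalBundle.isSubmersion_map hS₂.src_submersion hS₁.src_submersion hom.src_comp,
    NormalBundle.isSubmersion_map hS₂.tgt_submersion hS₁.tgt_submersion hom.tgt_comp,
    NormalBundle.contMDiff_map hS₂.contMDiff_one hS₁.contMDiff_one (hom.one_comp hS₁ hS₂),
    NormalBundle.contMDiff_map hS₂.contMDiff_inv hS₁.contMDiff_inv (hom.inv_comp hS₁ hS₂),
    NormalBundle.contMDiffOn_mul hS₁ hS₂ hom, ?_, ?_, ?_, ?_, ?_, ?_, ?_, ?_, ?_, ?_, ?_⟩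
  · exact fun x ↦ DNC.zero.inj (h.src_one (.zero x))
  · exact fun x ↦ DNC.zero.inj (h.tgt_one (.zero x))
  · exact fun g k hgk ↦ DNC.zero.inj (h.src_mul (.zero g) (.zero k) (congrArg DNC.zero hgk))
  · exact fun g k hgk ↦ DNC.zero.inj (h.tgt_mul (.zero g) (.zero k) (congrArg DNC.zero hgk))
  · exact fun g k l hgk hkl ↦ DNC.zero.inj (h.mul_assoc (.zero g) (.zero k) (.zero l)
      (congrArg DNC.zero hgk) (congrArg DNC.zero hkl))
  · exact fun g ↦ DNC.zero.inj (h.one_mul (.zero g))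
  · exact fun g ↦ DNC.zero.inj (h.mul_one (.zero g))
  · exact fun g ↦ DNC.zero.inj (h.src_inv (.zero g))
  · exact fun g ↦ DNC.zero.inj (h.tgt_inv (.zero g))
  · exact fun g ↦ DNC.zero.inj (h.inv_mul (.zero g))
  · exact fun g ↦ DNC.zero.inj (h.mul_inv (.zero g))

end DeformationGroupoid

section ToBase

variable {E₁ F₁ E₂ F₂ : Type*} [NormedAddCommGroup E₁] [NormedSpace ℝ E₁]
  [NormedAddCommGroup F₁] [NormedSpace ℝ F₁] [NormedAddCommGroup E₂] [NormedSpace ℝ E₂]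
  [NormedAddCommGroup F₂] [NormedSpace ℝ F₂] {G₁ M₁ G₂ M₂ : Type*} [TopologicalSpace G₁]
  [ChartedSpace E₁ G₁] [TopologicalSpace M₁] [ChartedSpace F₁ M₁] [TopologicalSpace G₂]
  [ChartedSpace E₂ G₂] [TopologicalSpace M₂] [ChartedSpace F₂ M₂] {S₁ : GroupoidStr G₁ M₁}
  {S₂ : GroupoidStr G₂ M₂} {j : G₁ → G₂} {j₀ : M₁ → M₂}
  {hj : Manifold.IsImmersion 𝓘(ℝ, E₁) 𝓘(ℝ, E₂) ∞ j}
  {hj₀ : Manifold.IsImmersion 𝓘(ℝ, F₁) 𝓘(ℝ, F₂) ∞ j₀}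

theorem DNC.isGroupoidHom_toBase (hom : IsGroupoidHom S₁ S₂ j j₀) :
    IsGroupoidHom (DNC.groupoid S₁ S₂ hj hj₀) S₂ DNC.toBase DNC.toBase where
  src_map d := (DNC.toBase_map hom.src_comp d).symm
  tgt_map d := (DNC.toBase_map hom.tgt_comp d).symm
  map_mul d e hde := by
    by_cases hp : e.param = 0
    · obtain ⟨ξ, η, hc, rfl, rfl⟩ := DNC.exists_zero_of_composable hde hp
      exact hom.map_mul _ _ hc
    · obtain ⟨x, x', t, ht, hxx, rfl, rfl⟩ := DNC.exists_off_of_composable hde hp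
      rfl

end ToBase

/-! ### Functoriality of the deformation groupoid and of the normal groupoid -/

section GroupoidMorphism

variable {E₁ F₁ E₂ F₂ : Type*} [NormedAddCommGroup E₁] [NormedSpace ℝ E₁] [FiniteDimensional ℝ E₁]
  [NormedAddCommGroup F₁] [NormedSpace ℝ F₁] [FiniteDimensional ℝ F₁] [NormedAddCommGroup E₂]
  [NormedSpace ℝ E₂] [FiniteDimensional ℝ E₂] [NormedAddCommGroup F₂] [NormedSpace ℝ F₂]
  [FiniteDimensional ℝ F₂] {G₁ M₁ G₂ M₂ : Type*} [TopologicalSpace G₁] [ChartedSpace E₁ G₁]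
  [TopologicalSpace M₁] [ChartedSpace F₁ M₁] [TopologicalSpace G₂] [ChartedSpace E₂ G₂]
  [IsManifold 𝓘(ℝ, E₂) ∞ G₂] [TopologicalSpace M₂] [ChartedSpace F₂ M₂]
  [IsManifold 𝓘(ℝ, F₂) ∞ M₂] {S₁ : GroupoidStr G₁ M₁} {S₂ : GroupoidStr G₂ M₂} {j : G₁ → G₂}
  {j₀ : M₁ → M₂} {hj : Manifold.IsImmersion 𝓘(ℝ, E₁) 𝓘(ℝ, E₂) ∞ j}
  {hj₀ : Manifold.IsImmersion 𝓘(ℝ, F₁) 𝓘(ℝ, F₂) ∞ j₀}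
  (hS₁ : IsLieGroupoid E₁ F₁ S₁) (hS₂ : IsLieGroupoid E₂ F₂ S₂) (hom : IsGroupoidHom S₁ S₂ j j₀)
  {E₁' F₁' E₂' F₂' : Type*} [NormedAddCommGroup E₁'] [NormedSpace ℝ E₁'] [FiniteDimensional ℝ E₁']
  [NormedAddCommGroup F₁'] [NormedSpace ℝ F₁'] [FiniteDimensional ℝ F₁'] [NormedAddCommGroup E₂']
  [NormedSpace ℝ E₂'] [FiniteDimensional ℝ E₂'] [NormedAddCommGroup F₂'] [NormedSpace ℝ F₂']
  [FiniteDimensional ℝ F₂'] {G₁' M₁' G₂' M₂' : Type*} [TopologicalSpace G₁'] [ChartedSpace E₁' G₁']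
  [TopologicalSpace M₁'] [ChartedSpace F₁' M₁'] [TopologicalSpace G₂'] [ChartedSpace E₂' G₂']
  [IsManifold 𝓘(ℝ, E₂') ∞ G₂'] [TopologicalSpace M₂'] [ChartedSpace F₂' M₂']
  [IsManifold 𝓘(ℝ, F₂') ∞ M₂'] {S₁' : GroupoidStr G₁' M₁'} {S₂' : GroupoidStr G₂' M₂'}
  {j' : G₁' → G₂'} {j₀' : M₁' → M₂'} {hj' : Manifold.IsImmersion 𝓘(ℝ, E₁') 𝓘(ℝ, E₂') ∞ j'}
  {hj₀' : Manifold.IsImmersion 𝓘(ℝ, F₁') 𝓘(ℝ, F₂') ∞ j₀'}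
  (hS₁' : IsLieGroupoid E₁' F₁' S₁') (hS₂' : IsLieGroupoid E₂' F₂' S₂')
  (hom' : IsGroupoidHom S₁' S₂' j' j₀')
  {f : G₂ → G₂'} {f₀ : M₂ → M₂'} {g : G₁ → G₁'} {g₀ : M₁ → M₁'}
  (hf : ContMDiff 𝓘(ℝ, E₂) 𝓘(ℝ, E₂') ∞ f) (hf₀ : ContMDiff 𝓘(ℝ, F₂) 𝓘(ℝ, F₂') ∞ f₀)
  (hg : ContMDiff 𝓘(ℝ, E₁) 𝓘(ℝ, E₁') ∞ g) (hg₀ : ContMDiff 𝓘(ℝ, F₁) 𝓘(ℝ, F₁') ∞ g₀)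
  (hom₂ : IsGroupoidHom S₂ S₂' f f₀) (hom₁ : IsGroupoidHom S₁ S₁' g g₀)
  (h : f ∘ j = j' ∘ g) (h₀ : f₀ ∘ j₀ = j₀' ∘ g₀)
include hS₁ hS₂ hom hS₁' hS₂' hom' hf hf₀ hg hg₀ hom₂ hom₁ h h₀

omit [IsManifold 𝓘(ℝ, F₂') ∞ M₂'] in
/-- A morphism of Lie groupoid immersions induces a morphism of the deformation groupoids. For the
product this follows by continuity from the part over `t ≠ 0`. -/
theorem DNC.isGroupoidHom_map : IsGroupoidHom (DNC.groupoid S₁ S₂ hj hj₀)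
    (DNC.groupoid S₁' S₂' hj' hj₀') (DNC.map hj hj' f g) (DNC.map hj₀ hj₀' f₀ g₀) := by
  have src_map : ∀ d, DNC.map hj' hj₀' S₂'.src S₁'.src (DNC.map hj hj' f g d) =
      DNC.map hj₀ hj₀' f₀ g₀ (DNC.map hj hj₀ S₂.src S₁.src d) := by
    intro d
    rw [DNC.map_map hf hS₂'.src_submersion.contMDiff hS₁'.src_submersion.contMDiff h
      hom'.src_comp, DNC.map_map hS₂.src_submersion.contMDiff hf₀ hg₀ hom.src_comp h₀,
      hom₂.src_comp, hom₁.src_comp]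
  have tgt_map : ∀ d, DNC.map hj' hj₀' S₂'.tgt S₁'.tgt (DNC.map hj hj' f g d) =
      DNC.map hj₀ hj₀' f₀ g₀ (DNC.map hj hj₀ S₂.tgt S₁.tgt d) := by
    intro d
    rw [DNC.map_map hf hS₂'.tgt_submersion.contMDiff hS₁'.tgt_submersion.contMDiff h
      hom'.tgt_comp, DNC.map_map hS₂.tgt_submersion.contMDiff hf₀ hg₀ hom.tgt_comp h₀,
      hom₂.tgt_comp, hom₁.tgt_comp]
  refine ⟨src_map, tgt_map, ?_⟩
  have hcomp : ∀ d e, (d, e) ∈ (DNC.groupoid S₁ S₂ hj hj₀).composable →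
      (DNC.map hj hj' f g d, DNC.map hj hj' f g e) ∈
        (DNC.groupoid S₁' S₂' hj' hj₀').composable := by
    intro d e hde
    exact (src_map d).trans ((congrArg (DNC.map hj₀ hj₀' f₀ g₀) hde).trans (tgt_map e).symm)
  have hc : Continuous (DNC.map hj hj' f g) := (DNC.contMDiff_map hf hg h).continuous
  intro d e hde
  by_cases hp : e.param = 0
  · obtain ⟨ξ, η, hc₁, rfl, rfl⟩ := DNC.exists_zero_of_composable hde hp
    obtain ⟨v, hv, hv'⟩ := DNC.exists_tendsto_zero η
    obtain ⟨u, hu, huv⟩ := DNC.exists_tendsto_composable hS₁ hS₂ hom hde hv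
    refine congrArg DNC.zero (DNC.eq_of_tendsto (hom₁.map_mul _ _ hc₁)
      ((hc.tendsto _).comp (DNC.tendsto_mul hS₁ hS₂ hom hde hu hv huv))
      ((DNC.tendsto_mul hS₁' hS₂' hom' (hcomp _ _ hde) ((hc.tendsto _).comp hu)
        ((hc.tendsto _).comp hv) (huv.mono fun i hi ↦ hcomp _ _ hi)).congr' ?_))
    filter_upwards [hv', huv] with i hi hi'
    obtain ⟨x, x', t, ht, hxx, hd, he⟩ := DNC.exists_off_of_composable hi' hi
    rw [Function.comp_apply, Function.comp_apply, Function.comp_apply, hd, he]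
    exact congrArg (DNC.off · t ht) (hom₂.map_mul x x' hxx).symm
  · obtain ⟨x, x', t, ht, hxx, rfl, rfl⟩ := DNC.exists_off_of_composable hde hp
    exact congrArg (DNC.off · t ht) (hom₂.map_mul x x' hxx)

omit [IsManifold 𝓘(ℝ, F₂') ∞ M₂'] in
theorem NormalBundle.isGroupoidHom_map : IsGroupoidHom (NormalBundle.groupoid S₁ S₂ hj hj₀)
    (NormalBundle.groupoid S₁' S₂' hj' hj₀') (NormalBundle.map hj hj' f g)
    (NormalBundle.map hj₀ hj₀' f₀ g₀) := by
  have H := DNC.isGroupoidHom_map (hj := hj) (hj₀ := hj₀) (hj' := hj') (hj₀' := hj₀') hS₁ hS₂ hom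
    hS₁' hS₂' hom' hf hf₀ hg hg₀ hom₂ hom₁ h h₀
  exact ⟨fun x ↦ DNC.zero.inj (H.src_map (.zero x)), fun x ↦ DNC.zero.inj (H.tgt_map (.zero x)),
    fun x y hxy ↦ DNC.zero.inj (H.map_mul (.zero x) (.zero y) (congrArg DNC.zero hxy))⟩

end GroupoidMorphism

/-! ### Charts in which a square of immersions is linear -/

section LinearSquare

/-- A commutative square of linear embeddings `J₂ I₁ = I₂ J₁` into `B₂` with retractions which
form commutative squares with the embeddings and with each other. Equivalently `B₂` is decomposed
into four summands such that the image of `A₁` is the first of them, and the images of `A₂` and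
`B₁` are the sums of the first one with the second and the third one, respectively. -/
structure LinearSquare (A₁ A₂ B₁ B₂ : Type*) [NormedAddCommGroup A₁] [NormedSpace ℝ A₁]
    [NormedAddCommGroup A₂] [NormedSpace ℝ A₂] [NormedAddCommGroup B₁] [NormedSpace ℝ B₁]
    [NormedAddCommGroup B₂] [NormedSpace ℝ B₂] where
  I₁ : A₁ →L[ℝ] A₂
  I₂ : B₁ →L[ℝ] B₂
  J₁ : A₁ →L[ℝ] B₁
  J₂ : A₂ →L[ℝ] B₂
  pI₁ : A₂ →L[ℝ] A₁
  pI₂ : B₂ →L[ℝ] B₁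
  pJ₁ : B₁ →L[ℝ] A₁
  pJ₂ : B₂ →L[ℝ] A₂
  pI₁_I₁ : ∀ u, pI₁ (I₁ u) = u
  pI₂_I₂ : ∀ u, pI₂ (I₂ u) = u
  pJ₁_J₁ : ∀ u, pJ₁ (J₁ u) = u
  pJ₂_J₂ : ∀ u, pJ₂ (J₂ u) = u
  J₂_I₁ : ∀ u, J₂ (I₁ u) = I₂ (J₁ u)
  pI₂_J₂ : ∀ u, pI₂ (J₂ u) = J₁ (pI₁ u)
  pJ₂_I₂ : ∀ u, pJ₂ (I₂ u) = I₁ (pJ₁ u)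
  pI₁_pJ₂ : ∀ u, pI₁ (pJ₂ u) = pJ₁ (pI₂ u)

variable {A₁ A₂ B₁ B₂ : Type*} [NormedAddCommGroup A₁] [NormedSpace ℝ A₁]
  [NormedAddCommGroup A₂] [NormedSpace ℝ A₂] [NormedAddCommGroup B₁] [NormedSpace ℝ B₁]
  [NormedAddCommGroup B₂] [NormedSpace ℝ B₂]

/-- The square given by one linear embedding. -/
def LinearSquare.ofEmbedding (I : A₁ →L[ℝ] B₂) (p : B₂ →L[ℝ] A₁) (h : ∀ u, p (I u) = u) :
    LinearSquare A₁ A₁ A₁ B₂ where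
  I₁ := .id ℝ A₁
  I₂ := I
  J₁ := .id ℝ A₁
  J₂ := I
  pI₁ := .id ℝ A₁
  pI₂ := p
  pJ₁ := .id ℝ A₁
  pJ₂ := p
  pI₁_I₁ _ := rfl
  pI₂_I₂ := h
  pJ₁_J₁ _ := rfl
  pJ₂_J₂ := h
  J₂_I₁ _ := rfl
  pI₂_J₂ := h
  pJ₂_I₂ := h
  pI₁_pJ₂ _ := rfl

theorem exists_continuous_leftInverse [FiniteDimensional ℝ A₁] [FiniteDimensional ℝ B₂]
    {I : A₁ →L[ℝ] B₂} (hI : Function.Injective I) : ∃ p : B₂ →L[ℝ] A₁, ∀ u, p (I u) = u := by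
  obtain ⟨p, hp⟩ := (I : A₁ →ₗ[ℝ] B₂).exists_leftInverse_of_injective (LinearMap.ker_eq_bot.2 hI)
  exact ⟨LinearMap.toContinuousLinearMap p, fun u ↦ LinearMap.congr_fun hp u⟩

/-- A commutative square of linear embeddings such that the images of `J₂` and `I₂` intersect in
the image of `A₁` admits compatible retractions. The retraction `(pJ₂, r)` of the embedding
`(l, m) ↦ J₂ l + I₂ m` of `A₂ × ker pJ₁` provides `pJ₂` and `pI₂ = r + J₁ pI₁ pJ₂`. -/
theorem LinearSquare.exists_of_clean [FiniteDimensional ℝ A₂] [FiniteDimensional ℝ B₁]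
    [FiniteDimensional ℝ B₂] {I₁ : A₁ →L[ℝ] A₂} {I₂ : B₁ →L[ℝ] B₂} {J₁ : A₁ →L[ℝ] B₁}
    {J₂ : A₂ →L[ℝ] B₂} {pI₁ : A₂ →L[ℝ] A₁} {pJ₁ : B₁ →L[ℝ] A₁} (hI₁ : ∀ u, pI₁ (I₁ u) = u)
    (hJ₁ : ∀ u, pJ₁ (J₁ u) = u) (hcomm : ∀ u, J₂ (I₁ u) = I₂ (J₁ u))
    (hI₂ : Function.Injective I₂) (hclean : ∀ l m, J₂ l = I₂ m → ∃ a, I₁ a = l) :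
    ∃ Q : LinearSquare A₁ A₂ B₁ B₂, Q.I₁ = I₁ ∧ Q.I₂ = I₂ ∧ Q.J₁ = J₁ ∧ Q.J₂ = J₂ := by
  -- cleanness makes this embedding injective
  let κ : A₂ × LinearMap.ker (pJ₁ : B₁ →ₗ[ℝ] A₁) →L[ℝ] B₂ :=
    J₂.coprod (I₂.comp (LinearMap.ker (pJ₁ : B₁ →ₗ[ℝ] A₁)).subtypeL)
  have hκ : Function.Injective κ := by
    rw [injective_iff_map_eq_zero]
    rintro ⟨l, m, hm⟩ h
    have h1 : J₂ l + I₂ m = 0 := h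
    have h2 : J₂ l = I₂ (-m) := by rw [map_neg]; exact eq_neg_of_add_eq_zero_left h1
    obtain ⟨a, rfl⟩ := hclean l (-m) h2
    rw [hcomm] at h2
    have h3 := hI₂ h2
    have hm' : pJ₁ m = 0 := hm
    have ha : a = 0 := by rw [← hJ₁ a, h3, map_neg, hm', neg_zero]
    subst ha
    have hm0 : m = 0 := by simpa using h3.symm
    simp [hm0]
  obtain ⟨ρ, hρ⟩ := exists_continuous_leftInverse hκ
  let pJ₂ : B₂ →L[ℝ] A₂ := (ContinuousLinearMap.fst ℝ _ _).comp ρ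
  let r : B₂ →L[ℝ] B₁ := (LinearMap.ker (pJ₁ : B₁ →ₗ[ℝ] A₁)).subtypeL.comp
    ((ContinuousLinearMap.snd ℝ _ _).comp ρ)
  have hr : ∀ w, pJ₁ (r w) = 0 := fun w ↦ (ρ w).2.2
  have hJ : ∀ l, ρ (J₂ l) = (l, 0) := fun l ↦ by
    have := hρ (l, 0)
    simpa [κ] using this
  have hpJ : ∀ l, pJ₂ (J₂ l) = l := fun l ↦ by simp [pJ₂, hJ]
  have hrJ : ∀ l, r (J₂ l) = 0 := fun l ↦ by simp [r, hJ]
  have hm : ∀ m, pJ₁ (m - J₁ (pJ₁ m)) = 0 := fun m ↦ by rw [map_sub, hJ₁, sub_self]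
  have hI : ∀ m, ρ (I₂ (m - J₁ (pJ₁ m))) = (0, ⟨m - J₁ (pJ₁ m), hm m⟩) := fun m ↦ by
    have := hρ (0, ⟨m - J₁ (pJ₁ m), hm m⟩)
    simpa [κ] using this
  have hdec : ∀ m, I₂ m = I₂ (m - J₁ (pJ₁ m)) + J₂ (I₁ (pJ₁ m)) := fun m ↦ by
    rw [hcomm, ← map_add, sub_add_cancel]
  have hpI : ∀ m, pJ₂ (I₂ m) = I₁ (pJ₁ m) := fun m ↦ by
    rw [hdec, map_add, hpJ]
    simp only [pJ₂, ContinuousLinearMap.comp_apply, hI]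
    simp
  have hrI : ∀ m, r (I₂ m) = m - J₁ (pJ₁ m) := fun m ↦ by
    rw [hdec, map_add, hrJ, add_zero]
    simp only [r, ContinuousLinearMap.comp_apply, hI]
    simp
  refine ⟨⟨I₁, I₂, J₁, J₂, pI₁, r + J₁.comp (pI₁.comp pJ₂), pJ₁, pJ₂, hI₁, ?_, hJ₁, hpJ, hcomm, ?_,
    hpI, ?_⟩, rfl, rfl, rfl, rfl⟩
  · intro m
    simp [hrI, hpI, hI₁]
  · intro l
    simp [hrJ, hpJ]
  · intro w
    simp [hr, hJ₁]

end LinearSquare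

section LinearizedChart

variable {A₁ A₂ B₁ B₂ : Type*} [NormedAddCommGroup A₁] [NormedSpace ℝ A₁]
  [NormedAddCommGroup A₂] [NormedSpace ℝ A₂] [NormedAddCommGroup B₁] [NormedSpace ℝ B₁]
  [NormedAddCommGroup B₂] [NormedSpace ℝ B₂] {L₁ L₂ M₁ M₂ : Type*} [TopologicalSpace L₁]
  [ChartedSpace A₁ L₁] [TopologicalSpace L₂] [ChartedSpace A₂ L₂] [TopologicalSpace M₁]
  [ChartedSpace B₁ M₁] [TopologicalSpace M₂] [ChartedSpace B₂ M₂]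
  {i₁ : L₁ → L₂} {i₂ : M₁ → M₂} {j₁ : L₁ → M₁} {j₂ : L₂ → M₂}

omit [ChartedSpace A₁ L₁] in
/-- If `i₁` and `j₁` are linear in charts near `y`, there is a chart of `M₂` in which `i₂` and `j₂`
are linear. If `î`, `ĵ` are `i₂`, `j₂` in given charts, with derivatives `I₂`, `J₂`, the new chart
is obtained by composing with the inverse of the local diffeomorphism
`w ↦ ĵ (pJ₂ w) + î (pI₂ w) - ĵ (I₁ pI₁ pJ₂ w) + (1 - J₂ pJ₂) (1 - I₂ pI₂) w`, which restricts to
`ĵ` on the image of `J₂` and to `î` on the image of `I₂`. -/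
theorem LinearSquare.exists_chart [FiniteDimensional ℝ B₂] (Q : LinearSquare A₁ A₂ B₁ B₂)
    (hi₂ : ContMDiff 𝓘(ℝ, B₁) 𝓘(ℝ, B₂) ∞ i₂) (hj₂ : ContMDiff 𝓘(ℝ, A₂) 𝓘(ℝ, B₂) ∞ j₂)
    (hcomm : j₂ ∘ i₁ = i₂ ∘ j₁) {y : L₁} {ψ : OpenPartialHomeomorph L₁ A₁}
    {φL : OpenPartialHomeomorph L₂ A₂} {φM : OpenPartialHomeomorph M₁ B₁}
    {φ : OpenPartialHomeomorph M₂ B₂} (hφL : φL ∈ IsManifold.maximalAtlas 𝓘(ℝ, A₂) ∞ L₂)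
    (hφM : φM ∈ IsManifold.maximalAtlas 𝓘(ℝ, B₁) ∞ M₁)
    (hφ : φ ∈ IsManifold.maximalAtlas 𝓘(ℝ, B₂) ∞ M₂) (hy : y ∈ ψ.source)
    (hyL : i₁ y ∈ φL.source) (hyM : j₁ y ∈ φM.source) (hyφ : j₂ (i₁ y) ∈ φ.source)
    (hi₁c : ContinuousAt i₁ y) (hj₁c : ContinuousAt j₁ y)
    (hL : ∀ᶠ x in 𝓝 y, φL (i₁ x) = Q.I₁ (ψ x)) (hM : ∀ᶠ x in 𝓝 y, φM (j₁ x) = Q.J₁ (ψ x))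
    (hdj : fderiv ℝ (φ ∘ j₂ ∘ φL.symm) (φL (i₁ y)) = Q.J₂)
    (hdi : fderiv ℝ (φ ∘ i₂ ∘ φM.symm) (φM (j₁ y)) = Q.I₂) :
    ∃ φ' ∈ IsManifold.maximalAtlas 𝓘(ℝ, B₂) ∞ M₂, j₂ (i₁ y) ∈ φ'.source ∧
      (∀ᶠ x in 𝓝 (i₁ y), φ' (j₂ x) = Q.J₂ (φL x)) ∧
      ∀ᶠ x in 𝓝 (j₁ y), φ' (i₂ x) = Q.I₂ (φM x) := by
  have hyφ' : i₂ (j₁ y) ∈ φ.source := by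
    rw [← show j₂ (i₁ y) = i₂ (j₁ y) from congrFun hcomm y]
    exact hyφ
  set jh := φ ∘ j₂ ∘ φL.symm with hjh
  set ih := φ ∘ i₂ ∘ φM.symm with hih
  set U := chartDomain φL φ j₂ with hU
  set V := chartDomain φM φ i₂ with hV
  have hUo : IsOpen U := isOpen_chartDomain hj₂.continuous
  have hVo : IsOpen V := isOpen_chartDomain hi₂.continuous
  have hjs : ContDiffOn ℝ ∞ jh U := contDiffOn_chart hφL hφ hj₂
  have his : ContDiffOn ℝ ∞ ih V := contDiffOn_chart hφM hφ hi₂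
  have hyU : φL (i₁ y) ∈ U := mem_chartDomain hyL hyφ
  have hyV : φM (j₁ y) ∈ V := mem_chartDomain hyM hyφ'
  set a := Q.J₂ (φL (i₁ y)) with ha
  have hLy := hL.self_of_nhds
  have hMy := hM.self_of_nhds
  have ha₁ : Q.pJ₂ a = φL (i₁ y) := Q.pJ₂_J₂ _
  have ha₂ : Q.pI₂ a = φM (j₁ y) := by rw [ha, Q.pI₂_J₂, hLy, Q.pI₁_I₁, hMy]
  have ha₃ : Q.I₁ (Q.pI₁ (Q.pJ₂ a)) = φL (i₁ y) := by rw [ha₁, hLy, Q.pI₁_I₁]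
  let K : B₂ →L[ℝ] B₂ := (.id ℝ B₂ - Q.J₂.comp Q.pJ₂) ∘L (.id ℝ B₂ - Q.I₂.comp Q.pI₂)
  let η : B₂ → B₂ := fun w ↦
    jh (Q.pJ₂ w) + ih (Q.pI₂ w) - jh (Q.I₁ (Q.pI₁ (Q.pJ₂ w))) + K w
  let O : Set B₂ := Q.pJ₂ ⁻¹' U ∩ Q.pI₂ ⁻¹' V ∩ (Q.I₁.comp (Q.pI₁.comp Q.pJ₂)) ⁻¹' U
  have hO : IsOpen O := ((hUo.preimage Q.pJ₂.continuous).inter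
    (hVo.preimage Q.pI₂.continuous)).inter (hUo.preimage (ContinuousLinearMap.continuous _))
  have hη : ContDiffOn ℝ ∞ η O := by
    refine (((hjs.comp Q.pJ₂.contDiff.contDiffOn fun w hw ↦ hw.1.1).add
      (his.comp Q.pI₂.contDiff.contDiffOn fun w hw ↦ hw.1.2)).sub
      (hjs.comp (Q.I₁.comp (Q.pI₁.comp Q.pJ₂)).contDiff.contDiffOn fun w hw ↦ hw.2)).add
      K.contDiff.contDiffOn
  have haO : a ∈ O := by
    refine ⟨⟨?_, ?_⟩, ?_⟩
    · rw [mem_preimage, ha₁]; exact hyU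
    · rw [mem_preimage, ha₂]; exact hyV
    · change Q.I₁ (Q.pI₁ (Q.pJ₂ a)) ∈ U
      rw [ha₃]; exact hyU
  have hdj' : HasFDerivAt jh Q.J₂ (φL (i₁ y)) := by
    rw [← hdj]
    exact ((hjs.contDiffAt (hUo.mem_nhds hyU)).differentiableAt (by simp)).hasFDerivAt
  have hdi' : HasFDerivAt ih Q.I₂ (φM (j₁ y)) := by
    rw [← hdi]
    exact ((his.contDiffAt (hVo.mem_nhds hyV)).differentiableAt (by simp)).hasFDerivAt
  have hd : HasFDerivAt η (ContinuousLinearMap.id ℝ B₂) a := by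
    have h1 : HasFDerivAt (fun w ↦ jh (Q.pJ₂ w)) (Q.J₂.comp Q.pJ₂) a :=
      HasFDerivAt.comp a (by rwa [ha₁]) Q.pJ₂.hasFDerivAt
    have h2 : HasFDerivAt (fun w ↦ ih (Q.pI₂ w)) (Q.I₂.comp Q.pI₂) a :=
      HasFDerivAt.comp a (by rwa [ha₂]) Q.pI₂.hasFDerivAt
    have h3 : HasFDerivAt (fun w ↦ jh (Q.I₁ (Q.pI₁ (Q.pJ₂ w))))
        (Q.J₂.comp (Q.I₁.comp (Q.pI₁.comp Q.pJ₂))) a :=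
      HasFDerivAt.comp a (f := Q.I₁.comp (Q.pI₁.comp Q.pJ₂)) (g := jh)
        (by change HasFDerivAt jh Q.J₂ (Q.I₁ (Q.pI₁ (Q.pJ₂ a))); rwa [ha₃])
        (Q.I₁.comp (Q.pI₁.comp Q.pJ₂)).hasFDerivAt
    have h4 := ((h1.add h2).sub h3).add K.hasFDerivAt
    refine h4.congr_fderiv ?_
    ext w
    simp only [K, add_apply, sub_apply,
      ContinuousLinearMap.comp_apply, ContinuousLinearMap.id_apply, map_sub, Q.pJ₂_I₂, Q.pI₁_pJ₂]
    abel
  obtain ⟨θ, hθ, haθ, -, hθη⟩ := exists_contDiffGroupoid_of_hasFDerivAt_id hO hη haO hd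
  -- `î J₁ = ĵ I₁` near the point
  have hij : ∀ᶠ u in 𝓝 (ψ y), ih (Q.J₁ u) = jh (Q.I₁ u) := by
    have h1 : ∀ᶠ x in 𝓝 y, ih (Q.J₁ (ψ x)) = jh (Q.I₁ (ψ x)) := by
      filter_upwards [hL, hM, hi₁c.eventually (φL.open_source.mem_nhds hyL),
        hj₁c.eventually (φM.open_source.mem_nhds hyM)] with x hx hx' hxL hxM
      rw [← hx, ← hx']
      simp only [hjh, hih, Function.comp_apply, φL.left_inv hxL, φM.left_inv hxM]
      rw [show j₂ (i₁ x) = i₂ (j₁ x) from congrFun hcomm x]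
    have h2 := (ψ.continuousAt_symm (ψ.map_source hy)).tendsto
    rw [ψ.left_inv hy] at h2
    filter_upwards [h2.eventually h1, ψ.open_target.mem_nhds (ψ.map_source hy)] with u hu hu'
    rwa [ψ.right_inv hu'] at hu
  have hKJ : ∀ l, K (Q.J₂ l) = 0 := fun l ↦ by
    simp only [K, sub_apply,
      ContinuousLinearMap.comp_apply, ContinuousLinearMap.id_apply, map_sub, Q.pJ₂_J₂,
      Q.pI₂_J₂, ← Q.J₂_I₁, sub_self]
  have hKI : ∀ m, K (Q.I₂ m) = 0 := fun m ↦ by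
    simp only [K, sub_apply,
      ContinuousLinearMap.comp_apply, ContinuousLinearMap.id_apply, Q.pI₂_I₂, sub_self, map_zero]
  have hηJ : ∀ l, ih (Q.J₁ (Q.pI₁ l)) = jh (Q.I₁ (Q.pI₁ l)) → η (Q.J₂ l) = jh l := by
    intro l hl
    simp only [η, hKJ, Q.pJ₂_J₂, Q.pI₂_J₂, hl]
    abel
  have hηI : ∀ m, η (Q.I₂ m) = ih m := by
    intro m
    simp only [η, hKI, Q.pJ₂_I₂, Q.pI₂_I₂, Q.pI₁_I₁]
    abel
  have hηa : η a = φ (j₂ (i₁ y)) := by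
    rw [ha, hηJ]
    · simp [hjh, φL.left_inv hyL]
    · rw [hLy, Q.pI₁_I₁]
      exact hij.self_of_nhds
  refine ⟨φ.trans θ.symm, trans_mem_maximalAtlas hφ (StructureGroupoid.symm _ hθ), ?_, ?_, ?_⟩
  · rw [OpenPartialHomeomorph.trans_source]
    refine ⟨hyφ, ?_⟩
    rw [mem_preimage, ← hηa, ← hθη]
    exact θ.map_source haθ
  · have c1 : ContinuousAt φL (i₁ y) := φL.continuousAt hyL
    have c2 : Tendsto (fun x ↦ Q.pI₁ (φL x)) (𝓝 (i₁ y)) (𝓝 (ψ y)) := by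
      have : Q.pI₁ (φL (i₁ y)) = ψ y := by rw [hLy, Q.pI₁_I₁]
      rw [← this]
      exact Q.pI₁.continuous.continuousAt.comp c1
    have c3 : ContinuousAt (fun x ↦ Q.J₂ (φL x)) (i₁ y) := Q.J₂.continuous.continuousAt.comp c1
    filter_upwards [c2.eventually hij, c3.eventually (θ.open_source.mem_nhds haθ),
      φL.open_source.mem_nhds hyL] with x hx hx' hxL
    have h1 : θ (Q.J₂ (φL x)) = φ (j₂ x) := by
      rw [hθη, hηJ _ hx]
      simp [hjh, φL.left_inv hxL]
    change θ.symm (φ (j₂ x)) = _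
    rw [← h1, θ.left_inv hx']
  · have c1 : ContinuousAt φM (j₁ y) := φM.continuousAt hyM
    have c3 : ContinuousAt (fun x ↦ Q.I₂ (φM x)) (j₁ y) := Q.I₂.continuous.continuousAt.comp c1
    have haI : a = Q.I₂ (φM (j₁ y)) := by rw [ha, hLy, hMy, Q.J₂_I₁]
    have haθ' : Q.I₂ (φM (j₁ y)) ∈ θ.source := haI ▸ haθ
    filter_upwards [c3.eventually (θ.open_source.mem_nhds haθ'),
      φM.open_source.mem_nhds hyM] with x hx' hxM
    have h1 : θ (Q.I₂ (φM x)) = φ (i₂ x) := by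
      rw [hθη, hηI]
      simp [hih, φM.left_inv hxM]
    change θ.symm (φ (i₂ x)) = _
    rw [← h1, θ.left_inv hx']

end LinearizedChart

/-! ### Clean squares of immersions -/

section CleanSquare

variable {E E' X X' : Type*} [NormedAddCommGroup E] [NormedSpace ℝ E] [NormedAddCommGroup E']
  [NormedSpace ℝ E'] [TopologicalSpace X] [ChartedSpace E X] [TopologicalSpace X']
  [ChartedSpace E' X'] {f : X → X'}

theorem fderiv_chart_injective (hf : Manifold.IsImmersion 𝓘(ℝ, E) 𝓘(ℝ, E') ∞ f)
    {φ : OpenPartialHomeomorph X E} (hφ : φ ∈ IsManifold.maximalAtlas 𝓘(ℝ, E) ∞ X)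
    {φ' : OpenPartialHomeomorph X' E'} (hφ' : φ' ∈ IsManifold.maximalAtlas 𝓘(ℝ, E') ∞ X')
    {x : X} (hx : x ∈ φ.source) (hx' : f x ∈ φ'.source) :
    Function.Injective (fderiv ℝ (φ' ∘ f ∘ φ.symm) (φ x)) := by
  rw [injective_iff_map_eq_zero]
  intro u hu
  obtain ⟨v, rfl⟩ := ((mdifferentiable_of_mem_maximalAtlas hφ).mfderiv_bijective hx).2 u
  have h1 := (fderiv_chart hφ hφ' hf.contMDiff hx hx' v).symm.trans hu
  have h2 := ((mdifferentiable_of_mem_maximalAtlas hφ').mfderiv_bijective hx').1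
    (h1.trans (map_zero _).symm)
  have h3 := mfderiv_injective_of_isImmersion hf x (h2.trans (map_zero _).symm)
  rw [h3]
  exact map_zero _

theorem hasFDerivAt_chart {φ : OpenPartialHomeomorph X E}
    (hφ : φ ∈ IsManifold.maximalAtlas 𝓘(ℝ, E) ∞ X) {φ' : OpenPartialHomeomorph X' E'}
    (hφ' : φ' ∈ IsManifold.maximalAtlas 𝓘(ℝ, E') ∞ X') (hf : ContMDiff 𝓘(ℝ, E) 𝓘(ℝ, E') ∞ f)
    {x : X} (hx : x ∈ φ.source) (hx' : f x ∈ φ'.source) :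
    HasFDerivAt (φ' ∘ f ∘ φ.symm) (fderiv ℝ (φ' ∘ f ∘ φ.symm) (φ x)) (φ x) :=
  (((contDiffOn_chart hφ hφ' hf).contDiffAt ((isOpen_chartDomain hf.continuous).mem_nhds
    (mem_chartDomain hx hx'))).differentiableAt (by simp)).hasFDerivAt

variable {A₁ A₂ B₁ B₂ : Type*} [NormedAddCommGroup A₁] [NormedSpace ℝ A₁]
  [NormedAddCommGroup A₂] [NormedSpace ℝ A₂] [NormedAddCommGroup B₁] [NormedSpace ℝ B₁]
  [NormedAddCommGroup B₂] [NormedSpace ℝ B₂] {L₁ L₂ M₁ M₂ : Type*} [TopologicalSpace L₁]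
  [ChartedSpace A₁ L₁] [TopologicalSpace L₂] [ChartedSpace A₂ L₂] [TopologicalSpace M₁]
  [ChartedSpace B₁ M₁] [TopologicalSpace M₂] [ChartedSpace B₂ M₂]

/-- The commutative square of immersions is clean at `y`: the intersection of the images of the
tangent spaces of `L₂` and `M₁` in the tangent space of `M₂` is the image of the tangent space of
`L₁`. -/
def IsCleanAt (A₁ A₂ B₁ B₂ : Type*) [NormedAddCommGroup A₁] [NormedSpace ℝ A₁]
    [NormedAddCommGroup A₂] [NormedSpace ℝ A₂] [NormedAddCommGroup B₁] [NormedSpace ℝ B₁]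
    [NormedAddCommGroup B₂] [NormedSpace ℝ B₂] {L₁ L₂ M₁ M₂ : Type*} [TopologicalSpace L₁]
    [ChartedSpace A₁ L₁] [TopologicalSpace L₂] [ChartedSpace A₂ L₂] [TopologicalSpace M₁]
    [ChartedSpace B₁ M₁] [TopologicalSpace M₂] [ChartedSpace B₂ M₂] (i₁ : L₁ → L₂) (i₂ : M₁ → M₂)
    (j₁ : L₁ → M₁) (j₂ : L₂ → M₂) (y : L₁) : Prop :=
  ∀ (l : A₂) (m : B₁), (mfderiv 𝓘(ℝ, A₂) 𝓘(ℝ, B₂) j₂ (i₁ y) l : B₂) =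
    mfderiv 𝓘(ℝ, B₁) 𝓘(ℝ, B₂) i₂ (j₁ y) m → ∃ a : A₁, (mfderiv 𝓘(ℝ, A₁) 𝓘(ℝ, A₂) i₁ y a : A₂) = l

variable {i₁ : L₁ → L₂} {i₂ : M₁ → M₂} {j₁ : L₁ → M₁} {j₂ : L₂ → M₂}

/-- If `N(j₂, j₁)` is an immersion, the square is clean: for `dj₂(l) = di₂(m)`, the normal vectors
`[s l]` are mapped to zero for all `s`, so that `[s l] = 0` for small `s`, since immersions are
locally injective. -/
theorem isCleanAt_of_isImmersion_map [FiniteDimensional ℝ A₂] [FiniteDimensional ℝ B₂]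
    {hi₁ : Manifold.IsImmersion 𝓘(ℝ, A₁) 𝓘(ℝ, A₂) ∞ i₁}
    {hi₂ : Manifold.IsImmersion 𝓘(ℝ, B₁) 𝓘(ℝ, B₂) ∞ i₂}
    (hj₁ : ContMDiff 𝓘(ℝ, A₁) 𝓘(ℝ, B₁) ∞ j₁) (hj₂ : ContMDiff 𝓘(ℝ, A₂) 𝓘(ℝ, B₂) ∞ j₂)
    (hcomm : j₂ ∘ i₁ = i₂ ∘ j₁)
    (hN : Manifold.IsImmersion 𝓘(ℝ, A₂) 𝓘(ℝ, B₂) ∞ (NormalBundle.map hi₁ hi₂ j₂ j₁)) (y : L₁) :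
    IsCleanAt A₁ A₂ B₁ B₂ i₁ i₂ j₁ j₂ y := by
  intro l m hlm
  obtain ⟨T, hT, e, -, e', -, h0, -, hlin⟩ := exists_hasLinearCharts_of_isImmersion hN
    (NormalBundle.mk hi₁ y (0 : A₂))
  have hinj : ∀ ξ ∈ e.source, ∀ η ∈ e.source,
      NormalBundle.map hi₁ hi₂ j₂ j₁ ξ = NormalBundle.map hi₁ hi₂ j₂ j₁ η → ξ = η := by
    intro ξ hξ η hη h
    refine e.injOn hξ hη (hT ?_)
    rw [← hlin ξ hξ, ← hlin η hη, h]
  obtain ⟨σ, hσ⟩ := exists_slice hi₁ y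
  -- the curve `s ↦ [s l]`
  let c : ℝ → NormalBundle hi₁ := fun s ↦ NormalBundle.mk hi₁ y (s • l : A₂)
  have hc : ContinuousAt c 0 := by
    have h1 : ∀ s, c s = (σ.normalHomeo hi₁).symm (σ.L (σ.ψ y) + s • σ.q (σ.dφ (i₁ y) l : A₂)) := by
      intro s
      have h2 : σ.normalHomeo hi₁ (c s) = σ.L (σ.ψ y) + s • σ.q (σ.dφ (i₁ y) l : A₂) := by
        refine (σ.normalHomeo_mk (hj := hi₁) hσ (s • l : A₂)).trans ?_
        have h3 : (σ.dφ (i₁ y) (s • l : A₂) : A₂) = s • (σ.dφ (i₁ y) l : A₂) := map_smul _ s l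
        exact (congrArg (fun e : A₂ ↦ σ.L (σ.ψ y) + σ.q e) h3).trans
          (congrArg (σ.L (σ.ψ y) + ·) (map_smul σ.q s _))
      rw [← h2, (σ.normalHomeo hi₁).left_inv (show c s ∈ (σ.normalHomeo hi₁).source from hσ)]
    have h2 : c 0 ∈ (σ.normalHomeo hi₁).source := hσ
    have h3 : σ.L (σ.ψ y) + (0 : ℝ) • σ.q (σ.dφ (i₁ y) l : A₂) ∈ (σ.normalHomeo hi₁).target := by
      rw [σ.mem_normalHomeo_target, zero_smul, add_zero, σ.p_L]
      exact σ.ψ.map_source hσ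
    rw [show c = fun s ↦ _ from funext h1]
    exact ContinuousAt.comp (g := (σ.normalHomeo hi₁).symm)
      (f := fun s : ℝ ↦ σ.L (σ.ψ y) + s • σ.q (σ.dφ (i₁ y) l : A₂))
      ((σ.normalHomeo hi₁).continuousAt_symm h3) (by fun_prop)
  have hc0 : c 0 = NormalBundle.mk hi₁ y (0 : A₂) :=
    congrArg (fun e : A₂ ↦ NormalBundle.mk hi₁ y e) (zero_smul ℝ l)
  have hev : ∀ᶠ s in 𝓝[≠] (0 : ℝ), c s ∈ e.source :=
    nhdsWithin_le_nhds (hc.eventually (e.open_source.mem_nhds (hc0 ▸ h0)))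
  obtain ⟨s, hs, hs0⟩ := (hev.and self_mem_nhdsWithin).exists
  have hzero : ∀ s : ℝ, NormalBundle.map hi₁ hi₂ j₂ j₁ (c s) =
      NormalBundle.mk hi₂ (j₁ y) (0 : B₂) := by
    intro s
    refine (NormalBundle.map_mk hi₁ hi₂ hj₂ hj₁ hcomm y _).trans ?_
    refine NormalBundle.mk_eq_mk.2 ⟨(s • m : B₁), ?_⟩
    have h1 : (mfderiv 𝓘(ℝ, B₁) 𝓘(ℝ, B₂) i₂ (j₁ y) (s • m : B₁) : B₂) =
      s • (mfderiv 𝓘(ℝ, B₁) 𝓘(ℝ, B₂) i₂ (j₁ y) m : B₂) := map_smul _ s m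
    have h2 : (mfderiv 𝓘(ℝ, A₂) 𝓘(ℝ, B₂) j₂ (i₁ y) (s • l : A₂) : B₂) =
      s • (mfderiv 𝓘(ℝ, A₂) 𝓘(ℝ, B₂) j₂ (i₁ y) l : B₂) := map_smul _ s l
    refine h1.trans ((congrArg (s • ·) hlm.symm).trans (h2.symm.trans ?_))
    exact (sub_zero (G := B₂) _).symm
  have heq := hinj _ hs _ h0 ((hzero s).trans (hc0 ▸ hzero 0).symm)
  obtain ⟨a, ha⟩ := NormalBundle.mk_eq_mk.1 heq
  refine ⟨s⁻¹ • a, ?_⟩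
  have h1 : (mfderiv 𝓘(ℝ, A₁) 𝓘(ℝ, A₂) i₁ y a : A₂) = s • l := ha.trans (sub_zero (G := A₂) _)
  refine (map_smul (mfderiv 𝓘(ℝ, A₁) 𝓘(ℝ, A₂) i₁ y) s⁻¹ a).trans ?_
  exact (congrArg (fun e : A₂ ↦ s⁻¹ • e) h1).trans (inv_smul_smul₀ hs0 l)

/-- Charts of the four manifolds of a commutative square of immersions, in which the square is
linear. -/
structure SquareChart (A₁ A₂ B₁ B₂ : Type*) [NormedAddCommGroup A₁] [NormedSpace ℝ A₁]
    [NormedAddCommGroup A₂] [NormedSpace ℝ A₂] [NormedAddCommGroup B₁] [NormedSpace ℝ B₁]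
    [NormedAddCommGroup B₂] [NormedSpace ℝ B₂] {L₁ L₂ M₁ M₂ : Type*} [TopologicalSpace L₁]
    [ChartedSpace A₁ L₁] [TopologicalSpace L₂] [ChartedSpace A₂ L₂] [TopologicalSpace M₁]
    [ChartedSpace B₁ M₁] [TopologicalSpace M₂] [ChartedSpace B₂ M₂] (i₁ : L₁ → L₂) (i₂ : M₁ → M₂)
    (j₁ : L₁ → M₁) (j₂ : L₂ → M₂) extends LinearSquare A₁ A₂ B₁ B₂ where
  ψ : OpenPartialHomeomorph L₁ A₁
  φL : OpenPartialHomeomorph L₂ A₂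
  φM : OpenPartialHomeomorph M₁ B₁
  φ : OpenPartialHomeomorph M₂ B₂
  ψ_mem : ψ ∈ IsManifold.maximalAtlas 𝓘(ℝ, A₁) ∞ L₁
  φL_mem : φL ∈ IsManifold.maximalAtlas 𝓘(ℝ, A₂) ∞ L₂
  φM_mem : φM ∈ IsManifold.maximalAtlas 𝓘(ℝ, B₁) ∞ M₁
  φ_mem : φ ∈ IsManifold.maximalAtlas 𝓘(ℝ, B₂) ∞ M₂
  maps_i₁ : ∀ y ∈ ψ.source, i₁ y ∈ φL.source
  maps_j₁ : ∀ y ∈ ψ.source, j₁ y ∈ φM.source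
  maps_i₂ : ∀ x ∈ φM.source, i₂ x ∈ φ.source
  maps_j₂ : ∀ x ∈ φL.source, j₂ x ∈ φ.source
  φL_i₁ : ∀ y ∈ ψ.source, φL (i₁ y) = I₁ (ψ y)
  φM_j₁ : ∀ y ∈ ψ.source, φM (j₁ y) = J₁ (ψ y)
  φ_i₂ : ∀ x ∈ φM.source, φ (i₂ x) = I₂ (φM x)
  φ_j₂ : ∀ x ∈ φL.source, φ (j₂ x) = J₂ (φL x)

/-- A clean square of immersions is linear in suitable charts. -/
theorem exists_squareChart [FiniteDimensional ℝ A₁] [FiniteDimensional ℝ A₂]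
    [FiniteDimensional ℝ B₁] [FiniteDimensional ℝ B₂]
    (hi₁ : Manifold.IsImmersion 𝓘(ℝ, A₁) 𝓘(ℝ, A₂) ∞ i₁)
    (hi₂ : Manifold.IsImmersion 𝓘(ℝ, B₁) 𝓘(ℝ, B₂) ∞ i₂)
    (hj₁ : Manifold.IsImmersion 𝓘(ℝ, A₁) 𝓘(ℝ, B₁) ∞ j₁)
    (hj₂ : Manifold.IsImmersion 𝓘(ℝ, A₂) 𝓘(ℝ, B₂) ∞ j₂) (hcomm : j₂ ∘ i₁ = i₂ ∘ j₁) {y : L₁}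
    (hy : IsCleanAt A₁ A₂ B₁ B₂ i₁ i₂ j₁ j₂ y) :
    ∃ κ : SquareChart A₁ A₂ B₁ B₂ i₁ i₂ j₁ j₂, y ∈ κ.ψ.source := by
  obtain ⟨σ, hσ⟩ := exists_slice hi₁ y
  obtain ⟨σM, hσM⟩ := exists_slice hj₁ y
  obtain ⟨σ₂, hσ₂⟩ := exists_slice hj₂ (i₁ y)
  have hij : j₂ (i₁ y) = i₂ (j₁ y) := congrFun hcomm y
  have hyL : i₁ y ∈ σ.φ.source := σ.maps y hσ
  have hyφ : j₂ (i₁ y) ∈ σ₂.φ.source := σ₂.maps _ hσ₂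
  have hyφ' : i₂ (j₁ y) ∈ σ₂.φ.source := hij ▸ hyφ
  have hL : ∀ᶠ x in 𝓝 y, σ.φ (i₁ x) = σ.L (σ.ψ x) := by
    filter_upwards [σ.ψ.open_source.mem_nhds hσ] with x hx using σ.φ_j x hx
  -- a chart of `M₁` in which `j₁` is linear and which belongs to the same chart of `L₁` as `σ`: a
  -- slice chart of `j₁` alone may require another one
  obtain ⟨pJ, hpJ⟩ := exists_continuous_leftInverse
    (fderiv_chart_injective hj₁ σ.ψ_mem σM.φ_mem hσ (σM.maps y hσM))
  set J := fderiv ℝ (σM.φ ∘ j₁ ∘ σ.ψ.symm) (σ.ψ y) with hJ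
  obtain ⟨φM, hφM, hyM, hM, -⟩ := (LinearSquare.ofEmbedding J pJ hpJ).exists_chart
    (i₁ := id) (j₁ := id) (ψ := σ.ψ) hj₁.contMDiff hj₁.contMDiff rfl σ.ψ_mem σ.ψ_mem σM.φ_mem hσ
    hσ hσ (σM.maps y hσM) continuousAt_id continuousAt_id (Eventually.of_forall fun _ ↦ rfl)
    (Eventually.of_forall fun _ ↦ rfl) rfl rfl
  replace hyM : j₁ y ∈ φM.source := hyM
  replace hM : ∀ᶠ x in 𝓝 y, φM (j₁ x) = J (σ.ψ x) := hM
  -- the derivatives of `i₂` and `j₂` in charts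
  set I₂ := fderiv ℝ (σ₂.φ ∘ i₂ ∘ φM.symm) (φM (j₁ y)) with hI₂
  set J₂ := fderiv ℝ (σ₂.φ ∘ j₂ ∘ σ.φ.symm) (σ.φ (i₁ y)) with hJ₂
  have hdI₂ : HasFDerivAt (σ₂.φ ∘ i₂ ∘ φM.symm) I₂ (φM (j₁ y)) :=
    hasFDerivAt_chart hφM σ₂.φ_mem hi₂.contMDiff hyM hyφ'
  have hdJ₂ : HasFDerivAt (σ₂.φ ∘ j₂ ∘ σ.φ.symm) J₂ (σ.φ (i₁ y)) :=
    hasFDerivAt_chart σ.φ_mem σ₂.φ_mem hj₂.contMDiff hyL hyφ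
  have hc₁ : ∀ u, J₂ (σ.L u) = I₂ (J u) := by
    rw [hL.self_of_nhds] at hdJ₂
    rw [hM.self_of_nhds] at hdI₂
    have h1 := HasFDerivAt.comp (σ.ψ y) hdJ₂ σ.L.hasFDerivAt
    have h2 := HasFDerivAt.comp (σ.ψ y) hdI₂ J.hasFDerivAt
    have h3 : (σ₂.φ ∘ j₂ ∘ σ.φ.symm) ∘ σ.L =ᶠ[𝓝 (σ.ψ y)] (σ₂.φ ∘ i₂ ∘ φM.symm) ∘ J := by
      have h4 := (σ.ψ.continuousAt_symm (σ.ψ.map_source hσ)).tendsto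
      rw [σ.ψ.left_inv hσ] at h4
      filter_upwards [h4.eventually hM,
        h4.eventually (hj₁.contMDiff.continuous.continuousAt.eventually
          (φM.open_source.mem_nhds hyM)),
        σ.ψ.open_target.mem_nhds (σ.ψ.map_source hσ)] with u h h' hu
      rw [σ.ψ.right_inv hu] at h
      simp only [Function.comp_apply, σ.φ_symm_L' hu, ← h, φM.left_inv h']
      rw [show j₂ (i₁ (σ.ψ.symm u)) = i₂ (j₁ (σ.ψ.symm u)) from congrFun hcomm _]
    exact fun u ↦ DFunLike.congr_fun ((h1.congr_of_eventuallyEq h3.symm).unique h2) u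
  have hclean : ∀ l m, J₂ l = I₂ m → ∃ a, σ.L a = l := by
    intro l m hlm
    obtain ⟨v, rfl⟩ := (σ.dφ_bij hyL).2 l
    obtain ⟨w, rfl⟩ := ((mdifferentiable_of_mem_maximalAtlas hφM).mfderiv_bijective hyM).2 m
    have h1 := (fderiv_chart σ.φ_mem σ₂.φ_mem hj₂.contMDiff hyL hyφ v).symm.trans
      (hlm.trans (fderiv_chart hφM σ₂.φ_mem hi₂.contMDiff hyM hyφ' w))
    have h2 := h1.trans (mfderiv_congr_point' (E := B₂) (E' := B₂) (f := σ₂.φ) hij.symm _)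
    obtain ⟨a, ha⟩ := hy v w ((σ₂.dφ_bij hyφ).1 h2)
    refine ⟨mfderiv 𝓘(ℝ, A₁) 𝓘(ℝ, A₁) σ.ψ y a, (σ.dφ_dj hi₁ hσ a).symm.trans ?_⟩
    exact congrArg (fun e : A₂ ↦ (σ.dφ (i₁ y) e : A₂)) ha
  obtain ⟨Q, hQI₁, hQI₂, hQJ₁, hQJ₂⟩ := LinearSquare.exists_of_clean σ.p_L hpJ hc₁
    (fderiv_chart_injective hi₂ hφM σ₂.φ_mem hyM hyφ') hclean
  obtain ⟨φ, hφ, hyφ, hφj, hφi⟩ := Q.exists_chart hi₂.contMDiff hj₂.contMDiff hcomm σ.φ_mem hφM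
    σ₂.φ_mem hσ hyL hyM hyφ hi₁.contMDiff.continuous.continuousAt
    hj₁.contMDiff.continuous.continuousAt (by rwa [hQI₁]) (by rwa [hQJ₁]) hQJ₂.symm hQI₂.symm
  -- the domains are shrunk so that all identities hold
  obtain ⟨U, hU, hUo, hyU⟩ := mem_nhds_iff.1 (hφj.and
    (hj₂.contMDiff.continuous.continuousAt.eventually (φ.open_source.mem_nhds hyφ)))
  obtain ⟨V, hV, hVo, hyV⟩ := mem_nhds_iff.1 (hφi.and
    (hi₂.contMDiff.continuous.continuousAt.eventually (φ.open_source.mem_nhds (hij ▸ hyφ))))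
  obtain ⟨W, hW, hWo, hyW⟩ := mem_nhds_iff.1 (hM.and
    ((hi₁.contMDiff.continuous.continuousAt.eventually (hUo.mem_nhds hyU)).and
    (hj₁.contMDiff.continuous.continuousAt.eventually ((φM.open_source.inter hVo).mem_nhds
      ⟨hyM, hyV⟩))))
  refine ⟨⟨Q, σ.ψ.restrOpen W hWo, σ.φ.restrOpen U hUo, φM.restrOpen V hVo, φ,
    restrOpen_mem_maximalAtlas σ.ψ_mem hWo, restrOpen_mem_maximalAtlas σ.φ_mem hUo,
    restrOpen_mem_maximalAtlas hφM hVo, hφ, ?_, ?_, ?_, ?_, ?_, ?_, ?_, ?_⟩, ⟨hσ, hyW⟩⟩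
  · exact fun x hx ↦ ⟨σ.maps x hx.1, (hW hx.2).2.1⟩
  · exact fun x hx ↦ (hW hx.2).2.2
  · exact fun x hx ↦ (hV hx.2).2
  · exact fun x hx ↦ (hU hx.2).2
  · exact fun x hx ↦ hQI₁ ▸ σ.φ_j x hx.1
  · exact fun x hx ↦ hQJ₁ ▸ (hW hx.2).1
  · exact fun x hx ↦ (hV hx.2).1
  · exact fun x hx ↦ (hU hx.2).1

end CleanSquare

/-! ### Charts of `N(D(j₂, j₁))` and of `D(N(i₂, i₁))` -/

section SquareSlices

variable {A₁ A₂ B₁ B₂ : Type*} [NormedAddCommGroup A₁] [NormedSpace ℝ A₁]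
  [NormedAddCommGroup A₂] [NormedSpace ℝ A₂] [NormedAddCommGroup B₁] [NormedSpace ℝ B₁]
  [NormedAddCommGroup B₂] [NormedSpace ℝ B₂] {L₁ L₂ M₁ M₂ : Type*} [TopologicalSpace L₁]
  [ChartedSpace A₁ L₁] [TopologicalSpace L₂] [ChartedSpace A₂ L₂] [TopologicalSpace M₁]
  [ChartedSpace B₁ M₁] [TopologicalSpace M₂] [ChartedSpace B₂ M₂]
  {i₁ : L₁ → L₂} {i₂ : M₁ → M₂} {j₁ : L₁ → M₁} {j₂ : L₂ → M₂}

theorem LinearSquare.J₂_injective (Q : LinearSquare A₁ A₂ B₁ B₂) : Function.Injective Q.J₂ :=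
  Function.LeftInverse.injective Q.pJ₂_J₂

theorem LinearSquare.I₂_injective (Q : LinearSquare A₁ A₂ B₁ B₂) : Function.Injective Q.I₂ :=
  Function.LeftInverse.injective Q.pI₂_I₂

namespace SquareChart

variable (κ : SquareChart A₁ A₂ B₁ B₂ i₁ i₂ j₁ j₂)

/-- The slice chart of `i₁` contained in the charts of the square. -/
@[simps]
def sliceI₁ : Slice A₁ A₂ i₁ where
  φ := κ.φL
  ψ := κ.ψ
  L := κ.I₁
  p := κ.pI₁
  φ_mem := κ.φL_mem
  ψ_mem := κ.ψ_mem
  p_L := κ.pI₁_I₁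
  maps := κ.maps_i₁
  φ_j := κ.φL_i₁

/-- The slice chart of `i₂` contained in the charts of the square. -/
@[simps]
def sliceI₂ : Slice B₁ B₂ i₂ where
  φ := κ.φ
  ψ := κ.φM
  L := κ.I₂
  p := κ.pI₂
  φ_mem := κ.φ_mem
  ψ_mem := κ.φM_mem
  p_L := κ.pI₂_I₂
  maps := κ.maps_i₂
  φ_j := κ.φ_i₂

/-- The slice chart of `j₁` contained in the charts of the square. -/
@[simps]
def sliceJ₁ : Slice A₁ B₁ j₁ where
  φ := κ.φM
  ψ := κ.ψ
  L := κ.J₁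
  p := κ.pJ₁
  φ_mem := κ.φM_mem
  ψ_mem := κ.ψ_mem
  p_L := κ.pJ₁_J₁
  maps := κ.maps_j₁
  φ_j := κ.φM_j₁

/-- The slice chart of `j₂` contained in the charts of the square. -/
@[simps]
def sliceJ₂ : Slice A₂ B₂ j₂ where
  φ := κ.φ
  ψ := κ.φL
  L := κ.J₂
  p := κ.pJ₂
  φ_mem := κ.φ_mem
  ψ_mem := κ.φL_mem
  p_L := κ.pJ₂_J₂
  maps := κ.maps_j₂
  φ_j := κ.φ_j₂

/-- The morphism `(j₂, j₁)` from `i₁` to `i₂` is linear in the charts of the square. -/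
theorem isLinear_J₂ : κ.sliceI₁.IsLinear κ.sliceI₂ j₂ j₁ κ.J₂ where
  maps := κ.maps_j₂
  maps₀ := κ.maps_j₁
  φ_f := κ.φ_j₂
  T_L_p w := by
    simp only [sliceI₁_L, sliceI₁_p, sliceI₂_L, sliceI₂_p]
    rw [κ.J₂_I₁, κ.pI₂_J₂]

/-- The morphism `(i₂, i₁)` from `j₁` to `j₂` is linear in the charts of the square. -/
theorem isLinear_I₂ : κ.sliceJ₁.IsLinear κ.sliceJ₂ i₂ i₁ κ.I₂ where
  maps := κ.maps_i₂
  maps₀ := κ.maps_i₁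
  φ_f := κ.φ_i₂
  T_L_p w := by
    simp only [sliceJ₁_L, sliceJ₁_p, sliceJ₂_L, sliceJ₂_p]
    rw [← κ.J₂_I₁, κ.pJ₂_I₂]

theorem pJ₂_δ (t : ℝ) (w : B₂) : κ.pJ₂ (κ.sliceI₂.δ t w) = κ.sliceI₁.δ t (κ.pJ₂ w) := by
  simp only [Slice.δ, Slice.q_apply, sliceI₁_L, sliceI₁_p, sliceI₂_L, sliceI₂_p, map_add, map_smul,
    map_sub, κ.pJ₂_I₂, κ.pI₁_pJ₂]

theorem δ_J₂ (t : ℝ) (l : A₂) : κ.sliceI₂.δ t (κ.J₂ l) = κ.J₂ (κ.sliceI₁.δ t l) :=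
  (κ.isLinear_J₂.T_δ t l).symm

end SquareChart

variable [FiniteDimensional ℝ A₂] [FiniteDimensional ℝ B₁] [FiniteDimensional ℝ B₂]
  {hi₁ : Manifold.IsImmersion 𝓘(ℝ, A₁) 𝓘(ℝ, A₂) ∞ i₁}
  {hi₂ : Manifold.IsImmersion 𝓘(ℝ, B₁) 𝓘(ℝ, B₂) ∞ i₂}
  {hj₁ : Manifold.IsImmersion 𝓘(ℝ, A₁) 𝓘(ℝ, B₁) ∞ j₁}
  {hj₂ : Manifold.IsImmersion 𝓘(ℝ, A₂) 𝓘(ℝ, B₂) ∞ j₂}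

/-- In charts in which the square is linear, `N(i₂, i₁)` is the linear embedding `I₂`. -/
theorem NormalBundle.isImmersion_map [FiniteDimensional ℝ A₁]
    (hi₁ : Manifold.IsImmersion 𝓘(ℝ, A₁) 𝓘(ℝ, A₂) ∞ i₁)
    (hi₂ : Manifold.IsImmersion 𝓘(ℝ, B₁) 𝓘(ℝ, B₂) ∞ i₂) (hcomm : j₂ ∘ i₁ = i₂ ∘ j₁)
    (hclean : ∀ y, IsCleanAt A₁ A₂ B₁ B₂ i₁ i₂ j₁ j₂ y) :
    Manifold.IsImmersion 𝓘(ℝ, B₁) 𝓘(ℝ, B₂) ∞ (NormalBundle.map hj₁ hj₂ i₂ i₁) := by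
  refine isImmersion_of_hasLinearCharts fun ξ ↦ ?_
  obtain ⟨κ, hκ⟩ := exists_squareChart hi₁ hi₂ hj₁ hj₂ hcomm (hclean ξ.proj)
  exact ⟨κ.I₂, κ.I₂_injective,
    κ.isLinear_I₂.hasLinearCharts_normal hi₂.contMDiff hi₁.contMDiff hcomm.symm hκ⟩

variable [IsManifold 𝓘(ℝ, A₂) ∞ L₂] [IsManifold 𝓘(ℝ, B₂) ∞ M₂]

/-- In charts in which the square is linear, `D(j₂, j₁)` is the linear embedding `J₂ × id`. -/
theorem DNC.isImmersion_map [FiniteDimensional ℝ A₁]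
    (hj₁ : Manifold.IsImmersion 𝓘(ℝ, A₁) 𝓘(ℝ, B₁) ∞ j₁)
    (hj₂ : Manifold.IsImmersion 𝓘(ℝ, A₂) 𝓘(ℝ, B₂) ∞ j₂) (hcomm : j₂ ∘ i₁ = i₂ ∘ j₁)
    (hclean : ∀ y, IsCleanAt A₁ A₂ B₁ B₂ i₁ i₂ j₁ j₂ y) :
    Manifold.IsImmersion 𝓘(ℝ, A₂ × ℝ) 𝓘(ℝ, B₂ × ℝ) ∞ (DNC.map hi₁ hi₂ j₂ j₁) := by
  refine isImmersion_of_hasLinearCharts ?_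
  have hprod : ∀ {T : A₂ →L[ℝ] B₂}, Function.Injective T →
      Function.Injective (T.prodMap (ContinuousLinearMap.id ℝ ℝ)) :=
    fun hT ↦ Function.Injective.prodMap hT Function.injective_id
  rintro (ξ | ⟨x, t, ht⟩)
  · obtain ⟨κ, hκ⟩ := exists_squareChart hi₁ hi₂ hj₁ hj₂ hcomm (hclean ξ.proj)
    exact ⟨_, hprod κ.J₂_injective,
      κ.isLinear_J₂.hasLinearCharts_dnc hj₂.contMDiff hj₁.contMDiff hcomm hκ⟩
  · obtain ⟨T, hT, h⟩ := exists_hasLinearCharts_of_isImmersion hj₂ x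
    exact ⟨_, hprod hT, h.off ht⟩

/-- The commutativity `j₂ ∘ i₁ = i₂ ∘ j₁` of a square of immersions; the proofs that the maps are
immersions are recorded so that they can be inferred. -/
@[nolint unusedArguments]
def ImmersionSquare (_hi₁ : Manifold.IsImmersion 𝓘(ℝ, A₁) 𝓘(ℝ, A₂) ∞ i₁)
    (_hi₂ : Manifold.IsImmersion 𝓘(ℝ, B₁) 𝓘(ℝ, B₂) ∞ i₂)
    (_hj₁ : Manifold.IsImmersion 𝓘(ℝ, A₁) 𝓘(ℝ, B₁) ∞ j₁)
    (_hj₂ : Manifold.IsImmersion 𝓘(ℝ, A₂) 𝓘(ℝ, B₂) ∞ j₂) : Prop :=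
  j₂ ∘ i₁ = i₂ ∘ j₁

variable (hcomm : ImmersionSquare hi₁ hi₂ hj₁ hj₂)
  (hD : Manifold.IsImmersion 𝓘(ℝ, A₂ × ℝ) 𝓘(ℝ, B₂ × ℝ) ∞ (DNC.map hi₁ hi₂ j₂ j₁))
  (hN : Manifold.IsImmersion 𝓘(ℝ, B₁) 𝓘(ℝ, B₂) ∞ (NormalBundle.map hj₁ hj₂ i₂ i₁))

namespace SquareChart

variable (κ : SquareChart A₁ A₂ B₁ B₂ i₁ i₂ j₁ j₂)

/-- The slice chart of `D(j₂, j₁)` given by charts of the square. -/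
def sliceD : Slice (A₂ × ℝ) (B₂ × ℝ) (DNC.map hi₁ hi₂ j₂ j₁) where
  φ := κ.sliceI₂.dncHomeo hi₂
  ψ := κ.sliceI₁.dncHomeo hi₁
  L := κ.J₂.prodMap (.id ℝ ℝ)
  p := κ.pJ₂.prodMap (.id ℝ ℝ)
  φ_mem := κ.sliceI₂.dncHomeo_mem
  ψ_mem := κ.sliceI₁.dncHomeo_mem
  p_L u := Prod.ext (κ.pJ₂_J₂ u.1) rfl
  maps _ hd := κ.isLinear_J₂.maps_dnc hd
  φ_j _ hd := κ.isLinear_J₂.dncHomeo_map hj₂.contMDiff hj₁.contMDiff hcomm hd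

/-- The slice chart of `N(i₂, i₁)` given by charts of the square. -/
def sliceN : Slice B₁ B₂ (NormalBundle.map hj₁ hj₂ i₂ i₁) where
  φ := κ.sliceJ₂.normalHomeo hj₂
  ψ := κ.sliceJ₁.normalHomeo hj₁
  L := κ.I₂
  p := κ.pI₂
  φ_mem := κ.sliceJ₂.normalHomeo_mem
  ψ_mem := κ.sliceJ₁.normalHomeo_mem
  p_L := κ.pI₂_I₂
  maps ξ hξ := κ.maps_i₁ ξ.proj hξ
  φ_j _ hξ := κ.isLinear_I₂.normalChart_map hi₂.contMDiff hi₁.contMDiff (Eq.symm hcomm) hξ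

/-- The chart of `N(D(j₂, j₁))` given by charts of the square. -/
def chartND : OpenPartialHomeomorph (NormalBundle hD) (B₂ × ℝ) :=
  (κ.sliceD hcomm).normalHomeo hD

/-- The chart of `D(N(i₂, i₁))` given by charts of the square. -/
def chartDN : OpenPartialHomeomorph (DNC hN) (B₂ × ℝ) :=
  (κ.sliceN hcomm).dncHomeo hN

omit [FiniteDimensional ℝ B₁] in
theorem mem_chartND_source {ξ : NormalBundle hD} :
    ξ ∈ (κ.chartND hcomm hD).source ↔ ξ.proj ∈ (κ.sliceI₁.dncHomeo hi₁).source := Iff.rfl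

omit [FiniteDimensional ℝ B₁] in
/-- The bundle projection of `N(D(j₂, j₁))` is `(b, t) ↦ (pJ₂ b, t)` in charts. -/
theorem chartND_fst (ξ : NormalBundle hD) :
    κ.pJ₂ (κ.chartND hcomm hD ξ).1 = (κ.sliceI₁.dncHomeo hi₁ ξ.proj).1 :=
  congrArg Prod.fst ((κ.sliceD hcomm).p_normalHomeo ξ)

omit [FiniteDimensional ℝ B₁] in
theorem chartND_snd (ξ : NormalBundle hD) : (κ.chartND hcomm hD ξ).2 = ξ.proj.param :=
  (congrArg Prod.snd ((κ.sliceD hcomm).p_normalHomeo ξ)).trans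
    (DNC.dncHomeo_snd κ.sliceI₁ _)

omit [FiniteDimensional ℝ B₁] in
theorem mem_chartND_target {b : B₂} {t : ℝ} : (b, t) ∈ (κ.chartND hcomm hD).target ↔
    (κ.pJ₂ b, t) ∈ (κ.sliceI₁.dncHomeo hi₁).target := Iff.rfl

/-- Both charts have the same image. -/
theorem chartND_target : (κ.chartND hcomm hD).target = (κ.chartDN hcomm hN).target := by
  ext ⟨b, t⟩
  rw [κ.mem_chartND_target]
  by_cases ht : t = 0
  · subst ht
    refine (κ.sliceI₁.mem_dncHomeo_target_zero (hj := hi₁)).trans (Iff.trans ?_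
      ((κ.sliceN hcomm).mem_dncHomeo_target_zero (hj := hN)).symm)
    change κ.pI₁ (κ.pJ₂ b) ∈ κ.ψ.target ↔ κ.pJ₁ (κ.pI₂ b) ∈ κ.ψ.target
    rw [κ.pI₁_pJ₂]
  · refine (κ.sliceI₁.mem_dncHomeo_target_off (hj := hi₁) ht).trans (Iff.trans ?_
      ((κ.sliceN hcomm).mem_dncHomeo_target_off (hj := hN) ht).symm)
    change κ.sliceI₁.δ t (κ.pJ₂ b) ∈ κ.φL.target ↔ κ.pJ₂ (κ.sliceI₂.δ t b) ∈ κ.φL.target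
    rw [κ.pJ₂_δ]

/-- Over the base point `y` of `L₁`, the inverse of the chart of `D(N(i₂, i₁))` takes values over
`y`. -/
theorem exists_chartDN_symm {ξ : NormalBundle hD} {η : NormalBundle hi₁} (hξ : ξ.proj = .zero η)
    (hη : η.proj ∈ κ.ψ.source) : ∃ ζ : NormalBundle hN,
      (κ.chartDN hcomm hN).symm (κ.chartND hcomm hD ξ) = .zero ζ ∧ ζ.proj.proj = η.proj := by
  have h2 : (κ.chartND hcomm hD ξ).2 = 0 := by rw [κ.chartND_snd, hξ, DNC.param_zero]
  have h1 : κ.pJ₂ (κ.chartND hcomm hD ξ).1 = κ.sliceI₁.normalHomeo hi₁ η := by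
    rw [κ.chartND_fst, hξ]
    rfl
  have h3 : κ.pI₁ (κ.sliceI₁.normalHomeo hi₁ η) = κ.ψ η.proj := κ.sliceI₁.p_normalHomeo η
  rw [← h1, κ.pI₁_pJ₂] at h3
  set w := κ.chartND hcomm hD ξ with hw
  have hw' : w = (w.1, 0) := Prod.ext rfl h2
  refine ⟨((κ.sliceN hcomm).normalHomeo hN).symm w.1, ?_, ?_⟩
  · rw [hw']
    exact (κ.sliceN hcomm).dncHomeo_symm_zero w.1
  · change κ.ψ.symm (κ.pJ₁ (κ.pI₂ w.1)) = η.proj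
    rw [h3, κ.ψ.left_inv hη]

omit [FiniteDimensional ℝ A₂] [IsManifold 𝓘(ℝ, A₂) ∞ L₂] [IsManifold 𝓘(ℝ, B₂) ∞ M₂] in
theorem zero_mem_chartDN_source {ζ : NormalBundle hN} :
    .zero ζ ∈ (κ.chartDN hcomm hN).source ↔ ζ.proj.proj ∈ κ.ψ.source := Iff.rfl

omit [FiniteDimensional ℝ B₁] in
/-- The map `N(pr, pr)` in the charts given by the square. Here `pr` is `(b, t) ↦ δ t b` in charts,
which is linear in `b`, so that its derivative in the direction of `b` is `δ t`. -/
theorem normalHomeo_map_toBase {ξ : NormalBundle hD} {x : L₂} {t : ℝ} {ht : t ≠ 0}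
    (hξ : ξ.proj = .off x t ht) (hx : x ∈ κ.φL.source) :
    κ.sliceJ₂.normalHomeo hj₂ (NormalBundle.map hD hj₂ DNC.toBase DNC.toBase ξ) =
      κ.sliceI₂.δ t (κ.chartND hcomm hD ξ).1 := by
  have hs : ξ ∈ (κ.chartND hcomm hD).source := by
    rw [κ.mem_chartND_source, hξ]
    exact hx
  have h2 : (κ.chartND hcomm hD ξ).2 = t := by rw [κ.chartND_snd, hξ, DNC.param_off]
  set w := κ.chartND hcomm hD ξ with hw
  have hwt : w = (w.1, t) := Prod.ext rfl h2
  have hξw : (κ.chartND hcomm hD).symm w = ξ := (κ.chartND hcomm hD).left_inv hs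
  have hwT : w ∈ (κ.chartND hcomm hD).target := (κ.chartND hcomm hD).map_source hs
  have hproj : (κ.sliceI₁.dncHomeo hi₁).symm (κ.pJ₂ w.1, w.2) = .off x t ht := by
    rw [← hξ, ← hξw]
    rfl
  have h := (κ.sliceD hcomm).normalChart_map_symm (hj := hD) (hj' := hj₂)
    κ.sliceJ₂ DNC.contMDiff_toBase DNC.contMDiff_toBase
    (funext fun d ↦ DNC.toBase_map hcomm d) (w := w) hwT (by
      change DNC.toBase ((κ.sliceI₁.dncHomeo hi₁).symm (κ.pJ₂ w.1, w.2)) ∈ κ.φL.source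
      rw [hproj]
      exact hx)
  set F : B₂ × ℝ → B₂ := κ.φ ∘ DNC.toBase ∘ (κ.sliceI₂.dncHomeo hi₂).symm with hF
  replace h : κ.sliceJ₂.normalHomeo hj₂ (NormalBundle.map hD hj₂ DNC.toBase DNC.toBase
      ((κ.chartND hcomm hD).symm w)) = κ.J₂ (κ.pJ₂ (F (κ.J₂ (κ.pJ₂ w.1), w.2))) +
        κ.sliceJ₂.q (fderiv ℝ F (κ.J₂ (κ.pJ₂ w.1), w.2)
          ((κ.sliceD hcomm).q w)) := h
  rw [hξw] at h
  rw [h, h2]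
  -- the projection to `M₂` is `(b, t) ↦ δ t b` in charts
  have htarget : (κ.J₂ (κ.pJ₂ w.1), t) ∈ (κ.sliceI₂.dncHomeo hi₂).target := by
    have h1 : κ.sliceI₂.dncHomeo hi₂ (DNC.map hi₁ hi₂ j₂ j₁ ξ.proj) =
        (κ.J₂ (κ.pJ₂ w.1), w.2) := by
      rw [κ.isLinear_J₂.dncHomeo_map hj₂.contMDiff hj₁.contMDiff hcomm hs]
      exact Prod.ext (congrArg κ.J₂ (κ.chartND_fst hcomm hD ξ).symm)
        ((DNC.dncHomeo_snd κ.sliceI₁ _).trans (κ.chartND_snd hcomm hD ξ).symm)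
    rw [← h2, ← h1]
    exact (κ.sliceI₂.dncHomeo hi₂).map_source (κ.isLinear_J₂.maps_dnc hs)
  have hFδ : F =ᶠ[𝓝 (κ.J₂ (κ.pJ₂ w.1), t)] fun z ↦ κ.sliceI₂.δ z.2 z.1 := by
    filter_upwards [(κ.sliceI₂.dncHomeo hi₂).open_target.mem_nhds htarget,
      continuousAt_snd.eventually_ne (y := (0 : ℝ)) ht] with z hz hz0
    have h1 : κ.sliceI₂.δ z.2 z.1 ∈ κ.φ.target := (κ.sliceI₂.mem_dncHomeo_target_off hz0).1 hz
    have h3 := DNC.toBase_eq_of_mem κ.sliceI₂ ((κ.sliceI₂.dncHomeo hi₂).map_target hz)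
    rw [(κ.sliceI₂.dncHomeo hi₂).right_inv hz] at h3
    change κ.φ (DNC.toBase ((κ.sliceI₂.dncHomeo hi₂).symm z)) = _
    rw [h3]
    exact κ.φ.right_inv h1
  have hq : (κ.sliceD hcomm).q w = (κ.sliceJ₂.q w.1, 0) :=
    Prod.ext rfl (sub_self w.2)
  have hd : fderiv ℝ F (κ.J₂ (κ.pJ₂ w.1), t) (κ.sliceJ₂.q w.1, 0) =
      κ.sliceI₂.δ t (κ.sliceJ₂.q w.1) := by
    rw [hFδ.fderiv_eq]
    have h1 : HasFDerivAt (fun z : B₂ × ℝ ↦ κ.sliceI₂.δ z.2 z.1)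
        (fderiv ℝ (fun z : B₂ × ℝ ↦ κ.sliceI₂.δ z.2 z.1) (κ.J₂ (κ.pJ₂ w.1), t))
        (κ.J₂ (κ.pJ₂ w.1), t) :=
      ((κ.sliceI₂.contDiff_δ.contDiffAt).differentiableAt (by simp)).hasFDerivAt
    have h3 := HasFDerivAt.comp (κ.J₂ (κ.pJ₂ w.1)) (f := fun b ↦ (b, t)) h1
      (hasFDerivAt_prodMk_left (𝕜 := ℝ) (κ.J₂ (κ.pJ₂ w.1)) t)
    have h4 : HasFDerivAt ((fun z : B₂ × ℝ ↦ κ.sliceI₂.δ z.2 z.1) ∘ fun b ↦ (b, t))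
        (κ.I₂.comp κ.pI₂ + t • κ.sliceI₂.q) (κ.J₂ (κ.pJ₂ w.1)) :=
      (κ.I₂.comp κ.pI₂ + t • κ.sliceI₂.q).hasFDerivAt
    exact DFunLike.congr_fun (h3.unique h4) (κ.sliceJ₂.q w.1)
  rw [hq, hd, hFδ.self_of_nhds]
  change κ.J₂ (κ.pJ₂ (κ.sliceI₂.δ t (κ.J₂ (κ.pJ₂ w.1)))) + _ = _
  have hadd : ∀ a b, κ.sliceI₂.δ t (a + b) = κ.sliceI₂.δ t a + κ.sliceI₂.δ t b := fun a b ↦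
    (κ.I₂.comp κ.pI₂ + t • κ.sliceI₂.q).map_add a b
  have hqδ : κ.sliceJ₂.q (κ.sliceI₂.δ t w.1) =
      κ.sliceJ₂.q (κ.sliceI₂.δ t (κ.sliceJ₂.q w.1)) := by
    conv_lhs => rw [← κ.sliceJ₂.L_p_add_q w.1, hadd, map_add]
    have h1 : κ.sliceI₂.δ t (κ.sliceJ₂.L (κ.sliceJ₂.p w.1)) =
      κ.sliceJ₂.L (κ.sliceI₁.δ t (κ.pJ₂ w.1)) := κ.δ_J₂ t _
    rw [h1, κ.sliceJ₂.q_L, zero_add]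
  rw [← hqδ, κ.δ_J₂, κ.pJ₂_J₂, ← κ.pJ₂_δ]
  exact κ.sliceJ₂.L_p_add_q _

end SquareChart

end SquareSlices

/-! ### The canonical identification -/

section Diffeomorph

variable {E X X' : Type*} [NormedAddCommGroup E] [NormedSpace ℝ E] [TopologicalSpace X]
  [ChartedSpace E X] [TopologicalSpace X'] [ChartedSpace E X']

/-- An injective map which is the identity in charts with the same images is a diffeomorphism, as
soon as these charts cover the target. -/
theorem exists_diffeomorph_of_charts {f : X → X'} (hf : Function.Injective f)
    (h : ∀ x', ∃ e ∈ IsManifold.maximalAtlas 𝓘(ℝ, E) ∞ X,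
      ∃ e' ∈ IsManifold.maximalAtlas 𝓘(ℝ, E) ∞ X', x' ∈ e'.source ∧ e.target = e'.target ∧
        ∀ x ∈ e.source, f x ∈ e'.source ∧ e' (f x) = e x) :
    ∃ Φ : Diffeomorph 𝓘(ℝ, E) 𝓘(ℝ, E) X X' ∞, ∀ x, Φ x = f x := by
  have hsymm : ∀ (e : OpenPartialHomeomorph X E) (e' : OpenPartialHomeomorph X' E),
      e.target = e'.target → (∀ x ∈ e.source, f x ∈ e'.source ∧ e' (f x) = e x) →
      ∀ x' ∈ e'.source, e.symm (e' x') ∈ e.source ∧ f (e.symm (e' x')) = x' := by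
    intro e e' ht he x' hx'
    have h1 : e' x' ∈ e.target := ht ▸ e'.map_source hx'
    have h2 := e.map_target h1
    refine ⟨h2, e'.injOn (he _ h2).1 hx' ?_⟩
    rw [(he _ h2).2, e.right_inv h1]
  have hsurj : Function.Surjective f := by
    intro x'
    obtain ⟨e, -, e', -, hx', ht, he⟩ := h x'
    exact ⟨_, (hsymm e e' ht he x' hx').2⟩
  let F : X ≃ X' := Equiv.ofBijective f ⟨hf, hsurj⟩
  refine ⟨⟨F, ?_, ?_⟩, fun x ↦ rfl⟩
  · intro x
    obtain ⟨e, hea, e', hea', hx', ht, he⟩ := h (f x)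
    have hx : x ∈ e.source := by
      obtain ⟨h1, h2⟩ := hsymm e e' ht he _ hx'
      rwa [hf h2] at h1
    refine contMDiffAt_of_chart_symm hea' (contMDiffAt_of_mem_maximalAtlas hea hx)
      (ht ▸ e.map_source hx) ?_
    filter_upwards [e.open_source.mem_nhds hx] with z hz
    change f z = _
    rw [← (he z hz).2, e'.left_inv (he z hz).1]
  · intro x'
    obtain ⟨e, hea, e', hea', hx', ht, he⟩ := h x'
    refine contMDiffAt_of_chart_symm hea (contMDiffAt_of_mem_maximalAtlas hea' hx')
      (ht ▸ e'.map_source hx') ?_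
    filter_upwards [e'.open_source.mem_nhds hx'] with z hz
    exact (Equiv.symm_apply_eq F).2 (hsymm e e' ht he z hz).2.symm

end Diffeomorph

section Canonical

variable {A₁ A₂ B₁ B₂ : Type*} [NormedAddCommGroup A₁] [NormedSpace ℝ A₁]
  [NormedAddCommGroup A₂] [NormedSpace ℝ A₂] [NormedAddCommGroup B₁] [NormedSpace ℝ B₁]
  [NormedAddCommGroup B₂] [NormedSpace ℝ B₂] {L₁ L₂ M₁ M₂ : Type*} [TopologicalSpace L₁]
  [ChartedSpace A₁ L₁] [TopologicalSpace L₂] [ChartedSpace A₂ L₂] [TopologicalSpace M₁]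
  [ChartedSpace B₁ M₁] [TopologicalSpace M₂] [ChartedSpace B₂ M₂]
  {i₁ : L₁ → L₂} {i₂ : M₁ → M₂} {j₁ : L₁ → M₁} {j₂ : L₂ → M₂}
  [FiniteDimensional ℝ A₂] [FiniteDimensional ℝ B₁] [FiniteDimensional ℝ B₂]
  {hi₁ : Manifold.IsImmersion 𝓘(ℝ, A₁) 𝓘(ℝ, A₂) ∞ i₁}
  {hi₂ : Manifold.IsImmersion 𝓘(ℝ, B₁) 𝓘(ℝ, B₂) ∞ i₂}
  {hj₁ : Manifold.IsImmersion 𝓘(ℝ, A₁) 𝓘(ℝ, B₁) ∞ j₁}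
  {hj₂ : Manifold.IsImmersion 𝓘(ℝ, A₂) 𝓘(ℝ, B₂) ∞ j₂}
  [IsManifold 𝓘(ℝ, A₂) ∞ L₂] [IsManifold 𝓘(ℝ, B₂) ∞ M₂]
  (hcomm : ImmersionSquare hi₁ hi₂ hj₁ hj₂)
  (hD : Manifold.IsImmersion 𝓘(ℝ, A₂ × ℝ) 𝓘(ℝ, B₂ × ℝ) ∞ (DNC.map hi₁ hi₂ j₂ j₁))
  (hN : Manifold.IsImmersion 𝓘(ℝ, B₁) 𝓘(ℝ, B₂) ∞ (NormalBundle.map hj₁ hj₂ i₂ i₁))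

namespace SquareChart

variable (κ : SquareChart A₁ A₂ B₁ B₂ i₁ i₂ j₁ j₂)

include hcomm in
omit [FiniteDimensional ℝ B₁] in
/-- The part of `N(D(j₂, j₁))` over `t ≠ 0` is dense. -/
theorem exists_tendsto {ξ : NormalBundle hD} (hs : ξ.proj ∈ (κ.sliceI₁.dncHomeo hi₁).source)
    (h0 : ξ.proj.param = 0) : ∃ u : ℝ → NormalBundle hD, Tendsto u (𝓝[≠] 0) (𝓝 ξ) ∧
      ∀ᶠ t in 𝓝[≠] 0, (u t).proj.param ≠ 0 := by
  set e := κ.chartND hcomm hD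
  have hs' : ξ ∈ e.source := hs
  have he : e ξ = ((e ξ).1, 0) := Prod.ext rfl ((κ.chartND_snd hcomm hD ξ).trans h0)
  have ht : ((e ξ).1, (0 : ℝ)) ∈ e.target := he ▸ e.map_source hs'
  have hc : ContinuousAt (fun t : ℝ ↦ ((e ξ).1, t)) 0 := by fun_prop
  refine ⟨fun t ↦ e.symm ((e ξ).1, t), ?_, ?_⟩
  · refine Tendsto.mono_left ?_ nhdsWithin_le_nhds
    have h1 := (e.continuousAt_symm ht).tendsto.comp hc.tendsto
    have h2 : e.symm ((e ξ).1, (0 : ℝ)) = ξ := by rw [← he, e.left_inv hs']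
    rwa [h2] at h1
  · filter_upwards [self_mem_nhdsWithin, nhdsWithin_le_nhds
      (hc.eventually (e.open_target.mem_nhds ht))] with t ht0 ht
    rw [← κ.chartND_snd hcomm hD]
    change (e (e.symm ((e ξ).1, t))).2 ≠ 0
    rwa [e.right_inv ht]

/-- Over `t ≠ 0` the obvious identification is the identity in the charts given by the square. -/
theorem chartDN_off {ξ : NormalBundle hD} {x : L₂} {t : ℝ} {ht : t ≠ 0}
    (hξ : ξ.proj = .off x t ht) (hx : x ∈ κ.φL.source) :
    .off (NormalBundle.map hD hj₂ DNC.toBase DNC.toBase ξ) t ht ∈ (κ.chartDN hcomm hN).source ∧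
      κ.chartDN hcomm hN (.off (NormalBundle.map hD hj₂ DNC.toBase DNC.toBase ξ) t ht) =
        κ.chartND hcomm hD ξ := by
  refine ⟨?_, ?_⟩
  · change DNC.toBase ξ.proj ∈ κ.φL.source
    rw [hξ]
    exact hx
  · have h1 := κ.normalHomeo_map_toBase hcomm hD hξ hx
    change ((κ.sliceN hcomm).δ t⁻¹ (κ.sliceJ₂.normalHomeo hj₂
      (NormalBundle.map hD hj₂ DNC.toBase DNC.toBase ξ)), t) = _
    rw [h1]
    refine Prod.ext (κ.sliceI₂.δ_inv ht _) ?_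
    rw [κ.chartND_snd, hξ, DNC.param_off]

end SquareChart

variable (hsq : ∀ y, ∃ κ : SquareChart A₁ A₂ B₁ B₂ i₁ i₂ j₁ j₂, y ∈ κ.ψ.source)

/-- The canonical map `N(D(j₂, j₁)) → D(N(i₂, i₁))`: the obvious identification for `t ≠ 0`, and
the identity in the charts given by the square for `t = 0`. -/
def canonicalMap (ξ : NormalBundle hD) : DNC hN :=
  match ξ.proj with
  | .off _ t ht => .off (NormalBundle.map hD hj₂ DNC.toBase DNC.toBase ξ) t ht
  | .zero η => ((hsq η.proj).choose.chartDN hcomm hN).symm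
      ((hsq η.proj).choose.chartND hcomm hD ξ)

theorem canonicalMap_of_off {ξ : NormalBundle hD} {x : L₂} {t : ℝ} {ht : t ≠ 0}
    (hξ : ξ.proj = .off x t ht) : canonicalMap hcomm hD hN hsq ξ =
      .off (NormalBundle.map hD hj₂ DNC.toBase DNC.toBase ξ) t ht := by
  unfold canonicalMap
  split
  · rename_i x' t' ht' h
    obtain ⟨rfl, rfl⟩ := DNC.off.inj (hξ.symm.trans h)
    rfl
  · rename_i η h
    cases hξ.symm.trans h

theorem exists_canonicalMap_of_zero {ξ : NormalBundle hD} {η : NormalBundle hi₁}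
    (hξ : ξ.proj = .zero η) : ∃ κ : SquareChart A₁ A₂ B₁ B₂ i₁ i₂ j₁ j₂, η.proj ∈ κ.ψ.source ∧
      canonicalMap hcomm hD hN hsq ξ = (κ.chartDN hcomm hN).symm (κ.chartND hcomm hD ξ) := by
  refine ⟨(hsq η.proj).choose, (hsq η.proj).choose_spec, ?_⟩
  unfold canonicalMap
  split
  · rename_i x' t' ht' h
    cases hξ.symm.trans h
  · rename_i η' h
    obtain rfl := DNC.zero.inj (hξ.symm.trans h)
    rfl

include hcomm hsq in
omit [FiniteDimensional ℝ A₂] [IsManifold 𝓘(ℝ, A₂) ∞ L₂] [IsManifold 𝓘(ℝ, B₂) ∞ M₂] in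
/-- Limits in `D(N(i₂, i₁))` over `t = 0` are unique once their base point in `L₁` is known. -/
theorem eq_of_tendsto_of_proj_proj {ι : Type*} {l : Filter ι} [l.NeBot] {u : ι → DNC hN}
    {a b : NormalBundle hN} (h : a.proj.proj = b.proj.proj) (ha : Tendsto u l (𝓝 (.zero a)))
    (hb : Tendsto u l (𝓝 (.zero b))) : a = b := by
  obtain ⟨κ, hκ⟩ := hsq a.proj.proj
  have hκ' : b.proj.proj ∈ κ.ψ.source := h ▸ hκ
  exact DNC.zero.inj ((κ.chartDN hcomm hN).eq_of_tendsto
    ((κ.zero_mem_chartDN_source hcomm hN).2 hκ) ((κ.zero_mem_chartDN_source hcomm hN).2 hκ') ha hb)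

/-- The canonical map is the identity in all charts given by the square: over `t = 0`, this follows
by continuity from the case `t ≠ 0`. -/
theorem canonicalMap_chart (κ : SquareChart A₁ A₂ B₁ B₂ i₁ i₂ j₁ j₂) {ξ : NormalBundle hD}
    (hξ : ξ.proj ∈ (κ.sliceI₁.dncHomeo hi₁).source) :
    canonicalMap hcomm hD hN hsq ξ ∈ (κ.chartDN hcomm hN).source ∧
      κ.chartDN hcomm hN (canonicalMap hcomm hD hN hsq ξ) = κ.chartND hcomm hD ξ := by
  rcases hp : ξ.proj with η | ⟨x, t, ht⟩
  swap
  · rw [canonicalMap_of_off hcomm hD hN hsq hp]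
    exact κ.chartDN_off hcomm hD hN hp (by rwa [hp] at hξ)
  have hη : η.proj ∈ κ.ψ.source := by rwa [hp] at hξ
  obtain ⟨κ', hη', hΦ⟩ := exists_canonicalMap_of_zero hcomm hD hN hsq hp
  have hξ' : ξ.proj ∈ (κ'.sliceI₁.dncHomeo hi₁).source := by rw [hp]; exact hη'
  obtain ⟨u, hu, hu0⟩ := κ.exists_tendsto hcomm hD hξ (by rw [hp, DNC.param_zero])
  have hlim : ∀ κ : SquareChart A₁ A₂ B₁ B₂ i₁ i₂ j₁ j₂,
      ξ.proj ∈ (κ.sliceI₁.dncHomeo hi₁).source →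
      Tendsto (fun t ↦ canonicalMap hcomm hD hN hsq (u t)) (𝓝[≠] 0)
        (𝓝 ((κ.chartDN hcomm hN).symm (κ.chartND hcomm hD ξ))) := by
    intro κ hξ
    have hs : ξ ∈ (κ.chartND hcomm hD).source := hξ
    have ht : κ.chartND hcomm hD ξ ∈ (κ.chartDN hcomm hN).target :=
      κ.chartND_target hcomm hD hN ▸ (κ.chartND hcomm hD).map_source hs
    refine ((((κ.chartDN hcomm hN).continuousAt_symm ht).tendsto.comp
      ((κ.chartND hcomm hD).continuousAt hs).tendsto).comp hu).congr' ?_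
    filter_upwards [hu0, hu.eventually ((κ.chartND hcomm hD).open_source.mem_nhds hs)] with t h0 ht
    have hoff := DNC.eq_off_of_param_ne_zero h0
    have hx : (u t).proj.toBase ∈ κ.φL.source := by
      have h1 : (u t).proj ∈ (κ.sliceI₁.dncHomeo hi₁).source := ht
      rwa [hoff] at h1
    obtain ⟨h1, h2⟩ := κ.chartDN_off hcomm hD hN hoff hx
    rw [canonicalMap_of_off hcomm hD hN hsq hoff, Function.comp_apply, Function.comp_apply, ← h2,
      (κ.chartDN hcomm hN).left_inv h1]
  obtain ⟨ζ, hζ, hζη⟩ := κ.exists_chartDN_symm hcomm hD hN hp hη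
  obtain ⟨ζ', hζ', hζη'⟩ := κ'.exists_chartDN_symm hcomm hD hN hp hη'
  have h1 := hlim κ hξ
  have h2 := hlim κ' hξ'
  rw [hζ] at h1
  rw [hζ'] at h2
  obtain rfl := eq_of_tendsto_of_proj_proj hcomm hN hsq (hζη.trans hζη'.symm) h1 h2
  have ht : κ.chartND hcomm hD ξ ∈ (κ.chartDN hcomm hN).target :=
    κ.chartND_target hcomm hD hN ▸ (κ.chartND hcomm hD).map_source hξ
  rw [hΦ, hζ', ← hζ]
  exact ⟨(κ.chartDN hcomm hN).map_target ht, (κ.chartDN hcomm hN).right_inv ht⟩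

/-- Over `t = 0` the canonical map covers the identity of `L₁`. -/
theorem exists_canonicalMap_eq_zero {ξ : NormalBundle hD} {η : NormalBundle hi₁}
    (hξ : ξ.proj = .zero η) : ∃ ζ : NormalBundle hN,
      canonicalMap hcomm hD hN hsq ξ = .zero ζ ∧ ζ.proj.proj = η.proj := by
  obtain ⟨κ, hη, hΦ⟩ := exists_canonicalMap_of_zero hcomm hD hN hsq hξ
  rw [hΦ]
  exact κ.exists_chartDN_symm hcomm hD hN hξ hη

theorem continuousAt_canonicalMap_of_zero {ξ : NormalBundle hD} {η : NormalBundle hi₁}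
    (hξ : ξ.proj = .zero η) : ContinuousAt (canonicalMap hcomm hD hN hsq) ξ := by
  obtain ⟨κ, hη⟩ := hsq η.proj
  have hs : ξ ∈ (κ.chartND hcomm hD).source := by
    rw [κ.mem_chartND_source, hξ]
    exact hη
  have ht : κ.chartND hcomm hD ξ ∈ (κ.chartDN hcomm hN).target :=
    κ.chartND_target hcomm hD hN ▸ (κ.chartND hcomm hD).map_source hs
  refine (((κ.chartDN hcomm hN).continuousAt_symm ht).comp
    ((κ.chartND hcomm hD).continuousAt hs)).congr ?_
  filter_upwards [(κ.chartND hcomm hD).open_source.mem_nhds hs] with ξ' hξ'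
  obtain ⟨h1, h2⟩ := canonicalMap_chart hcomm hD hN hsq κ hξ'
  rw [Function.comp_apply, ← h2, (κ.chartDN hcomm hN).left_inv h1]

/-- The canonical map covers the identity of `D(L₂, L₁, i₁)`. -/
theorem map_proj_canonicalMap (ξ : NormalBundle hD) :
    DNC.map hN hi₁ NormalBundle.proj NormalBundle.proj (canonicalMap hcomm hD hN hsq ξ) =
      ξ.proj := by
  have hoff : ∀ ξ : NormalBundle hD, ξ.proj.param ≠ 0 →
      DNC.map hN hi₁ NormalBundle.proj NormalBundle.proj (canonicalMap hcomm hD hN hsq ξ) =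
        ξ.proj := by
    intro ξ hξ
    rw [canonicalMap_of_off hcomm hD hN hsq (DNC.eq_off_of_param_ne_zero hξ), DNC.map_off,
      NormalBundle.proj_map, ← DNC.eq_off_of_param_ne_zero hξ]
  rcases hp : ξ.proj with η | ⟨x, t, ht⟩
  swap
  · rw [← hp]
    exact hoff ξ (by rw [hp]; exact ht)
  obtain ⟨ζ, hζ, hζη⟩ := exists_canonicalMap_eq_zero hcomm hD hN hsq hp
  obtain ⟨κ, hκ⟩ := hsq η.proj
  obtain ⟨u, hu, hu0⟩ := κ.exists_tendsto hcomm hD (ξ := ξ) (by rw [hp]; exact hκ)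
    (by rw [hp, DNC.param_zero])
  have hc := (DNC.contMDiff_map (hj := hN) (hj' := hi₁) NormalBundle.contMDiff_proj
    NormalBundle.contMDiff_proj (funext fun ξ ↦ rfl)).continuous.tendsto
    (canonicalMap hcomm hD hN hsq ξ)
  have h1 := (hc.comp (continuousAt_canonicalMap_of_zero hcomm hD hN hsq hp).tendsto).comp hu
  have h2 := (NormalBundle.contMDiff_proj.continuous.tendsto ξ).comp hu
  rw [hp] at h2
  rw [hζ] at h1 ⊢
  refine congrArg DNC.zero (DNC.eq_of_tendsto hζη h1 (h2.congr' ?_))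
  filter_upwards [hu0] with t ht using (hoff _ ht).symm

end Canonical

/-! ### The canonical identification is a diffeomorphism and unique -/

section CanonicalDiffeomorph

variable {A₁ A₂ B₁ B₂ : Type*} [NormedAddCommGroup A₁] [NormedSpace ℝ A₁]
  [NormedAddCommGroup A₂] [NormedSpace ℝ A₂] [NormedAddCommGroup B₁] [NormedSpace ℝ B₁]
  [NormedAddCommGroup B₂] [NormedSpace ℝ B₂] {L₁ L₂ M₁ M₂ : Type*} [TopologicalSpace L₁]
  [ChartedSpace A₁ L₁] [TopologicalSpace L₂] [ChartedSpace A₂ L₂] [TopologicalSpace M₁]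
  [ChartedSpace B₁ M₁] [TopologicalSpace M₂] [ChartedSpace B₂ M₂]
  {i₁ : L₁ → L₂} {i₂ : M₁ → M₂} {j₁ : L₁ → M₁} {j₂ : L₂ → M₂}
  [FiniteDimensional ℝ A₂] [FiniteDimensional ℝ B₁] [FiniteDimensional ℝ B₂]
  {hi₁ : Manifold.IsImmersion 𝓘(ℝ, A₁) 𝓘(ℝ, A₂) ∞ i₁}
  {hi₂ : Manifold.IsImmersion 𝓘(ℝ, B₁) 𝓘(ℝ, B₂) ∞ i₂}
  {hj₁ : Manifold.IsImmersion 𝓘(ℝ, A₁) 𝓘(ℝ, B₁) ∞ j₁}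
  {hj₂ : Manifold.IsImmersion 𝓘(ℝ, A₂) 𝓘(ℝ, B₂) ∞ j₂}
  [IsManifold 𝓘(ℝ, A₂) ∞ L₂] [IsManifold 𝓘(ℝ, B₂) ∞ M₂]
  (hcomm : ImmersionSquare hi₁ hi₂ hj₁ hj₂)
  (hD : Manifold.IsImmersion 𝓘(ℝ, A₂ × ℝ) 𝓘(ℝ, B₂ × ℝ) ∞ (DNC.map hi₁ hi₂ j₂ j₁))
  (hN : Manifold.IsImmersion 𝓘(ℝ, B₁) 𝓘(ℝ, B₂) ∞ (NormalBundle.map hj₁ hj₂ i₂ i₁))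

/-- The slice chart of `D(j₂, j₁)` over `t ≠ 0` given by a slice chart of `j₂`. -/
def Slice.offSlice (σ : Slice A₂ B₂ j₂) (hi₁ : Manifold.IsImmersion 𝓘(ℝ, A₁) 𝓘(ℝ, A₂) ∞ i₁)
    (hi₂ : Manifold.IsImmersion 𝓘(ℝ, B₁) 𝓘(ℝ, B₂) ∞ i₂) (j₁ : L₁ → M₁) :
    Slice (A₂ × ℝ) (B₂ × ℝ) (DNC.map hi₁ hi₂ j₂ j₁) where
  φ := offHomeo hi₂ σ.φ_mem
  ψ := offHomeo hi₁ σ.ψ_mem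
  L := σ.L.prodMap (.id ℝ ℝ)
  p := σ.p.prodMap (.id ℝ ℝ)
  φ_mem := offHomeo_mem _
  ψ_mem := offHomeo_mem _
  p_L u := Prod.ext (σ.p_L u.1) rfl
  maps d hd := by
    rcases d with η | ⟨x, t, ht⟩
    · exact hd.elim
    · exact σ.maps x hd
  φ_j d hd := by
    rcases d with η | ⟨x, t, ht⟩
    · exact hd.elim
    · exact Prod.ext (σ.φ_j x hd) rfl

omit [FiniteDimensional ℝ B₁] in
/-- The map `N(pr, pr)` is linear in the slice charts over `t ≠ 0`. -/
theorem Slice.isLinear_offSlice (σ : Slice A₂ B₂ j₂) :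
    (σ.offSlice hi₁ hi₂ j₁).IsLinear σ DNC.toBase DNC.toBase (.fst ℝ B₂ ℝ) where
  maps d hd := by
    rcases d with η | ⟨x, t, ht⟩
    · exact hd.elim
    · exact hd
  maps₀ d hd := by
    rcases d with η | ⟨x, t, ht⟩
    · exact hd.elim
    · exact hd
  φ_f d hd := by
    rcases d with η | ⟨x, t, ht⟩
    · exact hd.elim
    · rfl
  T_L_p w := rfl

/-- Over `t ≠ 0` the canonical map is the identity in the charts given by a slice chart of `j₂`.
These charts are needed in addition to those of the square, which only cover a neighbourhood of
the fibre over `t = 0`. -/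
theorem Slice.offHomeo_canonicalMap
    (hsq : ∀ y, ∃ κ : SquareChart A₁ A₂ B₁ B₂ i₁ i₂ j₁ j₂, y ∈ κ.ψ.source)
    (σ : Slice A₂ B₂ j₂) {ξ : NormalBundle hD}
    (hξ : ξ ∈ ((σ.offSlice hi₁ hi₂ j₁).normalHomeo hD).source) :
    canonicalMap hcomm hD hN hsq ξ ∈ (offHomeo hN (σ.normalHomeo_mem (hj := hj₂))).source ∧
      offHomeo hN σ.normalHomeo_mem (canonicalMap hcomm hD hN hsq ξ) =
        (σ.offSlice hi₁ hi₂ j₁).normalHomeo hD ξ := by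
  rcases hp : ξ.proj with η | ⟨x, t, ht⟩
  · have h : ξ.proj ∈ (offHomeo hi₁ σ.ψ_mem).source := hξ
    rw [hp] at h
    exact h.elim
  rw [canonicalMap_of_off hcomm hD hN hsq hp]
  have hx : ξ.proj ∈ (σ.offSlice hi₁ hi₂ j₁).ψ.source := hξ
  refine ⟨?_, Prod.ext ?_ ?_⟩
  · exact σ.isLinear_offSlice.maps₀ _ hx
  · exact σ.isLinear_offSlice.normalChart_map (hj := hD) (hj' := hj₂) DNC.contMDiff_toBase
      DNC.contMDiff_toBase (funext fun d ↦ DNC.toBase_map hcomm d) hx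
  · have h := congrArg Prod.snd ((σ.offSlice hi₁ hi₂ j₁).p_normalHomeo (hj := hD) ξ)
    rw [hp] at h
    exact h.symm

/-- Points with the same image have the same base point in `D(L₂, L₁, i₁)`, and hence lie in a
common chart, in which the canonical map is the identity. -/
theorem canonicalMap_injective
    (hsq : ∀ y, ∃ κ : SquareChart A₁ A₂ B₁ B₂ i₁ i₂ j₁ j₂, y ∈ κ.ψ.source) :
    Function.Injective (canonicalMap hcomm hD hN hsq) := by
  intro ξ ξ' h
  have hp : ξ.proj = ξ'.proj := by
    rw [← map_proj_canonicalMap hcomm hD hN hsq, h, map_proj_canonicalMap]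
  rcases hη : ξ.proj with η | ⟨x, t, ht⟩
  · obtain ⟨κ, hκ⟩ := hsq η.proj
    have h1 : ξ.proj ∈ (κ.sliceI₁.dncHomeo hi₁).source := by rw [hη]; exact hκ
    have h2 : ξ'.proj ∈ (κ.sliceI₁.dncHomeo hi₁).source := hp ▸ h1
    refine (κ.chartND hcomm hD).injOn h1 h2 ?_
    rw [← (canonicalMap_chart hcomm hD hN hsq κ h1).2, h,
      (canonicalMap_chart hcomm hD hN hsq κ h2).2]
  · obtain ⟨σ, hσ⟩ := exists_slice hj₂ x
    have h1 : ξ.proj ∈ (σ.offSlice hi₁ hi₂ j₁).ψ.source := by rw [hη]; exact hσ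
    have h2 : ξ'.proj ∈ (σ.offSlice hi₁ hi₂ j₁).ψ.source := hp ▸ h1
    refine ((σ.offSlice hi₁ hi₂ j₁).normalHomeo hD).injOn h1 h2 ?_
    rw [← (σ.offHomeo_canonicalMap hcomm hD hN hsq h1).2, h,
      (σ.offHomeo_canonicalMap hcomm hD hN hsq h2).2]

theorem isCanonical_canonicalMap
    (hsq : ∀ y, ∃ κ : SquareChart A₁ A₂ B₁ B₂ i₁ i₂ j₁ j₂, y ∈ κ.ψ.source) :
    IsCanonical hD hN (canonicalMap hcomm hD hN hsq) :=
  ⟨map_proj_canonicalMap hcomm hD hN hsq, fun _ _ _ _ h ↦ canonicalMap_of_off hcomm hD hN hsq h⟩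

include hcomm in
/-- The canonical map is a diffeomorphism if `L₁` is covered by charts in which the square is
linear. -/
theorem exists_diffeomorph_isCanonical
    (hsq : ∀ y, ∃ κ : SquareChart A₁ A₂ B₁ B₂ i₁ i₂ j₁ j₂, y ∈ κ.ψ.source) :
    ∃ Φ : Diffeomorph 𝓘(ℝ, B₂ × ℝ) 𝓘(ℝ, B₂ × ℝ) (NormalBundle hD) (DNC hN) ∞,
      IsCanonical hD hN Φ := by
  obtain ⟨Φ, hΦ⟩ := exists_diffeomorph_of_charts (E := B₂ × ℝ)
    (canonicalMap_injective hcomm hD hN hsq) (by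
      rintro (ζ | ⟨ζ, t, ht⟩)
      · obtain ⟨κ, hκ⟩ := hsq ζ.proj.proj
        exact ⟨κ.chartND hcomm hD, (κ.sliceD hcomm).normalHomeo_mem, κ.chartDN hcomm hN,
          (κ.sliceN hcomm).dncHomeo_mem, (κ.zero_mem_chartDN_source hcomm hN).2 hκ,
          κ.chartND_target hcomm hD hN, fun ξ hξ ↦ canonicalMap_chart hcomm hD hN hsq κ hξ⟩
      · obtain ⟨σ, hσ⟩ := exists_slice hj₂ ζ.proj
        refine ⟨(σ.offSlice hi₁ hi₂ j₁).normalHomeo hD, Slice.normalHomeo_mem _,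
          offHomeo hN σ.normalHomeo_mem, offHomeo_mem _, hσ, ?_,
          fun ξ hξ ↦ σ.offHomeo_canonicalMap hcomm hD hN hsq hξ⟩
        ext ⟨b, s⟩
        exact Iff.rfl)
  have h : (Φ : NormalBundle hD → DNC hN) = canonicalMap hcomm hD hN hsq := funext hΦ
  exact ⟨Φ, h ▸ isCanonical_canonicalMap hcomm hD hN hsq⟩

variable {hD hN}

/-- A canonical map preserves the fibre over `t = 0` and the base points in `L₁`. -/
theorem IsCanonical.exists_zero {Φ : NormalBundle hD → DNC hN} (hΦ : IsCanonical hD hN Φ)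
    {ξ : NormalBundle hD} {η : NormalBundle hi₁} (hξ : ξ.proj = .zero η) :
    ∃ ζ : NormalBundle hN, Φ ξ = .zero ζ ∧ ζ.proj.proj = η.proj := by
  have h := hΦ.1 ξ
  rw [hξ] at h
  rcases hζ : Φ ξ with ζ | ⟨x, t, ht⟩
  · rw [hζ] at h
    exact ⟨ζ, rfl, congrArg NormalBundle.proj (DNC.zero.inj h)⟩
  · rw [hζ] at h
    cases h

include hcomm in
/-- Canonical maps which are continuous agree: over `t ≠ 0` by definition, and over `t = 0` by
density, as their values have the same base point in `L₁`. -/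
theorem IsCanonical.eq
    (hsq : ∀ y, ∃ κ : SquareChart A₁ A₂ B₁ B₂ i₁ i₂ j₁ j₂, y ∈ κ.ψ.source)
    {Φ Ψ : NormalBundle hD → DNC hN} (hΦ : IsCanonical hD hN Φ) (hΨ : IsCanonical hD hN Ψ)
    (hΦc : Continuous Φ) (hΨc : Continuous Ψ) : Φ = Ψ := by
  funext ξ
  rcases hη : ξ.proj with η | ⟨x, t, ht⟩
  · obtain ⟨a, ha, haη⟩ := hΦ.exists_zero hη
    obtain ⟨b, hb, hbη⟩ := hΨ.exists_zero hη
    obtain ⟨κ, hκ⟩ := hsq η.proj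
    obtain ⟨u, hu, hu0⟩ := κ.exists_tendsto hcomm hD (ξ := ξ) (by rw [hη]; exact hκ)
      (by rw [hη, DNC.param_zero])
    have h1 := (hΦc.tendsto ξ).comp hu
    have h2 := (hΨc.tendsto ξ).comp hu
    rw [ha] at h1 ⊢
    rw [hb] at h2 ⊢
    refine congrArg DNC.zero (eq_of_tendsto_of_proj_proj hcomm hN hsq (haη.trans hbη.symm) h1
      (h2.congr' ?_))
    filter_upwards [hu0] with t ht
    have h := DNC.eq_off_of_param_ne_zero ht
    rw [Function.comp_apply, Function.comp_apply, hΦ.2 _ _ _ _ h, hΨ.2 _ _ _ _ h]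
  · rw [hΦ.2 _ _ _ _ hη, hΨ.2 _ _ _ _ hη]

end CanonicalDiffeomorph

/-! ### Compatibility of the canonical identification with the groupoid structures -/

section Naturality

variable {A₁ A₂ B₁ B₂ : Type*} [NormedAddCommGroup A₁] [NormedSpace ℝ A₁]
  [NormedAddCommGroup A₂] [NormedSpace ℝ A₂] [NormedAddCommGroup B₁] [NormedSpace ℝ B₁]
  [NormedAddCommGroup B₂] [NormedSpace ℝ B₂] {L₁ L₂ M₁ M₂ : Type*} [TopologicalSpace L₁]
  [ChartedSpace A₁ L₁] [TopologicalSpace L₂] [ChartedSpace A₂ L₂] [TopologicalSpace M₁]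
  [ChartedSpace B₁ M₁] [TopologicalSpace M₂] [ChartedSpace B₂ M₂]
  {i₁ : L₁ → L₂} {i₂ : M₁ → M₂} {j₁ : L₁ → M₁} {j₂ : L₂ → M₂}
  [FiniteDimensional ℝ A₂] [FiniteDimensional ℝ B₁] [FiniteDimensional ℝ B₂]
  {hi₁ : Manifold.IsImmersion 𝓘(ℝ, A₁) 𝓘(ℝ, A₂) ∞ i₁}
  {hi₂ : Manifold.IsImmersion 𝓘(ℝ, B₁) 𝓘(ℝ, B₂) ∞ i₂}
  {hj₁ : Manifold.IsImmersion 𝓘(ℝ, A₁) 𝓘(ℝ, B₁) ∞ j₁}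
  {hj₂ : Manifold.IsImmersion 𝓘(ℝ, A₂) 𝓘(ℝ, B₂) ∞ j₂}
  [IsManifold 𝓘(ℝ, A₂) ∞ L₂] [IsManifold 𝓘(ℝ, B₁) ∞ M₁] [IsManifold 𝓘(ℝ, B₂) ∞ M₂]
  {hD : Manifold.IsImmersion 𝓘(ℝ, A₂ × ℝ) 𝓘(ℝ, B₂ × ℝ) ∞ (DNC.map hi₁ hi₂ j₂ j₁)}
  {hN : Manifold.IsImmersion 𝓘(ℝ, B₁) 𝓘(ℝ, B₂) ∞ (NormalBundle.map hj₁ hj₂ i₂ i₁)}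
  {A₁' A₂' B₁' B₂' : Type*} [NormedAddCommGroup A₁'] [NormedSpace ℝ A₁']
  [NormedAddCommGroup A₂'] [NormedSpace ℝ A₂'] [NormedAddCommGroup B₁'] [NormedSpace ℝ B₁']
  [NormedAddCommGroup B₂'] [NormedSpace ℝ B₂'] {L₁' L₂' M₁' M₂' : Type*} [TopologicalSpace L₁']
  [ChartedSpace A₁' L₁'] [TopologicalSpace L₂'] [ChartedSpace A₂' L₂'] [TopologicalSpace M₁']
  [ChartedSpace B₁' M₁'] [TopologicalSpace M₂'] [ChartedSpace B₂' M₂']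
  {i₁' : L₁' → L₂'} {i₂' : M₁' → M₂'} {j₁' : L₁' → M₁'} {j₂' : L₂' → M₂'}
  [FiniteDimensional ℝ A₂'] [FiniteDimensional ℝ B₁'] [FiniteDimensional ℝ B₂']
  {hi₁' : Manifold.IsImmersion 𝓘(ℝ, A₁') 𝓘(ℝ, A₂') ∞ i₁'}
  {hi₂' : Manifold.IsImmersion 𝓘(ℝ, B₁') 𝓘(ℝ, B₂') ∞ i₂'}
  {hj₁' : Manifold.IsImmersion 𝓘(ℝ, A₁') 𝓘(ℝ, B₁') ∞ j₁'}
  {hj₂' : Manifold.IsImmersion 𝓘(ℝ, A₂') 𝓘(ℝ, B₂') ∞ j₂'}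
  [IsManifold 𝓘(ℝ, A₂') ∞ L₂'] [IsManifold 𝓘(ℝ, B₁') ∞ M₁'] [IsManifold 𝓘(ℝ, B₂') ∞ M₂']
  {hD' : Manifold.IsImmersion 𝓘(ℝ, A₂' × ℝ) 𝓘(ℝ, B₂' × ℝ) ∞ (DNC.map hi₁' hi₂' j₂' j₁')}
  {hN' : Manifold.IsImmersion 𝓘(ℝ, B₁') 𝓘(ℝ, B₂') ∞ (NormalBundle.map hj₁' hj₂' i₂' i₁')}

/-- The canonical identification is natural in the square: both composites agree over `t ≠ 0`, and
hence by continuity everywhere. -/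
theorem IsCanonical.map_comm (hcomm : ImmersionSquare hi₁ hi₂ hj₁ hj₂)
    (hcomm' : ImmersionSquare hi₁' hi₂' hj₁' hj₂')
    (hsq : ∀ y, ∃ κ : SquareChart A₁ A₂ B₁ B₂ i₁ i₂ j₁ j₂, y ∈ κ.ψ.source)
    (hsq' : ∀ y, ∃ κ : SquareChart A₁' A₂' B₁' B₂' i₁' i₂' j₁' j₂', y ∈ κ.ψ.source)
    {Φ : NormalBundle hD → DNC hN} {Φ' : NormalBundle hD' → DNC hN'} (hΦ : IsCanonical hD hN Φ)
    (hΦ' : IsCanonical hD' hN' Φ') (hΦc : Continuous Φ) (hΦc' : Continuous Φ')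
    {f₁ : L₁ → L₁'} {f₂ : L₂ → L₂'} {g₁ : M₁ → M₁'} {g₂ : M₂ → M₂'}
    (hf₁ : ContMDiff 𝓘(ℝ, A₁) 𝓘(ℝ, A₁') ∞ f₁) (hf₂ : ContMDiff 𝓘(ℝ, A₂) 𝓘(ℝ, A₂') ∞ f₂)
    (hg₁ : ContMDiff 𝓘(ℝ, B₁) 𝓘(ℝ, B₁') ∞ g₁) (hg₂ : ContMDiff 𝓘(ℝ, B₂) 𝓘(ℝ, B₂') ∞ g₂)
    (h₁ : f₂ ∘ i₁ = i₁' ∘ f₁) (h₂ : g₂ ∘ i₂ = i₂' ∘ g₁) (k₁ : g₁ ∘ j₁ = j₁' ∘ f₁)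
    (k₂ : g₂ ∘ j₂ = j₂' ∘ f₂) (ξ : NormalBundle hD) :
    DNC.map hN hN' (NormalBundle.map hj₂ hj₂' g₂ f₂) (NormalBundle.map hj₁ hj₁' g₁ f₁) (Φ ξ) =
      Φ' (NormalBundle.map hD hD' (DNC.map hi₂ hi₂' g₂ g₁) (DNC.map hi₁ hi₁' f₂ f₁) ξ) := by
  have hDf := DNC.contMDiff_map (hj := hi₁) (hj' := hi₁') hf₂ hf₁ h₁
  have hDg := DNC.contMDiff_map (hj := hi₂) (hj' := hi₂') hg₂ hg₁ h₂
  have hNf := NormalBundle.contMDiff_map (hj := hj₁) (hj' := hj₁') hg₁ hf₁ k₁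
  have hNg := NormalBundle.contMDiff_map (hj := hj₂) (hj' := hj₂') hg₂ hf₂ k₂
  have hDD : DNC.map hi₂ hi₂' g₂ g₁ ∘ DNC.map hi₁ hi₂ j₂ j₁ =
      DNC.map hi₁' hi₂' j₂' j₁' ∘ DNC.map hi₁ hi₁' f₂ f₁ := by
    funext d
    rw [Function.comp_apply, Function.comp_apply,
      DNC.map_map hj₂.contMDiff hg₂ hg₁ hcomm h₂, DNC.map_map hf₂ hj₂'.contMDiff hj₁'.contMDiff h₁
        hcomm', k₁, k₂]
  have hNN : NormalBundle.map hj₂ hj₂' g₂ f₂ ∘ NormalBundle.map hj₁ hj₂ i₂ i₁ =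
      NormalBundle.map hj₁' hj₂' i₂' i₁' ∘ NormalBundle.map hj₁ hj₁' g₁ f₁ := by
    funext η
    rw [Function.comp_apply, Function.comp_apply,
      NormalBundle.map_map hi₂.contMDiff hg₂ hf₂ hcomm.symm k₂,
      NormalBundle.map_map hg₁ hi₂'.contMDiff hi₁'.contMDiff k₁ hcomm'.symm, h₁, h₂]
  have hoff : ∀ ξ : NormalBundle hD, ξ.proj.param ≠ 0 →
      DNC.map hN hN' (NormalBundle.map hj₂ hj₂' g₂ f₂) (NormalBundle.map hj₁ hj₁' g₁ f₁) (Φ ξ) =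
        Φ' (NormalBundle.map hD hD' (DNC.map hi₂ hi₂' g₂ g₁) (DNC.map hi₁ hi₁' f₂ f₁) ξ) := by
    intro ξ hξ
    have h := DNC.eq_off_of_param_ne_zero hξ
    have h' : (NormalBundle.map hD hD' (DNC.map hi₂ hi₂' g₂ g₁) (DNC.map hi₁ hi₁' f₂ f₁) ξ).proj =
        .off (f₂ ξ.proj.toBase) ξ.proj.param hξ := congrArg (DNC.map hi₁ hi₁' f₂ f₁) h
    rw [hΦ.2 _ _ _ _ h, hΦ'.2 _ _ _ _ h', DNC.map_off]
    have hb : g₂ ∘ DNC.toBase = DNC.toBase ∘ DNC.map hi₂ hi₂' g₂ g₁ :=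
      funext fun d ↦ (DNC.toBase_map h₂ d).symm
    have hb' : f₂ ∘ DNC.toBase = DNC.toBase ∘ DNC.map hi₁ hi₁' f₂ f₁ :=
      funext fun d ↦ (DNC.toBase_map h₁ d).symm
    rw [NormalBundle.map_map DNC.contMDiff_toBase hg₂ hf₂
      (funext fun d ↦ DNC.toBase_map hcomm d) k₂, NormalBundle.map_map hDg DNC.contMDiff_toBase
      DNC.contMDiff_toBase hDD (funext fun d ↦ DNC.toBase_map hcomm' d), hb, hb']
  by_cases hp : ξ.proj.param = 0
  swap
  · exact hoff ξ hp
  rcases hη : ξ.proj with η | ⟨x, t, ht⟩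
  swap
  · exact absurd hp (by rw [hη]; exact ht)
  obtain ⟨a, ha, haη⟩ := hΦ.exists_zero hη
  obtain ⟨b, hb, hbη⟩ := hΦ'.exists_zero
    (ξ := NormalBundle.map hD hD' (DNC.map hi₂ hi₂' g₂ g₁) (DNC.map hi₁ hi₁' f₂ f₁) ξ)
    (congrArg (DNC.map hi₁ hi₁' f₂ f₁) hη)
  obtain ⟨κ, hκ⟩ := hsq η.proj
  obtain ⟨u, hu, hu0⟩ := κ.exists_tendsto hcomm hD (ξ := ξ) (by rw [hη]; exact hκ) hp
  have c1 := ((DNC.contMDiff_map (hj := hN) (hj' := hN') hNg hNf hNN).continuous.comp hΦc).tendsto ξ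
  have c2 := (hΦc'.comp (NormalBundle.contMDiff_map (hj := hD) (hj' := hD') hDg hDf
    hDD).continuous).tendsto ξ
  replace c1 := c1.comp hu
  replace c2 := c2.comp hu
  rw [Function.comp_apply, ha, DNC.map_zero] at c1
  rw [Function.comp_apply, hb] at c2
  rw [ha, DNC.map_zero, hb]
  refine congrArg DNC.zero (eq_of_tendsto_of_proj_proj hcomm' hN' hsq' ?_ c1 (c2.congr' ?_))
  · exact (congrArg f₁ haη).trans hbη.symm
  · filter_upwards [hu0] with t ht using (hoff _ ht).symm

end Naturality

section GroupoidIsomorphism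

variable {A₁ A₁' A₂ A₂' B₁ B₁' B₂ B₂' : Type*}
  [NormedAddCommGroup A₁] [NormedSpace ℝ A₁] [FiniteDimensional ℝ A₁]
  [NormedAddCommGroup A₁'] [NormedSpace ℝ A₁'] [FiniteDimensional ℝ A₁']
  [NormedAddCommGroup A₂] [NormedSpace ℝ A₂] [FiniteDimensional ℝ A₂]
  [NormedAddCommGroup A₂'] [NormedSpace ℝ A₂'] [FiniteDimensional ℝ A₂']
  [NormedAddCommGroup B₁] [NormedSpace ℝ B₁] [FiniteDimensional ℝ B₁]
  [NormedAddCommGroup B₁'] [NormedSpace ℝ B₁'] [FiniteDimensional ℝ B₁']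
  [NormedAddCommGroup B₂] [NormedSpace ℝ B₂] [FiniteDimensional ℝ B₂]
  [NormedAddCommGroup B₂'] [NormedSpace ℝ B₂'] [FiniteDimensional ℝ B₂']
  {G₁ M₁ G₂ M₂ H₁ P₁ H₂ P₂ : Type*}
  [TopologicalSpace G₁] [ChartedSpace A₁ G₁] [TopologicalSpace M₁] [ChartedSpace A₁' M₁]
  [TopologicalSpace G₂] [ChartedSpace A₂ G₂] [IsManifold 𝓘(ℝ, A₂) ∞ G₂]
  [TopologicalSpace M₂] [ChartedSpace A₂' M₂] [IsManifold 𝓘(ℝ, A₂') ∞ M₂]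
  [TopologicalSpace H₁] [ChartedSpace B₁ H₁] [IsManifold 𝓘(ℝ, B₁) ∞ H₁]
  [TopologicalSpace P₁] [ChartedSpace B₁' P₁] [IsManifold 𝓘(ℝ, B₁') ∞ P₁]
  [TopologicalSpace H₂] [ChartedSpace B₂ H₂] [IsManifold 𝓘(ℝ, B₂) ∞ H₂]
  [TopologicalSpace P₂] [ChartedSpace B₂' P₂] [IsManifold 𝓘(ℝ, B₂') ∞ P₂]
  {SG₁ : GroupoidStr G₁ M₁} {SG₂ : GroupoidStr G₂ M₂}
  {SH₁ : GroupoidStr H₁ P₁} {SH₂ : GroupoidStr H₂ P₂}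
  (hG₁ : IsLieGroupoid A₁ A₁' SG₁) (hG₂ : IsLieGroupoid A₂ A₂' SG₂)
  (hH₁ : IsLieGroupoid B₁ B₁' SH₁) (hH₂ : IsLieGroupoid B₂ B₂' SH₂)
  {i₁ : G₁ → G₂} {i₁' : M₁ → M₂} {i₂ : H₁ → H₂} {i₂' : P₁ → P₂}
  {j₁ : G₁ → H₁} {j₁' : M₁ → P₁} {j₂ : G₂ → H₂} {j₂' : M₂ → P₂}
  {hi₁ : Manifold.IsImmersion 𝓘(ℝ, A₁) 𝓘(ℝ, A₂) ∞ i₁}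
  {hi₂ : Manifold.IsImmersion 𝓘(ℝ, B₁) 𝓘(ℝ, B₂) ∞ i₂}
  {hj₁ : Manifold.IsImmersion 𝓘(ℝ, A₁) 𝓘(ℝ, B₁) ∞ j₁}
  {hj₂ : Manifold.IsImmersion 𝓘(ℝ, A₂) 𝓘(ℝ, B₂) ∞ j₂}
  {hi₁' : Manifold.IsImmersion 𝓘(ℝ, A₁') 𝓘(ℝ, A₂') ∞ i₁'}
  {hi₂' : Manifold.IsImmersion 𝓘(ℝ, B₁') 𝓘(ℝ, B₂') ∞ i₂'}
  {hj₁' : Manifold.IsImmersion 𝓘(ℝ, A₁') 𝓘(ℝ, B₁') ∞ j₁'}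
  {hj₂' : Manifold.IsImmersion 𝓘(ℝ, A₂') 𝓘(ℝ, B₂') ∞ j₂'}
  (homi₁ : IsGroupoidHom SG₁ SG₂ i₁ i₁') (homi₂ : IsGroupoidHom SH₁ SH₂ i₂ i₂')
  (homj₁ : IsGroupoidHom SG₁ SH₁ j₁ j₁') (homj₂ : IsGroupoidHom SG₂ SH₂ j₂ j₂')
  (hcomm : ImmersionSquare hi₁ hi₂ hj₁ hj₂) (hcomm' : ImmersionSquare hi₁' hi₂' hj₁' hj₂')
  {hD : Manifold.IsImmersion 𝓘(ℝ, A₂ × ℝ) 𝓘(ℝ, B₂ × ℝ) ∞ (DNC.map hi₁ hi₂ j₂ j₁)}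
  {hN : Manifold.IsImmersion 𝓘(ℝ, B₁) 𝓘(ℝ, B₂) ∞ (NormalBundle.map hj₁ hj₂ i₂ i₁)}
  {hD' : Manifold.IsImmersion 𝓘(ℝ, A₂' × ℝ) 𝓘(ℝ, B₂' × ℝ) ∞ (DNC.map hi₁' hi₂' j₂' j₁')}
  {hN' : Manifold.IsImmersion 𝓘(ℝ, B₁') 𝓘(ℝ, B₂') ∞ (NormalBundle.map hj₁' hj₂' i₂' i₁')}
  (homD : IsGroupoidHom (DNC.groupoid SG₁ SG₂ hi₁ hi₁') (DNC.groupoid SH₁ SH₂ hi₂ hi₂')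
    (DNC.map hi₁ hi₂ j₂ j₁) (DNC.map hi₁' hi₂' j₂' j₁'))
  (homN : IsGroupoidHom (NormalBundle.groupoid SG₁ SH₁ hj₁ hj₁')
    (NormalBundle.groupoid SG₂ SH₂ hj₂ hj₂') (NormalBundle.map hj₁ hj₂ i₂ i₁)
    (NormalBundle.map hj₁' hj₂' i₂' i₁'))
  (hsq : ∀ y, ∃ κ : SquareChart A₁ A₂ B₁ B₂ i₁ i₂ j₁ j₂, y ∈ κ.ψ.source)
  (hsq' : ∀ y, ∃ κ : SquareChart A₁' A₂' B₁' B₂' i₁' i₂' j₁' j₂', y ∈ κ.ψ.source)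
include hG₁ hG₂ hH₁ hH₂ homi₁ homi₂ homj₁ homj₂ hcomm hcomm' homD homN hsq hsq'

/-- The canonical identifications of arrows and units are compatible with the groupoid structures.
For the product, composable pairs over `t = 0` are limits of composable pairs over `t ≠ 0`, as the
source map is a submersion. -/
theorem IsCanonical.isGroupoidHom {Φ : NormalBundle hD → DNC hN} {Φ' : NormalBundle hD' → DNC hN'}
    (hΦ : IsCanonical hD hN Φ) (hΦ' : IsCanonical hD' hN' Φ') (hΦc : Continuous Φ)
    (hΦc' : Continuous Φ') :
    IsGroupoidHom
      (NormalBundle.groupoid (DNC.groupoid SG₁ SG₂ hi₁ hi₁') (DNC.groupoid SH₁ SH₂ hi₂ hi₂') hD hD')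
      (DNC.groupoid (NormalBundle.groupoid SG₁ SH₁ hj₁ hj₁')
        (NormalBundle.groupoid SG₂ SH₂ hj₂ hj₂') hN hN') Φ Φ' := by
  have hDG := DNC.isLieGroupoid (hj := hi₁) (hj₀ := hi₁') hG₁ hG₂ homi₁
  have hDH := DNC.isLieGroupoid (hj := hi₂) (hj₀ := hi₂') hH₁ hH₂ homi₂
  have hND := NormalBundle.isLieGroupoid (hj := hD) (hj₀ := hD') hDG hDH homD
  have hN₁ := NormalBundle.isLieGroupoid (hj := hj₁) (hj₀ := hj₁') hG₁ hH₁ homj₁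
  have hN₂ := NormalBundle.isLieGroupoid (hj := hj₂) (hj₀ := hj₂') hG₂ hH₂ homj₂
  have src_map : ∀ ξ, DNC.map hN hN' (NormalBundle.map hj₂ hj₂' SH₂.src SG₂.src)
      (NormalBundle.map hj₁ hj₁' SH₁.src SG₁.src) (Φ ξ) = Φ' (NormalBundle.map hD hD'
        (DNC.map hi₂ hi₂' SH₂.src SH₁.src) (DNC.map hi₁ hi₁' SG₂.src SG₁.src) ξ) :=
    hΦ.map_comm hcomm hcomm' hsq hsq' hΦ' hΦc hΦc' hG₁.src_submersion.contMDiff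
      hG₂.src_submersion.contMDiff hH₁.src_submersion.contMDiff hH₂.src_submersion.contMDiff
      homi₁.src_comp homi₂.src_comp homj₁.src_comp homj₂.src_comp
  have tgt_map : ∀ ξ, DNC.map hN hN' (NormalBundle.map hj₂ hj₂' SH₂.tgt SG₂.tgt)
      (NormalBundle.map hj₁ hj₁' SH₁.tgt SG₁.tgt) (Φ ξ) = Φ' (NormalBundle.map hD hD'
        (DNC.map hi₂ hi₂' SH₂.tgt SH₁.tgt) (DNC.map hi₁ hi₁' SG₂.tgt SG₁.tgt) ξ) :=
    hΦ.map_comm hcomm hcomm' hsq hsq' hΦ' hΦc hΦc' hG₁.tgt_submersion.contMDiff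
      hG₂.tgt_submersion.contMDiff hH₁.tgt_submersion.contMDiff hH₂.tgt_submersion.contMDiff
      homi₁.tgt_comp homi₂.tgt_comp homj₁.tgt_comp homj₂.tgt_comp
  refine ⟨src_map, tgt_map, ?_⟩
  set S := NormalBundle.groupoid (DNC.groupoid SG₁ SG₂ hi₁ hi₁') (DNC.groupoid SH₁ SH₂ hi₂ hi₂')
    hD hD' with hS
  set S' := DNC.groupoid (NormalBundle.groupoid SG₁ SH₁ hj₁ hj₁')
    (NormalBundle.groupoid SG₂ SH₂ hj₂ hj₂') hN hN' with hS'
  have hcomp : ∀ ξ η, S.src ξ = S.tgt η → S'.src (Φ ξ) = S'.tgt (Φ η) := by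
    intro ξ η h
    exact (src_map ξ).trans ((congrArg Φ' h).trans (tgt_map η).symm)
  have hproj : ∀ ξ η, S.src ξ = S.tgt η →
      (ξ.proj, η.proj) ∈ (DNC.groupoid SG₁ SG₂ hi₁ hi₁').composable :=
    fun ξ η h ↦ congrArg NormalBundle.proj h
  have hbase := NormalBundle.isGroupoidHom_map (hj := hD) (hj₀ := hD') (hj' := hj₂) (hj₀' := hj₂')
    hDG hDH homD hG₂ hH₂ homj₂ DNC.contMDiff_toBase DNC.contMDiff_toBase DNC.contMDiff_toBase
    DNC.contMDiff_toBase (DNC.isGroupoidHom_toBase homi₂) (DNC.isGroupoidHom_toBase homi₁)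
    (funext fun d ↦ DNC.toBase_map hcomm d) (funext fun d ↦ DNC.toBase_map hcomm' d)
  have hoff : ∀ ξ η, S.src ξ = S.tgt η → η.proj.param ≠ 0 →
      Φ (S.mul (ξ, η)) = S'.mul (Φ ξ, Φ η) := by
    intro ξ η h hη
    obtain ⟨x, x', t, ht, -, hξ, hη⟩ := DNC.exists_off_of_composable (hproj ξ η h) hη
    have hξη : (S.mul (ξ, η)).proj = .off (SG₂.mul (x, x')) t ht := by
      change (DNC.groupoid SG₁ SG₂ hi₁ hi₁').mul (ξ.proj, η.proj) = _
      rw [hξ, hη]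
      rfl
    rw [hΦ.2 _ _ _ _ hξ, hΦ.2 _ _ _ _ hη, hΦ.2 _ _ _ _ hξη]
    exact congrArg (DNC.off · t ht) (hbase.map_mul ξ η h)
  intro ξ η h
  by_cases hp : η.proj.param = 0
  swap
  · exact hoff ξ η h hp
  obtain ⟨ξ', η', -, hξ, hη⟩ := DNC.exists_zero_of_composable (hproj ξ η h) hp
  have hξη : (S.mul (ξ, η)).proj =
      .zero ((NormalBundle.groupoid SG₁ SG₂ hi₁ hi₁').mul (ξ', η')) := by
    change (DNC.groupoid SG₁ SG₂ hi₁ hi₁').mul (ξ.proj, η.proj) = _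
    rw [hξ, hη]
    rfl
  obtain ⟨a, ha, haξ⟩ := hΦ.exists_zero hξ
  obtain ⟨b, hb, hbη⟩ := hΦ.exists_zero hη
  obtain ⟨c, hc, hcξη⟩ := hΦ.exists_zero hξη
  -- a composable pair of curves with the limit `(ξ, η)`
  obtain ⟨κ, hκ⟩ := hsq η'.proj
  obtain ⟨v, hv, hv0⟩ := κ.exists_tendsto hcomm hD (ξ := η) (by rw [hη]; exact hκ) hp
  have htgt := (hND.tgt_submersion.contMDiff.continuous.tendsto η).comp hv
  rw [← h] at htgt
  obtain ⟨u, hu, huv⟩ := hND.src_submersion.exists_lift htgt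
  have l1 := (hΦc.tendsto _).comp
    ((hND.contMDiffOn_mul (ξ, η) h).continuousWithinAt.tendsto.comp
      (tendsto_nhdsWithin_iff.2 ⟨hu.prodMk_nhds hv, huv⟩))
  have l2 := DNC.tendsto_mul hN₁ hN₂ homN (hcomp ξ η h) ((hΦc.tendsto ξ).comp hu)
    ((hΦc.tendsto η).comp hv) (huv.mono fun i hi ↦ hcomp _ _ hi)
  change Φ (S.mul (ξ, η)) = DNC.mul (F₂ := B₂') _ _ hN (Φ ξ, Φ η)
  replace l1 : Tendsto (fun t ↦ Φ (S.mul (u t, v t))) (𝓝[≠] 0) (𝓝 (Φ (S.mul (ξ, η)))) := l1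
  rw [hc] at l1 ⊢
  rw [ha, hb] at l2 ⊢
  refine congrArg DNC.zero (eq_of_tendsto_of_proj_proj hcomm hN hsq ?_ l1 (l2.congr' ?_))
  · refine hcξη.trans ?_
    change SG₁.mul (ξ'.proj, η'.proj) = SG₁.mul (a.proj.proj, b.proj.proj)
    rw [haξ, hbη]
  · filter_upwards [hv0, huv] with t ht hcomp using (hoff _ _ hcomp ht).symm

end GroupoidIsomorphism

/-! ### Cleanness of the square of units -/

section Units

variable {E E' E'' EZ X X' X'' Z : Type*} [NormedAddCommGroup E] [NormedSpace ℝ E]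
  [NormedAddCommGroup E'] [NormedSpace ℝ E'] [NormedAddCommGroup E''] [NormedSpace ℝ E'']
  [NormedAddCommGroup EZ] [NormedSpace ℝ EZ] [TopologicalSpace X] [ChartedSpace E X]
  [TopologicalSpace X'] [ChartedSpace E' X'] [TopologicalSpace X''] [ChartedSpace E'' X'']
  [TopologicalSpace Z] [ChartedSpace EZ Z]

/-- The differentials of the maps in a commutative square form a commutative square. -/
theorem mfderiv_comm {f : X → X'} {g : X' → Z} {f' : X → X''} {g' : X'' → Z}
    (hf : ContMDiff 𝓘(ℝ, E) 𝓘(ℝ, E') ∞ f) (hg : ContMDiff 𝓘(ℝ, E') 𝓘(ℝ, EZ) ∞ g)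
    (hf' : ContMDiff 𝓘(ℝ, E) 𝓘(ℝ, E'') ∞ f') (hg' : ContMDiff 𝓘(ℝ, E'') 𝓘(ℝ, EZ) ∞ g')
    (h : g ∘ f = g' ∘ f') (x : X) (v : E) :
    (mfderiv 𝓘(ℝ, E') 𝓘(ℝ, EZ) g (f x) (mfderiv 𝓘(ℝ, E) 𝓘(ℝ, E') f x v : E') : EZ) =
      mfderiv 𝓘(ℝ, E'') 𝓘(ℝ, EZ) g' (f' x) (mfderiv 𝓘(ℝ, E) 𝓘(ℝ, E'') f' x v : E'') := by
  have h1 := mfderiv_comp x (hg.mdifferentiable (by simp) (f x)) (hf.mdifferentiable (by simp) x)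
  have h2 := mfderiv_comp x (hg'.mdifferentiable (by simp) (f' x)) (hf'.mdifferentiable (by simp) x)
  have h3 : (mfderiv 𝓘(ℝ, E) 𝓘(ℝ, EZ) (g ∘ f) x v : EZ) =
    mfderiv 𝓘(ℝ, E) 𝓘(ℝ, EZ) (g' ∘ f') x v := by rw [h]
  exact ((DFunLike.congr_fun h1 v).symm.trans h3).trans (DFunLike.congr_fun h2 v)

variable {A₁ A₁' A₂ A₂' B₁ B₁' B₂ B₂' : Type*}
  [NormedAddCommGroup A₁] [NormedSpace ℝ A₁] [NormedAddCommGroup A₁'] [NormedSpace ℝ A₁']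
  [NormedAddCommGroup A₂] [NormedSpace ℝ A₂] [NormedAddCommGroup A₂'] [NormedSpace ℝ A₂']
  [NormedAddCommGroup B₁] [NormedSpace ℝ B₁] [NormedAddCommGroup B₁'] [NormedSpace ℝ B₁']
  [NormedAddCommGroup B₂] [NormedSpace ℝ B₂] [NormedAddCommGroup B₂'] [NormedSpace ℝ B₂']
  {G₁ M₁ G₂ M₂ H₁ P₁ H₂ P₂ : Type*}
  [TopologicalSpace G₁] [ChartedSpace A₁ G₁] [TopologicalSpace M₁] [ChartedSpace A₁' M₁]
  [TopologicalSpace G₂] [ChartedSpace A₂ G₂] [TopologicalSpace M₂] [ChartedSpace A₂' M₂]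
  [TopologicalSpace H₁] [ChartedSpace B₁ H₁] [TopologicalSpace P₁] [ChartedSpace B₁' P₁]
  [TopologicalSpace H₂] [ChartedSpace B₂ H₂] [TopologicalSpace P₂] [ChartedSpace B₂' P₂]
  {SG₁ : GroupoidStr G₁ M₁} {SG₂ : GroupoidStr G₂ M₂}
  {SH₁ : GroupoidStr H₁ P₁} {SH₂ : GroupoidStr H₂ P₂}
  {i₁ : G₁ → G₂} {i₁' : M₁ → M₂} {i₂ : H₁ → H₂} {i₂' : P₁ → P₂}
  {j₁ : G₁ → H₁} {j₁' : M₁ → P₁} {j₂ : G₂ → H₂} {j₂' : M₂ → P₂}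
  (hG₁ : IsLieGroupoid A₁ A₁' SG₁) (hG₂ : IsLieGroupoid A₂ A₂' SG₂)
  (hH₁ : IsLieGroupoid B₁ B₁' SH₁) (hH₂ : IsLieGroupoid B₂ B₂' SH₂)
  (hi₁ : IsLieGroupoidImmersion A₁ A₁' A₂ A₂' SG₁ SG₂ i₁ i₁')
  (hi₂ : IsLieGroupoidImmersion B₁ B₁' B₂ B₂' SH₁ SH₂ i₂ i₂')
  (hj₁ : IsLieGroupoidImmersion A₁ A₁' B₁ B₁' SG₁ SH₁ j₁ j₁')
  (hj₂ : IsLieGroupoidImmersion A₂ A₂' B₂ B₂' SG₂ SH₂ j₂ j₂')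
  (hcomm : j₂ ∘ i₁ = i₂ ∘ j₁)
include hG₁ hi₁ hi₂ hj₁ hj₂ hcomm

/-- A square of groupoid morphisms which commutes on arrows commutes on units. -/
theorem units_comm : j₂' ∘ i₁' = i₂' ∘ j₁' := by
  funext x
  have h := congrArg SH₂.src (congrFun hcomm (SG₁.one x))
  simpa only [Function.comp_apply, hi₁.src_map, hi₂.src_map, hj₁.src_map, hj₂.src_map,
    hG₁.src_one] using h

include hG₂ hH₁ hH₂ in
/-- The units inherit cleanness from the arrows: tangent vectors are moved to the arrows along the
unit maps and back along the source map. -/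
theorem isCleanAt_units {x : M₁} (hclean : IsCleanAt A₁ A₂ B₁ B₂ i₁ i₂ j₁ j₂ (SG₁.one x)) :
    IsCleanAt A₁' A₂' B₁' B₂' i₁' i₂' j₁' j₂' x := by
  intro l m hlm
  have hi₁x : i₁ (SG₁.one x) = SG₂.one (i₁' x) := (congrFun (hi₁.one_comp hG₁ hG₂) x).symm
  have hj₁x : j₁ (SG₁.one x) = SH₁.one (j₁' x) := (congrFun (hj₁.one_comp hG₁ hH₁) x).symm
  have hx : j₂' (i₁' x) = i₂' (j₁' x) := congrFun (units_comm hG₁ hi₁ hi₂ hj₁ hj₂ hcomm) x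
  -- the images of the tangent vectors under the unit maps
  set l' : A₂ := mfderiv 𝓘(ℝ, A₂') 𝓘(ℝ, A₂) SG₂.one (i₁' x) l
  set m' : B₁ := mfderiv 𝓘(ℝ, B₁') 𝓘(ℝ, B₁) SH₁.one (j₁' x) m
  have h1 : (mfderiv 𝓘(ℝ, A₂) 𝓘(ℝ, B₂) j₂ (i₁ (SG₁.one x)) l' : B₂) =
      mfderiv 𝓘(ℝ, B₂') 𝓘(ℝ, B₂) SH₂.one (j₂' (i₁' x))
        (mfderiv 𝓘(ℝ, A₂') 𝓘(ℝ, B₂') j₂' (i₁' x) l : B₂') :=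
    (mfderiv_congr_point' (E := A₂) (E' := B₂) (f := j₂) hi₁x l').trans
      (mfderiv_comm hG₂.contMDiff_one hj₂.immersion.contMDiff hj₂.immersion₀.contMDiff
        hH₂.contMDiff_one (hj₂.one_comp hG₂ hH₂).symm (i₁' x) l)
  have h2 : (mfderiv 𝓘(ℝ, B₁) 𝓘(ℝ, B₂) i₂ (j₁ (SG₁.one x)) m' : B₂) =
      mfderiv 𝓘(ℝ, B₂') 𝓘(ℝ, B₂) SH₂.one (i₂' (j₁' x))
        (mfderiv 𝓘(ℝ, B₁') 𝓘(ℝ, B₂') i₂' (j₁' x) m : B₂') :=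
    (mfderiv_congr_point' (E := B₁) (E' := B₂) (f := i₂) hj₁x m').trans
      (mfderiv_comm hH₁.contMDiff_one hi₂.immersion.contMDiff hi₂.immersion₀.contMDiff
        hH₂.contMDiff_one (hi₂.one_comp hH₁ hH₂).symm (j₁' x) m)
  have h3 : (mfderiv 𝓘(ℝ, B₂') 𝓘(ℝ, B₂) SH₂.one (j₂' (i₁' x))
        (mfderiv 𝓘(ℝ, A₂') 𝓘(ℝ, B₂') j₂' (i₁' x) l : B₂') : B₂) =
      mfderiv 𝓘(ℝ, B₂') 𝓘(ℝ, B₂) SH₂.one (i₂' (j₁' x))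
        (mfderiv 𝓘(ℝ, B₁') 𝓘(ℝ, B₂') i₂' (j₁' x) m : B₂') :=
    (congrArg (fun e : B₂' ↦ (mfderiv 𝓘(ℝ, B₂') 𝓘(ℝ, B₂) SH₂.one (j₂' (i₁' x)) e : B₂)) hlm).trans
      (mfderiv_congr_point' (E := B₂') (E' := B₂) (f := SH₂.one) hx _)
  obtain ⟨a, ha⟩ := hclean l' m' (h1.trans (h3.trans h2.symm))
  -- the source map is a left inverse of the unit map
  refine ⟨(mfderiv 𝓘(ℝ, A₁) 𝓘(ℝ, A₁') SG₁.src (SG₁.one x) a : A₁'), ?_⟩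
  have h4 := mfderiv_comm hG₁.src_submersion.contMDiff hi₁.immersion₀.contMDiff
    hi₁.immersion.contMDiff hG₂.src_submersion.contMDiff hi₁.src_comp.symm (SG₁.one x) a
  have h5 := mfderiv_comm hG₂.contMDiff_one hG₂.src_submersion.contMDiff
    (contMDiff_id (I := 𝓘(ℝ, A₂'))) (contMDiff_id (I := 𝓘(ℝ, A₂')))
    (funext fun y ↦ hG₂.src_one y) (i₁' x) l
  have h6 : (mfderiv 𝓘(ℝ, A₂') 𝓘(ℝ, A₂') (id : M₂ → M₂) (i₁' x)
      (mfderiv 𝓘(ℝ, A₂') 𝓘(ℝ, A₂') (id : M₂ → M₂) (i₁' x) l : A₂') : A₂') = l := by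
    simp only [mfderiv_id]
    rfl
  have h7 : (mfderiv 𝓘(ℝ, A₁') 𝓘(ℝ, A₂') i₁' x
      (mfderiv 𝓘(ℝ, A₁) 𝓘(ℝ, A₁') SG₁.src (SG₁.one x) a : A₁') : A₂') =
      mfderiv 𝓘(ℝ, A₂) 𝓘(ℝ, A₂') SG₂.src (i₁ (SG₁.one x))
        (mfderiv 𝓘(ℝ, A₁) 𝓘(ℝ, A₂) i₁ (SG₁.one x) a : A₂) :=
    (mfderiv_congr_point' (E := A₁') (E' := A₂') (f := i₁') (hG₁.src_one x).symm _).trans h4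
  refine h7.trans (Eq.trans ?_ (h5.trans h6))
  exact (congrArg (fun e : A₂ ↦ (mfderiv 𝓘(ℝ, A₂) 𝓘(ℝ, A₂') SG₂.src (i₁ (SG₁.one x)) e : A₂'))
    ha).trans (mfderiv_congr_point' (E := A₂) (E' := A₂') (f := SG₂.src) hi₁x _)

end Units

end

theorem mainTheorem6
    {A₁ A₁' A₂ A₂' B₁ B₁' B₂ B₂' : Type*}
    [NormedAddCommGroup A₁] [NormedSpace ℝ A₁] [FiniteDimensional ℝ A₁]
    [NormedAddCommGroup A₁'] [NormedSpace ℝ A₁'] [FiniteDimensional ℝ A₁']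
    [NormedAddCommGroup A₂] [NormedSpace ℝ A₂] [FiniteDimensional ℝ A₂]
    [NormedAddCommGroup A₂'] [NormedSpace ℝ A₂'] [FiniteDimensional ℝ A₂']
    [NormedAddCommGroup B₁] [NormedSpace ℝ B₁] [FiniteDimensional ℝ B₁]
    [NormedAddCommGroup B₁'] [NormedSpace ℝ B₁'] [FiniteDimensional ℝ B₁']
    [NormedAddCommGroup B₂] [NormedSpace ℝ B₂] [FiniteDimensional ℝ B₂]
    [NormedAddCommGroup B₂'] [NormedSpace ℝ B₂'] [FiniteDimensional ℝ B₂']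
    {G₁ M₁ G₂ M₂ H₁ P₁ H₂ P₂ : Type*}
    [TopologicalSpace G₁] [ChartedSpace A₁ G₁] [IsManifold 𝓘(ℝ, A₁) ∞ G₁]
    [TopologicalSpace M₁] [ChartedSpace A₁' M₁] [IsManifold 𝓘(ℝ, A₁') ∞ M₁]
    [TopologicalSpace G₂] [ChartedSpace A₂ G₂] [IsManifold 𝓘(ℝ, A₂) ∞ G₂]
    [TopologicalSpace M₂] [ChartedSpace A₂' M₂] [IsManifold 𝓘(ℝ, A₂') ∞ M₂]
    [TopologicalSpace H₁] [ChartedSpace B₁ H₁] [IsManifold 𝓘(ℝ, B₁) ∞ H₁]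
    [TopologicalSpace P₁] [ChartedSpace B₁' P₁] [IsManifold 𝓘(ℝ, B₁') ∞ P₁]
    [TopologicalSpace H₂] [ChartedSpace B₂ H₂] [IsManifold 𝓘(ℝ, B₂) ∞ H₂]
    [TopologicalSpace P₂] [ChartedSpace B₂' P₂] [IsManifold 𝓘(ℝ, B₂') ∞ P₂]
    (SG₁ : GroupoidStr G₁ M₁) (SG₂ : GroupoidStr G₂ M₂)
    (SH₁ : GroupoidStr H₁ P₁) (SH₂ : GroupoidStr H₂ P₂)
    (hG₁ : IsLieGroupoid A₁ A₁' SG₁) (hG₂ : IsLieGroupoid A₂ A₂' SG₂)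
    (hH₁ : IsLieGroupoid B₁ B₁' SH₁) (hH₂ : IsLieGroupoid B₂ B₂' SH₂)
    (i₁ : G₁ → G₂) (i₁' : M₁ → M₂) (i₂ : H₁ → H₂) (i₂' : P₁ → P₂)
    (j₁ : G₁ → H₁) (j₁' : M₁ → P₁) (j₂ : G₂ → H₂) (j₂' : M₂ → P₂)
    (hi₁ : IsLieGroupoidImmersion A₁ A₁' A₂ A₂' SG₁ SG₂ i₁ i₁')
    (hi₂ : IsLieGroupoidImmersion B₁ B₁' B₂ B₂' SH₁ SH₂ i₂ i₂')
    (hj₁ : IsLieGroupoidImmersion A₁ A₁' B₁ B₁' SG₁ SH₁ j₁ j₁')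
    (hj₂ : IsLieGroupoidImmersion A₂ A₂' B₂ B₂' SG₂ SH₂ j₂ j₂')
    (hcomm : j₂ ∘ i₁ = i₂ ∘ j₁)
    (hNj : Manifold.IsImmersion 𝓘(ℝ, A₂) 𝓘(ℝ, B₂) ∞
      (NormalBundle.map hi₁.immersion hi₂.immersion j₂ j₁))
    (hNi : Manifold.IsImmersion 𝓘(ℝ, B₁) 𝓘(ℝ, B₂) ∞
      (NormalBundle.map hj₁.immersion hj₂.immersion i₂ i₁)) :
    -- `D(j₂, j₁) : D(G₂, G₁, i₁) → D(H₂, H₁, i₂)` is a Lie groupoid immersion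
    ∃ (hD : IsLieGroupoidImmersion (A₂ × ℝ) (A₂' × ℝ) (B₂ × ℝ) (B₂' × ℝ)
        (DNC.groupoid SG₁ SG₂ hi₁.immersion hi₁.immersion₀)
        (DNC.groupoid SH₁ SH₂ hi₂.immersion hi₂.immersion₀)
        (DNC.map hi₁.immersion hi₂.immersion j₂ j₁)
        (DNC.map hi₁.immersion₀ hi₂.immersion₀ j₂' j₁'))
      -- `N(i₂, i₁) : N(H₁, G₁, j₁) → N(H₂, G₂, j₂)` is a Lie groupoid immersion
      (hN : IsLieGroupoidImmersion B₁ B₁' B₂ B₂'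
        (NormalBundle.groupoid SG₁ SH₁ hj₁.immersion hj₁.immersion₀)
        (NormalBundle.groupoid SG₂ SH₂ hj₂.immersion hj₂.immersion₀)
        (NormalBundle.map hj₁.immersion hj₂.immersion i₂ i₁)
        (NormalBundle.map hj₁.immersion₀ hj₂.immersion₀ i₂' i₁')),
      -- the normal groupoid `N(D(j₂, j₁))` is a Lie groupoid
      IsLieGroupoid (B₂ × ℝ) (B₂' × ℝ)
        (NormalBundle.groupoid
          (DNC.groupoid SG₁ SG₂ hi₁.immersion hi₁.immersion₀)
          (DNC.groupoid SH₁ SH₂ hi₂.immersion hi₂.immersion₀) hD.immersion hD.immersion₀) ∧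
      -- the deformation groupoid `D(N(i₂, i₁))` is a Lie groupoid
      IsLieGroupoid (B₂ × ℝ) (B₂' × ℝ)
        (DNC.groupoid
          (NormalBundle.groupoid SG₁ SH₁ hj₁.immersion hj₁.immersion₀)
          (NormalBundle.groupoid SG₂ SH₂ hj₂.immersion hj₂.immersion₀)
          hN.immersion hN.immersion₀) ∧
      -- the canonical identification is an isomorphism of Lie groupoids
      ∃! Φ : Diffeomorph 𝓘(ℝ, B₂ × ℝ) 𝓘(ℝ, B₂ × ℝ)
            (NormalBundle hD.immersion) (DNC hN.immersion) ∞ ×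
          Diffeomorph 𝓘(ℝ, B₂' × ℝ) 𝓘(ℝ, B₂' × ℝ)
            (NormalBundle hD.immersion₀) (DNC hN.immersion₀) ∞,
        IsGroupoidHom
          (NormalBundle.groupoid
            (DNC.groupoid SG₁ SG₂ hi₁.immersion hi₁.immersion₀)
            (DNC.groupoid SH₁ SH₂ hi₂.immersion hi₂.immersion₀) hD.immersion hD.immersion₀)
          (DNC.groupoid
            (NormalBundle.groupoid SG₁ SH₁ hj₁.immersion hj₁.immersion₀)
            (NormalBundle.groupoid SG₂ SH₂ hj₂.immersion hj₂.immersion₀)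
            hN.immersion hN.immersion₀) Φ.1 Φ.2 ∧
        IsCanonical hD.immersion hN.immersion Φ.1 ∧
        IsCanonical hD.immersion₀ hN.immersion₀ Φ.2 := by
  have hcomm₀ := units_comm hG₁ hi₁ hi₂ hj₁ hj₂ hcomm
  have hclean : ∀ x, IsCleanAt A₁ A₂ B₁ B₂ i₁ i₂ j₁ j₂ x :=
    isCleanAt_of_isImmersion_map hj₁.immersion.contMDiff hj₂.immersion.contMDiff hcomm hNj
  have hclean₀ : ∀ x, IsCleanAt A₁' A₂' B₁' B₂' i₁' i₂' j₁' j₂' x := fun x ↦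
    isCleanAt_units hG₁ hG₂ hH₁ hH₂ hi₁ hi₂ hj₁ hj₂ hcomm (hclean _)
  have hsq := fun y ↦ exists_squareChart hi₁.immersion hi₂.immersion hj₁.immersion hj₂.immersion
    hcomm (hclean y)
  have hsq₀ := fun y ↦ exists_squareChart hi₁.immersion₀ hi₂.immersion₀ hj₁.immersion₀
    hj₂.immersion₀ hcomm₀ (hclean₀ y)
  have homD := DNC.isGroupoidHom_map (hj := hi₁.immersion) (hj₀ := hi₁.immersion₀)
    (hj' := hi₂.immersion) (hj₀' := hi₂.immersion₀) hG₁ hG₂ hi₁.toIsGroupoidHom hH₁ hH₂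
    hi₂.toIsGroupoidHom hj₂.immersion.contMDiff hj₂.immersion₀.contMDiff hj₁.immersion.contMDiff
    hj₁.immersion₀.contMDiff hj₂.toIsGroupoidHom hj₁.toIsGroupoidHom hcomm hcomm₀
  have homN := NormalBundle.isGroupoidHom_map (hj := hj₁.immersion) (hj₀ := hj₁.immersion₀)
    (hj' := hj₂.immersion) (hj₀' := hj₂.immersion₀) hG₁ hH₁ hj₁.toIsGroupoidHom hG₂ hH₂
    hj₂.toIsGroupoidHom hi₂.immersion.contMDiff hi₂.immersion₀.contMDiff hi₁.immersion.contMDiff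
    hi₁.immersion₀.contMDiff hi₂.toIsGroupoidHom hi₁.toIsGroupoidHom hcomm.symm hcomm₀.symm
  have hD : IsLieGroupoidImmersion (A₂ × ℝ) (A₂' × ℝ) (B₂ × ℝ) (B₂' × ℝ) _ _ _ _ :=
    ⟨homD, DNC.isImmersion_map hj₁.immersion hj₂.immersion hcomm hclean,
      DNC.isImmersion_map hj₁.immersion₀ hj₂.immersion₀ hcomm₀ hclean₀⟩
  have hN : IsLieGroupoidImmersion B₁ B₁' B₂ B₂' _ _ _ _ :=
    ⟨homN, hNi, NormalBundle.isImmersion_map hi₁.immersion₀ hi₂.immersion₀ hcomm₀ hclean₀⟩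
  have hDG := DNC.isLieGroupoid (hj := hi₁.immersion) (hj₀ := hi₁.immersion₀) hG₁ hG₂
    hi₁.toIsGroupoidHom
  have hDH := DNC.isLieGroupoid (hj := hi₂.immersion) (hj₀ := hi₂.immersion₀) hH₁ hH₂
    hi₂.toIsGroupoidHom
  have hNG := NormalBundle.isLieGroupoid (hj := hj₁.immersion) (hj₀ := hj₁.immersion₀) hG₁ hH₁
    hj₁.toIsGroupoidHom
  have hNH := NormalBundle.isLieGroupoid (hj := hj₂.immersion) (hj₀ := hj₂.immersion₀) hG₂ hH₂
    hj₂.toIsGroupoidHom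
  have sq : ImmersionSquare hi₁.immersion hi₂.immersion hj₁.immersion hj₂.immersion := hcomm
  have sq₀ : ImmersionSquare hi₁.immersion₀ hi₂.immersion₀ hj₁.immersion₀ hj₂.immersion₀ := hcomm₀
  refine ⟨hD, hN, NormalBundle.isLieGroupoid hDG hDH homD, DNC.isLieGroupoid hNG hNH homN, ?_⟩
  obtain ⟨Φ, hΦ⟩ := exists_diffeomorph_isCanonical sq hD.immersion hN.immersion hsq
  obtain ⟨Φ₀, hΦ₀⟩ := exists_diffeomorph_isCanonical sq₀ hD.immersion₀ hN.immersion₀ hsq₀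
  refine ⟨(Φ, Φ₀), ⟨hΦ.isGroupoidHom hG₁ hG₂ hH₁ hH₂ hi₁.toIsGroupoidHom hi₂.toIsGroupoidHom
    hj₁.toIsGroupoidHom hj₂.toIsGroupoidHom sq sq₀ homD homN hsq hsq₀ hΦ₀ Φ.continuous
    Φ₀.continuous, hΦ, hΦ₀⟩, ?_⟩
  rintro ⟨Ψ, Ψ₀⟩ ⟨-, hΨ, hΨ₀⟩
  exact Prod.ext (Diffeomorph.ext (congrFun (hΨ.eq sq hsq hΦ Ψ.continuous Φ.continuous)))
    (Diffeomorph.ext (congrFun (hΨ₀.eq sq₀ hsq₀ hΦ₀ Ψ₀.continuous Φ₀.continuous)))
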